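/- **Setting.** We work with formal power series in $d$ whose coefficients are polynomials in $u$ with complex coefficients. Put $\varepsilon=2\sinh(d/2)$, $T^{\pm}=\dfrac{u\pm\tanh d}{1\pm u\tanh d}$ (expanded in powers of $d$), and let $I_{2n-1}$ ($n\ge1$) be the polynomials with $\frac{2}{(2n)!}\,q_0^{(2n)}(s)=\sqrt{1-\tanh^2 s}\;I_{2n-1}(\tanh s)$, where $q_0(s)=4\arctan(e^{-s})$. Consider the equation $$\frac{A(d,T^+)}{\cosh d+u\sinh d}+\frac{A(d,T^-)}{\cosh d-u\sinh d}-2A(d,u)=\varepsilon^2\Big(2u\cos\big(A\sqrt{1-u^2}\big)+\frac{2u^2-1}{\sqrt{1-u^2}}\sin\big(A\sqrt{1-u^2}\big)\Big)-\sum_{n\ge1}I_{2n-1}(u)d^{2n},\qquad(\ast)$$ in which $\cos(A\sqrt{1-u^2})$ and $\sin(A\sqrt{1-u^2})/\sqrt{1-u^2}$ are expanded as power series in $A$ (their coefficients are polynomials in $u$). A *formal solution* is a series $A(d,u)=\sum_{n\ge1}A_{2n-1}(u)d^{2n}$ satisfying $(\ast)$, with $A_{2n-1}$ an odd polynomial of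 degree at most $2n-1$. Let $$U=-\tfrac14ud^2+\big(\tfrac{91}{864}u^3-\tfrac{47}{576}u\big)d^4+\big(-\tfrac{319}{2880}u^5+\tfrac{185}{1152}u^3-\tfrac{3703}{69120}u\big)d^6,$$ $$Q=1+\tfrac14(1-u^2)d^2+\big(\tfrac{91}{432}u^4-\tfrac{13}{48}u^2+\tfrac{13}{216}\big)d^4+\big(-\tfrac{319}{960}u^6+\tfrac{1079}{1728}u^4-\tfrac{937}{2880}u^2+\tfrac{287}{8640}\big)d^6 .$$ Let $\tau_0=1$, $\tau_1=u$, $\tau_{n+1}=\frac1n(1-u^2)\tau_n'$ for $n\ge1$; then $\deg\tau_n=n$ and $\tau_2=1-u^2$ divides $\tau_n$ for $n\ge2$. For a polynomial $p=\sum_{i=0}^n a_i\tau_i$ of degree at most $n$ put $\|p\|_n=\sum_{i=0}^n|a_i|(\pi/2)^{n-i}$. A *polynomial series* is a series $S=\sum_{n\ge0}S_n(u)d^n$ with $\deg S_n\le n$ for all $n$; for it put $\|S\|_n=\|S_n\|_n$. Finally let $$H_0=\sum_{\substack{n\ge10\\ n\text{ even}}}(n-1)!\Big(\frac{i}{2\pi}\Big)^{n}\tau_n(u)d^n,\quad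 H_1=\sum_{\substack{n\ge9\\ n\text{ odd}}}(n-1)!\Big(\frac{i}{2\pi}\Big)^{n+1}\tau_n(u)d^n,\quad H_2=\sum_{\substack{n\ge9\\ n\text{ odd}}}n!\Big(\frac{i}{2\pi}\Big)^{n+1}\tau_n(u)d^n .$$ **Theorem.** There is exactly one formal solution $A$ of $(\ast)$. It can be written as $A=U+Q\,G$ with a formal series $G$ divisible by $d^8$, and there are real constants $\alpha,\beta,\delta$ and a polynomial series $S$ such that $$G(d,u)=\Big(\frac{\alpha}{d^2}+\beta+\frac{\alpha}{3}\Big)\frac{u\,H_0(d,u)}{\tau_2(u)}-\Big(\beta d+\frac{\alpha}{d}\Big)H_2(d,u)+\delta\,d\,H_1(d,u)+S(d,u)$$ and $$\|S\|_n=O\big((n-3)!\,(2\pi)^{-n}\big)\qquad(n\to\infty).$$ -/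

import Mathlib

open Polynomial

/-- Formal power series in `d` whose coefficients are complex polynomials in `u`. -/
abbrev PolySeries : Type := PowerSeries (Polynomial ℂ)

namespace PolySeries

noncomputable section

/-- The formal variable `d`. -/
def d : PolySeries := PowerSeries.X

/-- A polynomial in `u`, as a series that is constant in `d`. -/
def ofPoly (p : ℂ[X]) : PolySeries := PowerSeries.C p

/-- The variable `u`. -/
def u : PolySeries := ofPoly X

/-- A complex number, as a constant series. -/
def const (c : ℂ) : PolySeries := ofPoly (C c)

/-- `cosh (θ d)`. -/
def coshS (θ : ℂ) : PolySeries :=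
  PowerSeries.mk fun n => if Even n then C (θ ^ n / (n.factorial : ℂ)) else 0

/-- `sinh (θ d)`. -/
def sinhS (θ : ℂ) : PolySeries :=
  PowerSeries.mk fun n => if Odd n then C (θ ^ n / (n.factorial : ℂ)) else 0

/-- The inverse of a series; it is only applied to series whose constant term is `1`. -/
def inv (Z : PolySeries) : PolySeries := PowerSeries.invOfUnit Z 1

/-- `tanh d = sinh d / cosh d`. -/
def tanhS : PolySeries := sinhS 1 * inv (coshS 1)

/-- `T⁺ = (u + tanh d) / (1 + u tanh d)`. -/
def Tplus : PolySeries := (u + tanhS) * inv (1 + u * tanhS)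

/-- `T⁻ = (u - tanh d) / (1 - u tanh d)`. -/
def Tminus : PolySeries := (u - tanhS) * inv (1 - u * tanhS)

/-- `ε = 2 sinh (d / 2)`. -/
def eps : PolySeries := 2 * sinhS (1 / 2)

/-- The series `Z (d, T) = ∑ₖ Zₖ(T) dᵏ` obtained from `Z (d, u) = ∑ₖ Zₖ(u) dᵏ` by replacing
`u` by the series `T`. Only the terms with `k ≤ m` contribute to the coefficient of `dᵐ`. -/
def substU (Z T : PolySeries) : PolySeries :=
  PowerSeries.mk fun m => PowerSeries.coeff m
    (∑ k ∈ Finset.range (m + 1), d ^ k * Polynomial.eval₂ (PowerSeries.C.comp C) T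
      (PowerSeries.coeff k Z))

/-- `cos (A √(1 - u²)) = ∑ₖ (-1)ᵏ (1 - u²)ᵏ A²ᵏ / (2k)!`, for a series `A` without constant term
in `d`. Only the terms with `k ≤ m` contribute to the coefficient of `dᵐ`. -/
def cosRoot (A : PolySeries) : PolySeries :=
  PowerSeries.mk fun m => PowerSeries.coeff m
    (∑ k ∈ Finset.range (m + 1),
      const ((-1) ^ k / ((2 * k).factorial : ℂ)) * (1 - u ^ 2) ^ k * A ^ (2 * k))

/-- `sin (A √(1 - u²)) / √(1 - u²) = ∑ₖ (-1)ᵏ (1 - u²)ᵏ A²ᵏ⁺¹ / (2k + 1)!`, for a series `A`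
without constant term in `d`. -/
def sinRoot (A : PolySeries) : PolySeries :=
  PowerSeries.mk fun m => PowerSeries.coeff m
    (∑ k ∈ Finset.range (m + 1),
      const ((-1) ^ k / ((2 * k + 1).factorial : ℂ)) * (1 - u ^ 2) ^ k * A ^ (2 * k + 1))

/-- The polynomial `P` with `q₀⁽ᵏ⁺¹⁾(s) = √(1 - tanh² s) · P (tanh s)`, where
`q₀(s) = 4 arctan (e⁻ˢ)`; see `iteratedDeriv_heteroclinic`. -/
def heteroclinicDeriv : ℕ → ℝ[X]
  | 0 => -2
  | k + 1 => (1 - X ^ 2) * derivative (heteroclinicDeriv k) - X * heteroclinicDeriv k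

/-- The polynomial `I_{2n-1}`, for `n ≥ 1`:
`2 / (2n)! · q₀⁽²ⁿ⁾(s) = √(1 - tanh² s) · I_{2n-1}(tanh s)`. -/
def Ipoly (n : ℕ) : ℂ[X] :=
  C (2 / ((2 * n).factorial : ℂ)) * (heteroclinicDeriv (2 * n - 1)).map Complex.ofRealHom

/-- `∑_{n ≥ 1} I_{2n-1}(u) d²ⁿ`. -/
def Iseries : PolySeries :=
  PowerSeries.mk fun m => if Even m ∧ 2 ≤ m then Ipoly (m / 2) else 0

/-- The right-hand side `f (ε, u, A)` of the equation. -/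
def rhs (A : PolySeries) : PolySeries :=
  eps ^ 2 * (2 * u * cosRoot A + (2 * u ^ 2 - 1) * sinRoot A) - Iseries

/-- `A` is a formal solution, of the form `∑_{n ≥ 1} A_{2n-1}(u) d²ⁿ` with odd polynomials
`A_{2n-1}` of degree at most `2n - 1`, of the equation
`A(T⁺) / (cosh d + u sinh d) + A(T⁻) / (cosh d - u sinh d) - 2 A = f (ε, u, A)`. -/
structure IsFormalSolution (A : PolySeries) : Prop where
  coeff_zero : PowerSeries.coeff 0 A = 0
  coeff_odd : ∀ n, PowerSeries.coeff (2 * n + 1) A = 0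
  odd_coeff_even : ∀ n, 1 ≤ n →
    (PowerSeries.coeff (2 * n) A).comp (-X) = -PowerSeries.coeff (2 * n) A
  natDegree_le : ∀ n, 1 ≤ n → (PowerSeries.coeff (2 * n) A).natDegree ≤ 2 * n - 1
  equation : substU A Tplus * inv (coshS 1 + u * sinhS 1)
      + substU A Tminus * inv (coshS 1 - u * sinhS 1) - 2 * A = rhs A

/-- The initial part `U` of the formal solution. -/
def U : PolySeries :=
  const (-1 / 4) * u * d ^ 2
    + (const (91 / 864) * u ^ 3 - const (47 / 576) * u) * d ^ 4
    + (const (-319 / 2880) * u ^ 5 + const (185 / 1152) * u ^ 3 - const (3703 / 69120) * u) * d ^ 6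

/-- The polynomial `Q` in `d` and `u`. -/
def Q : PolySeries :=
  1 + const (1 / 4) * (1 - u ^ 2) * d ^ 2
    + (const (91 / 432) * u ^ 4 - const (13 / 48) * u ^ 2 + const (13 / 216)) * d ^ 4
    + (const (-319 / 960) * u ^ 6 + const (1079 / 1728) * u ^ 4 - const (937 / 2880) * u ^ 2
        + const (287 / 8640)) * d ^ 6

/-- The polynomials `τ₀ = 1`, `τ₁ = u`, `τₙ₊₁ = (1 / n) (1 - u²) τₙ'` for `n ≥ 1`. -/
def tau : ℕ → ℂ[X]
  | 0 => 1
  | 1 => X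
  | n + 2 => C (1 / ((n : ℂ) + 1)) * ((1 - X ^ 2) * derivative (tau (n + 1)))

theorem tau_add_two (n : ℕ) :
    tau (n + 2) = C (1 / ((n : ℂ) + 1)) * ((1 - X ^ 2) * derivative (tau (n + 1))) := by
  rw [tau]

theorem degree_one_sub_X_sq : (1 - X ^ 2 : ℂ[X]).degree = 2 := by
  have h : (1 - X ^ 2 : ℂ[X]) = -(X ^ 2 - C 1) := by simp
  rw [h, degree_neg, degree_X_pow_sub_C (by norm_num)]
  rfl

theorem degree_tau_succ (n : ℕ) : (tau (n + 1)).degree = ((n + 1 : ℕ) : WithBot ℕ) := by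
  induction n with
  | zero => rw [show tau (0 + 1) = X by rw [tau]]; simp
  | succ n ih =>
    have hn : (1 / ((n : ℂ) + 1)) ≠ 0 := one_div_ne_zero (Nat.cast_add_one_ne_zero n)
    have hd : (derivative (tau (n + 1))).degree = (n : WithBot ℕ) := by
      have hN : (tau (n + 1)).natDegree = n + 1 := natDegree_eq_of_degree_eq_some ih
      rw [degree_derivative (by omega), hN]
      rfl
    rw [tau_add_two, degree_mul, degree_C hn, degree_mul, degree_one_sub_X_sq, hd, zero_add]
    norm_cast
    rw [add_comm]

theorem degree_tau (n : ℕ) : (tau n).degree = (n : WithBot ℕ) := by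
  cases n with
  | zero => rw [show tau 0 = 1 by rw [tau]]; simp
  | succ n => exact degree_tau_succ n

/-- The sequence `τ`, with `deg τₙ = n`. -/
def tauSeq : Polynomial.Sequence ℂ := ⟨tau, degree_tau⟩

theorem isUnit_leadingCoeff_tauSeq (i : ℕ) : IsUnit (tauSeq i).leadingCoeff :=
  isUnit_iff_ne_zero.mpr (leadingCoeff_ne_zero.mpr (tauSeq.ne_zero i))

/-- `τ₀, τ₁, …` as a basis of the space of polynomials. -/
def tauBasis : Module.Basis ℕ ℂ ℂ[X] := tauSeq.basis isUnit_leadingCoeff_tauSeq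

/-- For `p = ∑_{i ≤ n} aᵢ τᵢ` of degree at most `n`, the norm `‖p‖ₙ = ∑_{i ≤ n} |aᵢ| (π / 2)ⁿ⁻ⁱ`. -/
def tauNorm (n : ℕ) (p : ℂ[X]) : ℝ :=
  ∑ i ∈ Finset.range (n + 1), ‖tauBasis.repr p i‖ * (Real.pi / 2) ^ (n - i)

/-- The space of polynomial series: the coefficient of `dⁿ` has degree at most `n`. -/
def IsPolynomialSeries (Z : PolySeries) : Prop :=
  ∀ n, (PowerSeries.coeff n Z).natDegree ≤ n

/-- `H₀ = ∑_{n ≥ 10, n even} (n-1)! (i / 2π)ⁿ τₙ(u) dⁿ`. -/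
def H0 : PolySeries :=
  PowerSeries.mk fun n => if Even n ∧ 10 ≤ n then
    C (((n - 1).factorial : ℂ) * (Complex.I / (2 * (Real.pi : ℂ))) ^ n) * tau n else 0

/-- `H₁ = ∑_{n ≥ 9, n odd} (n-1)! (i / 2π)ⁿ⁺¹ τₙ(u) dⁿ`. -/
def H1 : PolySeries :=
  PowerSeries.mk fun n => if Odd n ∧ 9 ≤ n then
    C (((n - 1).factorial : ℂ) * (Complex.I / (2 * (Real.pi : ℂ))) ^ (n + 1)) * tau n else 0

/-- `H₂ = ∑_{n ≥ 9, n odd} n! (i / 2π)ⁿ⁺¹ τₙ(u) dⁿ`. -/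
def H2 : PolySeries :=
  PowerSeries.mk fun n => if Odd n ∧ 9 ≤ n then
    C ((n.factorial : ℂ) * (Complex.I / (2 * (Real.pi : ℂ))) ^ (n + 1)) * tau n else 0

/-- `u H₀ / τ₂`, by division of every coefficient; the division is exact, see
`tau_two_mul_uH0divTau2`. -/
def uH0divTau2 : PolySeries :=
  PowerSeries.mk fun n => X * PowerSeries.coeff n H0 / tau 2

theorem tau_two : tau 2 = 1 - X ^ 2 := by
  rw [show (2 : ℕ) = 0 + 2 from rfl, tau_add_two, show tau (0 + 1) = X by rw [tau]]
  simp

theorem tau_two_dvd (n : ℕ) : tau 2 ∣ tau (n + 2) := by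
  rw [tau_two, tau_add_two]
  exact ⟨C (1 / ((n : ℂ) + 1)) * derivative (tau (n + 1)), by ring⟩

theorem tau_two_mul_uH0divTau2 : ofPoly (tau 2) * uH0divTau2 = u * H0 := by
  ext1 n
  rw [ofPoly, u, ofPoly, PowerSeries.coeff_C_mul, PowerSeries.coeff_C_mul, uH0divTau2,
    PowerSeries.coeff_mk]
  refine EuclideanDomain.mul_div_cancel' ?_ (Dvd.dvd.mul_left ?_ _)
  · exact fun h => tauSeq.ne_zero 2 h
  · rw [H0, PowerSeries.coeff_mk]
    split_ifs with h
    · obtain ⟨m, rfl⟩ : ∃ m, n = m + 2 := ⟨n - 2, by omega⟩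
      exact Dvd.dvd.mul_left (tau_two_dvd m) _
    · exact dvd_zero _

theorem hasDerivAt_tanh (s : ℝ) : HasDerivAt Real.tanh (1 - Real.tanh s ^ 2) s := by
  have h := (Real.hasDerivAt_sinh s).div (Real.hasDerivAt_cosh s) (Real.cosh_pos s).ne'
  have e : Real.tanh = fun s => Real.sinh s / Real.cosh s := by
    funext s; exact Real.tanh_eq_sinh_div_cosh s
  rw [e]
  refine h.congr_deriv ?_
  have := (Real.cosh_pos s).ne'
  field_simp

theorem sqrt_one_sub_tanh_sq (s : ℝ) :
    Real.sqrt (1 - Real.tanh s ^ 2) = 1 / Real.cosh s := by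
  have hc := Real.cosh_pos s
  rw [← Real.sqrt_sq (by positivity : 0 ≤ 1 / Real.cosh s)]
  congr 1
  rw [Real.tanh_eq_sinh_div_cosh]
  field_simp
  linarith [Real.cosh_sq s]

/-- The derivatives of `q₀(s) = 4 arctan (e⁻ˢ)` are given by `heteroclinicDeriv`. -/
theorem iteratedDeriv_heteroclinic (k : ℕ) :
    iteratedDeriv (k + 1) (fun s : ℝ => 4 * Real.arctan (Real.exp (-s)))
      = fun s => Real.sqrt (1 - Real.tanh s ^ 2) * (heteroclinicDeriv k).eval (Real.tanh s) := by
  induction k with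
  | zero =>
    funext s
    rw [zero_add, iteratedDeriv_one, sqrt_one_sub_tanh_sq]
    have h := (((hasDerivAt_neg s).exp).arctan).const_mul 4
    refine Eq.trans h.deriv ?_
    rw [heteroclinicDeriv, Real.cosh_eq]
    simp only [eval_neg, eval_ofNat, Real.exp_neg]
    have := Real.exp_pos s
    field_simp
    ring
  | succ k ih =>
    rw [iteratedDeriv_succ, ih]
    funext s
    simp only [sqrt_one_sub_tanh_sq]
    have hc := (Real.cosh_pos s).ne'
    have h1 : HasDerivAt (fun s => 1 / Real.cosh s) (-(Real.tanh s / Real.cosh s)) s := by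
      have h := (hasDerivAt_const s (1 : ℝ)).div (Real.hasDerivAt_cosh s) hc
      refine h.congr_deriv ?_
      rw [Real.tanh_eq_sinh_div_cosh]
      field_simp
      ring
    have h2 := ((heteroclinicDeriv k).hasDerivAt (Real.tanh s)).comp s (hasDerivAt_tanh s)
    refine Eq.trans (h1.mul h2).deriv ?_
    rw [heteroclinicDeriv]
    simp only [eval_sub, eval_mul, eval_one, eval_pow, eval_X, Function.comp]
    ring

end

end PolySeries

open Polynomial

namespace PolySeries

noncomputable section

/-! ### The derivations `p ↦ (1 - u²) p' + a u p` and their exponentials -/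

/-! Put u = tanh s. Then d/ds acts on polynomials in u as (1 - u²) d/du, replacing u by T⁺ or T⁻ is
the shift s ↦ s ± d, and the denominators are cosh (s ± d) / cosh s. The equation therefore says
that q = q₀ + A / cosh s satisfies q(s + d) + q(s - d) - 2 q(s) = ε² sin q(s).

Existence and uniqueness: a change of A at order d²ⁿ changes the residual at order d²ⁿ⁺² by -(1 -
u²) times `leadOp` of the change (`residual_change`, `Dop_sq_sub`). `leadOp` is triangular on
monomials and invertible on odd polynomials, and the residual is divisible by 1 - u² because it
vanishes at u = 1 (`evalOne_residual`) and is odd. So the coefficients can be found one after the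
other (`exists_solution`, `solution_unique`).

Remainder: U satisfies the equation, and Q its linearization at U, up to O(d¹⁰). For A = U + Q G let
N = L(Q G) - G L(Q), where L is the left-hand side. By `d_mul_Nser`, N consists of the residual of
U, of G times the defect of Q, and of terms at least quadratic in G, all of high order in d.
Reduction of order gives ∇(τ₂ V) = τ₂ Q N and ∇G = M V with a convergent M (`nabla_tau2_mul_Vser`,
`nabla_eq_mul`), so G is recovered from N by inverting the central difference ∇ twice.

Inverting ∇: since d τₙ / ds = n τₙ₊₁, the coordinates along τᵢ dⁱ⁺ˡ for fixed l, divided by (i -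
1)!, form a formal Borel transform on which a shift by θ d is multiplication by exp (θ x)
(`diagS_shift`). Thus ∇ is multiplication by 2 sinh (x / 2), and its inverse has poles at x = ±2πi:
this is the origin of the growth n! (2π)⁻ⁿ. The norms are submultiplicative up to a constant
(`tauNorm_mul_le`), and division by τ₂ is bounded (`tauNorm_le_of_mul`).

Bounds: a bound for G with weights (n + κ + 8)! gives one for N with weights (n + κ)!, eight orders
further; inversion carries it back to G. For large κ the constants close up (`Remainder.exists_bd`);
afterwards κ is lowered in steps of 8 (`Remainder.exists_bd_eleven`, `Remainder.exists_bd_Nser`).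

Asymptotics: on each diagonal the poles produce multiples of (±i / 2π)ⁿ, with a relative error that
is a power of 1 / n (`exists_cf_asymptotics`). Parity and reality reduce them to real multiples of
H₀ (`Remainder.exists_Vser_asymptotics`). After division by τ₂ and multiplication by M, ∇G is
matched with ∇ of an explicit combination of u H₀ / τ₂ and H₂ (`Remainder.gev_nabla`,
`gev_nabla_mainPart`). A last inversion of ∇ adds the term with H₁ and leaves the error (n - 3)!
(2π)⁻ⁿ (`exists_last_term`). -/

/-- The operator `p ↦ (1 - u²) p' + a u p`. -/
def Dop (a : ℂ) : ℂ[X] →ₗ[ℂ] ℂ[X] where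
  toFun p := (1 - X ^ 2) * derivative p + C a * X * p
  map_add' p q := by simp only [derivative_add]; ring
  map_smul' c p := by
    simp only [RingHom.id_apply, smul_eq_C_mul, derivative_C_mul]; ring

theorem Dop_apply (a : ℂ) (p : ℂ[X]) :
    Dop a p = (1 - X ^ 2) * derivative p + C a * X * p := rfl

theorem Dop_C_mul (a c : ℂ) (p : ℂ[X]) : Dop a (C c * p) = C c * Dop a p := by
  rw [← smul_eq_C_mul, map_smul, smul_eq_C_mul]

/-- `Dop a` is d/ds conjugated by the power `a` of cosh s, so the exponents add under
multiplication. This Leibniz rule makes the exponentials below multiplicative. -/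
theorem Dop_mul (a b : ℂ) (p q : ℂ[X]) :
    Dop (a + b) (p * q) = Dop a p * q + p * Dop b q := by
  simp only [Dop_apply, derivative_mul, C_add]; ring

/-- `exp (θ d D) p` for a polynomial `p`. -/
def expPoly (a θ : ℂ) (p : ℂ[X]) : PolySeries :=
  PowerSeries.mk fun k => C (θ ^ k / (k.factorial : ℂ)) * ((Dop a) ^ k) p

theorem coeff_expPoly (a θ : ℂ) (p : ℂ[X]) (k : ℕ) :
    PowerSeries.coeff k (expPoly a θ p) = C (θ ^ k / (k.factorial : ℂ)) * ((Dop a) ^ k) p := by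
  rw [expPoly, PowerSeries.coeff_mk]

theorem succ_mul_coeff_expPoly (a θ : ℂ) (p : ℂ[X]) (k : ℕ) :
    PowerSeries.coeff (k + 1) (expPoly a θ p) * ((k : ℂ[X]) + 1)
      = C θ * Dop a (PowerSeries.coeff k (expPoly a θ p)) := by
  have h : (k : ℂ) + 1 ≠ 0 := Nat.cast_add_one_ne_zero k
  have hf : (k.factorial : ℂ) ≠ 0 := Nat.cast_ne_zero.mpr k.factorial_ne_zero
  rw [coeff_expPoly, coeff_expPoly, Dop_C_mul, pow_succ' (Dop a), Module.End.mul_apply,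
    show ((k : ℂ[X]) + 1) = C ((k : ℂ) + 1) by simp]
  rw [mul_right_comm, ← C_mul, ← mul_assoc, ← C_mul]
  congr 2
  rw [Nat.factorial_succ]; push_cast; field_simp; ring

/-- A series `F` is `exp (θ d D) p` as soon as `∂F/∂d = θ D F` and its constant term is `p`. -/
theorem eq_expPoly (a θ : ℂ) (p : ℂ[X]) (F : PolySeries) (h0 : PowerSeries.coeff 0 F = p)
    (hs : ∀ k, PowerSeries.coeff (k + 1) F * ((k : ℂ[X]) + 1)
      = C θ * Dop a (PowerSeries.coeff k F)) : F = expPoly a θ p := by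
  ext1 k
  induction k with
  | zero => rw [h0, coeff_expPoly]; simp
  | succ k ih =>
    have hk : ((k : ℂ[X]) + 1) ≠ 0 := by exact_mod_cast (Nat.cast_add_one_ne_zero k : (k : ℂ[X]) + 1 ≠ 0)
    refine mul_right_cancel₀ hk ?_
    rw [hs, ih, succ_mul_coeff_expPoly]

theorem coeff_succ_mul_mul_succ {R : Type*} [CommRing R] (f g : PowerSeries R) (k : ℕ) :
    PowerSeries.coeff (k + 1) (f * g) * ((k : R) + 1)
      = PowerSeries.coeff k (f * PowerSeries.derivative R g)
        + PowerSeries.coeff k (g * PowerSeries.derivative R f) := by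
  have hd := congrArg (PowerSeries.coeff k) ((PowerSeries.derivative R).leibniz f g)
  rwa [PowerSeries.coeff_derivative, map_add, smul_eq_mul, smul_eq_mul] at hd

theorem coeff_derivative_expPoly (a θ : ℂ) (p : ℂ[X]) (k : ℕ) :
    PowerSeries.coeff k (PowerSeries.derivative ℂ[X] (expPoly a θ p))
      = C θ * Dop a (PowerSeries.coeff k (expPoly a θ p)) := by
  rw [PowerSeries.coeff_derivative, succ_mul_coeff_expPoly]

/-- By the Leibniz rule the product on the right satisfies the differential equation in `d`, with
constant term `p * q`, that characterizes the left side. -/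
theorem expPoly_mul (a b θ : ℂ) (p q : ℂ[X]) :
    expPoly (a + b) θ (p * q) = expPoly a θ p * expPoly b θ q := by
  symm
  apply eq_expPoly
  · rw [PowerSeries.coeff_mul]; simp [coeff_expPoly]
  · intro k
    rw [coeff_succ_mul_mul_succ, PowerSeries.coeff_mul, PowerSeries.coeff_mul,
      PowerSeries.coeff_mul, map_sum, Finset.mul_sum]
    simp only [Dop_mul, mul_add, Finset.sum_add_distrib, coeff_derivative_expPoly]
    rw [add_comm]
    congr 1
    · rw [← Finset.Nat.sum_antidiagonal_swap]
      refine Finset.sum_congr rfl fun x _ => ?_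
      simp only [Prod.fst_swap, Prod.snd_swap]
      ring
    · refine Finset.sum_congr rfl fun x _ => ?_
      ring

/-- `exp (θ d D)`, where `D p = (1 - u²) p' + a u p`. -/
def expD (a θ : ℂ) (Z : PolySeries) : PolySeries :=
  PowerSeries.mk fun n => ∑ x ∈ Finset.HasAntidiagonal.antidiagonal n,
    PowerSeries.coeff x.1 (expPoly a θ (PowerSeries.coeff x.2 Z))

theorem coeff_expD (a θ : ℂ) (Z : PolySeries) (n : ℕ) :
    PowerSeries.coeff n (expD a θ Z) = ∑ x ∈ Finset.HasAntidiagonal.antidiagonal n,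
      C (θ ^ x.1 / (x.1.factorial : ℂ)) * ((Dop a) ^ x.1) (PowerSeries.coeff x.2 Z) := by
  rw [expD, PowerSeries.coeff_mk]
  exact Finset.sum_congr rfl fun x _ => coeff_expPoly _ _ _ _

theorem expPoly_add (a θ : ℂ) (p q : ℂ[X]) :
    expPoly a θ (p + q) = expPoly a θ p + expPoly a θ q := by
  ext1 k; simp [coeff_expPoly, mul_add]

theorem expPoly_zero (a θ : ℂ) : expPoly a θ 0 = 0 := by
  ext1 k; simp [coeff_expPoly]

theorem expPoly_sum {ι : Type*} (a θ : ℂ) (s : Finset ι) (f : ι → ℂ[X]) :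
    expPoly a θ (∑ i ∈ s, f i) = ∑ i ∈ s, expPoly a θ (f i) := by
  classical
  induction s using Finset.induction_on with
  | empty => simp [expPoly_zero]
  | insert i s hi ih => rw [Finset.sum_insert hi, Finset.sum_insert hi, expPoly_add, ih]

theorem expD_add (a θ : ℂ) (Z Y : PolySeries) : expD a θ (Z + Y) = expD a θ Z + expD a θ Y := by
  ext1 n
  simp only [coeff_expD, map_add, mul_add, Finset.sum_add_distrib]

theorem expD_neg (a θ : ℂ) (Z : PolySeries) : expD a θ (-Z) = -expD a θ Z := by
  ext1 n
  simp only [coeff_expD, map_neg, mul_neg, Finset.sum_neg_distrib]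

theorem expD_zero_right (a θ : ℂ) : expD a θ 0 = 0 := by
  ext1 n
  simp [coeff_expD]

theorem expD_mul (a b θ : ℂ) (Z Y : PolySeries) :
    expD (a + b) θ (Z * Y) = expD a θ Z * expD b θ Y := by
  ext1 n
  simp only [expD, PowerSeries.coeff_mk, PowerSeries.coeff_mul, expPoly_sum, expPoly_mul, map_sum,
    Finset.sum_mul_sum]
  simp only [Finset.sum_sigma', ← Finset.sum_product']
  -- The four indices form a 2 × 2 array, operator order or coefficient order for each of the two
  -- factors. One side sums it by rows, the other by columns; the bijection transposes it.
  refine Finset.sum_bij'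
    (fun x _ => ⟨(x.2.2.1 + x.2.1.1, x.2.2.2 + x.2.1.2), (x.2.2.1, x.2.1.1), (x.2.2.2, x.2.1.2)⟩)
    (fun x _ => ⟨(x.2.1.1 + x.2.2.1, x.2.1.2 + x.2.2.2), (x.2.1.2, x.2.2.2), (x.2.1.1, x.2.2.1)⟩)
    ?_ ?_ ?_ ?_ ?_
  · rintro ⟨⟨k, m⟩, ⟨i, j⟩, ⟨p, q⟩⟩ h
    simp only [Finset.mem_sigma, Finset.mem_product, Finset.HasAntidiagonal.mem_antidiagonal] at h ⊢
    exact ⟨by omega, trivial, trivial⟩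
  · rintro ⟨⟨k, m⟩, ⟨i, j⟩, ⟨p, q⟩⟩ h
    simp only [Finset.mem_sigma, Finset.mem_product, Finset.HasAntidiagonal.mem_antidiagonal] at h ⊢
    exact ⟨by omega, trivial, trivial⟩
  · rintro ⟨⟨k, m⟩, ⟨i, j⟩, ⟨p, q⟩⟩ h
    simp only [Finset.mem_sigma, Finset.mem_product, Finset.HasAntidiagonal.mem_antidiagonal] at h ⊢
    obtain ⟨h1, h2, h3⟩ := h
    subst h2; subst h3; rfl
  · rintro ⟨⟨k, m⟩, ⟨i, j⟩, ⟨p, q⟩⟩ h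
    simp only [Finset.mem_sigma, Finset.mem_product, Finset.HasAntidiagonal.mem_antidiagonal] at h ⊢
    obtain ⟨h1, h2, h3⟩ := h
    subst h2; subst h3; rfl
  · rintro ⟨⟨k, m⟩, ⟨i, j⟩, ⟨p, q⟩⟩ h
    rfl

theorem expD_expD (a θ φ : ℂ) (Z : PolySeries) :
    expD a θ (expD a φ Z) = expD a (θ + φ) Z := by
  ext1 n
  simp only [coeff_expD, map_sum, Finset.mul_sum]
  -- The binomial theorem in its exponential form: (θ + φ)ᵏ / k! is the sum of θⁱ φʲ / (i! j!) over
  -- i + j = k.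
  have h : ∀ x : ℕ × ℕ, C ((θ + φ) ^ x.1 / (x.1.factorial : ℂ)) * ((Dop a) ^ x.1)
      (PowerSeries.coeff x.2 Z) = ∑ y ∈ Finset.HasAntidiagonal.antidiagonal x.1,
        C (θ ^ y.1 / (y.1.factorial : ℂ)) * C (φ ^ y.2 / (y.2.factorial : ℂ))
          * ((Dop a) ^ x.1) (PowerSeries.coeff x.2 Z) := by
    intro x
    rw [← Finset.sum_mul]
    congr 1
    simp only [← C_mul]
    rw [← map_sum]
    congr 1
    rw [(Commute.all θ φ).add_pow', Finset.sum_div]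
    refine Finset.sum_congr rfl fun y hy => ?_
    rw [Finset.HasAntidiagonal.mem_antidiagonal] at hy
    have h1 : (y.1.factorial : ℂ) ≠ 0 := Nat.cast_ne_zero.mpr y.1.factorial_ne_zero
    have h2 : (y.2.factorial : ℂ) ≠ 0 := Nat.cast_ne_zero.mpr y.2.factorial_ne_zero
    have h3 : (x.1.factorial : ℂ) ≠ 0 := Nat.cast_ne_zero.mpr x.1.factorial_ne_zero
    have h4 : (x.1.choose y.1 : ℂ) * y.1.factorial * y.2.factorial = x.1.factorial := by
      rw [← hy, Nat.choose_symm_add]; exact_mod_cast Nat.add_choose_mul_factorial_mul_factorial y.1 y.2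
    rw [nsmul_eq_mul]
    field_simp
    rw [← h4]; ring
  simp only [h]
  simp only [Finset.sum_sigma']
  refine Finset.sum_bij'
    (fun x _ => ⟨(x.1.1 + x.2.1, x.2.2), (x.1.1, x.2.1)⟩)
    (fun x _ => ⟨(x.2.1, x.2.2 + x.1.2), (x.2.2, x.1.2)⟩)
    ?_ ?_ ?_ ?_ ?_
  · rintro ⟨⟨k, m⟩, ⟨i, j⟩⟩ h
    simp only [Finset.mem_sigma, Finset.HasAntidiagonal.mem_antidiagonal] at h ⊢
    exact ⟨by omega, trivial⟩
  · rintro ⟨⟨k, m⟩, ⟨i, j⟩⟩ h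
    simp only [Finset.mem_sigma, Finset.HasAntidiagonal.mem_antidiagonal] at h ⊢
    exact ⟨by omega, trivial⟩
  · rintro ⟨⟨k, m⟩, ⟨i, j⟩⟩ h
    simp only [Finset.mem_sigma, Finset.HasAntidiagonal.mem_antidiagonal] at h ⊢
    obtain ⟨h1, h2⟩ := h
    subst h2; rfl
  · rintro ⟨⟨k, m⟩, ⟨i, j⟩⟩ h
    simp only [Finset.mem_sigma, Finset.HasAntidiagonal.mem_antidiagonal] at h ⊢
    obtain ⟨h1, h2⟩ := h
    subst h2; rfl
  · rintro ⟨⟨k, m⟩, ⟨i, j⟩⟩ h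
    rw [← smul_eq_C_mul, ← smul_eq_C_mul, map_smul, ← Module.End.mul_apply, ← pow_add,
      smul_eq_C_mul, smul_eq_C_mul, mul_assoc]

theorem expD_zero_left (a : ℂ) (Z : PolySeries) : expD a 0 Z = Z := by
  ext1 n
  rw [coeff_expD, Finset.sum_eq_single (0, n)]
  · simp
  · rintro ⟨i, j⟩ hij hne
    rw [Finset.HasAntidiagonal.mem_antidiagonal] at hij
    have : i ≠ 0 := by rintro rfl; apply hne; simp at hij; simp [hij]
    simp [this]
  · simp

theorem expD_ofPoly (a θ : ℂ) (p : ℂ[X]) : expD a θ (ofPoly p) = expPoly a θ p := by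
  ext1 n
  rw [coeff_expD, coeff_expPoly, Finset.sum_eq_single (n, 0)]
  · simp [ofPoly]
  · rintro ⟨i, j⟩ hij hne
    rw [Finset.HasAntidiagonal.mem_antidiagonal] at hij
    have : j ≠ 0 := by rintro rfl; apply hne; simp at hij; simp [hij]
    simp [ofPoly, PowerSeries.coeff_C, this]
  · simp

/-! ### Shifts and the addition theorems of the hyperbolic functions. -/

/-- The substitution `u = tanh s ↦ tanh (s + θ d)`, as a ring homomorphism. -/
def shift (θ : ℂ) : PolySeries →+* PolySeries where
  toFun := expD 0 θ
  map_one' := by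
    have : (1 : PolySeries) = ofPoly 1 := by simp [ofPoly]
    rw [this, expD_ofPoly]
    ext1 n
    rw [coeff_expPoly]
    cases n with
    | zero => simp [ofPoly]
    | succ n =>
      have : Dop 0 1 = 0 := by simp [Dop_apply]
      rw [pow_succ (Dop _), Module.End.mul_apply, this]; simp [ofPoly, PowerSeries.coeff_one]
  map_mul' Z Y := by
    have := expD_mul 0 0 θ Z Y
    rwa [add_zero] at this
  map_zero' := expD_zero_right 0 θ
  map_add' := expD_add 0 θ

theorem shift_apply (θ : ℂ) (Z : PolySeries) : shift θ Z = expD 0 θ Z := rfl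

theorem shift_shift (θ φ : ℂ) (Z : PolySeries) : shift θ (shift φ Z) = shift (θ + φ) Z :=
  expD_expD 0 θ φ Z

theorem shift_zero (Z : PolySeries) : shift 0 Z = Z := expD_zero_left 0 Z

/-- A series with coefficients independent of `u` is invariant. -/
theorem shift_mk_C (θ : ℂ) (c : ℕ → ℂ) :
    shift θ (PowerSeries.mk fun n => C (c n)) = PowerSeries.mk fun n => C (c n) := by
  ext1 n
  rw [shift_apply, coeff_expD, Finset.sum_eq_single (0, n)]
  · simp
  · rintro ⟨i, j⟩ hij hne
    rw [Finset.HasAntidiagonal.mem_antidiagonal] at hij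
    have : i ≠ 0 := by rintro rfl; apply hne; simp at hij; simp [hij]
    obtain ⟨i, rfl⟩ := Nat.exists_eq_succ_of_ne_zero this
    have h0 : Dop 0 (C (c j)) = 0 := by simp [Dop_apply]
    rw [PowerSeries.coeff_mk]
    dsimp only
    rw [Nat.succ_eq_add_one, pow_succ (Dop _), Module.End.mul_apply, h0]; simp
  · simp

theorem shift_const (θ c : ℂ) : shift θ (const c) = const c := by
  have : const c = PowerSeries.mk fun n => C (if n = 0 then c else 0) := by
    ext1 n; simp only [const, ofPoly, PowerSeries.coeff_mk, PowerSeries.coeff_C]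
    split_ifs <;> simp
  rw [this, shift_mk_C]

theorem shift_d (θ : ℂ) : shift θ d = d := by
  have : d = PowerSeries.mk fun n => C (if n = 1 then 1 else 0) := by
    ext1 n; simp only [d, PowerSeries.coeff_mk, PowerSeries.coeff_X]
    split_ifs <;> simp
  rw [this, shift_mk_C]

theorem expD_shift_mul (a θ : ℂ) (Z Y : PolySeries) :
    expD a θ (Z * Y) = shift θ Z * expD a θ Y := by
  have := expD_mul 0 a θ Z Y
  rwa [zero_add] at this

/-- `cosh (s + θ d) / cosh s`. -/
def cfac (θ : ℂ) : PolySeries := expD 1 θ 1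

/-- `cosh s / cosh (s + θ d)`. -/
def kap (θ : ℂ) : PolySeries := expD (-1) θ 1

theorem kap_mul_cfac (θ : ℂ) : kap θ * cfac θ = 1 := by
  rw [kap, cfac, ← expD_mul, mul_one, neg_add_cancel]
  exact map_one (shift θ)

theorem Dop_one_one : Dop 1 1 = X := by simp [Dop_apply]

theorem Dop_one_X : Dop 1 X = 1 := by simp [Dop_apply]; ring

theorem Dop_one_pow_even (k : ℕ) : ((Dop 1) ^ (2 * k)) 1 = 1 ∧ ((Dop 1) ^ (2 * k)) X = X := by
  induction k with
  | zero => simp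
  | succ k ih =>
    rw [show 2 * (k + 1) = 2 * k + 1 + 1 by ring, pow_succ, pow_succ]
    simp only [Module.End.mul_apply, Dop_one_one, Dop_one_X]
    exact ih

theorem one_eq_ofPoly : (1 : PolySeries) = ofPoly 1 := by simp [ofPoly]

/-- With weight 1 the operator exchanges 1 and u, just as d/ds exchanges cosh s and sinh s, so the
exponential series splits into its even and odd parts. -/
theorem cfac_eq (θ : ℂ) : cfac θ = coshS θ + u * sinhS θ := by
  ext1 n
  rw [cfac, one_eq_ofPoly, expD_ofPoly, coeff_expPoly, map_add, u, ofPoly, PowerSeries.coeff_C_mul,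
    coshS, sinhS, PowerSeries.coeff_mk, PowerSeries.coeff_mk]
  rcases Nat.even_or_odd n with h | h
  · have h' : ¬ Odd n := Nat.not_odd_iff_even.mpr h
    obtain ⟨k, rfl⟩ := h
    rw [← two_mul] at h' ⊢
    simp [(Dop_one_pow_even k).1]
  · have h' : ¬ Even n := Nat.not_even_iff_odd.mpr h
    rw [if_neg h', if_pos h]
    obtain ⟨k, rfl⟩ := h
    rw [pow_succ (Dop _), Module.End.mul_apply, Dop_one_one, (Dop_one_pow_even k).2]
    ring

theorem expD_one_u (θ : ℂ) : expD 1 θ u = sinhS θ + u * coshS θ := by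
  ext1 n
  rw [u, expD_ofPoly, coeff_expPoly, map_add, ofPoly, PowerSeries.coeff_C_mul,
    coshS, sinhS, PowerSeries.coeff_mk, PowerSeries.coeff_mk]
  rcases Nat.even_or_odd n with h | h
  · have h' : ¬ Odd n := Nat.not_odd_iff_even.mpr h
    obtain ⟨k, rfl⟩ := h
    rw [← two_mul] at h' ⊢
    rw [(Dop_one_pow_even k).2, if_neg h', if_pos (even_two_mul k)]
    ring
  · have h' : ¬ Even n := Nat.not_even_iff_odd.mpr h
    rw [if_neg h', if_pos h]
    obtain ⟨k, rfl⟩ := h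
    rw [pow_succ (Dop _), Module.End.mul_apply, Dop_one_X, (Dop_one_pow_even k).1]
    ring

/-- The addition theorem of `tanh`. -/
theorem shift_u_mul_cfac (θ : ℂ) : shift θ u * cfac θ = sinhS θ + u * coshS θ := by
  rw [cfac, ← expD_shift_mul, mul_one, expD_one_u]

/-- `1 - u²`. -/
def tau2 : PolySeries := 1 - u ^ 2

theorem tau2_eq : tau2 = ofPoly (1 - X ^ 2) := by simp [tau2, u, ofPoly]

/-- Since 1 - u² = 1 / cosh² s, the operator of weight 2 annihilates it and its exponential fixes
it. Writing that exponential of `tau2 * 1` as a shift times the exponential of 1 gives the formula.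
-/
theorem shift_tau2_mul (θ : ℂ) : shift θ tau2 * cfac θ ^ 2 = tau2 := by
  have h : expD 2 θ tau2 = tau2 := by
    rw [tau2_eq, expD_ofPoly]
    ext1 n
    rw [coeff_expPoly]
    cases n with
    | zero => simp [ofPoly]
    | succ n =>
      have : Dop 2 (1 - X ^ 2) = 0 := by
        rw [Dop_apply, show (C (2 : ℂ)) = 2 from map_ofNat C 2]
        simp only [derivative_sub, derivative_one, derivative_X_pow, Nat.cast_ofNat]
        rw [show (C (2 : ℂ)) = 2 from map_ofNat C 2]; ring
      rw [pow_succ (Dop _), Module.End.mul_apply, this]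
      simp only [map_zero, mul_zero, ofPoly, PowerSeries.coeff_succ_C]
  have h2 : expD 2 θ 1 = cfac θ ^ 2 := by
    have := expD_mul 1 1 θ 1 1
    rw [mul_one, one_add_one_eq_two] at this
    rw [this, cfac, sq]
  conv_rhs => rw [← h, ← mul_one tau2, expD_shift_mul, h2]

theorem shift_tau2 (θ : ℂ) : shift θ tau2 = tau2 * kap θ ^ 2 := by
  linear_combination (-(shift θ tau2) * (kap θ * cfac θ + 1)) * kap_mul_cfac θ
    + kap θ ^ 2 * shift_tau2_mul θ

theorem expD_neg_one (θ : ℂ) (Z : PolySeries) : expD (-1) θ Z = shift θ Z * kap θ := by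
  rw [kap, ← expD_shift_mul, mul_one]

/-- The cocycle identity of the quotients cosh s / cosh (s + θ d). It makes the factors telescope in
`nabla_tau2_mul_Vser`. -/
theorem kap_mul_shift_kap (θ φ : ℂ) : kap θ * shift θ (kap φ) = kap (θ + φ) := by
  rw [mul_comm, ← expD_neg_one, kap, expD_expD, kap]

theorem kap_zero : kap 0 = 1 := expD_zero_left _ _

theorem cosh_sq_sub_sinh_sq (θ : ℂ) : coshS θ ^ 2 - sinhS θ ^ 2 = 1 := by
  -- evaluate `cfac θ * shift θ (cfac (-θ)) = 1` through the exponential series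
  have key : (coshS θ + sinhS θ) * (coshS θ - sinhS θ) = 1 := by
    have e1 : coshS θ + sinhS θ = PowerSeries.map (C : ℂ →+* ℂ[X])
        (PowerSeries.rescale θ (PowerSeries.exp ℂ)) := by
      ext1 n
      rw [PowerSeries.coeff_map, PowerSeries.coeff_rescale, PowerSeries.coeff_exp, map_add,
        coshS, sinhS, PowerSeries.coeff_mk, PowerSeries.coeff_mk]
      rcases Nat.even_or_odd n with h | h
      · rw [if_pos h, if_neg (Nat.not_odd_iff_even.mpr h), add_zero]
        congr 1; simp [div_eq_mul_inv]
      · rw [if_pos h, if_neg (Nat.not_even_iff_odd.mpr h), zero_add]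
        congr 1; simp [div_eq_mul_inv]
    have e2 : coshS θ - sinhS θ = PowerSeries.map (C : ℂ →+* ℂ[X])
        (PowerSeries.rescale (-θ) (PowerSeries.exp ℂ)) := by
      ext1 n
      rw [PowerSeries.coeff_map, PowerSeries.coeff_rescale, PowerSeries.coeff_exp, map_sub,
        coshS, sinhS, PowerSeries.coeff_mk, PowerSeries.coeff_mk]
      rcases Nat.even_or_odd n with h | h
      · rw [if_pos h, if_neg (Nat.not_odd_iff_even.mpr h), sub_zero, h.neg_pow]
        congr 1; simp [div_eq_mul_inv]
      · rw [if_pos h, if_neg (Nat.not_even_iff_odd.mpr h), zero_sub, h.neg_pow, ← C_neg]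
        congr 1; simp [div_eq_mul_inv]
    rw [e1, e2, ← map_mul, PowerSeries.exp_mul_exp_eq_exp_add, add_neg_cancel]
    simp
  linear_combination key

/-- Expand cosh s = cosh ((s + θ d) - θ d) and divide by cosh (s + θ d). In this form the reciprocal
of `cfac θ` is visibly convergent, without a geometric series. -/
theorem kap_eq (θ : ℂ) : kap θ = coshS θ - sinhS θ * shift θ u := by
  have h : cfac θ * (coshS θ - sinhS θ * shift θ u) = 1 := by
    have := shift_u_mul_cfac θ
    have h2 := cosh_sq_sub_sinh_sq θ
    rw [cfac_eq] at this ⊢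
    linear_combination (-sinhS θ) * this + h2
  linear_combination (coshS θ - sinhS θ * shift θ u) * kap_mul_cfac θ - kap θ * h

theorem coshS_neg (θ : ℂ) : coshS (-θ) = coshS θ := by
  ext1 n; simp only [coshS, PowerSeries.coeff_mk]
  split_ifs with h
  · rw [h.neg_pow]
  · rfl

theorem sinhS_neg (θ : ℂ) : sinhS (-θ) = -sinhS θ := by
  ext1 n; simp only [sinhS, PowerSeries.coeff_mk, map_neg]
  split_ifs with h
  · rw [h.neg_pow, neg_div, C_neg]
  · simp

theorem cfac_neg (θ : ℂ) : cfac (-θ) = coshS θ - u * sinhS θ := by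
  rw [cfac_eq, coshS_neg, sinhS_neg]; ring

/-! ### The substitutions T⁺, T⁻ and the left-hand side as shifts. -/

theorem inv_eq_of_mul_eq_one {Z Y : PolySeries} (h0 : PowerSeries.coeff 0 Z = 1) (h : Y * Z = 1) :
    inv Z = Y := by
  have := PowerSeries.invOfUnit_mul Z 1 (by simpa using h0)
  calc inv Z = inv Z * (Y * Z) := by rw [h, mul_one]
    _ = Y * (inv Z * Z) := by ring
    _ = Y := by rw [inv, this, mul_one]

theorem inv_mul_self {Z : PolySeries} (h0 : PowerSeries.coeff 0 Z = 1) : inv Z * Z = 1 :=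
  PowerSeries.invOfUnit_mul Z 1 (by simpa using h0)

theorem coeff_zero_mul (Z Y : PolySeries) : PowerSeries.coeff 0 (Z * Y)
    = PowerSeries.coeff 0 Z * PowerSeries.coeff 0 Y := by
  simp only [PowerSeries.coeff_zero_eq_constantCoeff_apply, map_mul]

theorem coeff_zero_coshS (θ : ℂ) : PowerSeries.coeff 0 (coshS θ) = 1 := by
  rw [coshS, PowerSeries.coeff_mk]; simp

theorem coeff_zero_sinhS (θ : ℂ) : PowerSeries.coeff 0 (sinhS θ) = 0 := by
  rw [sinhS, PowerSeries.coeff_mk]; simp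

theorem coeff_zero_cfac (θ : ℂ) : PowerSeries.coeff 0 (cfac θ) = 1 := by
  rw [cfac_eq, map_add, coeff_zero_coshS, coeff_zero_mul, coeff_zero_sinhS]; simp

theorem inv_cfac (θ : ℂ) : inv (cfac θ) = kap θ :=
  inv_eq_of_mul_eq_one (coeff_zero_cfac θ) (kap_mul_cfac θ)

theorem coeff_zero_tanhS : PowerSeries.coeff 0 tanhS = 0 := by
  rw [tanhS, coeff_zero_mul, coeff_zero_sinhS, zero_mul]

theorem tanhS_mul : tanhS * coshS 1 = sinhS 1 := by
  rw [tanhS]; linear_combination sinhS 1 * inv_mul_self (coeff_zero_coshS 1)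

theorem Tplus_eq : Tplus = shift 1 u := by
  have h0 : PowerSeries.coeff 0 (1 + u * tanhS) = 1 := by
    rw [map_add, coeff_zero_mul, coeff_zero_tanhS]; simp
  have h1 := inv_mul_self h0
  have hc := inv_mul_self (coeff_zero_coshS 1)
  have h2 := shift_u_mul_cfac 1
  rw [cfac_eq] at h2
  have h3 : shift 1 u * (1 + u * tanhS) = u + tanhS := by
    have ht := tanhS_mul
    rw [tanhS]
    linear_combination inv (coshS 1) * h2 + (u - shift 1 u) * hc
  rw [Tplus, ← h3]
  linear_combination shift 1 u * h1

theorem Tminus_eq : Tminus = shift (-1) u := by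
  have h0 : PowerSeries.coeff 0 (1 - u * tanhS) = 1 := by
    rw [map_sub, coeff_zero_mul, coeff_zero_tanhS]; simp
  have h1 := inv_mul_self h0
  have hc := inv_mul_self (coeff_zero_coshS 1)
  have h2 := shift_u_mul_cfac (-1)
  rw [cfac_neg, coshS_neg, sinhS_neg] at h2
  have h3 : shift (-1) u * (1 - u * tanhS) = u - tanhS := by
    rw [tanhS]
    linear_combination inv (coshS 1) * h2 + (u - shift (-1) u) * hc
  rw [Tminus, ← h3]
  linear_combination shift (-1) u * h1

/-- Evaluation at the shifted u and the shift of a constant series are ring homomorphisms that agree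
on scalars and on u. The truncation in `substU` is harmless because the k-th summand carries dᵏ. -/
theorem substU_shift (θ : ℂ) (Z : PolySeries) : substU Z (shift θ u) = shift θ Z := by
  have he : ∀ p : ℂ[X], Polynomial.eval₂ (PowerSeries.C.comp C) (shift θ u) p
      = expPoly 0 θ p := by
    intro p
    rw [← expD_ofPoly, ← shift_apply]
    have h1 : ofPoly p = Polynomial.eval₂ (PowerSeries.C.comp C) u p := by
      conv_lhs => rw [← Polynomial.eval₂_C_X (p := p)]
      rw [ofPoly, Polynomial.hom_eval₂]; rfl
    rw [h1, Polynomial.hom_eval₂]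
    congr 1
    exact RingHom.ext fun c => (shift_const θ c).symm
  ext1 m
  rw [substU, PowerSeries.coeff_mk, map_sum, shift_apply θ Z, expD, PowerSeries.coeff_mk,
    ← Finset.Nat.sum_antidiagonal_swap, Finset.Nat.sum_antidiagonal_eq_sum_range_succ_mk]
  refine Finset.sum_congr rfl fun k hk => ?_
  have hk' : k ≤ m := Nat.lt_succ_iff.mp (Finset.mem_range.mp hk)
  rw [he, d, PowerSeries.coeff_X_pow_mul', if_pos hk']
  rfl

/-- The left-hand side of the equation. -/
def lhs (Z : PolySeries) : PolySeries := expD (-1) 1 Z + expD (-1) (-1) Z - 2 * Z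

/-- The two denominators are `cfac 1` and `cfac (-1)`. Their inverses turn the plain shifts into
exponentials of weight -1, which are shifts acting on Z / cosh s. -/
theorem lhs_eq (Z : PolySeries) :
    substU Z Tplus * inv (coshS 1 + u * sinhS 1) + substU Z Tminus * inv (coshS 1 - u * sinhS 1)
      - 2 * Z = lhs Z := by
  rw [Tplus_eq, Tminus_eq, substU_shift, substU_shift, ← cfac_eq, ← cfac_neg, inv_cfac, inv_cfac,
    lhs, expD_neg_one, expD_neg_one]

/-! ### Entire functions of a series, and the addition theorems -/

theorem coeff_eq_zero_of_dvd {p n : ℕ} {Z : PolySeries} (h : d ^ p ∣ Z) (hn : n < p) :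
    PowerSeries.coeff n Z = 0 := PowerSeries.X_pow_dvd_iff.mp h n hn

theorem dvd_of_coeff_eq_zero {p : ℕ} {Z : PolySeries}
    (h : ∀ n < p, PowerSeries.coeff n Z = 0) : d ^ p ∣ Z := PowerSeries.X_pow_dvd_iff.mpr h

theorem coeff_add_mul_of_dvd {a b : ℕ} {Z Y : PolySeries} (hZ : d ^ a ∣ Z) (hY : d ^ b ∣ Y) :
    PowerSeries.coeff (a + b) (Z * Y) = PowerSeries.coeff a Z * PowerSeries.coeff b Y := by
  rw [PowerSeries.coeff_mul, Finset.sum_eq_single (a, b)]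
  · rintro ⟨i, j⟩ hij hne
    rw [Finset.HasAntidiagonal.mem_antidiagonal] at hij
    dsimp only at hij ⊢
    rcases lt_or_ge i a with h | h
    · rw [coeff_eq_zero_of_dvd hZ h, zero_mul]
    · have : j < b := by
        by_contra hj
        have h1 : i = a := by omega
        have h2 : j = b := by omega
        exact hne (by rw [h1, h2])
      rw [coeff_eq_zero_of_dvd hY this, mul_zero]
  · intro h
    simp at h

/-- `∑ₖ φₖ Xᵏ`, for a series `X` without constant term in `d`. -/
def entire (φ : ℕ → ℂ) (Y : PolySeries) : PolySeries :=
  PowerSeries.mk fun m => PowerSeries.coeff m (∑ k ∈ Finset.range (m + 1), const (φ k) * Y ^ k)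

theorem coeff_entire (φ : ℕ → ℂ) {Y : PolySeries} (hY : d ∣ Y) {m M : ℕ} (h : m < M) :
    PowerSeries.coeff m (entire φ Y)
      = PowerSeries.coeff m (∑ k ∈ Finset.range M, const (φ k) * Y ^ k) := by
  rw [entire, PowerSeries.coeff_mk, map_sum, map_sum]
  refine Finset.sum_subset (Finset.range_mono (by omega)) fun k _ hk => ?_
  have hk' : m < k := by simpa using hk
  exact coeff_eq_zero_of_dvd ((pow_dvd_pow_of_dvd hY k).mul_left _) hk'

theorem entire_sub_dvd (φ : ℕ → ℂ) {Y : PolySeries} (hY : d ∣ Y) (M : ℕ) :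
    d ^ M ∣ entire φ Y - ∑ k ∈ Finset.range M, const (φ k) * Y ^ k := by
  refine dvd_of_coeff_eq_zero fun n hn => ?_
  rw [map_sub, coeff_entire φ hY hn, sub_self]

theorem eq_of_forall_dvd_sub {Z Y : PolySeries} (h : ∀ M, d ^ M ∣ Z - Y) : Z = Y := by
  ext1 n
  have := coeff_eq_zero_of_dvd (h (n + 1)) (Nat.lt_succ_self n)
  rwa [map_sub, sub_eq_zero] at this

theorem const_add (a b : ℂ) : const (a + b) = const a + const b := by simp [const, ofPoly]

theorem const_mul (a b : ℂ) : const (a * b) = const a * const b := by simp [const, ofPoly]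

theorem const_neg (a : ℂ) : const (-a) = -const a := by simp [const, ofPoly]

theorem const_one : const 1 = 1 := by simp [const, ofPoly]

theorem const_natCast (n : ℕ) : const n = n := by
  simp [const, ofPoly]

/-- Horner's rule. It isolates the first terms of cosine and sine and leaves an unspecified entire
tail, which suffices for all divisibility statements. -/
theorem entire_eq (φ : ℕ → ℂ) {Y : PolySeries} (hY : d ∣ Y) :
    entire φ Y = const (φ 0) + Y * entire (fun k => φ (k + 1)) Y := by
  refine eq_of_forall_dvd_sub fun M => ?_
  have h1 := entire_sub_dvd φ hY (M + 1)
  have h2 := entire_sub_dvd (fun k => φ (k + 1)) hY M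
  rw [Finset.sum_range_succ'] at h1
  have h3 : ∑ k ∈ Finset.range M, const (φ (k + 1)) * Y ^ (k + 1)
      = Y * ∑ k ∈ Finset.range M, const (φ (k + 1)) * Y ^ k := by
    rw [Finset.mul_sum]; exact Finset.sum_congr rfl fun k _ => by ring
  rw [h3] at h1
  have h4 := ((pow_dvd_pow d (Nat.le_succ M)).trans h1).sub (h2.mul_left Y)
  convert h4 using 1
  ring

theorem coeff_zero_entire (φ : ℕ → ℂ) (Y : PolySeries) :
    PowerSeries.coeff 0 (entire φ Y) = C (φ 0) := by
  rw [entire, PowerSeries.coeff_mk]; simp [const, ofPoly]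

/-- The coefficients of `cos √x`. -/
def cosCoeff (k : ℕ) : ℂ := (-1) ^ k / ((2 * k).factorial : ℂ)

/-- The coefficients of `sin √x / √x`. -/
def sinCoeff (k : ℕ) : ℂ := (-1) ^ k / ((2 * k + 1).factorial : ℂ)

theorem dvd_tau2_mul_sq {A : PolySeries} (hA : d ∣ A) : d ∣ tau2 * A ^ 2 :=
  (dvd_pow hA two_ne_zero).mul_left _

theorem cosRoot_eq (A : PolySeries) : cosRoot A = entire cosCoeff (tau2 * A ^ 2) := by
  refine eq_of_forall_dvd_sub fun M => dvd_of_coeff_eq_zero fun m _ => ?_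
  have h3 : ∑ k ∈ Finset.range (m + 1), const (cosCoeff k) * (tau2 * A ^ 2) ^ k
      = ∑ k ∈ Finset.range (m + 1), const ((-1) ^ k / ((2 * k).factorial : ℂ))
        * (1 - u ^ 2) ^ k * A ^ (2 * k) := by
    refine Finset.sum_congr rfl fun k _ => ?_
    rw [cosCoeff, tau2, mul_pow, ← pow_mul]; ring
  rw [map_sub, sub_eq_zero, entire, PowerSeries.coeff_mk, h3]
  exact PowerSeries.coeff_mk _ _

theorem sinRoot_eq {A : PolySeries} (hA : d ∣ A) :
    sinRoot A = A * entire sinCoeff (tau2 * A ^ 2) := by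
  refine eq_of_forall_dvd_sub fun M => dvd_of_coeff_eq_zero fun m _ => ?_
  have h := (entire_sub_dvd sinCoeff (dvd_tau2_mul_sq hA) (m + 1)).mul_left A
  have h2 := coeff_eq_zero_of_dvd h (Nat.lt_succ_self m)
  rw [mul_sub, map_sub, sub_eq_zero] at h2
  have h3 : A * ∑ k ∈ Finset.range (m + 1), const (sinCoeff k) * (tau2 * A ^ 2) ^ k
      = ∑ k ∈ Finset.range (m + 1), const ((-1) ^ k / ((2 * k + 1).factorial : ℂ))
        * (1 - u ^ 2) ^ k * A ^ (2 * k + 1) := by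
    rw [Finset.mul_sum]
    refine Finset.sum_congr rfl fun k _ => ?_
    rw [sinCoeff, tau2, mul_pow, ← pow_mul]; ring
  rw [map_sub, h2, h3, sub_eq_zero]
  exact PowerSeries.coeff_mk _ _

/-! ### Differentiation in `d` and the addition theorems for `cosRoot` and `sinRoot`. -/

theorem derivative_mul' {R : Type*} [CommRing R] (f g : PowerSeries R) :
    PowerSeries.derivative R (f * g)
      = f * PowerSeries.derivative R g + g * PowerSeries.derivative R f := by
  rw [(PowerSeries.derivative R).leibniz f g, smul_eq_mul, smul_eq_mul]

/-- The derivative with respect to `d`. -/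
def dd (Z : PolySeries) : PolySeries := PowerSeries.derivative ℂ[X] Z

theorem coeff_dd (Z : PolySeries) (n : ℕ) :
    PowerSeries.coeff n (dd Z) = PowerSeries.coeff (n + 1) Z * ((n : ℂ[X]) + 1) := by
  rw [dd, PowerSeries.coeff_derivative]

theorem dd_mul (Z Y : PolySeries) : dd (Z * Y) = Z * dd Y + Y * dd Z := derivative_mul' Z Y

theorem dd_add (Z Y : PolySeries) : dd (Z + Y) = dd Z + dd Y := map_add _ Z Y

theorem dd_sub (Z Y : PolySeries) : dd (Z - Y) = dd Z - dd Y := map_sub _ Z Y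

theorem dd_sum {ι : Type*} (s : Finset ι) (f : ι → PolySeries) :
    dd (∑ i ∈ s, f i) = ∑ i ∈ s, dd (f i) := map_sum _ _ _

theorem dd_pow (Z : PolySeries) (n : ℕ) : dd (Z ^ (n + 1)) = (n + 1) * Z ^ n * dd Z := by
  rw [dd, PowerSeries.derivative_pow]; push_cast; rfl

theorem dd_ofPoly (p : ℂ[X]) : dd (ofPoly p) = 0 := by rw [dd, ofPoly, PowerSeries.derivative_C]

theorem dd_dvd {M : ℕ} {Z : PolySeries} (h : d ^ (M + 1) ∣ Z) : d ^ M ∣ dd Z := by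
  refine dvd_of_coeff_eq_zero fun n hn => ?_
  rw [coeff_dd, coeff_eq_zero_of_dvd h (by omega), zero_mul]

theorem dd_tau2_pow (k : ℕ) (c : ℂ) : dd (const c * tau2 ^ k) = 0 := by
  have : const c * tau2 ^ k = ofPoly (C c * (1 - X ^ 2) ^ k) := by
    rw [tau2_eq, const, ofPoly, ofPoly, ofPoly, map_mul, map_pow]
  rw [this, dd_ofPoly]

theorem cosRoot_sub_dvd {A : PolySeries} (hA : d ∣ A) (M : ℕ) :
    d ^ M ∣ cosRoot A - ∑ k ∈ Finset.range M, const (cosCoeff k) * tau2 ^ k * A ^ (2 * k) := by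
  rw [cosRoot_eq]
  convert entire_sub_dvd cosCoeff (dvd_tau2_mul_sq hA) M using 3 with k
  ring

theorem sinRoot_sub_dvd {A : PolySeries} (hA : d ∣ A) (M : ℕ) :
    d ^ M ∣ sinRoot A - ∑ k ∈ Finset.range M, const (sinCoeff k) * tau2 ^ k * A ^ (2 * k + 1) := by
  rw [sinRoot_eq hA]
  have := (entire_sub_dvd sinCoeff (dvd_tau2_mul_sq hA) M).mul_left A
  rw [mul_sub, Finset.mul_sum] at this
  convert this using 3 with k
  ring

theorem dd_cosRoot {A : PolySeries} (hA : d ∣ A) : dd (cosRoot A) = -(tau2 * dd A * sinRoot A) := by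
  refine eq_of_forall_dvd_sub fun M => ?_
  -- One term more than the precision `M`: differentiation costs an order of the truncation error,
  -- and the first term of the cosine has derivative zero.
  have h1 := dd_dvd (cosRoot_sub_dvd hA (M + 1))
  have h2 := (sinRoot_sub_dvd hA M).mul_left (tau2 * dd A)
  rw [dd_sub, dd_sum, Finset.sum_range_succ'] at h1
  have h3 : ∀ k, dd (const (cosCoeff (k + 1)) * tau2 ^ (k + 1) * A ^ (2 * (k + 1)))
      = -(tau2 * dd A * (const (sinCoeff k) * tau2 ^ k * A ^ (2 * k + 1))) := by
    intro k
    rw [dd_mul, dd_tau2_pow, mul_zero, add_zero, show 2 * (k + 1) = 2 * k + 1 + 1 by ring, dd_pow]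
    have hc : const (cosCoeff (k + 1)) * (((2 * k + 1 : ℕ) : PolySeries) + 1)
        = -const (sinCoeff k) := by
      have : ((2 * k + 1 : ℕ) : PolySeries) + 1 = const ((2 * k + 2 : ℕ) : ℂ) := by
        rw [const_natCast]; push_cast; ring
      rw [this, ← const_mul, ← const_neg]
      congr 1
      rw [cosCoeff, sinCoeff, show 2 * (k + 1) = (2 * k + 1) + 1 by ring,
        Nat.factorial_succ (2 * k + 1)]
      have h1 : ((2 * k + 1).factorial : ℂ) ≠ 0 := Nat.cast_ne_zero.mpr (Nat.factorial_ne_zero _)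
      have h2 : ((2 * k + 1 + 1 : ℕ) : ℂ) ≠ 0 := Nat.cast_ne_zero.mpr (Nat.succ_ne_zero _)
      rw [Nat.cast_mul, pow_succ]
      field_simp
    linear_combination (tau2 ^ (k + 1) * A ^ (2 * k + 1) * dd A) * hc
  have h4 : dd (const (cosCoeff 0) * tau2 ^ 0 * A ^ (2 * 0)) = 0 := by
    rw [mul_zero, pow_zero A, mul_one, dd_tau2_pow]
  rw [Finset.sum_congr rfl fun k _ => h3 k, h4, add_zero, Finset.sum_neg_distrib,
    ← Finset.mul_sum] at h1
  convert h1.add h2 using 1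
  ring

theorem dd_sinRoot {A : PolySeries} (hA : d ∣ A) : dd (sinRoot A) = dd A * cosRoot A := by
  refine eq_of_forall_dvd_sub fun M => ?_
  have h1 := dd_dvd (sinRoot_sub_dvd hA (M + 1))
  have h2 := ((pow_dvd_pow d (Nat.le_succ M)).trans (cosRoot_sub_dvd hA (M + 1))).mul_left (dd A)
  rw [dd_sub, dd_sum] at h1
  have h3 : ∀ k, dd (const (sinCoeff k) * tau2 ^ k * A ^ (2 * k + 1))
      = dd A * (const (cosCoeff k) * tau2 ^ k * A ^ (2 * k)) := by
    intro k
    rw [dd_mul, dd_tau2_pow, mul_zero, add_zero, dd_pow]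
    have hc : const (sinCoeff k) * (((2 * k : ℕ) : PolySeries) + 1) = const (cosCoeff k) := by
      have : ((2 * k : ℕ) : PolySeries) + 1 = const ((2 * k + 1 : ℕ) : ℂ) := by
        rw [const_natCast]; push_cast; ring
      rw [this, ← const_mul]
      congr 1
      rw [cosCoeff, sinCoeff, Nat.factorial_succ (2 * k)]
      have h1 : ((2 * k).factorial : ℂ) ≠ 0 := Nat.cast_ne_zero.mpr (Nat.factorial_ne_zero _)
      have h2 : ((2 * k + 1 : ℕ) : ℂ) ≠ 0 := Nat.cast_ne_zero.mpr (Nat.succ_ne_zero _)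
      rw [Nat.cast_mul]
      field_simp
    linear_combination (tau2 ^ k * A ^ (2 * k) * dd A) * hc
  rw [Finset.sum_congr rfl fun k _ => h3 k, ← Finset.mul_sum] at h1
  convert h1.sub h2 using 1
  ring

/-- Uniqueness for a linear system of differential equations. -/
theorem eq_zero_of_linear_system {P Y a b : PolySeries} (hP : dd P = a * Y) (hY : dd Y = b * P)
    (hP0 : PowerSeries.coeff 0 P = 0) (hY0 : PowerSeries.coeff 0 Y = 0) : P = 0 ∧ Y = 0 := by
  have key : ∀ n, d ^ (n + 1) ∣ P ∧ d ^ (n + 1) ∣ Y := by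
    intro n
    induction n with
    | zero =>
      constructor <;> refine dvd_of_coeff_eq_zero fun n hn => ?_
      · obtain rfl : n = 0 := by omega
        exact hP0
      · obtain rfl : n = 0 := by omega
        exact hY0
    | succ n ih =>
      -- The next coefficient of F is, up to a nonzero integer factor, a coefficient of its
      -- derivative one order lower, where the product with E still vanishes.
      have step : ∀ F E c : PolySeries, dd F = c * E → d ^ (n + 1) ∣ F → d ^ (n + 1) ∣ E →
          d ^ (n + 1 + 1) ∣ F := by
        intro F E c h hF hE
        refine dvd_of_coeff_eq_zero fun m hm => ?_
        rcases Nat.lt_succ_iff_lt_or_eq.mp hm with h' | rfl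
        · exact coeff_eq_zero_of_dvd hF h'
        · have h3 := coeff_eq_zero_of_dvd (hE.mul_left c) (Nat.lt_succ_self n)
          rw [← h, coeff_dd] at h3
          exact (mul_eq_zero.mp h3).resolve_right (Nat.cast_add_one_ne_zero n)
      exact ⟨step P Y a hP ih.1 ih.2, step Y P b hY ih.2 ih.1⟩
  constructor <;> refine eq_of_forall_dvd_sub fun M => ?_
  · rw [sub_zero]; exact (pow_dvd_pow d (Nat.le_succ M)).trans (key M).1
  · rw [sub_zero]; exact (pow_dvd_pow d (Nat.le_succ M)).trans (key M).2

theorem coeff_zero_cosRoot (A : PolySeries) : PowerSeries.coeff 0 (cosRoot A) = 1 := by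
  rw [cosRoot_eq, coeff_zero_entire, cosCoeff]; simp

theorem coeff_zero_of_dvd {A : PolySeries} (hA : d ∣ A) : PowerSeries.coeff 0 A = 0 := by
  rw [← pow_one d] at hA; exact coeff_eq_zero_of_dvd hA one_pos

theorem coeff_zero_sinRoot {A : PolySeries} (hA : d ∣ A) :
    PowerSeries.coeff 0 (sinRoot A) = 0 := by
  rw [sinRoot_eq hA, coeff_zero_mul, coeff_zero_of_dvd hA, zero_mul]

/-- The defects of the two formulas have no constant term and satisfy a homogeneous linear system in
`d`, so `eq_zero_of_linear_system` applies. No square root of 1 - u² is ever needed. -/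
theorem addition_theorem {A B : PolySeries} (hA : d ∣ A) (hB : d ∣ B) :
    cosRoot (A + B) = cosRoot A * cosRoot B - tau2 * sinRoot A * sinRoot B ∧
    sinRoot (A + B) = sinRoot A * cosRoot B + cosRoot A * sinRoot B := by
  have hAB : d ∣ A + B := hA.add hB
  have ht : dd tau2 = 0 := by rw [tau2_eq, dd_ofPoly]
  have := eq_zero_of_linear_system
    (P := cosRoot (A + B) - (cosRoot A * cosRoot B - tau2 * sinRoot A * sinRoot B))
    (Y := sinRoot (A + B) - (sinRoot A * cosRoot B + cosRoot A * sinRoot B))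
    (a := -(tau2 * dd (A + B))) (b := dd (A + B)) ?_ ?_ ?_ ?_
  · exact ⟨sub_eq_zero.mp this.1, sub_eq_zero.mp this.2⟩
  · simp only [dd_sub, dd_mul, dd_cosRoot hA, dd_cosRoot hB, dd_cosRoot hAB, dd_sinRoot hA,
      dd_sinRoot hB, ht, dd_add]
    ring
  · simp only [dd_sub, dd_mul, dd_cosRoot hA, dd_cosRoot hB, dd_sinRoot hAB, dd_sinRoot hA,
      dd_sinRoot hB, dd_add]
    ring
  · simp only [map_sub, coeff_zero_mul, coeff_zero_cosRoot, coeff_zero_sinRoot hA]; simp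
  · simp only [map_sub, map_add, coeff_zero_mul, coeff_zero_sinRoot hA, coeff_zero_sinRoot hB,
      coeff_zero_sinRoot hAB]; simp

/-! ### The residual and its change under a perturbation. -/

/-- `sin (q₀ + a) cosh s`, for `a = A / cosh s`. -/
def sinQ (A : PolySeries) : PolySeries := 2 * u * cosRoot A + (2 * u ^ 2 - 1) * sinRoot A

/-- `cos (q₀ + a)`, for `a = A / cosh s`. -/
def cosQ (A : PolySeries) : PolySeries := (2 * u ^ 2 - 1) * cosRoot A - 2 * u * tau2 * sinRoot A

theorem sinQ_add {A B : PolySeries} (hA : d ∣ A) (hB : d ∣ B) :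
    sinQ (A + B) = sinQ A * cosRoot B + cosQ A * sinRoot B := by
  obtain ⟨h1, h2⟩ := addition_theorem hA hB
  rw [sinQ, sinQ, cosQ, h1, h2]; ring

theorem rhs_eq (A : PolySeries) : rhs A = eps ^ 2 * sinQ A - Iseries := rfl

theorem rhs_add {A B : PolySeries} (hA : d ∣ A) (hB : d ∣ B) :
    rhs (A + B) = rhs A + eps ^ 2 * (sinQ A * (cosRoot B - 1) + cosQ A * sinRoot B) := by
  rw [rhs_eq, rhs_eq, sinQ_add hA hB]; ring

theorem d_pow_dvd_cosRoot_sub_one {m : ℕ} {B : PolySeries} (hm : 1 ≤ m) (hB : d ^ m ∣ B) :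
    d ^ (m + m) ∣ cosRoot B - 1 := by
  have hB' : d ∣ B := (dvd_pow_self d (by omega)).trans hB
  rw [cosRoot_eq, entire_eq _ (dvd_tau2_mul_sq hB')]
  have : const (cosCoeff 0) = 1 := by simp [cosCoeff, const_one]
  rw [this, add_sub_cancel_left, sq, pow_add]
  exact ((mul_dvd_mul hB hB).mul_left _).mul_right _

theorem d_pow_dvd_sinRoot {m : ℕ} {B : PolySeries} (hm : 1 ≤ m) (hB : d ^ m ∣ B) :
    d ^ m ∣ sinRoot B := by
  have hB' : d ∣ B := (dvd_pow_self d (by omega)).trans hB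
  rw [sinRoot_eq hB']
  exact hB.mul_right _

theorem coeff_sinRoot {m : ℕ} {B : PolySeries} (hm : 1 ≤ m) (hB : d ^ m ∣ B) :
    PowerSeries.coeff m (sinRoot B) = PowerSeries.coeff m B := by
  have hB' : d ∣ B := (dvd_pow_self d (by omega)).trans hB
  have h := coeff_add_mul_of_dvd (b := 0) hB (one_dvd (entire sinCoeff (tau2 * B ^ 2)))
  rw [add_zero, ← sinRoot_eq hB', coeff_zero_entire] at h
  rw [h]; simp [sinCoeff]

theorem coeff_lhs (Z : PolySeries) (n : ℕ) : PowerSeries.coeff n (lhs Z)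
    = ∑ x ∈ Finset.HasAntidiagonal.antidiagonal n, (C ((1 + (-1) ^ x.1) / (x.1.factorial : ℂ))
        * ((Dop (-1)) ^ x.1) (PowerSeries.coeff x.2 Z)) - 2 * PowerSeries.coeff n Z := by
  rw [lhs, map_sub, map_add, coeff_expD, coeff_expD, ← Finset.sum_add_distrib]
  congr 1
  · refine Finset.sum_congr rfl fun x _ => ?_
    rw [← add_mul, ← C_add, one_pow, ← add_div]
  · rw [show (2 : PolySeries) = PowerSeries.C 2 from (map_ofNat _ 2).symm, PowerSeries.coeff_C_mul]

/-- In the second difference the odd powers of the operator cancel between the two shifts and the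
zeroth power cancels against 2 Z, so the expansion starts with d² times the square of the operator.
-/
theorem d_pow_dvd_lhs_and_coeff {m : ℕ} {Z : PolySeries} (hZ : d ^ m ∣ Z) :
    d ^ (m + 2) ∣ lhs Z ∧ PowerSeries.coeff (m + 2) (lhs Z)
      = ((Dop (-1)) ^ 2) (PowerSeries.coeff m Z) := by
  have hterm : ∀ n, n ≤ m + 2 → PowerSeries.coeff n (lhs Z)
      = if n = m + 2 then ((Dop (-1)) ^ 2) (PowerSeries.coeff m Z) else 0 := by
    intro n hn
    rw [coeff_lhs, Finset.Nat.sum_antidiagonal_eq_sum_range_succ_mk]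
    have h0 : ∀ k, 1 ≤ k → k ≠ 2 → k < n + 1 → C ((1 + (-1) ^ k) / (k.factorial : ℂ))
        * ((Dop (-1)) ^ k) (PowerSeries.coeff (n - k) Z) = 0 := by
      intro k hk hk2 hkn
      rcases eq_or_ne k 1 with rfl | hk1
      · simp
      · rw [coeff_eq_zero_of_dvd hZ (by omega)]; simp
    rw [Finset.sum_range_succ']
    have h2 : ∑ k ∈ Finset.range n, C ((1 + (-1) ^ (k + 1)) / ((k + 1).factorial : ℂ))
        * ((Dop (-1)) ^ (k + 1)) (PowerSeries.coeff (n - (k + 1)) Z)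
        = if n = m + 2 then ((Dop (-1)) ^ 2) (PowerSeries.coeff m Z) else 0 := by
      split_ifs with h
      · rw [Finset.sum_eq_single 1]
        · subst h
          norm_num
        · intro k hk hk1
          exact h0 (k + 1) (by omega) (by omega) (by simpa using hk)
        · intro h1; simp at h1; omega
      · refine Finset.sum_eq_zero fun k hk => ?_
        rcases eq_or_ne (k + 1) 2 with h2 | h2
        · rw [coeff_eq_zero_of_dvd hZ (by have := Finset.mem_range.mp hk; omega)]; simp
        · exact h0 (k + 1) (by omega) h2 (by simpa using hk)
    rw [h2]
    have h3 : C ((1 + (-1) ^ 0) / (Nat.factorial 0 : ℂ)) * ((Dop (-1)) ^ 0)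
        (PowerSeries.coeff (n - 0) Z) = 2 * PowerSeries.coeff n Z := by
      simp only [pow_zero, Nat.factorial_zero, Nat.cast_one, div_one, Module.End.one_apply,
        Nat.sub_zero]
      rw [show (1 + 1 : ℂ) = 2 by norm_num, show C (2 : ℂ) = 2 from map_ofNat C 2]
    rw [h3]; ring
  refine ⟨dvd_of_coeff_eq_zero fun n hn => ?_, ?_⟩
  · rw [hterm n hn.le, if_neg hn.ne]
  · rw [hterm _ le_rfl, if_pos rfl]

theorem lhs_add (Z Y : PolySeries) : lhs (Z + Y) = lhs Z + lhs Y := by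
  simp only [lhs, expD_add]; ring

/-- The residual of the equation. -/
def residual (A : PolySeries) : PolySeries := rhs A - lhs A

theorem residual_add {A B : PolySeries} (hA : d ∣ A) (hB : d ∣ B) :
    residual (A + B) = residual A
      + (eps ^ 2 * (sinQ A * (cosRoot B - 1) + cosQ A * sinRoot B) - lhs B) := by
  rw [residual, residual, rhs_add hA hB, lhs_add]; ring

theorem d_sq_dvd_eps_sq : d ^ 2 ∣ eps ^ 2 := by
  refine pow_dvd_pow_of_dvd ?_ 2
  rw [eps]
  refine Dvd.dvd.mul_left ?_ _
  rw [← pow_one d]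
  refine dvd_of_coeff_eq_zero fun n hn => ?_
  obtain rfl : n = 0 := by omega
  exact coeff_zero_sinhS _

theorem coeff_two_eps_sq : PowerSeries.coeff 2 (eps ^ 2) = 1 := by
  have h : d ^ 1 ∣ eps := by
    rw [eps]
    refine Dvd.dvd.mul_left ?_ _
    refine dvd_of_coeff_eq_zero fun n hn => ?_
    obtain rfl : n = 0 := by omega
    exact coeff_zero_sinhS _
  rw [sq, show (2 : ℕ) = 1 + 1 from rfl, coeff_add_mul_of_dvd h h]
  have : PowerSeries.coeff 1 eps = 1 := by
    rw [eps, show (2 : PolySeries) = PowerSeries.C 2 from (map_ofNat _ 2).symm,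
      PowerSeries.coeff_C_mul, sinhS, PowerSeries.coeff_mk, if_pos odd_one,
      show (2 : ℂ[X]) = C 2 from (map_ofNat _ 2).symm, ← C_mul]
    norm_num
  rw [this, mul_one]

theorem coeff_zero_cosQ {A : PolySeries} (hA : d ∣ A) :
    PowerSeries.coeff 0 (cosQ A) = 2 * X ^ 2 - 1 := by
  rw [cosQ, map_sub, coeff_zero_mul, coeff_zero_mul, coeff_zero_cosRoot, coeff_zero_sinRoot hA,
    mul_zero, mul_one, sub_zero, map_sub, sq, ← mul_assoc, coeff_zero_mul, coeff_zero_mul, u, ofPoly,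
    show (2 : PolySeries) = PowerSeries.C 2 from (map_ofNat _ 2).symm, PowerSeries.coeff_zero_C,
    PowerSeries.coeff_zero_C, PowerSeries.coeff_zero_one]
  ring

/-- The effect on the residual of a change of `A` of order `m`. -/
theorem residual_change {m : ℕ} {A B : PolySeries} (hm : 1 ≤ m) (hA : d ∣ A) (hB : d ^ m ∣ B) :
    d ^ (m + 2) ∣ residual (A + B) - residual A ∧
    PowerSeries.coeff (m + 2) (residual (A + B)) = PowerSeries.coeff (m + 2) (residual A)
      + ((2 * X ^ 2 - 1) * PowerSeries.coeff m B - ((Dop (-1)) ^ 2) (PowerSeries.coeff m B)) := by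
  have hB' : d ∣ B := (dvd_pow_self d (by omega)).trans hB
  obtain ⟨h1, h2⟩ := d_pow_dvd_lhs_and_coeff hB
  have h3 : d ^ (m + 1) ∣ sinQ A * (cosRoot B - 1) :=
    ((pow_dvd_pow d (by omega)).trans (d_pow_dvd_cosRoot_sub_one hm hB)).mul_left _
  have h4 : d ^ m ∣ cosQ A * sinRoot B := (d_pow_dvd_sinRoot hm hB).mul_left _
  have h5 : d ^ m ∣ sinQ A * (cosRoot B - 1) + cosQ A * sinRoot B :=
    ((pow_dvd_pow d (Nat.le_succ m)).trans h3).add h4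
  have h6 : d ^ (m + 2) ∣ eps ^ 2 * (sinQ A * (cosRoot B - 1) + cosQ A * sinRoot B) := by
    rw [add_comm m, pow_add]; exact mul_dvd_mul d_sq_dvd_eps_sq h5
  rw [residual_add hA hB']
  refine ⟨by rw [add_sub_cancel_left]; exact h6.sub h1, ?_⟩
  rw [map_add, map_sub, h2]
  congr 2
  rw [add_comm m, coeff_add_mul_of_dvd d_sq_dvd_eps_sq h5, coeff_two_eps_sq, one_mul, map_add,
    coeff_eq_zero_of_dvd h3 (Nat.lt_succ_self m), zero_add]
  have h7 := coeff_add_mul_of_dvd (a := 0) (one_dvd (cosQ A)) (d_pow_dvd_sinRoot hm hB)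
  rw [zero_add] at h7
  rw [h7, coeff_zero_cosQ hA, coeff_sinRoot hm hB]

/-! ### The degree filtration -/

/-- The degree of `p` is at most `k`, an integer; for `k < 0` this means `p = 0`. -/
def PolyDeg (k : ℤ) (p : ℂ[X]) : Prop := ∀ i : ℕ, k < i → p.coeff i = 0

theorem PolyDeg.mono {k l : ℤ} {p : ℂ[X]} (h : PolyDeg k p) (hkl : k ≤ l) : PolyDeg l p :=
  fun i hi => h i (by omega)

theorem PolyDeg.add {k : ℤ} {p q : ℂ[X]} (hp : PolyDeg k p) (hq : PolyDeg k q) :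
    PolyDeg k (p + q) := fun i hi => by rw [coeff_add, hp i hi, hq i hi, add_zero]

theorem PolyDeg.neg {k : ℤ} {p : ℂ[X]} (hp : PolyDeg k p) : PolyDeg k (-p) :=
  fun i hi => by rw [coeff_neg, hp i hi, neg_zero]

theorem PolyDeg.sub {k : ℤ} {p q : ℂ[X]} (hp : PolyDeg k p) (hq : PolyDeg k q) :
    PolyDeg k (p - q) := by rw [sub_eq_add_neg]; exact hp.add hq.neg

theorem PolyDeg.zero (k : ℤ) : PolyDeg k 0 := fun _ _ => coeff_zero _

theorem PolyDeg.sum {ι : Type*} {k : ℤ} {s : Finset ι} {f : ι → ℂ[X]}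
    (h : ∀ i ∈ s, PolyDeg k (f i)) : PolyDeg k (∑ i ∈ s, f i) := by
  intro i hi
  rw [finsetSum_coeff]
  exact Finset.sum_eq_zero fun j hj => h j hj i hi

theorem PolyDeg.mul {k l : ℤ} {p q : ℂ[X]} (hp : PolyDeg k p) (hq : PolyDeg l q) :
    PolyDeg (k + l) (p * q) := by
  intro i hi
  rw [coeff_mul]
  refine Finset.sum_eq_zero fun x hx => ?_
  rw [Finset.HasAntidiagonal.mem_antidiagonal] at hx
  rcases lt_or_ge k x.1 with h | h
  · rw [hp _ h, zero_mul]
  · rw [hq _ (by omega), mul_zero]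

theorem PolyDeg.C (c : ℂ) : PolyDeg 0 (C c) := fun i hi => by
  rw [coeff_C, if_neg (by omega)]

theorem PolyDeg.varX : PolyDeg 1 (X : ℂ[X]) := fun i hi => by
  rw [coeff_X, if_neg (by omega)]

theorem PolyDeg.one : PolyDeg 0 (1 : ℂ[X]) := PolyDeg.C 1

theorem PolyDeg.derivative {k : ℤ} {p : ℂ[X]} (hp : PolyDeg k p) :
    PolyDeg (k - 1) (derivative p) := fun i hi => by
  rw [coeff_derivative, hp (i + 1) (by push_cast; omega), zero_mul]

theorem PolyDeg.one_sub_X_sq : PolyDeg 2 (1 - X ^ 2 : ℂ[X]) := by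
  refine (PolyDeg.one.mono (by norm_num)).sub ?_
  rw [sq]; exact PolyDeg.varX.mul PolyDeg.varX

theorem PolyDeg.Dop {k : ℤ} {p : ℂ[X]} (a : ℂ) (hp : PolyDeg k p) :
    PolyDeg (k + 1) (Dop a p) := by
  rw [Dop_apply]
  refine PolyDeg.add ?_ ?_
  · exact (PolyDeg.one_sub_X_sq.mul hp.derivative).mono (by omega)
  · exact (((PolyDeg.C a).mul PolyDeg.varX).mul hp).mono (by omega)

theorem PolyDeg.Dop_pow {k : ℤ} {p : ℂ[X]} (a : ℂ) (hp : PolyDeg k p) (m : ℕ) :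
    PolyDeg (k + m) (((PolySeries.Dop a) ^ m) p) := by
  induction m with
  | zero => simpa using hp
  | succ m ih =>
    rw [pow_succ', Module.End.mul_apply]
    exact (ih.Dop a).mono (by push_cast; omega)

theorem polyDeg_natCast_iff {k : ℕ} {p : ℂ[X]} : PolyDeg k p ↔ p.natDegree ≤ k := by
  rw [natDegree_le_iff_coeff_eq_zero]
  exact ⟨fun h i hi => h i (by exact_mod_cast hi), fun h i hi => h i (by exact_mod_cast hi)⟩

theorem PolyDeg.eq_zero {k : ℤ} {p : ℂ[X]} (hp : PolyDeg k p) (hk : k < 0) : p = 0 := by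
  ext i; rw [hp i (by omega), coeff_zero]

/-- The coefficient of `dⁿ` has degree at most `n + k`. -/
def DegLE (k : ℤ) (Z : PolySeries) : Prop := ∀ n : ℕ, PolyDeg (n + k) (PowerSeries.coeff n Z)

theorem DegLE.mono {k l : ℤ} {Z : PolySeries} (h : DegLE k Z) (hkl : k ≤ l) : DegLE l Z :=
  fun n => (h n).mono (by omega)

theorem DegLE.add {k : ℤ} {Z Y : PolySeries} (hZ : DegLE k Z) (hY : DegLE k Y) :
    DegLE k (Z + Y) := fun n => by rw [map_add]; exact (hZ n).add (hY n)

theorem DegLE.neg {k : ℤ} {Z : PolySeries} (hZ : DegLE k Z) : DegLE k (-Z) := fun n => by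
  rw [map_neg]; exact (hZ n).neg

theorem DegLE.sub {k : ℤ} {Z Y : PolySeries} (hZ : DegLE k Z) (hY : DegLE k Y) :
    DegLE k (Z - Y) := by rw [sub_eq_add_neg]; exact hZ.add hY.neg

theorem DegLE.mul {k l m : ℤ} {Z Y : PolySeries} (hZ : DegLE k Z) (hY : DegLE l Y)
    (h : k + l ≤ m) : DegLE m (Z * Y) := fun n => by
  rw [PowerSeries.coeff_mul]
  refine PolyDeg.sum fun x hx => ?_
  rw [Finset.HasAntidiagonal.mem_antidiagonal] at hx
  exact ((hZ x.1).mul (hY x.2)).mono (by omega)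

theorem DegLE.ofPoly {k : ℤ} {p : ℂ[X]} (hp : PolyDeg k p) : DegLE k (ofPoly p) := fun n => by
  rw [PolySeries.ofPoly, PowerSeries.coeff_C]
  split_ifs with h
  · subst h; simpa using hp
  · exact PolyDeg.zero _

theorem DegLE.const (c : ℂ) : DegLE 0 (const c) := DegLE.ofPoly (PolyDeg.C c)

theorem DegLE.one : DegLE 0 1 := by rw [one_eq_ofPoly]; exact DegLE.ofPoly PolyDeg.one

theorem DegLE.zero (k : ℤ) : DegLE k 0 := fun n => by rw [map_zero]; exact PolyDeg.zero _

theorem DegLE.u : DegLE 1 u := DegLE.ofPoly PolyDeg.varX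

theorem DegLE.tau2 : DegLE 2 tau2 := by rw [tau2_eq]; exact DegLE.ofPoly PolyDeg.one_sub_X_sq

theorem DegLE.d : DegLE (-1) d := fun n => by
  rw [PolySeries.d, PowerSeries.coeff_X]
  split_ifs with h
  · subst h; exact PolyDeg.one
  · exact PolyDeg.zero _

theorem DegLE.pow {k m : ℤ} {Z : PolySeries} (hZ : DegLE k Z) (j : ℕ) (h : j * k = m) :
    DegLE m (Z ^ j) := by
  subst h
  induction j with
  | zero => rw [pow_zero]; simpa using DegLE.one
  | succ j ih => rw [pow_succ]; exact ih.mul hZ (by push_cast; linarith)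

theorem DegLE.natCast (n : ℕ) : DegLE 0 (n : PolySeries) := by
  rw [← const_natCast]; exact DegLE.const _

theorem DegLE.two : DegLE 0 (2 : PolySeries) := by exact_mod_cast DegLE.natCast 2

theorem DegLE.sum {ι : Type*} {k : ℤ} {s : Finset ι} {f : ι → PolySeries}
    (h : ∀ i ∈ s, DegLE k (f i)) : DegLE k (∑ i ∈ s, f i) := fun n => by
  rw [map_sum]; exact PolyDeg.sum fun i hi => h i hi n

theorem DegLE.expD {k : ℤ} {Z : PolySeries} (a θ : ℂ) (hZ : DegLE k Z) :
    DegLE k (expD a θ Z) := fun n => by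
  rw [coeff_expD]
  refine PolyDeg.sum fun x hx => ?_
  rw [Finset.HasAntidiagonal.mem_antidiagonal] at hx
  exact ((PolyDeg.C _).mul ((hZ x.2).Dop_pow a x.1)).mono (by omega)

theorem DegLE.shift {k : ℤ} {Z : PolySeries} (θ : ℂ) (hZ : DegLE k Z) : DegLE k (shift θ Z) :=
  hZ.expD 0 θ

theorem DegLE.sinhS (θ : ℂ) : DegLE (-1) (sinhS θ) := fun n => by
  rw [PolySeries.sinhS, PowerSeries.coeff_mk]
  split_ifs with h
  · have := h.pos
    exact (PolyDeg.C _).mono (by omega)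
  · exact PolyDeg.zero _

theorem DegLE.eps : DegLE (-1) eps := DegLE.two.mul (DegLE.sinhS _) (by norm_num)

theorem DegLE.eps_sq : DegLE (-2) (PolySeries.eps ^ 2) := DegLE.eps.pow 2 (by norm_num)

theorem DegLE.entire {Y : PolySeries} (φ : ℕ → ℂ) (hY : DegLE 0 Y) : DegLE 0 (entire φ Y) :=
  fun n => by
    rw [PolySeries.entire, PowerSeries.coeff_mk]
    exact DegLE.sum (fun k _ => (DegLE.const _).mul (hY.pow k (mul_zero _)) (by norm_num)) n

theorem DegLE.tau2_mul_sq {A : PolySeries} (hA : DegLE (-1) A) : DegLE 0 (PolySeries.tau2 * A ^ 2) :=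
  DegLE.tau2.mul (hA.pow 2 rfl) (by norm_num)

theorem DegLE.cosRoot {A : PolySeries} (hA : DegLE (-1) A) : DegLE 0 (cosRoot A) := by
  rw [cosRoot_eq]; exact hA.tau2_mul_sq.entire _

theorem DegLE.sinRoot {A : PolySeries} (hA : DegLE (-1) A) (hd : PolySeries.d ∣ A) :
    DegLE (-1) (sinRoot A) := by
  rw [sinRoot_eq hd]; exact hA.mul (hA.tau2_mul_sq.entire _) (by norm_num)

theorem DegLE.two_u_sq : DegLE 2 (2 * PolySeries.u ^ 2 - 1) :=
  (DegLE.two.mul (DegLE.u.pow 2 rfl) (by norm_num)).sub (DegLE.one.mono (by norm_num))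

theorem DegLE.sinQ {A : PolySeries} (hA : DegLE (-1) A) (hd : PolySeries.d ∣ A) :
    DegLE 1 (sinQ A) :=
  ((DegLE.two.mul DegLE.u le_rfl).mul hA.cosRoot (by norm_num)).add
    (DegLE.two_u_sq.mul (hA.sinRoot hd) (by norm_num))

/-- Since q₀' = -2 / cosh s, every further derivative applies the operator of weight -1 to the
polynomial factor. -/
theorem map_heteroclinicDeriv (k : ℕ) :
    (heteroclinicDeriv k).map Complex.ofRealHom = C (-2) * ((Dop (-1)) ^ k) 1 := by
  induction k with
  | zero =>
    rw [heteroclinicDeriv, pow_zero, Module.End.one_apply, mul_one, Polynomial.map_neg, C_neg,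
      show C (2 : ℂ) = 2 from map_ofNat C 2]
    simp
  | succ k ih =>
    rw [heteroclinicDeriv, pow_succ' (Dop _), Module.End.mul_apply, ← Dop_C_mul, ← ih, Dop_apply]
    simp only [Polynomial.map_sub, Polynomial.map_mul, Polynomial.map_one, Polynomial.map_pow,
      Polynomial.map_X, derivative_map, C_neg, C_1]
    ring

theorem coeff_Iseries (m : ℕ) : PowerSeries.coeff m Iseries = if Even m ∧ 2 ≤ m then
    C (-4 / (m.factorial : ℂ)) * ((Dop (-1)) ^ (m - 1)) 1 else 0 := by
  rw [Iseries, PowerSeries.coeff_mk]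
  split_ifs with h
  · rw [Ipoly, map_heteroclinicDeriv, Nat.two_mul_div_two_of_even h.1, ← mul_assoc, ← C_mul]
    congr 2
    ring
  · rfl

theorem DegLE.Iseries : DegLE (-1) Iseries := fun n => by
  rw [coeff_Iseries]
  split_ifs with h
  · exact ((PolyDeg.C _).mul (PolyDeg.one.Dop_pow (-1) (n - 1))).mono (by omega)
  · exact PolyDeg.zero _

theorem DegLE.rhs {A : PolySeries} (hA : DegLE (-1) A) (hd : PolySeries.d ∣ A) :
    DegLE (-1) (rhs A) :=
  (DegLE.eps_sq.mul (hA.sinQ hd) (by norm_num)).sub DegLE.Iseries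

theorem DegLE.lhs {k : ℤ} {Z : PolySeries} (hZ : DegLE k Z) : DegLE k (lhs Z) :=
  ((hZ.expD _ _).add (hZ.expD _ _)).sub (DegLE.two.mul hZ (by norm_num))

/-! ### Symmetries -/

/-- The substitution `d ↦ -d`. -/
def nu : PolySeries →+* PolySeries := PowerSeries.rescale (-1 : ℂ[X])

/-- The substitution `u ↦ -u`. -/
def flipU : PolySeries →+* PolySeries := PowerSeries.map (compRingHom (-X))

/-- Complex conjugation of all coefficients. -/
def conjS : PolySeries →+* PolySeries := PowerSeries.map (mapRingHom (starRingEnd ℂ))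

theorem coeff_nu (n : ℕ) (Z : PolySeries) :
    PowerSeries.coeff n (nu Z) = (-1) ^ n * PowerSeries.coeff n Z := by
  rw [nu, PowerSeries.coeff_rescale]

theorem coeff_flipU (n : ℕ) (Z : PolySeries) :
    PowerSeries.coeff n (flipU Z) = (PowerSeries.coeff n Z).comp (-X) := by
  rw [flipU, PowerSeries.coeff_map]; rfl

theorem coeff_conjS (n : ℕ) (Z : PolySeries) :
    PowerSeries.coeff n (conjS Z) = (PowerSeries.coeff n Z).map (starRingEnd ℂ) := by
  rw [conjS, PowerSeries.coeff_map]; rfl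

/-- A homomorphism that acts coefficient by coefficient passes through the order-dependent
truncation in `entire`. All three symmetries are of this kind. -/
theorem map_entire (Φ : PolySeries →+* PolySeries) (ψ : ℕ → ℂ[X] → ℂ[X])
    (hΦ : ∀ m Z, PowerSeries.coeff m (Φ Z) = ψ m (PowerSeries.coeff m Z)) (φ : ℕ → ℂ)
    (hφ : ∀ k, Φ (const (φ k)) = const (φ k)) (Y : PolySeries) :
    Φ (entire φ Y) = entire φ (Φ Y) := by
  ext1 m
  rw [hΦ, entire, PowerSeries.coeff_mk, ← hΦ, entire, PowerSeries.coeff_mk, map_sum]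
  simp only [map_mul, map_pow, hφ]

theorem nu_ofPoly (p : ℂ[X]) : nu (ofPoly p) = ofPoly p := by
  ext1 n
  rw [coeff_nu, ofPoly, PowerSeries.coeff_C]
  split_ifs with h
  · subst h; simp
  · simp

theorem flipU_ofPoly (p : ℂ[X]) : flipU (ofPoly p) = ofPoly (p.comp (-X)) := by
  rw [flipU, ofPoly, PowerSeries.map_C]; rfl

theorem conjS_ofPoly (p : ℂ[X]) : conjS (ofPoly p) = ofPoly (p.map (starRingEnd ℂ)) := by
  rw [conjS, ofPoly, PowerSeries.map_C]; rfl

theorem nu_const (c : ℂ) : nu (const c) = const c := nu_ofPoly _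

theorem flipU_const (c : ℂ) : flipU (const c) = const c := by
  rw [const, flipU_ofPoly, C_comp]

theorem conjS_const (c : ℂ) : conjS (const c) = const (starRingEnd ℂ c) := by
  rw [const, conjS_ofPoly, map_C, const]

theorem nu_u : nu u = u := nu_ofPoly _

theorem flipU_u : flipU u = -u := by
  rw [u, flipU_ofPoly, X_comp]; simp [ofPoly]

theorem conjS_u : conjS u = u := by
  rw [u, conjS_ofPoly, map_X]

theorem nu_d : nu d = -d := by
  rw [nu, d, PowerSeries.rescale_neg_one_X]

theorem flipU_d : flipU d = d := by rw [flipU, d, PowerSeries.map_X]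

theorem conjS_d : conjS d = d := by rw [conjS, d, PowerSeries.map_X]

theorem nu_tau2 : nu tau2 = tau2 := by rw [tau2_eq, nu_ofPoly]

theorem flipU_tau2 : flipU tau2 = tau2 := by
  rw [tau2, map_sub, map_one, map_pow, flipU_u]; ring

theorem conjS_tau2 : conjS tau2 = tau2 := by
  rw [tau2, map_sub, map_one, map_pow, conjS_u]

theorem nu_expD (a θ : ℂ) (Z : PolySeries) : nu (expD a θ Z) = expD a (-θ) (nu Z) := by
  ext1 n
  rw [coeff_nu, coeff_expD, coeff_expD, Finset.mul_sum]
  refine Finset.sum_congr rfl fun x hx => ?_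
  rw [Finset.HasAntidiagonal.mem_antidiagonal] at hx
  rw [coeff_nu, ← hx, pow_add, neg_pow θ, mul_div_assoc, C_mul,
    show ((-1 : ℂ[X]) ^ x.2) = C ((-1) ^ x.2) by simp, ← smul_eq_C_mul ((-1) ^ x.2), map_smul,
    smul_eq_C_mul]
  simp only [C_pow, C_neg, C_1]
  ring

theorem Dop_comp_neg (a : ℂ) (p : ℂ[X]) : (Dop a p).comp (-X) = -Dop a (p.comp (-X)) := by
  rw [Dop_apply, Dop_apply, derivative_comp]
  simp only [add_comp, mul_comp, sub_comp, one_comp, pow_comp, X_comp, C_comp, derivative_neg,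
    derivative_X]
  ring

theorem Dop_pow_comp_neg (a : ℂ) (p : ℂ[X]) (k : ℕ) :
    (((Dop a) ^ k) p).comp (-X) = (-1) ^ k * ((Dop a) ^ k) (p.comp (-X)) := by
  induction k with
  | zero => simp
  | succ k ih =>
    rw [pow_succ', Module.End.mul_apply, Dop_comp_neg, ih, Module.End.mul_apply,
      show ((-1 : ℂ[X]) ^ k) = C ((-1) ^ k) by simp, Dop_C_mul, pow_succ (-1 : ℂ[X])]
    simp

theorem flipU_expD (a θ : ℂ) (Z : PolySeries) :
    flipU (expD a θ Z) = expD a (-θ) (flipU Z) := by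
  ext1 n
  rw [coeff_flipU, coeff_expD, coeff_expD, Polynomial.sum_comp]
  refine Finset.sum_congr rfl fun x hx => ?_
  rw [mul_comp, C_comp, Dop_pow_comp_neg, coeff_flipU, neg_pow θ, mul_div_assoc, C_mul]
  simp only [C_pow, C_neg, C_1]
  ring

theorem Dop_map_conj (a : ℝ) (p : ℂ[X]) :
    (Dop a p).map (starRingEnd ℂ) = Dop a (p.map (starRingEnd ℂ)) := by
  rw [Dop_apply, Dop_apply]
  simp only [Polynomial.map_add, Polynomial.map_mul, Polynomial.map_sub, Polynomial.map_one,
    Polynomial.map_pow, Polynomial.map_X, Polynomial.map_C, derivative_map, Complex.conj_ofReal]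

theorem Dop_pow_map_conj (a : ℝ) (p : ℂ[X]) (k : ℕ) :
    (((Dop a) ^ k) p).map (starRingEnd ℂ) = ((Dop a) ^ k) (p.map (starRingEnd ℂ)) := by
  induction k with
  | zero => simp
  | succ k ih =>
    rw [pow_succ', Module.End.mul_apply, Dop_map_conj, ih, Module.End.mul_apply]

theorem conjS_expD (a θ : ℝ) (Z : PolySeries) : conjS (expD a θ Z) = expD a θ (conjS Z) := by
  ext1 n
  rw [coeff_conjS, coeff_expD, coeff_expD, Polynomial.map_sum]
  refine Finset.sum_congr rfl fun x hx => ?_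
  rw [Polynomial.map_mul, Polynomial.map_C, Dop_pow_map_conj, coeff_conjS]
  congr 2
  simp

theorem nu_lhs (Z : PolySeries) : nu (lhs Z) = lhs (nu Z) := by
  rw [lhs, lhs, map_sub, map_add, nu_expD, nu_expD, map_mul, map_ofNat, neg_neg]; ring

theorem flipU_lhs (Z : PolySeries) : flipU (lhs Z) = lhs (flipU Z) := by
  rw [lhs, lhs, map_sub, map_add, flipU_expD, flipU_expD, map_mul, map_ofNat, neg_neg]; ring

theorem conjS_lhs (Z : PolySeries) : conjS (lhs Z) = lhs (conjS Z) := by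
  have h1 := conjS_expD (-1) 1 Z
  have h2 := conjS_expD (-1) (-1) Z
  push_cast at h1 h2
  rw [lhs, lhs, map_sub, map_add, h1, h2, map_mul, map_ofNat]

theorem nu_cosRoot (A : PolySeries) : nu (cosRoot A) = cosRoot (nu A) := by
  rw [cosRoot_eq, cosRoot_eq, map_entire nu _ coeff_nu _ fun _ => nu_const _, map_mul, map_pow,
    nu_tau2]

theorem flipU_cosRoot (A : PolySeries) : flipU (cosRoot A) = cosRoot (flipU A) := by
  rw [cosRoot_eq, cosRoot_eq, map_entire flipU _ coeff_flipU _ fun _ => flipU_const _, map_mul,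
    map_pow, flipU_tau2]

theorem conj_cosCoeff (k : ℕ) : starRingEnd ℂ (cosCoeff k) = cosCoeff k := by simp [cosCoeff]

theorem conj_sinCoeff (k : ℕ) : starRingEnd ℂ (sinCoeff k) = sinCoeff k := by
  rw [sinCoeff, map_div₀, map_pow, map_neg, map_one, Complex.conj_natCast]

theorem conjS_cosRoot (A : PolySeries) : conjS (cosRoot A) = cosRoot (conjS A) := by
  rw [cosRoot_eq, cosRoot_eq, map_entire conjS _ coeff_conjS _ fun k => by
    rw [conjS_const, conj_cosCoeff], map_mul, map_pow, conjS_tau2]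

theorem nu_sinRoot {A : PolySeries} (hA : d ∣ A) : nu (sinRoot A) = sinRoot (nu A) := by
  have hA' : d ∣ nu A := by
    have := map_dvd nu hA; rwa [nu_d, neg_dvd] at this
  rw [sinRoot_eq hA, sinRoot_eq hA', map_mul, map_entire nu _ coeff_nu _ fun _ => nu_const _,
    map_mul, map_pow, nu_tau2]

theorem flipU_sinRoot {A : PolySeries} (hA : d ∣ A) : flipU (sinRoot A) = sinRoot (flipU A) := by
  have hA' : d ∣ flipU A := by
    have := map_dvd flipU hA; rwa [flipU_d] at this
  rw [sinRoot_eq hA, sinRoot_eq hA', map_mul,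
    map_entire flipU _ coeff_flipU _ fun _ => flipU_const _, map_mul, map_pow, flipU_tau2]

theorem conjS_sinRoot {A : PolySeries} (hA : d ∣ A) : conjS (sinRoot A) = sinRoot (conjS A) := by
  have hA' : d ∣ conjS A := by
    have := map_dvd conjS hA; rwa [conjS_d] at this
  rw [sinRoot_eq hA, sinRoot_eq hA', map_mul, map_entire conjS _ coeff_conjS _ fun k => by
    rw [conjS_const, conj_sinCoeff], map_mul, map_pow, conjS_tau2]

theorem cosRoot_neg (A : PolySeries) : cosRoot (-A) = cosRoot A := by
  rw [cosRoot_eq, cosRoot_eq, neg_sq]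

theorem sinRoot_neg {A : PolySeries} (hA : d ∣ A) : sinRoot (-A) = -sinRoot A := by
  rw [sinRoot_eq hA, sinRoot_eq (dvd_neg.mpr hA), neg_sq, neg_mul]

theorem nu_sinhS (θ : ℂ) : nu (sinhS θ) = -sinhS θ := by
  ext1 n
  rw [coeff_nu, map_neg, sinhS, PowerSeries.coeff_mk]
  split_ifs with h
  · rw [h.neg_one_pow, neg_one_mul]
  · simp

theorem flipU_mk_C (c : ℕ → ℂ) :
    flipU (PowerSeries.mk fun n => C (c n)) = PowerSeries.mk fun n => C (c n) := by
  ext1 n; rw [coeff_flipU, PowerSeries.coeff_mk, C_comp]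

theorem flipU_sinhS (θ : ℂ) : flipU (sinhS θ) = sinhS θ := by
  have : sinhS θ = PowerSeries.mk fun n => C (if Odd n then θ ^ n / (n.factorial : ℂ) else 0) := by
    ext1 n; simp only [sinhS, PowerSeries.coeff_mk]; split_ifs <;> simp
  rw [this, flipU_mk_C]

theorem conjS_sinhS (θ : ℝ) : conjS (sinhS θ) = sinhS θ := by
  ext1 n
  rw [coeff_conjS, sinhS, PowerSeries.coeff_mk]
  split_ifs
  · rw [Polynomial.map_C]; congr 1; simp
  · simp

theorem nu_eps_sq : nu (eps ^ 2) = eps ^ 2 := by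
  rw [eps, map_pow, map_mul, nu_sinhS, map_ofNat]; ring

theorem flipU_eps_sq : flipU (eps ^ 2) = eps ^ 2 := by
  rw [eps, map_pow, map_mul, flipU_sinhS, map_ofNat]

theorem conjS_eps_sq : conjS (eps ^ 2) = eps ^ 2 := by
  have := conjS_sinhS (1 / 2)
  push_cast at this
  rw [eps, map_pow, map_mul, this, map_ofNat]

theorem nu_Iseries : nu Iseries = Iseries := by
  ext1 n
  rw [coeff_nu, coeff_Iseries]
  split_ifs with h
  · rw [h.1.neg_one_pow, one_mul]
  · rw [mul_zero]

theorem flipU_Iseries : flipU Iseries = -Iseries := by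
  ext1 n
  rw [coeff_flipU, map_neg, coeff_Iseries]
  split_ifs with h
  · have h1 : Odd (n - 1) := Nat.Even.sub_odd (by omega) h.1 odd_one
    rw [mul_comp, C_comp, Dop_pow_comp_neg, one_comp, h1.neg_one_pow]; ring
  · simp

theorem conjS_Iseries : conjS Iseries = Iseries := by
  ext1 n
  rw [coeff_conjS, coeff_Iseries]
  split_ifs with h
  · have := Dop_pow_map_conj (-1) 1 (n - 1)
    push_cast at this
    rw [Polynomial.map_mul, Polynomial.map_C, this, Polynomial.map_one, map_div₀, map_neg,
      map_ofNat, Complex.conj_natCast]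
  · simp

theorem nu_sinQ {A : PolySeries} (hA : d ∣ A) : nu (sinQ A) = sinQ (nu A) := by
  rw [sinQ, sinQ]
  simp only [map_add, map_sub, map_mul, map_pow, map_one, map_ofNat, nu_u, nu_cosRoot,
    nu_sinRoot hA]

theorem flipU_sinQ {A : PolySeries} (hA : d ∣ A) (h : flipU A = -A) :
    flipU (sinQ A) = -sinQ A := by
  rw [sinQ]
  simp only [map_add, map_sub, map_mul, map_pow, map_one, map_ofNat, flipU_u, flipU_cosRoot,
    flipU_sinRoot hA, h, cosRoot_neg, sinRoot_neg hA]
  ring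

theorem conjS_sinQ {A : PolySeries} (hA : d ∣ A) : conjS (sinQ A) = sinQ (conjS A) := by
  rw [sinQ, sinQ]
  simp only [map_add, map_sub, map_mul, map_pow, map_one, map_ofNat, conjS_u, conjS_cosRoot,
    conjS_sinRoot hA]

theorem nu_residual {A : PolySeries} (hA : d ∣ A) : nu (residual A) = residual (nu A) := by
  rw [residual, residual, map_sub, rhs_eq, rhs_eq, map_sub, map_mul, nu_eps_sq, nu_sinQ hA,
    nu_Iseries, nu_lhs]

theorem flipU_residual {A : PolySeries} (hA : d ∣ A) (h : flipU A = -A) :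
    flipU (residual A) = -residual A := by
  have : lhs (-A) = -lhs A := by
    rw [lhs, lhs, expD_neg, expD_neg]; ring
  rw [residual, map_sub, rhs_eq, map_sub, map_mul, flipU_eps_sq, flipU_sinQ hA h,
    flipU_Iseries, flipU_lhs, h, this]
  ring

theorem conjS_residual {A : PolySeries} (hA : d ∣ A) :
    conjS (residual A) = residual (conjS A) := by
  rw [residual, residual, map_sub, rhs_eq, rhs_eq, map_sub, map_mul, conjS_eps_sq, conjS_sinQ hA,
    conjS_Iseries, conjS_lhs]

/-! ### Evaluation at `u = 1` -/

/-- The substitution `u = 1`. -/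
def evalOne : PolySeries →+* PowerSeries ℂ := PowerSeries.map (evalRingHom 1)

theorem coeff_evalOne (n : ℕ) (Z : PolySeries) :
    PowerSeries.coeff n (evalOne Z) = (PowerSeries.coeff n Z).eval 1 := by
  rw [evalOne, PowerSeries.coeff_map]; rfl

/-- At u = 1, the limit s → ∞, the factor 1 - u² removes the derivative and the operator becomes
multiplication by -1, the decay rate of 1 / cosh s. -/
theorem eval_one_Dop_pow (p : ℂ[X]) (k : ℕ) :
    (((Dop (-1)) ^ k) p).eval 1 = (-1) ^ k * p.eval 1 := by
  induction k with
  | zero => simp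
  | succ k ih =>
    rw [pow_succ', Module.End.mul_apply, Dop_apply]
    simp [ih, pow_succ]

theorem evalOne_u : evalOne u = 1 := by
  rw [evalOne, u, ofPoly, PowerSeries.map_C]; simp

theorem evalOne_tau2 : evalOne tau2 = 0 := by
  rw [tau2, map_sub, map_one, map_pow, evalOne_u]; ring

theorem evalOne_entire (φ : ℕ → ℂ) {Y : PolySeries} (hY : evalOne Y = 0) (hd : d ∣ Y) :
    evalOne (entire φ Y) = PowerSeries.C (φ 0) := by
  rw [entire_eq φ hd, map_add, map_mul, hY, zero_mul, add_zero, evalOne, const, ofPoly,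
    PowerSeries.map_C]
  simp

theorem evalOne_sinQ {A : PolySeries} (hA : d ∣ A) : evalOne (sinQ A) = 2 + evalOne A := by
  have h : evalOne (tau2 * A ^ 2) = 0 := by rw [map_mul, evalOne_tau2, zero_mul]
  rw [sinQ, cosRoot_eq, sinRoot_eq hA]
  simp only [map_add, map_sub, map_mul, map_pow, map_one, map_ofNat, evalOne_u,
    evalOne_entire _ h (dvd_tau2_mul_sq hA)]
  rw [show cosCoeff 0 = 1 by simp [cosCoeff], show sinCoeff 0 = 1 by simp [sinCoeff], map_one]
  ring

/-- `2 cosh d - 2`, as a series with complex coefficients. -/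
def coshSub : PowerSeries ℂ := PowerSeries.rescale (-1) (PowerSeries.exp ℂ) + PowerSeries.exp ℂ - 2

theorem evalOne_expD (θ : ℂ) (Z : PolySeries) :
    evalOne (expD (-1) θ Z) = PowerSeries.rescale (-θ) (PowerSeries.exp ℂ) * evalOne Z := by
  ext1 n
  rw [coeff_evalOne, coeff_expD, PowerSeries.coeff_mul, eval_finsetSum]
  refine Finset.sum_congr rfl fun x _ => ?_
  rw [eval_mul, eval_C, eval_one_Dop_pow, coeff_evalOne, PowerSeries.coeff_rescale,
    PowerSeries.coeff_exp, neg_pow]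
  simp
  ring

theorem evalOne_lhs (Z : PolySeries) : evalOne (lhs Z) = coshSub * evalOne Z := by
  rw [lhs, map_sub, map_add, evalOne_expD, evalOne_expD, map_mul, map_ofNat, neg_neg,
    PowerSeries.rescale_one, coshSub, RingHom.id_apply]
  ring

theorem coeff_coshSub (n : ℕ) : PowerSeries.coeff n coshSub
    = if Even n ∧ 2 ≤ n then 2 / (n.factorial : ℂ) else 0 := by
  rw [coshSub, map_sub, map_add, PowerSeries.coeff_rescale, PowerSeries.coeff_exp,
    show (2 : PowerSeries ℂ) = PowerSeries.C 2 from (map_ofNat _ 2).symm, PowerSeries.coeff_C]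
  rcases Nat.even_or_odd n with h | h
  · rw [h.neg_one_pow]
    rcases eq_or_ne n 0 with rfl | h0
    · norm_num
    · have : 2 ≤ n := by
        obtain ⟨k, rfl⟩ := h; omega
      rw [if_neg h0, if_pos ⟨h, this⟩]
      simp
      ring
  · have h0 : n ≠ 0 := h.pos.ne'
    rw [h.neg_one_pow, if_neg h0, if_neg (fun h' => Nat.not_even_iff_odd.mpr h h'.1)]
    simp

theorem evalOne_Iseries : evalOne Iseries = 2 * coshSub := by
  ext1 n
  rw [coeff_evalOne, coeff_Iseries, show (2 : PowerSeries ℂ) = PowerSeries.C 2 from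
    (map_ofNat _ 2).symm, PowerSeries.coeff_C_mul, coeff_coshSub]
  split_ifs with h
  · have h1 : Odd (n - 1) := Nat.Even.sub_odd (by omega) h.1 odd_one
    rw [eval_mul, eval_C, eval_one_Dop_pow, h1.neg_one_pow, eval_one]; ring
  · simp

theorem sinhS_add_coshS (θ : ℂ) : evalOne (coshS θ) + evalOne (sinhS θ)
    = PowerSeries.rescale θ (PowerSeries.exp ℂ) ∧ evalOne (coshS θ) - evalOne (sinhS θ)
    = PowerSeries.rescale (-θ) (PowerSeries.exp ℂ) := by
  constructor
  all_goals
    ext1 n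
    rw [PowerSeries.coeff_rescale, PowerSeries.coeff_exp]
    first | rw [map_add] | rw [map_sub]
    rw [coeff_evalOne, coeff_evalOne, coshS, sinhS, PowerSeries.coeff_mk, PowerSeries.coeff_mk]
    rcases Nat.even_or_odd n with h | h
    · rw [if_pos h, if_neg (Nat.not_odd_iff_even.mpr h)]
      simp [div_eq_mul_inv, h.neg_pow]
    · rw [if_pos h, if_neg (Nat.not_even_iff_odd.mpr h)]
      simp [div_eq_mul_inv, h.neg_pow]

theorem evalOne_eps_sq : evalOne (eps ^ 2) = coshSub := by
  obtain ⟨h1, h2⟩ := sinhS_add_coshS (1 / 2)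
  have e1 : PowerSeries.rescale (1 / 2 : ℂ) (PowerSeries.exp ℂ)
      * PowerSeries.rescale (1 / 2 : ℂ) (PowerSeries.exp ℂ) = PowerSeries.exp ℂ := by
    rw [PowerSeries.exp_mul_exp_eq_exp_add]; norm_num
  have e2 : PowerSeries.rescale (-(1 / 2) : ℂ) (PowerSeries.exp ℂ)
      * PowerSeries.rescale (-(1 / 2) : ℂ) (PowerSeries.exp ℂ)
      = PowerSeries.rescale (-1) (PowerSeries.exp ℂ) := by
    rw [PowerSeries.exp_mul_exp_eq_exp_add]; norm_num
  have e3 : PowerSeries.rescale (1 / 2 : ℂ) (PowerSeries.exp ℂ)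
      * PowerSeries.rescale (-(1 / 2) : ℂ) (PowerSeries.exp ℂ) = 1 := by
    rw [PowerSeries.exp_mul_exp_eq_exp_add, add_neg_cancel]; simp
  rw [← h1] at e1 e3
  rw [← h2] at e2 e3
  rw [eps, map_pow, map_mul, map_ofNat, coshSub, ← e2]
  linear_combination e1 - 2 * e3

/-- At u = 1 the left-hand side and ε² both become multiplication by 2 cosh d - 2, the sine term is
2 + A, and the inhomogeneity is twice 2 cosh d - 2: everything cancels, whatever A is. -/
theorem evalOne_residual {A : PolySeries} (hA : d ∣ A) : evalOne (residual A) = 0 := by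
  rw [residual, map_sub, rhs_eq, map_sub, map_mul, evalOne_eps_sq, evalOne_sinQ hA,
    evalOne_Iseries, evalOne_lhs]
  ring

/-! ### Existence and uniqueness of the formal solution -/

theorem coeff_comp_neg_X (p : ℂ[X]) (i : ℕ) : (p.comp (-X)).coeff i = p.coeff i * (-1) ^ i := by
  rw [show (-X : ℂ[X]) = C (-1) * X by simp, comp_C_mul_X_coeff]

theorem coeff_eq_zero_of_odd {p : ℂ[X]} (hp : p.comp (-X) = -p) {i : ℕ} (hi : Even i) :
    p.coeff i = 0 := by
  have h := congrArg (fun q => coeff q i) hp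
  simp only [coeff_comp_neg_X, hi.neg_one_pow, mul_one, coeff_neg] at h
  exact self_eq_neg.mp h

/-- The linearized operator on the leading coefficient. -/
def leadOp (p : ℂ[X]) : ℂ[X] :=
  (1 - X ^ 2) * derivative (derivative p) - 4 * X * derivative p

/-- The function 1 / cosh s solves the linearized pendulum equation at q₀, so constants p lie in the
kernel. No zeroth-order term remains and 1 - u² splits off. -/
theorem Dop_sq_sub (p : ℂ[X]) :
    ((Dop (-1)) ^ 2) p - (2 * X ^ 2 - 1) * p = (1 - X ^ 2) * leadOp p := by
  rw [sq, Module.End.mul_apply, Dop_apply, Dop_apply, leadOp]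
  simp only [derivative_add, derivative_mul, derivative_sub, derivative_one, derivative_X_pow,
    derivative_C, derivative_X, C_neg, C_1, Nat.cast_ofNat, map_ofNat, derivative_neg]
  ring

theorem leadOp_add (p q : ℂ[X]) : leadOp (p + q) = leadOp p + leadOp q := by
  simp only [leadOp, derivative_add]; ring

theorem leadOp_comp_neg (p : ℂ[X]) : (leadOp p).comp (-X) = leadOp (p.comp (-X)) := by
  rw [leadOp, leadOp]
  simp only [derivative_comp, sub_comp, mul_comp, one_comp, pow_comp, X_comp, derivative_neg,
    derivative_X, derivative_mul, ofNat_comp, derivative_one]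
  ring

theorem PolyDeg.leadOp {k : ℤ} {p : ℂ[X]} (hp : PolyDeg k p) : PolyDeg k (leadOp p) := by
  refine PolyDeg.sub ((PolyDeg.one_sub_X_sq.mul hp.derivative.derivative).mono (by omega)) ?_
  rw [show (4 : ℂ[X]) = Polynomial.C 4 from (map_ofNat _ 4).symm]
  exact (((PolyDeg.C 4).mul PolyDeg.varX).mul hp.derivative).mono (by omega)

/-- On monomials `leadOp` is triangular with diagonal -k (k + 3). This vanishes only for k = 0,
which oddness excludes. -/
theorem coeff_leadOp {k : ℕ} {p : ℂ[X]} (hp : PolyDeg k p) :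
    (leadOp p).coeff k = -(k * (k + 3)) * p.coeff k := by
  have h1 : (leadOp p) = derivative (derivative p) - X * (X * derivative (derivative p))
      - C 4 * (X * derivative p) := by
    rw [leadOp, show (4 : ℂ[X]) = C 4 from (map_ofNat _ 4).symm]; ring
  rw [h1, coeff_sub, coeff_sub, coeff_C_mul, coeff_derivative, coeff_derivative,
    hp (k + 1 + 1) (by push_cast; omega)]
  rcases k with _ | _ | k
  · simp
  · simp only [coeff_X_mul, coeff_derivative, zero_add, coeff_X_mul_zero]
    push_cast; ring
  · simp only [coeff_X_mul, coeff_derivative]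
    push_cast; ring

/-- Cancel the top coefficient by a monomial; the coefficient below it vanishes by parity, so the
degree drops by two. Degrees are integers here, so the case n = 0 concerns degree at most -1, that
is, r = 0. -/
theorem exists_odd_leadOp_eq (n : ℕ) : ∀ r : ℂ[X], r.comp (-X) = -r → PolyDeg (2 * n - 1) r →
    ∃ p : ℂ[X], p.comp (-X) = -p ∧ PolyDeg (2 * n - 1) p ∧ leadOp p = r := by
  induction n with
  | zero =>
    intro r _ hd
    have : r = 0 := hd.eq_zero (by norm_num)
    exact ⟨0, by simp, PolyDeg.zero _, by simp [leadOp, this]⟩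
  | succ n ih =>
    intro r ho hd
    set j : ℕ := 2 * n + 1 with hj
    have hd' : PolyDeg j r := hd.mono (by push_cast; omega)
    have hjodd : Odd j := ⟨n, rfl⟩
    have hj0 : (-((j : ℂ) * (j + 3))) ≠ 0 := by
      have : (j : ℂ) ≠ 0 := Nat.cast_ne_zero.mpr (by omega)
      have h2 : (j : ℂ) + 3 ≠ 0 := by exact_mod_cast (Nat.succ_ne_zero (j + 2))
      exact neg_ne_zero.mpr (mul_ne_zero this h2)
    set p₀ : ℂ[X] := C (r.coeff j / (-((j : ℂ) * (j + 3)))) * X ^ j with hp₀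
    have hp₀d : PolyDeg j p₀ := by
      intro i hi
      rw [hp₀, coeff_C_mul, coeff_X_pow, if_neg (by omega), mul_zero]
    have hp₀o : p₀.comp (-X) = -p₀ := by
      rw [hp₀, mul_comp, C_comp, pow_comp, X_comp, hjodd.neg_pow]; ring
    obtain ⟨p, h1, h2, h3⟩ := ih (r - leadOp p₀) (by
      rw [sub_comp, ho, leadOp_comp_neg, hp₀o]
      have : leadOp (-p₀) = -leadOp p₀ := by
        simp only [leadOp, derivative_neg]; ring
      rw [this]; ring) (by
      intro i hi
      rcases lt_or_ge j i with h | h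
      · exact (hd'.sub hp₀d.leadOp) i (by exact_mod_cast h)
      · rcases eq_or_ne i j with rfl | hne
        · rw [coeff_sub, coeff_leadOp hp₀d, hp₀, coeff_C_mul, coeff_X_pow_self, mul_one,
            mul_comm, div_mul_cancel₀ _ hj0, sub_self]
        · have hi2 : i = 2 * n := by omega
          have hev : Even i := ⟨n, by omega⟩
          have ho' : (r - leadOp p₀).comp (-X) = -(r - leadOp p₀) := by
            rw [sub_comp, ho, leadOp_comp_neg, hp₀o]
            have : leadOp (-p₀) = -leadOp p₀ := by
              simp only [leadOp, derivative_neg]; ring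
            rw [this]; ring
          exact coeff_eq_zero_of_odd ho' hev)
    refine ⟨p + p₀, by rw [add_comp, h1, hp₀o]; ring, ?_, ?_⟩
    · exact (h2.mono (by push_cast; omega)).add (hp₀d.mono (by push_cast; omega))
    · rw [leadOp_add, h3]; ring

theorem eq_zero_of_leadOp_eq_zero {p : ℂ[X]} (hp : p.comp (-X) = -p) (h : leadOp p = 0) :
    p = 0 := by
  by_contra hne
  have h1 : PolyDeg p.natDegree p := polyDeg_natCast_iff.mpr le_rfl
  have h2 := coeff_leadOp h1
  rw [h, coeff_zero] at h2
  have h3 : p.coeff p.natDegree ≠ 0 := leadingCoeff_ne_zero.mpr hne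
  have h4 : ((p.natDegree : ℂ) * (p.natDegree + 3)) = 0 := by
    have := (mul_eq_zero.mp h2.symm).resolve_right h3
    exact neg_eq_zero.mp this
  have h5 : p.natDegree = 0 := by
    have h6 : ((p.natDegree * (p.natDegree + 3) : ℕ) : ℂ) = 0 := by push_cast; exact h4
    have h7 := Nat.cast_eq_zero.mp h6
    rcases Nat.mul_eq_zero.mp h7 with h8 | h8 <;> omega
  rw [h5] at h3
  exact h3 (coeff_eq_zero_of_odd hp (by simp))

theorem exists_eq_tau2_mul {n : ℕ} {r : ℂ[X]} (ho : r.comp (-X) = -r) (h1 : r.eval 1 = 0)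
    (hd : PolyDeg (2 * n + 1) r) :
    ∃ r₁ : ℂ[X], r = (1 - X ^ 2) * r₁ ∧ r₁.comp (-X) = -r₁ ∧ PolyDeg (2 * n - 1) r₁ := by
  have h2 : r.eval (-1) = 0 := by
    have := congrArg (eval 1) ho
    rw [eval_comp, eval_neg, eval_neg, eval_X, h1, neg_zero] at this
    exact this
  obtain ⟨q, hq⟩ := dvd_iff_isRoot.mpr h1
  have h3 : q.eval (-1) = 0 := by
    rw [hq, eval_mul] at h2
    refine (mul_eq_zero.mp h2).resolve_left ?_
    norm_num
  obtain ⟨q', hq'⟩ := dvd_iff_isRoot.mpr h3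
  have hr : r = (1 - X ^ 2) * (-q') := by
    rw [hq, hq']; simp only [map_neg, map_one]; ring
  have hne : (1 - X ^ 2 : ℂ[X]) ≠ 0 := by
    intro h0
    have := degree_one_sub_X_sq
    rw [h0] at this; simp at this
  refine ⟨-q', hr, ?_, ?_⟩
  · have h4 := ho
    rw [hr, mul_comp] at h4
    have h5 : (1 - X ^ 2 : ℂ[X]).comp (-X) = 1 - X ^ 2 := by
      simp only [sub_comp, one_comp, pow_comp, X_comp]; ring
    rw [h5] at h4
    refine mul_left_cancel₀ hne ?_
    rw [h4]; ring
  · intro i hi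
    by_contra hc
    have hq0 : (-q') ≠ 0 := by
      intro h0; rw [h0] at hc; simp at hc
    have h6 : r.natDegree = 2 + (-q').natDegree := by
      rw [hr, natDegree_mul hne hq0, natDegree_eq_of_degree_eq_some degree_one_sub_X_sq]
    have h7 : r.natDegree ≤ 2 * n + 1 := polyDeg_natCast_iff.mp (by exact_mod_cast hd)
    have h8 : i ≤ (-q').natDegree := le_natDegree_of_ne_zero hc
    omega

/-! ### Admissible series and the construction of the solution. -/

/-- The shape required of a formal solution. -/
structure Admissible (A : PolySeries) : Prop where
  dvd : d ∣ A
  even : nu A = A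
  odd : flipU A = -A
  deg : DegLE (-1) A

theorem coeff_odd_of_even {A : PolySeries} (h : nu A = A) {n : ℕ} (hn : Odd n) :
    PowerSeries.coeff n A = 0 := by
  have h1 := coeff_nu n A
  rw [h, hn.neg_one_pow, neg_one_mul] at h1
  exact self_eq_neg.mp h1

theorem coeff_comp_of_odd {A : PolySeries} (h : flipU A = -A) (n : ℕ) :
    (PowerSeries.coeff n A).comp (-X) = -PowerSeries.coeff n A := by
  rw [← coeff_flipU, h, map_neg]

/-- The conditions on single coefficients become invariance under ring homomorphisms, evenness in d
and oddness in u, together with a degree filtration. In this form they pass to sums and limits, and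
the symmetries of the residual follow from them. -/
theorem isFormalSolution_iff {A : PolySeries} :
    IsFormalSolution A ↔ Admissible A ∧ residual A = 0 := by
  constructor
  · intro h
    refine ⟨⟨?_, ?_, ?_, ?_⟩, ?_⟩
    · rw [← pow_one d]
      refine dvd_of_coeff_eq_zero fun n hn => ?_
      obtain rfl : n = 0 := by omega
      exact h.coeff_zero
    · ext1 n
      rw [coeff_nu]
      rcases Nat.even_or_odd n with hn | hn
      · rw [hn.neg_one_pow, one_mul]
      · obtain ⟨k, rfl⟩ := hn
        rw [h.coeff_odd, mul_zero]
    · ext1 n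
      rw [coeff_flipU, map_neg]
      rcases Nat.even_or_odd n with hn | hn
      · obtain ⟨k, rfl⟩ := hn
        rw [← two_mul]
        rcases Nat.eq_zero_or_pos k with rfl | hk
        · rw [mul_zero, h.coeff_zero]; simp
        · exact h.odd_coeff_even k hk
      · obtain ⟨k, rfl⟩ := hn
        rw [h.coeff_odd]; simp
    · intro n
      rcases Nat.even_or_odd n with hn | hn
      · obtain ⟨k, rfl⟩ := hn
        rw [← two_mul]
        rcases Nat.eq_zero_or_pos k with rfl | hk
        · rw [mul_zero, h.coeff_zero]; exact PolyDeg.zero _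
        · exact (polyDeg_natCast_iff.mpr (h.natDegree_le k hk)).mono (by omega)
      · obtain ⟨k, rfl⟩ := hn
        rw [h.coeff_odd]; exact PolyDeg.zero _
    · rw [residual, ← h.equation, lhs_eq, sub_self]
  · rintro ⟨h, hr⟩
    refine ⟨coeff_zero_of_dvd h.dvd, fun n => coeff_odd_of_even h.even ⟨n, rfl⟩,
      fun n _ => coeff_comp_of_odd h.odd _, fun n hn => ?_, ?_⟩
    · exact polyDeg_natCast_iff.mp ((h.deg (2 * n)).mono (by omega))
    · rw [lhs_eq]; exact (sub_eq_zero.mp hr).symm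

theorem Admissible.residual_coeff {A : PolySeries} (hA : Admissible A) (n : ℕ) :
    (PowerSeries.coeff n (residual A)).comp (-X) = -PowerSeries.coeff n (residual A) ∧
    (PowerSeries.coeff n (residual A)).eval 1 = 0 ∧
    PolyDeg (n - 1) (PowerSeries.coeff n (residual A)) ∧
    (Odd n → PowerSeries.coeff n (residual A) = 0) := by
  refine ⟨coeff_comp_of_odd (flipU_residual hA.dvd hA.odd) n, ?_, ?_, fun hn => ?_⟩
  · rw [← coeff_evalOne, evalOne_residual hA.dvd, map_zero]
  · exact ((hA.deg.rhs hA.dvd).sub hA.deg.lhs) n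
  · exact coeff_odd_of_even (by rw [nu_residual hA.dvd, hA.even]) hn

theorem Admissible.add {A B : PolySeries} (hA : Admissible A) (hB : Admissible B) :
    Admissible (A + B) :=
  ⟨hA.dvd.add hB.dvd, by rw [map_add, hA.even, hB.even], by rw [map_add, hA.odd, hB.odd]; ring,
    hA.deg.add hB.deg⟩

theorem admissible_monomial {n : ℕ} (hn : 1 ≤ n) {p : ℂ[X]} (ho : p.comp (-X) = -p)
    (hd : PolyDeg (2 * n - 1) p) : Admissible (d ^ (2 * n) * ofPoly p) := by
  refine ⟨(dvd_pow_self d (by omega)).mul_right _, ?_, ?_, ?_⟩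
  · rw [map_mul, map_pow, nu_d, nu_ofPoly, (even_two_mul n).neg_pow]
  · rw [map_mul, map_pow, flipU_d, flipU_ofPoly, ho]
    simp [ofPoly]
  · exact (DegLE.d.pow (2 * n) rfl).mul (DegLE.ofPoly hd) (by push_cast; linarith)

/-- One step of the construction of the formal solution. -/
theorem exists_correction {n : ℕ} (hn : 1 ≤ n) {A : PolySeries} (hA : Admissible A)
    (hr : d ^ (2 * n + 2) ∣ residual A) :
    ∃ B, Admissible B ∧ d ^ (2 * n) ∣ B ∧ d ^ (2 * (n + 1) + 2) ∣ residual (A + B) := by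
  obtain ⟨h1, h2, h3, -⟩ := hA.residual_coeff (2 * n + 2)
  obtain ⟨r₁, hr₁, ho, hd⟩ := exists_eq_tau2_mul (n := n) h1 h2 (h3.mono (by push_cast; omega))
  obtain ⟨p, hp, hpd, hpr⟩ := exists_odd_leadOp_eq n r₁ ho hd
  have hB := admissible_monomial hn hp hpd
  have hdB : d ^ (2 * n) ∣ d ^ (2 * n) * ofPoly p := dvd_mul_right _ _
  refine ⟨d ^ (2 * n) * ofPoly p, hB, hdB, ?_⟩
  obtain ⟨h5, h6⟩ := residual_change (by omega : 1 ≤ 2 * n) hA.dvd hdB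
  have h7 : d ^ (2 * n + 2) ∣ residual (A + d ^ (2 * n) * ofPoly p) := by
    have := h5.add hr
    rwa [sub_add_cancel] at this
  refine dvd_of_coeff_eq_zero fun k hk => ?_
  rcases lt_or_ge k (2 * n + 2) with h | h
  · exact coeff_eq_zero_of_dvd h7 h
  · rcases eq_or_ne k (2 * n + 2) with rfl | hne
    · have hc : PowerSeries.coeff (2 * n) (d ^ (2 * n) * ofPoly p) = p := by
        rw [d, ofPoly, PowerSeries.coeff_mul_C, PowerSeries.coeff_X_pow_self, one_mul]
      rw [h6, hc, hr₁, ← hpr]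
      linear_combination -Dop_sq_sub p
    · exact ((hA.add hB).residual_coeff k).2.2.2 ⟨n + 1, by omega⟩

/-- Corrections of orders 2n, 2n + 2, … are added successively and converge in the d-adic topology.
Starting from an arbitrary approximate solution, rather than from 0, shows that the solution begins
with U. -/
theorem exists_solution {n : ℕ} (hn : 1 ≤ n) {A : PolySeries} (hA : Admissible A)
    (hr : d ^ (2 * n + 2) ∣ residual A) :
    ∃ A', Admissible A' ∧ residual A' = 0 ∧ d ^ (2 * n) ∣ A' - A := by
  have step : ∀ (k : ℕ) (Y : {Y // Admissible Y ∧ d ^ (2 * (n + k) + 2) ∣ residual Y}),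
      ∃ Y' : {Y // Admissible Y ∧ d ^ (2 * (n + (k + 1)) + 2) ∣ residual Y},
        d ^ (2 * (n + k)) ∣ Y'.1 - Y.1 := by
    rintro k ⟨Y, hY, hYr⟩
    obtain ⟨B, hB, hdB, hrB⟩ := exists_correction (by omega : 1 ≤ n + k) hY hYr
    exact ⟨⟨Y + B, hY.add hB, hrB⟩, by simpa using hdB⟩
  choose f hf using step
  let S : (k : ℕ) → {Y // Admissible Y ∧ d ^ (2 * (n + k) + 2) ∣ residual Y} :=
    fun k => Nat.rec ⟨A, hA, hr⟩ (fun k Y => f k Y) k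
  have hS : ∀ k, d ^ (2 * (n + k)) ∣ (S (k + 1)).1 - (S k).1 := fun k => hf k (S k)
  have hS' : ∀ k j, d ^ (2 * (n + k)) ∣ (S (k + j)).1 - (S k).1 := by
    intro k j
    induction j with
    | zero => simp
    | succ j ih =>
      have h1 := (pow_dvd_pow d (by omega : 2 * (n + k) ≤ 2 * (n + (k + j)))).trans (hS (k + j))
      have := h1.add ih
      rwa [sub_add_sub_cancel] at this
  -- From step m on, corrections have order at least 2 (n + m) > m, so the coefficient of dᵐ no
  -- longer changes.
  set A' : PolySeries := PowerSeries.mk fun m => PowerSeries.coeff m (S m).1 with hA'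
  have hlim : ∀ k, d ^ (2 * (n + k)) ∣ A' - (S k).1 := by
    intro k
    refine dvd_of_coeff_eq_zero fun m hm => ?_
    rw [map_sub, hA', PowerSeries.coeff_mk]
    rcases le_total k m with h | h
    · obtain ⟨j, rfl⟩ := Nat.exists_eq_add_of_le h
      rw [← map_sub]; exact coeff_eq_zero_of_dvd (hS' k j) hm
    · obtain ⟨j, rfl⟩ := Nat.exists_eq_add_of_le h
      rw [← neg_sub, ← map_sub, coeff_eq_zero_of_dvd (hS' m j) (by omega), neg_zero]
  have hadm : Admissible A' := by
    refine ⟨?_, ?_, ?_, ?_⟩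
    · rw [← pow_one d]
      refine dvd_of_coeff_eq_zero fun m hm => ?_
      obtain rfl : m = 0 := by omega
      rw [hA', PowerSeries.coeff_mk]; exact coeff_zero_of_dvd (S 0).2.1.dvd
    · ext1 m
      have := congrArg (PowerSeries.coeff m) (S m).2.1.even
      rw [coeff_nu] at this ⊢
      rw [hA', PowerSeries.coeff_mk, this]
    · ext1 m
      have := congrArg (PowerSeries.coeff m) (S m).2.1.odd
      rw [coeff_flipU, map_neg] at this ⊢
      rw [hA', PowerSeries.coeff_mk, this]
    · intro m
      rw [hA', PowerSeries.coeff_mk]; exact (S m).2.1.deg m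
  refine ⟨A', hadm, ?_, hlim 0⟩
  refine eq_of_forall_dvd_sub fun M => ?_
  rw [sub_zero]
  obtain ⟨h1, -⟩ := residual_change (by omega : 1 ≤ 2 * (n + M)) (S M).2.1.dvd (hlim M)
  rw [add_sub_cancel] at h1
  have h2 := ((pow_dvd_pow d (by omega : M ≤ 2 * (n + M) + 2)).trans h1).add
    ((pow_dvd_pow d (by omega : M ≤ 2 * (n + M) + 2)).trans (S M).2.2)
  rwa [sub_add_cancel] at h2

/-- By `residual_change` the lowest coefficient of the difference lies in the kernel of `leadOp`. It
is odd, hence zero. -/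
theorem solution_unique {A B : PolySeries} (hA : Admissible A) (hB : Admissible B)
    (hrA : residual A = 0) (hrB : residual B = 0) : B = A := by
  have hdvd : ∀ m, d ^ (m + 1) ∣ B - A := by
    intro m
    induction m with
    | zero => rw [zero_add, pow_one]; exact hB.dvd.sub hA.dvd
    | succ m ih =>
      obtain ⟨-, h2⟩ := residual_change (by omega : 1 ≤ m + 1) hA.dvd ih
      rw [add_sub_cancel, hrA, hrB, map_zero, zero_add] at h2
      have h3 := Dop_sq_sub (PowerSeries.coeff (m + 1) (B - A))
      have h4 : (1 - X ^ 2) * leadOp (PowerSeries.coeff (m + 1) (B - A)) = 0 := by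
        rw [← h3]; linear_combination h2
      have hne : (1 - X ^ 2 : ℂ[X]) ≠ 0 := by
        intro h0
        have := degree_one_sub_X_sq
        rw [h0] at this; simp at this
      have h5 := (mul_eq_zero.mp h4).resolve_left hne
      have ho : flipU (B - A) = -(B - A) := by rw [map_sub, hA.odd, hB.odd]; ring
      have h6 := eq_zero_of_leadOp_eq_zero (coeff_comp_of_odd ho _) h5
      refine dvd_of_coeff_eq_zero fun k hk => ?_
      rcases Nat.lt_succ_iff_lt_or_eq.mp hk with h | rfl
      · exact coeff_eq_zero_of_dvd ih h
      · exact h6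
  exact eq_of_forall_dvd_sub fun M => (pow_dvd_pow d (Nat.le_succ M)).trans (hdvd M)

/-- Combined with uniqueness this shows that the solution has real coefficients, which is why α, β
and δ can be taken real. -/
theorem Admissible.conj {A : PolySeries} (hA : Admissible A) : Admissible (conjS A) := by
  refine ⟨by simpa [conjS_d] using map_dvd conjS hA.dvd, ?_, ?_, ?_⟩
  · ext1 n
    have := congrArg (PowerSeries.coeff n) hA.even
    rw [coeff_nu] at this
    rw [coeff_nu, coeff_conjS]
    conv_rhs => rw [← this, Polynomial.map_mul]
    simp
  · ext1 n
    have := congrArg (PowerSeries.coeff n) hA.odd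
    rw [coeff_flipU, map_neg] at this
    rw [coeff_flipU, map_neg, coeff_conjS, ← Polynomial.map_neg, ← this, Polynomial.map_comp]
    simp
  · intro n i hi
    rw [coeff_conjS, coeff_map, hA.deg n i hi, map_zero]

/-! ### Explicit low-order coefficients. -/

theorem Dop_neg_one_sq (p : ℂ[X]) : ((Dop (-1)) ^ 2) p =
    (1 - X ^ 2) ^ 2 * derivative (derivative p) - 4 * X * (1 - X ^ 2) * derivative p
      + (2 * X ^ 2 - 1) * p := by
  rw [pow_two, Module.End.mul_apply, Dop_apply, Dop_apply]
  refine Polynomial.funext fun x => ?_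
  simp; ring

theorem Dop_neg_one_pow_4 (p : ℂ[X]) :
    ((Dop (-1)) ^ 4) p = ((Dop (-1)) ^ 2) (((Dop (-1)) ^ 2) p) := rfl

theorem Dop_neg_one_pow_6 (p : ℂ[X]) :
    ((Dop (-1)) ^ 6) p = ((Dop (-1)) ^ 2) (((Dop (-1)) ^ 4) p) := rfl

theorem Dop_neg_one_pow_8 (p : ℂ[X]) :
    ((Dop (-1)) ^ 8) p = ((Dop (-1)) ^ 2) (((Dop (-1)) ^ 6) p) := rfl

theorem Dop_pow_2_X_pow_0 : ((Dop (-1)) ^ 2) (X ^ 0) =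
    -1 + 2 * X ^ 2 := by
  rw [Dop_neg_one_sq]
  refine Polynomial.funext fun x => ?_
  simp; ring

theorem Dop_pow_4_X_pow_0 : ((Dop (-1)) ^ 4) (X ^ 0) =
    5 - 28 * X ^ 2 + 24 * X ^ 4 := by
  rw [Dop_neg_one_pow_4, Dop_pow_2_X_pow_0, Dop_neg_one_sq]
  refine Polynomial.funext fun x => ?_
  simp; ring

theorem Dop_pow_6_X_pow_0 : ((Dop (-1)) ^ 6) (X ^ 0) =
    -61 + 662 * X ^ 2 - 1320 * X ^ 4 + 720 * X ^ 6 := by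
  rw [Dop_neg_one_pow_6, Dop_pow_4_X_pow_0, Dop_neg_one_sq]
  refine Polynomial.funext fun x => ?_
  simp; ring

theorem Dop_pow_8_X_pow_0 : ((Dop (-1)) ^ 8) (X ^ 0) =
    1385 - 24568 * X ^ 2 + 83664 * X ^ 4 - 100800 * X ^ 6 + 40320 * X ^ 8 := by
  rw [Dop_neg_one_pow_8, Dop_pow_6_X_pow_0, Dop_neg_one_sq]
  refine Polynomial.funext fun x => ?_
  simp; ring

theorem Dop_pow_2_X_pow_1 : ((Dop (-1)) ^ 2) (X ^ 1) =
    -5 * X ^ 1 + 6 * X ^ 3 := by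
  rw [Dop_neg_one_sq]
  refine Polynomial.funext fun x => ?_
  simp; ring

theorem Dop_pow_4_X_pow_1 : ((Dop (-1)) ^ 4) (X ^ 1) =
    61 * X ^ 1 - 180 * X ^ 3 + 120 * X ^ 5 := by
  rw [Dop_neg_one_pow_4, Dop_pow_2_X_pow_1, Dop_neg_one_sq]
  refine Polynomial.funext fun x => ?_
  simp; ring

theorem Dop_pow_6_X_pow_1 : ((Dop (-1)) ^ 6) (X ^ 1) =
    -1385 * X ^ 1 + 7266 * X ^ 3 - 10920 * X ^ 5 + 5040 * X ^ 7 := by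
  rw [Dop_neg_one_pow_6, Dop_pow_4_X_pow_1, Dop_neg_one_sq]
  refine Polynomial.funext fun x => ?_
  simp; ring

theorem Dop_pow_2_X_pow_2 : ((Dop (-1)) ^ 2) (X ^ 2) =
    2 - 13 * X ^ 2 + 12 * X ^ 4 := by
  rw [Dop_neg_one_sq]
  refine Polynomial.funext fun x => ?_
  simp; ring

theorem Dop_pow_4_X_pow_2 : ((Dop (-1)) ^ 4) (X ^ 2) =
    -28 + 317 * X ^ 2 - 648 * X ^ 4 + 360 * X ^ 6 := by
  rw [Dop_neg_one_pow_4, Dop_pow_2_X_pow_2, Dop_neg_one_sq]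
  refine Polynomial.funext fun x => ?_
  simp; ring

theorem Dop_pow_6_X_pow_2 : ((Dop (-1)) ^ 6) (X ^ 2) =
    662 - 11953 * X ^ 2 + 41172 * X ^ 4 - 50040 * X ^ 6 + 20160 * X ^ 8 := by
  rw [Dop_neg_one_pow_6, Dop_pow_4_X_pow_2, Dop_neg_one_sq]
  refine Polynomial.funext fun x => ?_
  simp; ring

theorem Dop_pow_2_X_pow_3 : ((Dop (-1)) ^ 2) (X ^ 3) =
    6 * X ^ 1 - 25 * X ^ 3 + 20 * X ^ 5 := by
  rw [Dop_neg_one_sq]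
  refine Polynomial.funext fun x => ?_
  simp; ring

theorem Dop_pow_4_X_pow_3 : ((Dop (-1)) ^ 4) (X ^ 3) =
    -180 * X ^ 1 + 1061 * X ^ 3 - 1720 * X ^ 5 + 840 * X ^ 7 := by
  rw [Dop_neg_one_pow_4, Dop_pow_2_X_pow_3, Dop_neg_one_sq]
  refine Polynomial.funext fun x => ?_
  simp; ring

theorem Dop_pow_2_X_pow_4 : ((Dop (-1)) ^ 2) (X ^ 4) =
    12 * X ^ 2 - 41 * X ^ 4 + 30 * X ^ 6 := by
  rw [Dop_neg_one_sq]
  refine Polynomial.funext fun x => ?_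
  simp; ring

theorem Dop_pow_4_X_pow_4 : ((Dop (-1)) ^ 4) (X ^ 4) =
    24 - 648 * X ^ 2 + 2725 * X ^ 4 - 3780 * X ^ 6 + 1680 * X ^ 8 := by
  rw [Dop_neg_one_pow_4, Dop_pow_2_X_pow_4, Dop_neg_one_sq]
  refine Polynomial.funext fun x => ?_
  simp; ring

theorem Dop_pow_2_X_pow_5 : ((Dop (-1)) ^ 2) (X ^ 5) =
    20 * X ^ 3 - 61 * X ^ 5 + 42 * X ^ 7 := by
  rw [Dop_neg_one_sq]
  refine Polynomial.funext fun x => ?_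
  simp; ring

theorem Dop_pow_2_X_pow_6 : ((Dop (-1)) ^ 2) (X ^ 6) =
    30 * X ^ 4 - 85 * X ^ 6 + 56 * X ^ 8 := by
  rw [Dop_neg_one_sq]
  refine Polynomial.funext fun x => ?_
  simp; ring



/-- The low coefficients of `lhs Z`. -/
theorem coeff_lhs_low (Z : PolySeries) :
    PowerSeries.coeff 0 (lhs Z) = 0 ∧
    PowerSeries.coeff 2 (lhs Z) = ((Dop (-1)) ^ 2) (PowerSeries.coeff 0 Z) ∧
    PowerSeries.coeff 4 (lhs Z) = ((Dop (-1)) ^ 2) (PowerSeries.coeff 2 Z)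
      + C (1 / 12) * ((Dop (-1)) ^ 4) (PowerSeries.coeff 0 Z) ∧
    PowerSeries.coeff 6 (lhs Z) = ((Dop (-1)) ^ 2) (PowerSeries.coeff 4 Z)
      + C (1 / 12) * ((Dop (-1)) ^ 4) (PowerSeries.coeff 2 Z)
      + C (1 / 360) * ((Dop (-1)) ^ 6) (PowerSeries.coeff 0 Z) ∧
    PowerSeries.coeff 8 (lhs Z) = ((Dop (-1)) ^ 2) (PowerSeries.coeff 6 Z)
      + C (1 / 12) * ((Dop (-1)) ^ 4) (PowerSeries.coeff 4 Z)
      + C (1 / 360) * ((Dop (-1)) ^ 6) (PowerSeries.coeff 2 Z)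
      + C (1 / 20160) * ((Dop (-1)) ^ 8) (PowerSeries.coeff 0 Z) := by
  have e0 : (C (2 : ℂ) : ℂ[X]) = 2 := map_ofNat C 2
  refine ⟨?_, ?_, ?_, ?_, ?_⟩ <;>
  · rw [coeff_lhs, Finset.Nat.sum_antidiagonal_eq_sum_range_succ_mk]
    simp only [Finset.sum_range_succ, Finset.sum_range_zero, Nat.factorial]
    norm_num [e0]
    try ring

theorem coeff_Iseries_low :
    PowerSeries.coeff 0 Iseries = 0 ∧ PowerSeries.coeff 2 Iseries = 2 * X ∧
    PowerSeries.coeff 4 Iseries = C (1 / 6) * ((Dop (-1)) ^ 2) X ∧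
    PowerSeries.coeff 6 Iseries = C (1 / 180) * ((Dop (-1)) ^ 4) X ∧
    PowerSeries.coeff 8 Iseries = C (1 / 10080) * ((Dop (-1)) ^ 6) X := by
  have h (k : ℕ) : ((Dop (-1)) ^ (k + 1)) 1 = -((Dop (-1)) ^ k) X := by
    rw [pow_succ (Dop (-1)), Module.End.mul_apply, ← map_neg]
    congr 1
    rw [Dop_apply]; simp
  refine ⟨?_, ?_, ?_, ?_, ?_⟩
  · rw [coeff_Iseries, if_neg (by omega)]
  all_goals
    rw [coeff_Iseries, if_pos (by decide), h]
    refine Polynomial.funext fun x => ?_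
    simp [Nat.factorial]
    try ring

/-! ### Exponential series and truncations. -/

/-- `exp (θ d)`. -/
def expS (θ : ℂ) : PolySeries := PowerSeries.map C (PowerSeries.rescale θ (PowerSeries.exp ℂ))

theorem coeff_expS (θ : ℂ) (n : ℕ) :
    PowerSeries.coeff n (expS θ) = C (θ ^ n / (n.factorial : ℂ)) := by
  rw [expS, PowerSeries.coeff_map, PowerSeries.coeff_rescale, PowerSeries.coeff_exp]
  simp [div_eq_mul_inv]

theorem expS_mul_expS (θ φ : ℂ) : expS θ * expS φ = expS (θ + φ) := by
  rw [expS, expS, expS, ← map_mul, PowerSeries.exp_mul_exp_eq_exp_add]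

theorem expS_zero : expS 0 = 1 := by
  rw [expS]; simp

theorem two_mul_coshS (θ : ℂ) : 2 * coshS θ = expS θ + expS (-θ) := by
  ext1 n
  rw [map_add, coeff_expS, coeff_expS, coshS, two_mul, map_add, PowerSeries.coeff_mk, neg_pow]
  split_ifs with h
  · rw [h.neg_one_pow, one_mul]
  · rw [(Nat.not_even_iff_odd.mp h).neg_one_pow, ← C_add, neg_one_mul, neg_div,
      add_neg_cancel, C_0, add_zero]

theorem two_mul_sinhS (θ : ℂ) : 2 * sinhS θ = expS θ - expS (-θ) := by
  ext1 n
  rw [map_sub, coeff_expS, coeff_expS, sinhS, two_mul, map_add, PowerSeries.coeff_mk, neg_pow]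
  split_ifs with h
  · rw [h.neg_one_pow, ← C_sub, ← C_add]; congr 1; ring
  · rw [(Nat.not_odd_iff_even.mp h).neg_one_pow, one_mul]; simp

theorem two_ne_zero_polySeries : (2 : PolySeries) ≠ 0 := by
  intro h
  have h1 := congrArg (fun Z => (PowerSeries.coeff 0 Z).coeff 0) h
  have e2 : (2 : PolySeries) = PowerSeries.C (C 2) := by rw [map_ofNat, map_ofNat]
  simp only [e2, PowerSeries.coeff_zero_C, coeff_C_zero] at h1
  simp at h1

theorem sinhS_two_mul (θ : ℂ) : sinhS (2 * θ) = 2 * sinhS θ * coshS θ := by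
  refine mul_left_cancel₀ two_ne_zero_polySeries ?_
  have e1 := expS_mul_expS θ θ
  have e2 := expS_mul_expS (-θ) (-θ)
  rw [← two_mul] at e1 e2
  rw [mul_neg] at e2
  rw [two_mul_sinhS, ← e1, ← e2, show 2 * (2 * sinhS θ * coshS θ)
    = (2 * sinhS θ) * (2 * coshS θ) by ring, two_mul_sinhS, two_mul_coshS]
  ring

theorem coshS_two_mul (θ : ℂ) : coshS (2 * θ) = 1 + 2 * sinhS θ ^ 2 := by
  refine mul_left_cancel₀ two_ne_zero_polySeries ?_
  have e1 := expS_mul_expS θ θ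
  have e2 := expS_mul_expS (-θ) (-θ)
  have e3 := expS_mul_expS θ (-θ)
  rw [add_neg_cancel, expS_zero] at e3
  rw [← two_mul] at e1 e2
  rw [mul_neg] at e2
  rw [two_mul_coshS, ← e1, ← e2, show 2 * (1 + 2 * sinhS θ ^ 2)
    = 2 + (2 * sinhS θ) ^ 2 by ring, two_mul_sinhS]
  linear_combination 2 * e3

theorem eps_sq_eq : eps ^ 2 = 2 * coshS 1 - 2 := by
  have h := coshS_two_mul (1 / 2)
  rw [show (2 * (1 / 2) : ℂ) = 1 by norm_num] at h
  rw [h, eps]; ring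

theorem coeff_eps_sq (n : ℕ) : PowerSeries.coeff n (eps ^ 2)
    = if Even n ∧ 2 ≤ n then C (2 / (n.factorial : ℂ)) else 0 := by
  have e0 : (C (2 : ℂ) : ℂ[X]) = 2 := map_ofNat C 2
  have e2 : (2 : PolySeries) = PowerSeries.C 2 := (map_ofNat _ 2).symm
  rw [eps_sq_eq, map_sub, e2, PowerSeries.coeff_C_mul, coshS, PowerSeries.coeff_mk,
    PowerSeries.coeff_C]
  rcases n with _ | _ | n
  · simp
  · simp
  · by_cases h : Even (n + 2)
    · rw [if_pos h, if_neg (by omega), if_pos ⟨h, by omega⟩, ← e0, ← C_mul, sub_zero]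
      congr 1; rw [one_pow, mul_one_div]
    · rw [if_neg h, if_neg (by omega), if_neg (fun h' => h h'.1)]; simp

/-- A series that is even in `d`, up to the terms of order `10`. -/
theorem even_trunc {Z : PolySeries} (hZ : nu Z = Z) : d ^ 10 ∣ Z -
    (ofPoly (PowerSeries.coeff 0 Z) + ofPoly (PowerSeries.coeff 2 Z) * d ^ 2
      + ofPoly (PowerSeries.coeff 4 Z) * d ^ 4 + ofPoly (PowerSeries.coeff 6 Z) * d ^ 6
      + ofPoly (PowerSeries.coeff 8 Z) * d ^ 8) := by
  refine dvd_of_coeff_eq_zero fun n hn => ?_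
  simp only [map_sub, map_add, ofPoly, d, PowerSeries.coeff_C_mul, PowerSeries.coeff_X_pow,
    PowerSeries.coeff_C]
  have hodd : Odd n → PowerSeries.coeff n Z = 0 := fun h => coeff_odd_of_even hZ h
  interval_cases n <;> first | (rw [hodd (by decide)]; simp; done) | simp

theorem eps_sq_trunc : d ^ 10 ∣ eps ^ 2 - (d ^ 2 + const (1 / 12) * d ^ 4
    + const (1 / 360) * d ^ 6 + const (1 / 20160) * d ^ 8) := by
  refine (even_trunc nu_eps_sq).trans (dvd_of_eq ?_)
  simp only [coeff_eps_sq]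
  have e1 : ofPoly (C (2 / ((2 : ℕ).factorial : ℂ))) = 1 := by
    rw [one_eq_ofPoly]; norm_num
  simp only [show (Even 0 ∧ 2 ≤ 0) = False by simp, show (Even 2 ∧ 2 ≤ 2) = True by decide,
    show (Even 4 ∧ 2 ≤ 4) = True by decide, show (Even 6 ∧ 2 ≤ 6) = True by decide,
    show (Even 8 ∧ 2 ≤ 8) = True by decide, if_true, if_false, e1, const, Nat.factorial]
  norm_num [ofPoly]

/-- Precision d⁸ is enough: in the equation these series are multiplied by ε², which supplies the
two missing orders. -/
theorem exists_cosRoot_sinRoot_eq {a b c : PolySeries} :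
    let A := d ^ 2 * (a + b * d ^ 2 + c * d ^ 4)
    d ^ 8 ∣ cosRoot A - (1 - const (1 / 2) * tau2 * (a ^ 2 * d ^ 4 + 2 * a * b * d ^ 6)) ∧
    d ^ 8 ∣ sinRoot A - (A - const (1 / 6) * tau2 * a ^ 3 * d ^ 6) := by
  intro A
  have hA : d ∣ A := (dvd_pow_self d two_ne_zero).mul_right _
  have hY := dvd_tau2_mul_sq hA
  rw [cosRoot_eq, sinRoot_eq hA, entire_eq cosCoeff hY, entire_eq (fun k => cosCoeff (k + 1)) hY,
    entire_eq sinCoeff hY, entire_eq (fun k => sinCoeff (k + 1)) hY]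
  have h0 : const (cosCoeff 0) = 1 := by simp [cosCoeff, const_one]
  have h1 : const (cosCoeff (0 + 1)) = -const (1 / 2) := by
    rw [← const_neg]; congr 1; simp [cosCoeff]; norm_num
  have h2 : const (sinCoeff 0) = 1 := by simp [sinCoeff, const_one]
  have h3 : const (sinCoeff (0 + 1)) = -const (1 / 6) := by
    rw [← const_neg]; congr 1; simp [sinCoeff, Nat.factorial]; norm_num
  rw [h0, h1, h2, h3]
  generalize entire (fun k => cosCoeff (k + 1 + 1)) (tau2 * A ^ 2) = E
  generalize entire (fun k => sinCoeff (k + 1 + 1)) (tau2 * A ^ 2) = F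
  -- Each quotient collects the terms of order at least 8 of the first nontrivial Taylor term,
  -- followed by the entire tail E or F.
  refine ⟨⟨-const (1 / 2) * tau2 * (b ^ 2 + 2 * a * c + 2 * b * c * d ^ 2 + c ^ 2 * d ^ 4)
    + tau2 ^ 2 * (a + b * d ^ 2 + c * d ^ 4) ^ 4 * E, ?_⟩,
    ⟨-const (1 / 6) * tau2 * ((b + c * d ^ 2) * (3 * a ^ 2 + 3 * a * d ^ 2 * (b + c * d ^ 2)
      + d ^ 4 * (b + c * d ^ 2) ^ 2))
    + d ^ 2 * tau2 ^ 2 * (a + b * d ^ 2 + c * d ^ 4) ^ 5 * F, ?_⟩⟩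
  · simp only [A]; ring
  · simp only [A]; ring

theorem ofPoly_add (p q : ℂ[X]) : ofPoly (p + q) = ofPoly p + ofPoly q := map_add _ _ _

theorem ofPoly_sub (p q : ℂ[X]) : ofPoly (p - q) = ofPoly p - ofPoly q := map_sub _ _ _

theorem ofPoly_mul (p q : ℂ[X]) : ofPoly (p * q) = ofPoly p * ofPoly q := map_mul _ _ _

theorem ofPoly_pow (p : ℂ[X]) (n : ℕ) : ofPoly (p ^ n) = ofPoly p ^ n := map_pow _ _ _

theorem ofPoly_two : ofPoly 2 = 2 := map_ofNat _ 2

theorem ofPoly_one : ofPoly 1 = 1 := one_eq_ofPoly.symm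

/-! ### The approximate solution `U` and the approximate solution `Q` of the linearized equation. -/

/-- The coefficient of `d²` in `U`. -/
def Ucoeff2 : ℂ[X] := C (-1 / 4) * X

/-- The coefficient of `d⁴` in `U`. -/
def Ucoeff4 : ℂ[X] := C (91 / 864) * X ^ 3 - C (47 / 576) * X

/-- The coefficient of `d⁶` in `U`. -/
def Ucoeff6 : ℂ[X] := C (-319 / 2880) * X ^ 5 + C (185 / 1152) * X ^ 3 - C (3703 / 69120) * X

/-- The coefficient of `d²` in `Q`. -/
def Qcoeff2 : ℂ[X] := C (1 / 4) * (1 - X ^ 2)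

/-- The coefficient of `d⁴` in `Q`. -/
def Qcoeff4 : ℂ[X] := C (91 / 432) * X ^ 4 - C (13 / 48) * X ^ 2 + C (13 / 216)

/-- The coefficient of `d⁶` in `Q`. -/
def Qcoeff6 : ℂ[X] := C (-319 / 960) * X ^ 6 + C (1079 / 1728) * X ^ 4 - C (937 / 2880) * X ^ 2
  + C (287 / 8640)

theorem U_eq : U = d ^ 2 * (ofPoly Ucoeff2 + ofPoly Ucoeff4 * d ^ 2 + ofPoly Ucoeff6 * d ^ 4) := by
  simp only [U, Ucoeff2, Ucoeff4, Ucoeff6, ofPoly_add, ofPoly_sub, ofPoly_mul, ofPoly_pow, const, u]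
  ring

theorem Q_eq : Q = 1 + ofPoly Qcoeff2 * d ^ 2 + ofPoly Qcoeff4 * d ^ 4 + ofPoly Qcoeff6 * d ^ 6 := by
  simp only [Q, Qcoeff2, Qcoeff4, Qcoeff6, ofPoly_add, ofPoly_sub, ofPoly_mul, ofPoly_pow, const, u,
    ofPoly_one]

theorem nu_U : nu U = U := by
  simp only [U, map_add, map_sub, map_mul, map_pow, nu_const, nu_u, nu_d]
  ring

theorem flipU_U : flipU U = -U := by
  simp only [U, map_add, map_sub, map_mul, map_pow, flipU_const, flipU_u, flipU_d]
  ring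

theorem conjS_U : conjS U = U := by
  simp only [U, map_add, map_sub, map_mul, map_pow, conjS_const, conjS_u, conjS_d, map_div₀,
    map_neg, map_one, map_ofNat]

theorem nu_Q : nu Q = Q := by
  simp only [Q, map_add, map_sub, map_mul, map_pow, nu_const, nu_u, nu_d, map_one]
  ring

theorem flipU_Q : flipU Q = Q := by
  simp only [Q, map_add, map_sub, map_mul, map_pow, flipU_const, flipU_u, flipU_d, map_one]
  ring

theorem conjS_Q : conjS Q = Q := by
  simp only [Q, map_add, map_sub, map_mul, map_pow, conjS_const, conjS_u, conjS_d, map_div₀,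
    map_neg, map_one, map_ofNat]

theorem coeff_U_low : PowerSeries.coeff 0 U = 0 ∧ PowerSeries.coeff 2 U = Ucoeff2 ∧
    PowerSeries.coeff 4 U = Ucoeff4 ∧ PowerSeries.coeff 6 U = Ucoeff6 := by
  have h : U = PowerSeries.C Ucoeff2 * PowerSeries.X ^ 2 + PowerSeries.C Ucoeff4 * PowerSeries.X ^ 4
      + PowerSeries.C Ucoeff6 * PowerSeries.X ^ 6 := by
    rw [U_eq]; simp only [ofPoly, d]; ring
  rw [h]
  refine ⟨?_, ?_, ?_, ?_⟩ <;>
  · simp only [map_add, PowerSeries.coeff_C_mul, PowerSeries.coeff_X_pow]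
    norm_num

theorem coeff_Q_low : PowerSeries.coeff 0 Q = 1 ∧ PowerSeries.coeff 2 Q = Qcoeff2 ∧
    PowerSeries.coeff 4 Q = Qcoeff4 ∧ PowerSeries.coeff 6 Q = Qcoeff6 := by
  have h : Q = PowerSeries.C 1 + PowerSeries.C Qcoeff2 * PowerSeries.X ^ 2
      + PowerSeries.C Qcoeff4 * PowerSeries.X ^ 4
      + PowerSeries.C Qcoeff6 * PowerSeries.X ^ 6 := by
    rw [Q_eq]; simp only [ofPoly, d, map_one]
  rw [h]
  refine ⟨?_, ?_, ?_, ?_⟩ <;>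
  · simp only [map_add, PowerSeries.coeff_C_mul, PowerSeries.coeff_X_pow, PowerSeries.coeff_C]
    norm_num

theorem Dop_pow_C_mul (a c : ℂ) (k : ℕ) (p : ℂ[X]) :
    ((Dop a) ^ k) (C c * p) = C c * ((Dop a) ^ k) p := by
  rw [← smul_eq_C_mul, ← smul_eq_C_mul, map_smul]

theorem Dop_pow_C (a c : ℂ) (k : ℕ) : ((Dop a) ^ k) (C c) = C c * ((Dop a) ^ k) 1 := by
  rw [← Dop_pow_C_mul, mul_one]

theorem const_half_mul_two : const (1 / 2) * 2 = 1 := by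
  rw [show (2 : PolySeries) = const 2 by rw [const, map_ofNat, ofPoly_two], ← const_mul]
  norm_num [const_one]

/-- The residual is even in d, so only the orders 2, 4, 6 and 8 have to be checked, and order 2 does
not involve U. -/
theorem d_pow_dvd_residual_U : d ^ 10 ∣ residual U := by
  obtain ⟨r1, h1⟩ := eps_sq_trunc
  obtain ⟨⟨r2, h2⟩, ⟨r3, h3⟩⟩ := exists_cosRoot_sinRoot_eq (a := ofPoly Ucoeff2)
    (b := ofPoly Ucoeff4) (c := ofPoly Ucoeff6)
  obtain ⟨r4, h4⟩ := even_trunc nu_Iseries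
  obtain ⟨r5, h5⟩ := even_trunc (show nu (lhs U) = lhs U by rw [nu_lhs, nu_U])
  rw [← U_eq] at h2 h3
  obtain ⟨i0, i2, i4, i6, i8⟩ := coeff_Iseries_low
  obtain ⟨l0, l2, l4, l6, l8⟩ := coeff_lhs_low U
  obtain ⟨u0, u2, u4, u6⟩ := coeff_U_low
  rw [i0, i2, i4, i6, i8] at h4
  rw [l0, l2, l4, l6, l8, u0, u2, u4, u6] at h5
  simp only [map_zero, mul_zero, add_zero] at h5
  have z0 : ofPoly 0 = 0 := map_zero _
  rw [z0] at h4 h5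
  -- The coefficients of d², d⁴ and d⁶ in `sinQ U`, after the leading term 2u.
  set s2 : ℂ[X] := (2 * X ^ 2 - 1) * Ucoeff2 with hs2
  set s4 : ℂ[X] := (2 * X ^ 2 - 1) * Ucoeff4 - X * (1 - X ^ 2) * Ucoeff2 ^ 2 with hs4
  set s6 : ℂ[X] := (2 * X ^ 2 - 1) * (Ucoeff6 - C (1 / 6) * (1 - X ^ 2) * Ucoeff2 ^ 3)
    - 2 * X * (1 - X ^ 2) * Ucoeff2 * Ucoeff4 with hs6
  have x2 := Dop_pow_2_X_pow_1
  have x4 := Dop_pow_4_X_pow_1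
  have x6 := Dop_pow_6_X_pow_1
  rw [pow_one] at x2 x4 x6
  -- The equation at the orders 4, 6 and 8; these identities verify the rational coefficients of U.
  -- The numbers 1/12, 1/360 and 1/20160 are 2 / 4!, 2 / 6! and 2 / 8!.
  have k4 : s2 + C (1 / 12) * (2 * X) = C (1 / 6) * ((Dop (-1)) ^ 2) X
      + ((Dop (-1)) ^ 2) Ucoeff2 := by
    simp only [hs2, hs4, hs6, Ucoeff2, Ucoeff4, Ucoeff6, map_add, map_sub, Dop_pow_C_mul, x2, x4, x6,
      Dop_pow_2_X_pow_3, Dop_pow_4_X_pow_3, Dop_pow_2_X_pow_5]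
    refine Polynomial.funext fun x => ?_
    simp; ring
  have k6 : s4 + C (1 / 12) * s2 + C (1 / 360) * (2 * X) = C (1 / 180) * ((Dop (-1)) ^ 4) X
      + (((Dop (-1)) ^ 2) Ucoeff4 + C (1 / 12) * ((Dop (-1)) ^ 4) Ucoeff2) := by
    simp only [hs2, hs4, hs6, Ucoeff2, Ucoeff4, Ucoeff6, map_add, map_sub, Dop_pow_C_mul, x2, x4, x6,
      Dop_pow_2_X_pow_3, Dop_pow_4_X_pow_3, Dop_pow_2_X_pow_5]
    refine Polynomial.funext fun x => ?_
    simp; ring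
  have k8 : s6 + C (1 / 12) * s4 + C (1 / 360) * s2 + C (1 / 20160) * (2 * X)
      = C (1 / 10080) * ((Dop (-1)) ^ 6) X
      + (((Dop (-1)) ^ 2) Ucoeff6 + C (1 / 12) * ((Dop (-1)) ^ 4) Ucoeff4
        + C (1 / 360) * ((Dop (-1)) ^ 6) Ucoeff2) := by
    simp only [hs2, hs4, hs6, Ucoeff2, Ucoeff4, Ucoeff6, map_add, map_sub, Dop_pow_C_mul, x2, x4, x6,
      Dop_pow_2_X_pow_3, Dop_pow_4_X_pow_3, Dop_pow_2_X_pow_5]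
    refine Polynomial.funext fun x => ?_
    simp; ring
  replace k4 := congrArg ofPoly k4
  replace k6 := congrArg ofPoly k6
  replace k8 := congrArg ofPoly k8
  simp only [hs2, hs4, hs6, ofPoly_add, ofPoly_sub, ofPoly_mul, ofPoly_pow, ofPoly_two, ofPoly_one]
    at k4 k6 k8 h4 h5
  rw [residual, rhs_eq, sinQ]
  have hh := const_half_mul_two
  have hU := U_eq
  have hc (c : ℂ) : ofPoly (C c) = const c := rfl
  have hu : ofPoly X = u := rfl
  have ht : tau2 = 1 - u ^ 2 := rfl
  simp only [hc, hu, ht] at h2 h3 h4 h5 k4 k6 k8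
  generalize ofPoly Ucoeff2 = a at *
  generalize ofPoly Ucoeff4 = b at *
  generalize ofPoly Ucoeff6 = c at *
  refine ⟨r1 * (2 * u * cosRoot U + (2 * u ^ 2 - 1) * sinRoot U)
    + (1 + const (1 / 12) * d ^ 2 + const (1 / 360) * d ^ 4 + const (1 / 20160) * d ^ 6)
      * (2 * u * r2 + (2 * u ^ 2 - 1) * r3)
    + (const (1 / 12) * ((2 * u ^ 2 - 1) * (c - const (1 / 6) * (1 - u ^ 2) * a ^ 3)
          - 2 * u * (1 - u ^ 2) * a * b)
        + const (1 / 360) * ((2 * u ^ 2 - 1) * b - u * (1 - u ^ 2) * a ^ 2)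
        + const (1 / 20160) * ((2 * u ^ 2 - 1) * a)
        + d ^ 2 * (const (1 / 360) * ((2 * u ^ 2 - 1) * (c - const (1 / 6) * (1 - u ^ 2) * a ^ 3)
            - 2 * u * (1 - u ^ 2) * a * b)
          + const (1 / 20160) * ((2 * u ^ 2 - 1) * b - u * (1 - u ^ 2) * a ^ 2))
        + d ^ 4 * const (1 / 20160) * ((2 * u ^ 2 - 1) * (c - const (1 / 6) * (1 - u ^ 2) * a ^ 3)
            - 2 * u * (1 - u ^ 2) * a * b)) - r4 - r5, ?_⟩
  linear_combination h1 * (2 * u * cosRoot U + (2 * u ^ 2 - 1) * sinRoot U)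
    + (d ^ 2 + const (1 / 12) * d ^ 4 + const (1 / 360) * d ^ 6 + const (1 / 20160) * d ^ 8)
      * (2 * u * h2 + (2 * u ^ 2 - 1) * h3 + (2 * u ^ 2 - 1) * hU
        - u * (1 - u ^ 2) * (a ^ 2 * d ^ 4 + 2 * a * b * d ^ 6) * hh)
    - h4 - h5 + d ^ 4 * k4 + d ^ 6 * k6 + d ^ 8 * k8

/-- Again all terms are even in d, and the claim reduces to four polynomial identities. The
remainder of order 10 makes the term of N that is linear in G small. -/
theorem d_pow_dvd_lhs_Q_sub : d ^ 10 ∣ lhs Q - eps ^ 2 * cosQ U * Q := by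
  obtain ⟨r1, h1⟩ := eps_sq_trunc
  obtain ⟨⟨r2, h2⟩, ⟨r3, h3⟩⟩ := exists_cosRoot_sinRoot_eq (a := ofPoly Ucoeff2)
    (b := ofPoly Ucoeff4) (c := ofPoly Ucoeff6)
  obtain ⟨r5, h5⟩ := even_trunc (show nu (lhs Q) = lhs Q by rw [nu_lhs, nu_Q])
  rw [← U_eq] at h2 h3
  obtain ⟨l0, l2, l4, l6, l8⟩ := coeff_lhs_low Q
  obtain ⟨u0, u2, u4, u6⟩ := coeff_Q_low
  rw [l0, l2, l4, l6, l8, u0, u2, u4, u6] at h5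
  have z0 : ofPoly 0 = 0 := map_zero _
  rw [z0] at h5
  -- The g's are the coefficients of `cosQ U`, and the f's below those of `cosQ U * Q`, up to order
  -- 6.
  set g0 : ℂ[X] := 2 * X ^ 2 - 1 with hg0
  set g2 : ℂ[X] := - (2 * X * (1 - X ^ 2) * Ucoeff2) with hg2
  set g4 : ℂ[X] := - (C (1 / 2) * (2 * X ^ 2 - 1) * (1 - X ^ 2) * Ucoeff2 ^ 2)
    - 2 * X * (1 - X ^ 2) * Ucoeff4 with hg4
  set g6 : ℂ[X] := - ((2 * X ^ 2 - 1) * (1 - X ^ 2) * Ucoeff2 * Ucoeff4)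
    - 2 * X * (1 - X ^ 2) * (Ucoeff6 - C (1 / 6) * (1 - X ^ 2) * Ucoeff2 ^ 3) with hg6
  have x2 := Dop_pow_2_X_pow_0
  have x4 := Dop_pow_4_X_pow_0
  have x6 := Dop_pow_6_X_pow_0
  have x8 := Dop_pow_8_X_pow_0
  rw [pow_zero] at x2 x4 x6 x8
  set f2 : ℂ[X] := g2 + g0 * Qcoeff2 with hf2
  set f4 : ℂ[X] := g4 + g2 * Qcoeff2 + g0 * Qcoeff4 with hf4
  set f6 : ℂ[X] := g6 + g4 * Qcoeff2 + g2 * Qcoeff4 + g0 * Qcoeff6 with hf6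
  have k2 : g0 = ((Dop (-1)) ^ 2) 1 := by
    simp only [hg0, x2]; ring
  have k4 : f2 + C (1 / 12) * g0 = ((Dop (-1)) ^ 2) Qcoeff2
      + C (1 / 12) * ((Dop (-1)) ^ 4) 1 := by
    simp only [hf2, hf4, hf6, hg0, hg2, hg4, hg6, Ucoeff2, Ucoeff4, Ucoeff6, Qcoeff2, Qcoeff4, Qcoeff6,
      map_add, map_sub, Dop_pow_C_mul, Dop_pow_C, x2, x4, x6, x8, Dop_pow_2_X_pow_2,
      Dop_pow_4_X_pow_2, Dop_pow_6_X_pow_2, Dop_pow_2_X_pow_4, Dop_pow_4_X_pow_4, Dop_pow_2_X_pow_6]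
    refine Polynomial.funext fun x => ?_
    simp; ring
  have k6 : f4 + C (1 / 12) * f2 + C (1 / 360) * g0 = ((Dop (-1)) ^ 2) Qcoeff4
      + C (1 / 12) * ((Dop (-1)) ^ 4) Qcoeff2 + C (1 / 360) * ((Dop (-1)) ^ 6) 1 := by
    simp only [hf2, hf4, hf6, hg0, hg2, hg4, hg6, Ucoeff2, Ucoeff4, Ucoeff6, Qcoeff2, Qcoeff4, Qcoeff6,
      map_add, map_sub, Dop_pow_C_mul, Dop_pow_C, x2, x4, x6, x8, Dop_pow_2_X_pow_2,
      Dop_pow_4_X_pow_2, Dop_pow_6_X_pow_2, Dop_pow_2_X_pow_4, Dop_pow_4_X_pow_4, Dop_pow_2_X_pow_6]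
    refine Polynomial.funext fun x => ?_
    simp; ring
  have k8 : f6 + C (1 / 12) * f4 + C (1 / 360) * f2 + C (1 / 20160) * g0
      = ((Dop (-1)) ^ 2) Qcoeff6
      + C (1 / 12) * ((Dop (-1)) ^ 4) Qcoeff4 + C (1 / 360) * ((Dop (-1)) ^ 6) Qcoeff2
      + C (1 / 20160) * ((Dop (-1)) ^ 8) 1 := by
    simp only [hf2, hf4, hf6, hg0, hg2, hg4, hg6, Ucoeff2, Ucoeff4, Ucoeff6, Qcoeff2, Qcoeff4, Qcoeff6,
      map_add, map_sub, Dop_pow_C_mul, Dop_pow_C, x2, x4, x6, x8, Dop_pow_2_X_pow_2,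
      Dop_pow_4_X_pow_2, Dop_pow_6_X_pow_2, Dop_pow_2_X_pow_4, Dop_pow_4_X_pow_4, Dop_pow_2_X_pow_6]
    refine Polynomial.funext fun x => ?_
    simp; ring
  have hh := const_half_mul_two
  have hQ := Q_eq
  have hU := U_eq
  have hc (c : ℂ) : ofPoly (C c) = const c := rfl
  have hu : ofPoly X = u := rfl
  have ht : tau2 = 1 - u ^ 2 := rfl
  replace k2 := congrArg ofPoly k2
  replace k4 := congrArg ofPoly k4
  replace k6 := congrArg ofPoly k6
  replace k8 := congrArg ofPoly k8
  have ofPoly_neg (p : ℂ[X]) : ofPoly (-p) = -ofPoly p := map_neg _ _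
  have G0 := congrArg ofPoly hg0
  have G2 := congrArg ofPoly hg2
  have G4 := congrArg ofPoly hg4
  have G6 := congrArg ofPoly hg6
  have F2 := congrArg ofPoly hf2
  have F4 := congrArg ofPoly hf4
  have F6 := congrArg ofPoly hf6
  clear_value f2 f4 f6
  clear_value g2 g4 g6
  clear_value g0
  clear hg0 hg2 hg4 hg6 hf2 hf4 hf6
  simp only [ofPoly_add, ofPoly_sub, ofPoly_mul, ofPoly_pow, ofPoly_two, ofPoly_one, ofPoly_neg, hc,
    hu, ht] at k2 k4 k6 k8 h2 h3 h5 G0 G2 G4 G6 F2 F4 F6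
  generalize ofPoly Ucoeff2 = a at *
  generalize ofPoly Ucoeff4 = b at *
  generalize ofPoly Ucoeff6 = c at *
  generalize ofPoly Qcoeff2 = q2 at *
  generalize ofPoly Qcoeff4 = q4 at *
  generalize ofPoly Qcoeff6 = q6 at *
  generalize ofPoly g0 = g0 at *
  generalize ofPoly g2 = g2 at *
  generalize ofPoly g4 = g4 at *
  generalize ofPoly g6 = g6 at *
  generalize ofPoly f2 = f2 at *
  generalize ofPoly f4 = f4 at *
  generalize ofPoly f6 = f6 at *
  have hg : cosQ U = g0 + g2 * d ^ 2 + g4 * d ^ 4 + g6 * d ^ 6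
      + d ^ 8 * ((2 * u ^ 2 - 1) * r2 - 2 * u * (1 - u ^ 2) * r3) := by
    rw [cosQ, ht]
    linear_combination (2 * u ^ 2 - 1) * h2 - 2 * u * (1 - u ^ 2) * h3 - 2 * u * (1 - u ^ 2) * hU
      - (2 * u ^ 2 - 1) * (1 - u ^ 2) * a * b * d ^ 6 * hh - G0 - G2 * d ^ 2 - G4 * d ^ 4 - G6 * d ^ 6
  have hgQ : cosQ U * Q = g0 + f2 * d ^ 2 + f4 * d ^ 4 + f6 * d ^ 6
      + d ^ 8 * (((2 * u ^ 2 - 1) * r2 - 2 * u * (1 - u ^ 2) * r3) * Q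
        + g2 * q6 + g4 * q4 + g6 * q2 + (g4 * q6 + g6 * q4) * d ^ 2 + g6 * q6 * d ^ 4) := by
    rw [hg, add_mul]
    linear_combination (g0 + g2 * d ^ 2 + g4 * d ^ 4 + g6 * d ^ 6) * hQ
      - F2 * d ^ 2 - F4 * d ^ 4 - F6 * d ^ 6
  generalize ((2 * u ^ 2 - 1) * r2 - 2 * u * (1 - u ^ 2) * r3) * Q
        + g2 * q6 + g4 * q4 + g6 * q2 + (g4 * q6 + g6 * q4) * d ^ 2 + g6 * q6 * d ^ 4 = r6 at hgQ
  refine ⟨r5 - r1 * (cosQ U * Q)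
    - (1 + const (1 / 12) * d ^ 2 + const (1 / 360) * d ^ 4 + const (1 / 20160) * d ^ 6) * r6
    - (const (1 / 12) * f6 + const (1 / 360) * f4 + const (1 / 20160) * f2
      + d ^ 2 * (const (1 / 360) * f6 + const (1 / 20160) * f4)
      + d ^ 4 * (const (1 / 20160) * f6)), ?_⟩
  linear_combination h5 - h1 * (cosQ U * Q)
    - (d ^ 2 + const (1 / 12) * d ^ 4 + const (1 / 360) * d ^ 6 + const (1 / 20160) * d ^ 8) * hgQ
    - d ^ 2 * k2 - d ^ 4 * k4 - d ^ 6 * k6 - d ^ 8 * k8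

/-- The series `U / d`, as a polynomial in `d` and `d u`. -/
def UdivD : PolySeries :=
  const (-1 / 4) * (d * u) + (const (91 / 864) * (d * u) ^ 3 - const (47 / 576) * (d * u) * d ^ 2)
    + (const (-319 / 2880) * (d * u) ^ 5 + const (185 / 1152) * (d * u) ^ 3 * d ^ 2
      - const (3703 / 69120) * (d * u) * d ^ 4)

theorem U_eq_d_mul : U = d * UdivD := by
  rw [U, UdivD]; ring

theorem Q_eq_du : Q = 1 + const (1 / 4) * (d ^ 2 - (d * u) ^ 2)
    + (const (91 / 432) * (d * u) ^ 4 - const (13 / 48) * (d * u) ^ 2 * d ^ 2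
      + const (13 / 216) * d ^ 4)
    + (const (-319 / 960) * (d * u) ^ 6 + const (1079 / 1728) * (d * u) ^ 4 * d ^ 2
      - const (937 / 2880) * (d * u) ^ 2 * d ^ 4 + const (287 / 8640) * d ^ 6) := by
  rw [Q]; ring

/-! ### Bernoulli numbers -/

/-- The coefficients of `x / (exp x - 1)`. -/
def bern (n : ℕ) : ℝ := (_root_.bernoulli n : ℝ) / n.factorial

/-- Euler's formula, with z = ζ(2k). The upper bound compares ζ(2k) - 1 with ζ(2) - 1 < 1, since 1 /
n²ᵏ is at most 4 / 4ᵏ times 1 / n² for n ≥ 2. -/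
theorem exists_bern_even {k : ℕ} (hk : k ≠ 0) : ∃ z : ℝ, 1 ≤ z ∧ z ≤ 1 + 4 / 4 ^ k ∧
    bern (2 * k) = (-1) ^ (k + 1) * 2 * z / (2 * Real.pi) ^ (2 * k) := by
  have h1 := hasSum_zeta_nat hk
  have h2 := hasSum_zeta_two
  set z := (-1 : ℝ) ^ (k + 1) * (2 : ℝ) ^ (2 * k - 1) * Real.pi ^ (2 * k) *
        _root_.bernoulli (2 * k) / (2 * k).factorial with hz
  have h3 : HasSum (fun n : ℕ => if n = 1 then (1 : ℝ) else 0) 1 := hasSum_ite_eq 1 1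
  have hz1 : 1 ≤ z := by
    refine hasSum_le (fun n => ?_) h3 h1
    split_ifs with h
    · simp [h]
    · positivity
  have h4 := (h2.sub h3).mul_left ((4 : ℝ) / 4 ^ k)
  have hz2 : z - 1 ≤ 4 / 4 ^ k * (Real.pi ^ 2 / 6 - 1) := by
    refine hasSum_le (fun n => ?_) (h1.sub h3) h4
    rcases n with _ | _ | n
    · simp [hk]
    · simp
    · obtain ⟨j, rfl⟩ := Nat.exists_eq_succ_of_ne_zero hk
      simp only [Nat.add_eq_right, Nat.add_eq_zero_iff, one_ne_zero, and_false, if_false, sub_zero]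
      have e : (4 : ℝ) / 4 ^ (j + 1) = 1 / 2 ^ (2 * j) := by
        rw [pow_mul, pow_succ]; norm_num; field_simp
      rw [Nat.succ_eq_add_one, e, mul_add, pow_add, ← one_div_mul_one_div, mul_one]
      refine mul_le_mul_of_nonneg_right ?_ (by positivity)
      refine one_div_le_one_div_of_le (by positivity) ?_
      refine pow_le_pow_left₀ (by norm_num) ?_ _
      push_cast; linarith [(Nat.cast_nonneg n : (0 : ℝ) ≤ n)]
  have hpi : Real.pi ^ 2 / 6 - 1 ≤ 1 := by nlinarith [Real.pi_lt_d2, Real.pi_pos]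
  refine ⟨z, hz1, ?_, ?_⟩
  · have : 4 / 4 ^ k * (Real.pi ^ 2 / 6 - 1) ≤ 4 / 4 ^ k * 1 :=
      mul_le_mul_of_nonneg_left hpi (by positivity)
    linarith
  · obtain ⟨j, rfl⟩ := Nat.exists_eq_succ_of_ne_zero hk
    have hs : ((-1 : ℝ) ^ (j.succ + 1)) * (-1) ^ (j.succ + 1) = 1 := by
      rw [← pow_add]; exact (Even.add_self _).neg_one_pow
    rw [bern, hz, mul_pow, show 2 * j.succ - 1 = 2 * j + 1 by omega,
      show 2 * j.succ = 2 * j + 1 + 1 by omega]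
    have hpi := Real.pi_ne_zero
    field_simp
    linear_combination (-(_root_.bernoulli (2 * j + 1 + 1) : ℝ)) * hs * 2 ^ (2 * j + 2)

theorem bern_odd {n : ℕ} (hn : Odd n) (h1 : 1 < n) : bern n = 0 := by
  rw [bern, bernoulli_eq_zero_of_odd hn h1]; simp

theorem abs_bern_le (n : ℕ) : |bern n| ≤ 4 / (2 * Real.pi) ^ n := by
  rcases Nat.even_or_odd' n with ⟨k, rfl | rfl⟩
  · rcases eq_or_ne k 0 with rfl | hk
    · simp [bern]
    · obtain ⟨z, h1, h2, h3⟩ := exists_bern_even hk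
      have h4 : z ≤ 2 := by
        refine h2.trans ?_
        have : (4 : ℝ) / 4 ^ k ≤ 1 := by
          rw [div_le_one (by positivity)]
          calc (4 : ℝ) = 4 ^ 1 := by norm_num
            _ ≤ 4 ^ k := pow_le_pow_right₀ (by norm_num) (Nat.one_le_iff_ne_zero.mpr hk)
        linarith
      rw [h3, abs_div, abs_mul, abs_mul, abs_neg_one_pow, abs_of_pos (by linarith : 0 < z),
        abs_of_pos (by positivity : 0 < (2 * Real.pi) ^ (2 * k))]
      gcongr
      norm_num; linarith
  · rcases eq_or_ne k 0 with rfl | hk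
    · have : bern (2 * 0 + 1) = -1 / 2 := by simp [bern]
      rw [this, abs_div, abs_neg, abs_one, abs_two, mul_zero, zero_add, pow_one,
        div_le_div_iff₀ (by norm_num) (by positivity)]
      nlinarith [Real.pi_lt_d2]
    · rw [bern_odd ⟨k, rfl⟩ (by omega)]; simp; positivity

/-- The coefficients of `x coth x`. -/
def cothCoeff (n : ℕ) : ℂ := if n = 1 then 0 else ((2 ^ n * bern n : ℝ) : ℂ)

/-- The coefficients of `x / (2 sinh (x / 2))`. -/
def cschCoeff (n : ℕ) : ℂ := (((2 * (1 / 2) ^ n - 1) * bern n : ℝ) : ℂ)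

theorem cothCoeff_zero : cothCoeff 0 = 1 := by simp [cothCoeff, bern]

theorem cothCoeff_odd {n : ℕ} (hn : Odd n) : cothCoeff n = 0 := by
  rw [cothCoeff]
  split_ifs with h
  · rfl
  · rw [bern_odd hn (by have := hn.pos; omega)]; simp

theorem norm_cothCoeff_le (n : ℕ) : ‖cothCoeff n‖ ≤ 4 / Real.pi ^ n := by
  rw [cothCoeff]
  split_ifs with h
  · rw [norm_zero]; positivity
  · rw [Complex.norm_real, Real.norm_eq_abs, abs_mul, abs_of_pos (by positivity : (0:ℝ) < 2 ^ n)]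
    calc 2 ^ n * |bern n| ≤ 2 ^ n * (4 / (2 * Real.pi) ^ n) := by gcongr; exact abs_bern_le n
      _ = 4 / Real.pi ^ n := by rw [mul_pow]; field_simp

theorem norm_cschCoeff_le (n : ℕ) : ‖cschCoeff n‖ ≤ 4 / (2 * Real.pi) ^ n := by
  rw [cschCoeff, Complex.norm_real, Real.norm_eq_abs, abs_mul]
  have h : |2 * (1 / 2 : ℝ) ^ n - 1| ≤ 1 := by
    rw [abs_le]
    constructor
    · linarith [pow_pos (by norm_num : (0:ℝ) < 1 / 2) n]
    · linarith [pow_le_one₀ (n := n) (by norm_num : (0:ℝ) ≤ 1 / 2) (by norm_num)]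
  calc _ ≤ 1 * |bern n| := by gcongr
    _ ≤ _ := by rw [one_mul]; exact abs_bern_le n

/-- `i / (2π)`. -/
def rr : ℂ := Complex.I / (2 * (Real.pi : ℂ))

theorem norm_rr : ‖rr‖ = (2 * Real.pi)⁻¹ := by
  rw [rr, norm_div, Complex.norm_I, norm_mul, Complex.norm_real, Real.norm_eq_abs,
    abs_of_pos Real.pi_pos]
  simp

theorem rr_pow_even (k : ℕ) : rr ^ (2 * k) = ((-1) ^ k / (2 * Real.pi) ^ (2 * k) : ℝ) := by
  rw [rr, div_pow, pow_mul, Complex.I_sq]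
  push_cast; rfl

theorem cschCoeff_odd {n : ℕ} (hn : Odd n) : cschCoeff n = 0 := by
  rw [cschCoeff]
  rcases eq_or_ne n 1 with rfl | h
  · simp
  · rw [bern_odd hn (by have := hn.pos; omega)]; simp

/-- The function x / (2 sinh (x / 2)) has simple poles at ±2πi, whose principal parts give the two
geometric sequences; the next poles are at ±4πi. In terms of z = ζ(2k), the error is controlled by
(1 - 2 / 4ᵏ) z - 1. -/
theorem norm_cschCoeff_sub_le (n : ℕ) :
    ‖cschCoeff n - (rr ^ n + (-rr) ^ n)‖ ≤ 8 / (4 * Real.pi) ^ n := by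
  rcases Nat.even_or_odd' n with ⟨k, rfl | rfl⟩
  · rcases eq_or_ne k 0 with rfl | hk
    · simp [cschCoeff, bern]; norm_num
    · obtain ⟨z, h1, h2, h3⟩ := exists_bern_even hk
      rw [neg_pow, (even_two_mul k).neg_one_pow, one_mul, rr_pow_even, cschCoeff, h3,
        ← Complex.ofReal_add, ← Complex.ofReal_sub, Complex.norm_real, Real.norm_eq_abs]
      have e4 : (4 * Real.pi) ^ (2 * k) = 4 ^ k * (2 * Real.pi) ^ (2 * k) := by
        rw [show 4 * Real.pi = 2 * (2 * Real.pi) by ring, mul_pow, pow_mul 2 2]; norm_num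
      have e : (2 * (1 / 2) ^ (2 * k) - 1) * ((-1) ^ (k + 1) * 2 * z / (2 * Real.pi) ^ (2 * k))
          - ((-1) ^ k / (2 * Real.pi) ^ (2 * k) + (-1) ^ k / (2 * Real.pi) ^ (2 * k))
          = (-1) ^ k * (((1 - 2 / 4 ^ k) * z - 1) * 2 / (2 * Real.pi) ^ (2 * k)) := by
        rw [pow_mul (1 / 2 : ℝ), show ((1 / 2 : ℝ) ^ 2) = 4⁻¹ by norm_num, inv_pow]; ring
      rw [e, abs_mul, abs_neg_one_pow, one_mul, e4, abs_div, abs_mul, abs_two,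
        abs_of_pos (by positivity : 0 < (2 * Real.pi) ^ (2 * k)), ← div_div]
      gcongr
      have hp : (0 : ℝ) < 4 ^ k := by positivity
      have hq : (1 : ℝ) / 4 ^ k ≤ 1 / 4 := by
        refine one_div_le_one_div_of_le (by norm_num) ?_
        calc (4 : ℝ) = 4 ^ 1 := by norm_num
            _ ≤ 4 ^ k := pow_le_pow_right₀ (by norm_num) (Nat.one_le_iff_ne_zero.mpr hk)
      set q := (1 : ℝ) / 4 ^ k with hq'
      have hq0 : 0 < q := by positivity
      rw [show (4 : ℝ) / 4 ^ k = 4 * q by rw [hq']; ring] at h2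
      rw [show (2 : ℝ) / 4 ^ k = 2 * q by rw [hq']; ring, show (8 : ℝ) / 4 ^ k = 4 * q * 2 by
        rw [hq']; ring]
      gcongr
      rw [abs_le]
      constructor <;> nlinarith
  · rw [cschCoeff_odd ⟨k, rfl⟩, neg_pow, (odd_two_mul_add_one k).neg_one_pow]
    simp; positivity

theorem exp_mul_exp_neg (a : ℂ) : PowerSeries.rescale a (PowerSeries.exp ℂ)
    * PowerSeries.rescale (-a) (PowerSeries.exp ℂ) = 1 := by
  rw [PowerSeries.exp_mul_exp_eq_exp_add, add_neg_cancel]; simp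

theorem coeff_bernoulliPowerSeries (n : ℕ) :
    PowerSeries.coeff n (bernoulliPowerSeries ℂ) = (bern n : ℂ) := by
  rw [bernoulliPowerSeries, PowerSeries.coeff_mk, bern]
  simp

theorem cothCoeff_mul : PowerSeries.mk cothCoeff
    * (PowerSeries.exp ℂ - PowerSeries.rescale (-1) (PowerSeries.exp ℂ))
    = PowerSeries.X * (PowerSeries.exp ℂ + PowerSeries.rescale (-1) (PowerSeries.exp ℂ)) := by
  -- x coth x = 2x / (exp (2x) - 1) + x. The extra x cancels the linear Bernoulli term, hence the
  -- exceptional value of `cothCoeff` at 1.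
  have e : PowerSeries.mk cothCoeff
      = PowerSeries.rescale 2 (bernoulliPowerSeries ℂ) + PowerSeries.X := by
    ext n
    rw [PowerSeries.coeff_mk, map_add, PowerSeries.coeff_rescale, coeff_bernoulliPowerSeries,
      PowerSeries.coeff_X, cothCoeff]
    split_ifs with h
    · subst h; simp [bern]; norm_num
    · push_cast; ring
  have h1 := congrArg (PowerSeries.rescale (2 : ℂ)) (bernoulliPowerSeries_mul_exp_sub_one ℂ)
  have h2 : PowerSeries.rescale (2 : ℂ) (PowerSeries.exp ℂ) = PowerSeries.exp ℂ * PowerSeries.exp ℂ := by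
    have := PowerSeries.exp_mul_exp_eq_exp_add (A := ℂ) 1 1
    rw [PowerSeries.rescale_one] at this
    rw [← one_add_one_eq_two, ← this]; rfl
  have h3 := exp_mul_exp_neg 1
  rw [PowerSeries.rescale_one] at h3
  rw [map_mul, map_sub, map_one, h2, PowerSeries.rescale_X] at h1
  have hC : PowerSeries.C (2 : ℂ) = 2 := map_ofNat _ 2
  rw [hC] at h1
  simp only [RingHom.id_apply] at h3
  rw [e]
  generalize PowerSeries.exp ℂ = y at *
  generalize PowerSeries.rescale (-1) y = y' at *
  generalize PowerSeries.rescale 2 (bernoulliPowerSeries ℂ) = B at *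
  linear_combination y' * h1 - B * y * h3

theorem cschCoeff_mul : PowerSeries.mk cschCoeff
    * (PowerSeries.rescale (1 / 2) (PowerSeries.exp ℂ)
      - PowerSeries.rescale (-(1 / 2)) (PowerSeries.exp ℂ)) = PowerSeries.X := by
  -- x / (2 sinh (x / 2)) is twice the Bernoulli function at x / 2 minus the Bernoulli function at
  -- x.
  have e : PowerSeries.mk cschCoeff
      = 2 * PowerSeries.rescale (1 / 2) (bernoulliPowerSeries ℂ) - bernoulliPowerSeries ℂ := by
    have hC : (2 : PowerSeries ℂ) = PowerSeries.C 2 := (map_ofNat _ 2).symm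
    ext n
    rw [PowerSeries.coeff_mk, map_sub, hC, PowerSeries.coeff_C_mul, PowerSeries.coeff_rescale,
      coeff_bernoulliPowerSeries, cschCoeff]
    push_cast; ring
  have h0 := bernoulliPowerSeries_mul_exp_sub_one ℂ
  have h1 := congrArg (PowerSeries.rescale (1 / 2 : ℂ)) h0
  have h2 : PowerSeries.exp ℂ = PowerSeries.rescale (1 / 2 : ℂ) (PowerSeries.exp ℂ)
      * PowerSeries.rescale (1 / 2 : ℂ) (PowerSeries.exp ℂ) := by
    rw [PowerSeries.exp_mul_exp_eq_exp_add]; norm_num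
  have h3 := exp_mul_exp_neg (1 / 2)
  have h4 : (2 : PowerSeries ℂ) * PowerSeries.C (1 / 2) = 1 := by
    rw [show (2 : PowerSeries ℂ) = PowerSeries.C 2 from (map_ofNat _ 2).symm, ← map_mul]; norm_num
  rw [map_mul, map_sub, map_one, PowerSeries.rescale_X] at h1
  rw [e]
  generalize PowerSeries.rescale (-(1 / 2) : ℂ) (PowerSeries.exp ℂ) = y' at *
  generalize PowerSeries.rescale (1 / 2 : ℂ) (PowerSeries.exp ℂ) = y at *
  generalize PowerSeries.rescale (1 / 2 : ℂ) (bernoulliPowerSeries ℂ) = B at *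
  generalize bernoulliPowerSeries ℂ = B' at *
  generalize PowerSeries.exp ℂ = E at *
  generalize PowerSeries.C (1 / 2 : ℂ) = c at *
  subst h2
  linear_combination 2 * (1 + y') * h1 - y' * h0 + (PowerSeries.X * (1 + y')) * h4
    + (-2 * B + B' * y) * h3

/-! ### The polynomials `τₙ` -/

theorem tau_zero : tau 0 = 1 := by rw [tau]

theorem tau_one : tau 1 = X := by rw [tau]

theorem polyDeg_tau (n : ℕ) : PolyDeg n (tau n) :=
  polyDeg_natCast_iff.mpr (natDegree_le_of_degree_le (degree_tau n).le)

/-- The normalization of the τ's is that of Taylor coefficients, so d/ds acts as a weighted index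
shift. For n = 0 both sides vanish. -/
theorem Dop_tau (n : ℕ) : Dop 0 (tau n) = C (n : ℂ) * tau (n + 1) := by
  rcases n with _ | n
  · rw [tau_zero, Dop_apply]; simp
  · rw [tau_add_two, ← mul_assoc, ← C_mul, Dop_apply]
    have h : (((n + 1 : ℕ) : ℂ)) * (1 / ((n : ℂ) + 1)) = 1 := by
      push_cast; exact mul_one_div_cancel (Nat.cast_add_one_ne_zero n)
    rw [h]; simp

theorem Dop_pow_tau (a b : ℕ) : ((Dop 0) ^ a) (tau (b + 1))
    = C (((b + a).factorial : ℂ) / (b.factorial : ℂ)) * tau (b + 1 + a) := by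
  induction a with
  | zero => simp [div_self (Nat.cast_ne_zero.mpr b.factorial_ne_zero : (b.factorial : ℂ) ≠ 0)]
  | succ a ih =>
    rw [pow_succ' (Dop 0), Module.End.mul_apply, ih, Dop_C_mul, Dop_tau, ← mul_assoc, ← C_mul,
      ← add_assoc, ← add_assoc, Nat.factorial_succ]
    congr 2; push_cast; ring

/-- Taylor's formula for tanh (s + x): the τₙ₊₁ are its coefficients in x. The product formula and
the division by τ₂ are read off from such generating functions. -/
theorem coeff_shift_u (θ : ℂ) (n : ℕ) :
    PowerSeries.coeff n (shift θ u) = C (θ ^ n) * tau (n + 1) := by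
  rw [shift_apply, u, expD_ofPoly, coeff_expPoly, ← tau_one, ← zero_add 1, Dop_pow_tau, ← mul_assoc,
    ← C_mul]
  have := (Nat.cast_ne_zero.mpr n.factorial_ne_zero : (n.factorial : ℂ) ≠ 0)
  congr 2
  · rw [zero_add, Nat.factorial_zero]; field_simp; simp
  · omega

theorem coeff_shift_tau2 (n : ℕ) :
    PowerSeries.coeff n (shift 1 tau2) = C ((n : ℂ) + 1) * tau (n + 2) := by
  rw [shift_apply, tau2_eq, expD_ofPoly, coeff_expPoly, ← tau_two, show 2 = 1 + 1 from rfl,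
    Dop_pow_tau, ← mul_assoc, ← C_mul, show 1 + 1 + n = n + (1 + 1) by ring]
  have := (Nat.cast_ne_zero.mpr n.factorial_ne_zero : (n.factorial : ℂ) ≠ 0)
  congr 2
  rw [add_comm 1 n, Nat.factorial_succ, Nat.factorial_one]; push_cast; field_simp; simp

theorem tau_comp_neg (n : ℕ) : (tau n).comp (-X) = (-1) ^ n * tau n := by
  induction n with
  | zero => rw [tau_zero]; simp
  | succ n ih =>
    rcases n with _ | n
    · rw [tau_one]; simp
    · have h := Dop_comp_neg 0 (tau (n + 1))
      rw [Dop_tau, ih, mul_comp, C_comp] at h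
      have h2 : Dop 0 ((-1) ^ (n + 1) * tau (n + 1))
          = (-1) ^ (n + 1) * (C (((n + 1 : ℕ) : ℂ)) * tau (n + 1 + 1)) := by
        rw [show ((-1 : ℂ[X]) ^ (n + 1)) = C ((-1) ^ (n + 1)) by simp, Dop_C_mul, Dop_tau]
      rw [h2] at h
      have hc : C (((n + 1 : ℕ) : ℂ)) ≠ 0 := by
        rw [Ne, C_eq_zero]; exact_mod_cast Nat.succ_ne_zero n
      refine mul_left_cancel₀ hc ?_
      rw [h]; ring

theorem tau_map_conj (n : ℕ) : (tau n).map (starRingEnd ℂ) = tau n := by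
  induction n with
  | zero => rw [tau_zero]; simp
  | succ n ih =>
    rcases n with _ | n
    · rw [tau_one]; simp
    · rw [tau_add_two, Polynomial.map_mul, Polynomial.map_mul, ← derivative_map, ih]
      simp

/-! ### Coordinates with respect to `τ₀, τ₁, …` -/

/-- The coordinate of a polynomial with respect to `τᵢ`. -/
def cf (i : ℕ) : ℂ[X] →ₗ[ℂ] ℂ := tauBasis.coord i

theorem tauBasis_apply (i : ℕ) : tauBasis i = tau i := by
  rw [tauBasis, Polynomial.Sequence.basis_eq_self]; rfl

theorem cf_apply (i : ℕ) (p : ℂ[X]) : cf i p = tauBasis.repr p i := rfl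

theorem cf_tau (i n : ℕ) : cf i (tau n) = if n = i then 1 else 0 := by
  rw [cf_apply, ← tauBasis_apply, Module.Basis.repr_self, Finsupp.single_apply]

theorem cf_C_mul (i : ℕ) (c : ℂ) (p : ℂ[X]) : cf i (C c * p) = c * cf i p := by
  rw [← smul_eq_C_mul, map_smul, smul_eq_mul]

theorem cf_eq_zero {k : ℤ} {p : ℂ[X]} (hp : PolyDeg k p) {i : ℕ} (hi : k < i) : cf i p = 0 := by
  rcases lt_or_ge k 0 with hk | hk
  · rw [hp.eq_zero hk, map_zero]
  · lift k to ℕ using hk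
    rw [polyDeg_natCast_iff] at hp
    have h1 : p ∈ Polynomial.degreeLE ℂ (k : WithBot ℕ) := by
      rw [mem_degreeLE]; exact natDegree_le_iff_degree_le.mp hp
    rw [← tauSeq.span_degreeLE (fun i _ => isUnit_leadingCoeff_tauSeq i)] at h1
    have h2 : (⇑tauSeq '' Set.Iic k) = tauBasis '' Set.Iic k := by
      refine Set.image_congr fun j _ => ?_
      rw [tauBasis_apply]; rfl
    rw [h2, Module.Basis.mem_span_image] at h1
    by_contra hne
    have h3 := h1 (Finsupp.mem_support_iff.mpr hne)
    simp only [Set.mem_Iic] at h3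
    omega

theorem ext_cf {p q : ℂ[X]} (h : ∀ i, cf i p = cf i q) : p = q :=
  tauBasis.ext_elem h

theorem eq_sum_cf {n : ℕ} {p : ℂ[X]} (hp : PolyDeg n p) :
    p = ∑ i ∈ Finset.range (n + 1), C (cf i p) * tau i := by
  refine ext_cf fun j => ?_
  rw [map_sum]
  simp only [cf_C_mul, cf_tau, mul_ite, mul_one, mul_zero, Finset.sum_ite_eq', Finset.mem_range]
  split_ifs with h
  · rfl
  · exact cf_eq_zero hp (by omega)

theorem cf_comp_neg (i : ℕ) (p : ℂ[X]) : cf i (p.comp (-X)) = (-1) ^ i * cf i p := by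
  rw [eq_sum_cf (polyDeg_natCast_iff.mpr (le_refl p.natDegree)), Polynomial.sum_comp, map_sum, map_sum,
    Finset.mul_sum]
  refine Finset.sum_congr rfl fun j _ => ?_
  rw [mul_comp, C_comp, tau_comp_neg, show ((-1 : ℂ[X]) ^ j) = C ((-1) ^ j) by simp, cf_C_mul,
    cf_C_mul, cf_C_mul, cf_tau]
  split_ifs with h
  · subst h; ring
  · simp

theorem cf_map_conj (i : ℕ) (p : ℂ[X]) :
    cf i (p.map (starRingEnd ℂ)) = starRingEnd ℂ (cf i p) := by
  rw [eq_sum_cf (polyDeg_natCast_iff.mpr (le_refl p.natDegree)), Polynomial.map_sum, map_sum, map_sum,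
    map_sum]
  refine Finset.sum_congr rfl fun j _ => ?_
  rw [Polynomial.map_mul, Polynomial.map_C, tau_map_conj, cf_C_mul, cf_C_mul, cf_tau, map_mul]
  split_ifs <;> simp

theorem tau_eval_one (n : ℕ) : (tau (n + 2)).eval 1 = 0 := by
  rw [tau_add_two]; simp

theorem tau_eval_neg_one (n : ℕ) : (tau (n + 2)).eval (-1) = 0 := by
  rw [tau_add_two]; simp

/-- A multiple of `τ₂` has no components along `τ₀` and `τ₁`. -/
theorem cf_zero_one_of_dvd {p : ℂ[X]} (h : (1 - X ^ 2 : ℂ[X]) ∣ p) : cf 0 p = 0 ∧ cf 1 p = 0 := by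
  obtain ⟨q, hq⟩ := h
  have hp : PolyDeg ((p.natDegree + 1 : ℕ) : ℤ) p := polyDeg_natCast_iff.mpr (Nat.le_succ _)
  have h1 := congrArg (Polynomial.eval 1) (eq_sum_cf hp)
  have h2 := congrArg (Polynomial.eval (-1)) (eq_sum_cf hp)
  rw [eval_finsetSum, Finset.sum_range_succ', Finset.sum_range_succ',
    Finset.sum_eq_zero (fun i _ => by rw [eval_mul, tau_eval_one, mul_zero])] at h1
  rw [eval_finsetSum, Finset.sum_range_succ', Finset.sum_range_succ',
    Finset.sum_eq_zero (fun i _ => by rw [eval_mul, tau_eval_neg_one, mul_zero])] at h2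
  have e1 : p.eval 1 = 0 := by rw [hq]; simp
  have e2 : p.eval (-1) = 0 := by rw [hq]; simp
  rw [e1, tau_zero, zero_add, tau_one] at h1
  rw [e2, tau_zero, zero_add, tau_one] at h2
  simp at h1 h2
  constructor
  · linear_combination (-1 / 2 : ℂ) * h1 - 1 / 2 * h2
  · linear_combination (-1 / 2 : ℂ) * h1 + 1 / 2 * h2

/-! ### The norm -/

theorem tauNorm_eq (n : ℕ) (p : ℂ[X]) :
    tauNorm n p = ∑ i ∈ Finset.range (n + 1), ‖cf i p‖ * (Real.pi / 2) ^ (n - i) := rfl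

theorem tauNorm_nonneg (n : ℕ) (p : ℂ[X]) : 0 ≤ tauNorm n p :=
  Finset.sum_nonneg fun _ _ => by have := Real.pi_pos; positivity

theorem tauNorm_zero (n : ℕ) : tauNorm n 0 = 0 := by
  rw [tauNorm_eq]; simp

theorem tauNorm_add_le (n : ℕ) (p q : ℂ[X]) : tauNorm n (p + q) ≤ tauNorm n p + tauNorm n q := by
  rw [tauNorm_eq, tauNorm_eq, tauNorm_eq, ← Finset.sum_add_distrib]
  refine Finset.sum_le_sum fun i _ => ?_
  rw [map_add, ← add_mul]
  have := Real.pi_pos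
  gcongr
  exact norm_add_le _ _

theorem tauNorm_C_mul (n : ℕ) (c : ℂ) (p : ℂ[X]) : tauNorm n (C c * p) = ‖c‖ * tauNorm n p := by
  rw [tauNorm_eq, tauNorm_eq, Finset.mul_sum]
  refine Finset.sum_congr rfl fun i _ => ?_
  rw [cf_C_mul, norm_mul, mul_assoc]

theorem tauNorm_neg (n : ℕ) (p : ℂ[X]) : tauNorm n (-p) = tauNorm n p := by
  rw [tauNorm_eq, tauNorm_eq]
  simp only [map_neg, norm_neg]

theorem tauNorm_sub_le (n : ℕ) (p q : ℂ[X]) : tauNorm n (p - q) ≤ tauNorm n p + tauNorm n q := by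
  rw [sub_eq_add_neg, ← tauNorm_neg n q]; exact tauNorm_add_le n p (-q)

theorem tauNorm_sum_le {ι : Type*} (n : ℕ) (s : Finset ι) (f : ι → ℂ[X]) :
    tauNorm n (∑ i ∈ s, f i) ≤ ∑ i ∈ s, tauNorm n (f i) := by
  classical
  induction s using Finset.induction_on with
  | empty => simp [tauNorm_zero]
  | insert a s ha ih =>
    rw [Finset.sum_insert ha, Finset.sum_insert ha]
    exact (tauNorm_add_le _ _ _).trans (by linarith)

theorem tauNorm_tau {n i : ℕ} (h : i ≤ n) : tauNorm n (tau i) = (Real.pi / 2) ^ (n - i) := by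
  rw [tauNorm_eq, Finset.sum_eq_single i]
  · rw [cf_tau, if_pos rfl]; simp
  · intro j _ hj; rw [cf_tau, if_neg (Ne.symm hj)]; simp
  · intro h'; exact absurd (Finset.mem_range.mpr (by omega)) h'

theorem tauNorm_one (n : ℕ) : tauNorm n 1 = (Real.pi / 2) ^ n := by
  rw [← tau_zero, tauNorm_tau (Nat.zero_le n), Nat.sub_zero]

theorem tauNorm_C (n : ℕ) (c : ℂ) : tauNorm n (C c) = ‖c‖ * (Real.pi / 2) ^ n := by
  rw [← tauNorm_one, ← tauNorm_C_mul, mul_one]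

theorem tauNorm_add_right {n : ℕ} {p : ℂ[X]} (hp : PolyDeg n p) (k : ℕ) :
    tauNorm (n + k) p = (Real.pi / 2) ^ k * tauNorm n p := by
  rw [tauNorm_eq, tauNorm_eq, Finset.mul_sum]
  rw [← Finset.sum_subset (Finset.range_subset_range.mpr (show n + 1 ≤ n + k + 1 by omega))]
  · refine Finset.sum_congr rfl fun i hi => ?_
    rw [Finset.mem_range] at hi
    rw [show n + k - i = k + (n - i) by omega, pow_add]; ring
  · intro i _ hi
    rw [Finset.mem_range] at hi
    rw [cf_eq_zero hp (by omega)]; simp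

theorem norm_cf_le {n i : ℕ} (h : i ≤ n) (p : ℂ[X]) :
    ‖cf i p‖ * (Real.pi / 2) ^ (n - i) ≤ tauNorm n p := by
  rw [tauNorm_eq]
  have := Real.pi_pos
  exact Finset.single_le_sum (f := fun i => ‖cf i p‖ * (Real.pi / 2) ^ (n - i))
    (fun _ _ => by positivity) (Finset.mem_range.mpr (by omega))

/-- A linear map is bounded as soon as it is on the polynomials `τᵢ`. -/
theorem tauNorm_map_le (L : ℂ[X] →ₗ[ℂ] ℂ[X]) {n m : ℕ} {K : ℝ}
    (hL : ∀ i ≤ n, tauNorm m (L (tau i)) ≤ K * (Real.pi / 2) ^ (n - i)) {p : ℂ[X]}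
    (hp : PolyDeg n p) : tauNorm m (L p) ≤ K * tauNorm n p := by
  conv_lhs => rw [eq_sum_cf hp]
  rw [map_sum, tauNorm_eq n p, Finset.mul_sum]
  refine (tauNorm_sum_le _ _ _).trans (Finset.sum_le_sum fun i hi => ?_)
  rw [← smul_eq_C_mul, map_smul, smul_eq_C_mul, tauNorm_C_mul]
  rw [Finset.mem_range] at hi
  calc _ ≤ ‖cf i p‖ * (K * (Real.pi / 2) ^ (n - i)) :=
        mul_le_mul_of_nonneg_left (hL i (by omega)) (norm_nonneg _)
    _ = _ := by ring

/-! ### Products of the polynomials `τₙ` -/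

/-- `d coth d`. -/
def dcothS : PolySeries := PowerSeries.mk fun n => C (cothCoeff n)

theorem dcothS_mul_sinhS : dcothS * sinhS 1 = d * coshS 1 := by
  refine mul_left_cancel₀ two_ne_zero_polySeries ?_
  have h := congrArg (PowerSeries.map C) cothCoeff_mul
  rw [map_mul, map_mul, map_sub, map_add, PowerSeries.map_X] at h
  have e1 : PowerSeries.map C (PowerSeries.exp ℂ) = expS 1 := by
    rw [expS, PowerSeries.rescale_one]; rfl
  have e2 : PowerSeries.map C (PowerSeries.rescale (-1) (PowerSeries.exp ℂ)) = expS (-1) := rfl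
  have e3 : PowerSeries.map C (PowerSeries.mk cothCoeff) = dcothS := by
    ext1 n
    rw [PowerSeries.coeff_map, PowerSeries.coeff_mk, dcothS, PowerSeries.coeff_mk]
  rw [e1, e2, e3, ← two_mul_sinhS, ← two_mul_coshS, ← d] at h
  linear_combination h

theorem sinhS_ne_zero : sinhS 1 ≠ 0 := by
  intro h
  have h1 := congrArg (PowerSeries.coeff 1) h
  rw [sinhS, PowerSeries.coeff_mk, if_pos (by decide)] at h1
  simp at h1

/-- The addition theorem of tanh solved for the product tanh s tanh (s + d), with a factor d to
clear the pole of coth d. -/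
theorem one_sub_u_mul_shift_u : d * (1 - u * shift 1 u) = dcothS * (shift 1 u - u) := by
  refine mul_right_cancel₀ sinhS_ne_zero ?_
  have h1 := shift_u_mul_cfac 1
  rw [cfac_eq] at h1
  linear_combination (-d) * h1 - (shift 1 u - u) * dcothS_mul_sinhS

theorem X_mul_tau (a : ℕ) : X * tau (a + 1) = (if a = 0 then 1 else 0)
    - ∑ n ∈ Finset.range (a + 1), C (cothCoeff n) * tau (a + 2 - n) := by
  have h := congrArg (PowerSeries.coeff (a + 1)) one_sub_u_mul_shift_u
  rw [d, PowerSeries.coeff_succ_X_mul, map_sub, u, ofPoly, PowerSeries.coeff_C_mul, ← ofPoly, ← u,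
    coeff_shift_u, PowerSeries.coeff_mul, Finset.Nat.sum_antidiagonal_eq_sum_range_succ_mk,
    Finset.sum_range_succ] at h
  simp only [dcothS, PowerSeries.coeff_mk, map_sub, Nat.sub_self] at h
  -- The last term of the convolution drops out, so only τ's of index at least 2 appear in the sum.
  have e0 : PowerSeries.coeff 0 (shift 1 u) - PowerSeries.coeff 0 u = 0 := by
    rw [coeff_shift_u, u, ofPoly, PowerSeries.coeff_zero_C, zero_add, tau_one]; simp
  rw [e0, mul_zero, add_zero, PowerSeries.coeff_one] at h
  have e1 : ∀ n ∈ Finset.range (a + 1), C (cothCoeff n) *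
      (PowerSeries.coeff (a + 1 - n) (shift 1 u) - PowerSeries.coeff (a + 1 - n) u)
      = C (cothCoeff n) * tau (a + 2 - n) := by
    intro n hn
    rw [Finset.mem_range] at hn
    rw [coeff_shift_u, u, ofPoly, PowerSeries.coeff_C, if_neg (by omega), one_pow, C_1, one_mul,
      sub_zero, show a + 1 - n + 1 = a + 2 - n by omega]
  rw [Finset.sum_congr rfl e1] at h
  rw [← h, one_pow, C_1]
  split_ifs <;> ring

/-- The coefficients in the product formula. -/
def prodCoeff (a b k : ℕ) : ℂ :=
  cothCoeff (k + 1) * ((-1) ^ b * (k.choose b : ℂ) + (-1) ^ a * (k.choose a : ℂ))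

/-- The recursion that the Leibniz rule imposes on the structure constants; it amounts to (c + 1)
binom(k, c + 1) = (k - c) binom(k, c), for c = a and c = b. -/
theorem prodCoeff_step (a b k : ℕ) : ((b : ℂ) + 1) * prodCoeff a (b + 1) k
    = ((a : ℂ) + b + 1 - k) * prodCoeff a b k - ((a : ℂ) + 1) * prodCoeff (a + 1) b k := by
  have h (c : ℕ) : ((k.choose (c + 1) : ℂ)) * ((c : ℂ) + 1) = k.choose c * ((k : ℂ) - c) := by
    rcases le_or_gt c k with hc | hc
    · have := Nat.choose_succ_right_eq k c
      have h2 : ((k - c : ℕ) : ℂ) = (k : ℂ) - c := Nat.cast_sub hc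
      rw [← h2]; exact_mod_cast this
    · rw [Nat.choose_eq_zero_of_lt hc, Nat.choose_eq_zero_of_lt (by omega)]; simp
  rw [prodCoeff, prodCoeff, prodCoeff, pow_succ, pow_succ]
  linear_combination (-(cothCoeff (k + 1)) * (-1) ^ b) * h b
    - (cothCoeff (k + 1)) * (-1) ^ a * h a

/-- Induction on b: the Leibniz rule expresses (b + 1) τₐ₊₁ τ_{b+2} by the derivative of τₐ₊₁
τ_{b+1} and by τₐ₊₂ τ_{b+1}, which is why a is generalized. The base case is multiplication by u. -/
theorem tau_mul_tau (a b : ℕ) : tau (a + 1) * tau (b + 1)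
    = (if a = 0 ∧ b = 0 then 1 else 0) - tau (a + b + 2)
      - ∑ k ∈ Finset.range (a + b + 1), C (prodCoeff a b k) * tau (a + b + 1 - k) := by
  induction b generalizing a with
  | zero =>
    rw [zero_add, tau_one, mul_comm, X_mul_tau, Finset.sum_range_succ', add_zero,
      Finset.sum_range_succ, cothCoeff_zero, C_1, one_mul, Nat.sub_zero]
    have e1 : ∀ k ∈ Finset.range a, C (prodCoeff a 0 k) * tau (a + 1 - k)
        = C (cothCoeff (k + 1)) * tau (a + 2 - (k + 1)) := by
      intro k hk
      rw [Finset.mem_range] at hk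
      rw [prodCoeff, Nat.choose_eq_zero_of_lt hk, Nat.choose_zero_right,
        show a + 2 - (k + 1) = a + 1 - k by omega]; simp
    -- For even a the coth coefficient of odd index vanishes; for odd a the two binomial terms
    -- cancel.
    have e2 : prodCoeff a 0 a = 0 := by
      rcases Nat.even_or_odd a with ha | ha
      · rw [prodCoeff, cothCoeff_odd ha.add_one, zero_mul]
      · rw [prodCoeff, ha.neg_one_pow, Nat.choose_zero_right, Nat.choose_self]; simp
    rw [Finset.sum_congr rfl e1, e2, C_0, zero_mul, add_zero]
    simp only [and_true]
    ring
  | succ b ih =>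
    have hD : C ((b : ℂ) + 1) * (tau (a + 1) * tau (b + 1 + 1))
        = Dop 0 (tau (a + 1) * tau (b + 1))
          - C ((a : ℂ) + 1) * (tau (a + 1 + 1) * tau (b + 1)) := by
      have := Dop_mul 0 0 (tau (a + 1)) (tau (b + 1))
      rw [add_zero] at this
      rw [this, Dop_tau, Dop_tau]; push_cast; ring
    have hc : C ((b : ℂ) + 1) ≠ 0 := by
      rw [Ne, C_eq_zero]; exact Nat.cast_add_one_ne_zero b
    refine mul_left_cancel₀ hc ?_
    rw [hD, ih a, ih (a + 1), map_sub, map_sub, map_sum, Dop_tau,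
      if_neg (show ¬(a + 1 = 0 ∧ b = 0) by omega), if_neg (show ¬(a = 0 ∧ b + 1 = 0) by omega)]
    have e0 : Dop 0 (if a = 0 ∧ b = 0 then 1 else 0) = 0 := by
      split_ifs
      · rw [Dop_apply]; simp
      · rw [map_zero]
    have e1 : ∑ k ∈ Finset.range (a + b + 1), Dop 0 (C (prodCoeff a b k) * tau (a + b + 1 - k))
        = ∑ k ∈ Finset.range (a + b + 1 + 1),
          C (((a : ℂ) + b + 1 - k) * prodCoeff a b k) * tau (a + b + 2 - k) := by
      rw [Finset.sum_range_succ (n := a + b + 1)]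
      -- The factor produced by differentiation vanishes at the new top index, so the range of
      -- summation can be enlarged for free.
      have : ((a : ℂ) + b + 1 - (a + b + 1 : ℕ)) = 0 := by push_cast; ring
      rw [this, zero_mul, C_0, zero_mul, add_zero]
      refine Finset.sum_congr rfl fun k hk => ?_
      rw [Finset.mem_range] at hk
      rw [Dop_C_mul, Dop_tau, show a + b + 1 - k + 1 = a + b + 2 - k by omega, Nat.cast_sub (by omega)]
      push_cast
      simp only [C_mul, C_sub, C_add, C_1]
      ring
    rw [e0, e1, show a + 1 + b + 1 = a + b + 1 + 1 by ring, show a + (b + 1) + 1 = a + b + 1 + 1 by ring,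
      show a + 1 + b + 2 = a + b + 2 + 1 by ring, show a + (b + 1) + 2 = a + b + 2 + 1 by ring]
    have e2 : ∑ k ∈ Finset.range (a + b + 1 + 1), C ((b : ℂ) + 1) * (C (prodCoeff a (b + 1) k)
          * tau (a + b + 1 + 1 - k))
        = ∑ k ∈ Finset.range (a + b + 1 + 1),
          C (((a : ℂ) + b + 1 - k) * prodCoeff a b k) * tau (a + b + 2 - k)
        - ∑ k ∈ Finset.range (a + b + 1 + 1), C ((a : ℂ) + 1) * (C (prodCoeff (a + 1) b k)
          * tau (a + b + 1 + 1 - k)) := by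
      rw [← Finset.sum_sub_distrib]
      refine Finset.sum_congr rfl fun k _ => ?_
      rw [← mul_assoc, ← mul_assoc, ← C_mul, ← C_mul, prodCoeff_step, C_sub]; ring
    have e3 : C (((a + b + 2 : ℕ) : ℂ)) = C ((a : ℂ) + 1) + C ((b : ℂ) + 1) := by
      rw [← C_add]; congr 1; push_cast; ring
    rw [mul_sub, mul_sub, mul_sub, mul_sub, Finset.mul_sum, Finset.mul_sum, e2, e3]
    ring

/-- By Pascal's rule the sum for b + 1 is bounded by the mean of the sums for b and for b + 1 with
fewer terms, so the bound 2 of the geometric series is inherited by every b. -/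
theorem sum_choose_le (b M : ℕ) :
    ∑ k ∈ Finset.range M, (k.choose b : ℝ) / 2 ^ k ≤ 2 := by
  induction b generalizing M with
  | zero =>
    have h : ∀ M : ℕ, ∑ k ∈ Finset.range M, (k.choose 0 : ℝ) / 2 ^ k = 2 - 2 / 2 ^ M := by
      intro M
      induction M with
      | zero => simp
      | succ M ih => rw [Finset.sum_range_succ, ih, pow_succ]; simp; field_simp; ring
    rw [h]
    have : (0 : ℝ) < 2 / 2 ^ M := by positivity
    linarith
  | succ b ih =>
    induction M with
    | zero => simp
    | succ M ihM =>
      rw [Finset.sum_range_succ']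
      have e : ∑ k ∈ Finset.range M, ((k + 1).choose (b + 1) : ℝ) / 2 ^ (k + 1)
          = 1 / 2 * (∑ k ∈ Finset.range M, (k.choose b : ℝ) / 2 ^ k
            + ∑ k ∈ Finset.range M, (k.choose (b + 1) : ℝ) / 2 ^ k) := by
        rw [← Finset.sum_add_distrib, Finset.mul_sum]
        refine Finset.sum_congr rfl fun k _ => ?_
        rw [Nat.choose_succ_succ, pow_succ]; push_cast; field_simp
      rw [e]
      have := ih M
      simp
      linarith

/-- The coth coefficients decay like π⁻ᵏ, so the weight (π / 2)ᵏ of the norm leaves 2⁻ᵏ against the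
binomial coefficients. -/
theorem norm_prodCoeff_le (a b k : ℕ) : ‖prodCoeff a b k‖ * (Real.pi / 2) ^ (k + 1)
    ≤ 2 * ((k.choose b : ℝ) / 2 ^ k) + 2 * ((k.choose a : ℝ) / 2 ^ k) := by
  rw [prodCoeff, norm_mul]
  have h1 : ‖(-1) ^ b * (k.choose b : ℂ) + (-1) ^ a * (k.choose a : ℂ)‖
      ≤ (k.choose b : ℝ) + k.choose a := by
    refine (norm_add_le _ _).trans (le_of_eq ?_)
    simp
  have hpi := Real.pi_pos
  calc _ ≤ 4 / Real.pi ^ (k + 1) * ((k.choose b : ℝ) + k.choose a) * (Real.pi / 2) ^ (k + 1) := by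
        gcongr; exact norm_cothCoeff_le _
    _ = _ := by rw [div_pow, pow_succ 2 k]; field_simp; norm_num; ring

theorem tauNorm_tau_mul_tau (i j : ℕ) : tauNorm (i + j) (tau i * tau j) ≤ 12 := by
  rcases i with _ | a
  · rw [tau_zero, one_mul, zero_add, tauNorm_tau le_rfl]; norm_num
  rcases j with _ | b
  · rw [tau_zero, mul_one, add_zero, tauNorm_tau le_rfl]; norm_num
  rw [tau_mul_tau]
  have hpi := Real.pi_pos
  -- The constant 12 is 3 + 1 + 8: the constant polynomial 1, present only for a = b = 0 and then of
  -- norm (π / 2)², the top term τ, and the sum.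
  have h1 : tauNorm (a + 1 + (b + 1)) (if a = 0 ∧ b = 0 then 1 else 0) ≤ 3 := by
    split_ifs with h
    · rw [tauNorm_one, h.1, h.2]; nlinarith [Real.pi_lt_d2]
    · rw [tauNorm_zero]; norm_num
  have h2 : tauNorm (a + 1 + (b + 1)) (tau (a + b + 2)) = 1 := by
    rw [show a + 1 + (b + 1) = a + b + 2 by ring, tauNorm_tau le_rfl]; simp
  have h3 : tauNorm (a + 1 + (b + 1))
      (∑ k ∈ Finset.range (a + b + 1), C (prodCoeff a b k) * tau (a + b + 1 - k)) ≤ 8 := by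
    calc _ ≤ ∑ k ∈ Finset.range (a + b + 1),
          (2 * ((k.choose b : ℝ) / 2 ^ k) + 2 * ((k.choose a : ℝ) / 2 ^ k)) := by
          refine (tauNorm_sum_le _ _ _).trans (Finset.sum_le_sum fun k hk => ?_)
          rw [Finset.mem_range] at hk
          rw [tauNorm_C_mul, tauNorm_tau (by omega),
            show a + 1 + (b + 1) - (a + b + 1 - k) = k + 1 by omega]
          exact norm_prodCoeff_le a b k
      _ ≤ 8 := by
          rw [Finset.sum_add_distrib, ← Finset.mul_sum, ← Finset.mul_sum]
          linarith [sum_choose_le a (a + b + 1), sum_choose_le b (a + b + 1)]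
  have := tauNorm_sub_le (a + 1 + (b + 1)) ((if a = 0 ∧ b = 0 then 1 else 0) - tau (a + b + 2))
    (∑ k ∈ Finset.range (a + b + 1), C (prodCoeff a b k) * tau (a + b + 1 - k))
  have := tauNorm_sub_le (a + 1 + (b + 1)) (if a = 0 ∧ b = 0 then 1 else 0) (tau (a + b + 2))
  linarith

/-- The norms are submultiplicative, up to a constant. -/
theorem tauNorm_mul_le {n m : ℕ} {p q : ℂ[X]} (hp : PolyDeg n p) (hq : PolyDeg m q) :
    tauNorm (n + m) (p * q) ≤ 12 * (tauNorm n p * tauNorm m q) := by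
  have hpi := Real.pi_pos
  have h : ∀ i ≤ n, tauNorm (n + m) (LinearMap.mulRight ℂ q (tau i))
      ≤ (12 * tauNorm m q) * (Real.pi / 2) ^ (n - i) := by
    intro i hi
    rw [LinearMap.mulRight_apply, ← LinearMap.mulLeft_apply (R := ℂ)]
    have h2 : tauNorm (n + m) (LinearMap.mulLeft ℂ (tau i) q)
        ≤ (12 * (Real.pi / 2) ^ (n - i)) * tauNorm m q := by
      refine tauNorm_map_le _ (fun j hj => ?_) hq
      rw [LinearMap.mulLeft_apply, show n + m = i + j + ((n - i) + (m - j)) by omega,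
        tauNorm_add_right (by push_cast; exact (polyDeg_tau i).mul (polyDeg_tau j)), pow_add]
      have := tauNorm_tau_mul_tau i j
      calc _ ≤ (Real.pi / 2) ^ (n - i) * (Real.pi / 2) ^ (m - j) * 12 := by gcongr
        _ = _ := by ring
    linarith
  have := tauNorm_map_le _ h hp
  rw [LinearMap.mulRight_apply] at this
  linarith

/-! ### Division by `τ₂` -/

/-- The quotient `τₙ₊₂ / τ₂`. -/
def tauQuot (n : ℕ) : ℂ[X] := C (1 / ((n : ℂ) + 1)) * derivative (tau (n + 1))

theorem mul_tauQuot (n : ℕ) : (1 - X ^ 2) * tauQuot n = tau (n + 2) := by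
  rw [tauQuot, tau_add_two]; ring

theorem one_sub_X_sq_ne_zero : (1 - X ^ 2 : ℂ[X]) ≠ 0 := by
  intro h
  have := congrArg (Polynomial.eval 0) h
  simp at this

theorem polyDeg_tauQuot (n : ℕ) : PolyDeg n (tauQuot n) := by
  have h := (PolyDeg.C (1 / ((n : ℂ) + 1))).mul (polyDeg_tau (n + 1)).derivative
  refine h.mono ?_
  push_cast; linarith

/-- Dividing the Taylor series of the shifted τ₂ by τ₂ leaves `kap 1 ^ 2`, which is thus a
generating function of the quotients τₙ₊₂ / τ₂. -/
theorem coeff_kap_sq (n : ℕ) : PowerSeries.coeff n (kap 1 ^ 2) = C ((n : ℂ) + 1) * tauQuot n := by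
  have h := congrArg (PowerSeries.coeff n) (shift_tau2 1)
  rw [coeff_shift_tau2, tau2_eq, ofPoly, PowerSeries.coeff_C_mul, ← mul_tauQuot] at h
  refine mul_left_cancel₀ one_sub_X_sq_ne_zero ?_
  rw [← h]; ring

/-- Square `kap_eq` and replace T² by 1 - (1 - T²). The result is linear in two series whose
coefficients are multiples of single τ's. -/
theorem kap_sq_eq : kap 1 ^ 2 = coshS 2 - sinhS 2 * shift 1 u - sinhS 1 ^ 2 * shift 1 tau2 := by
  have h1 := coshS_two_mul 1
  have h2 := sinhS_two_mul 1
  rw [mul_one] at h1 h2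
  rw [kap_eq, h1, h2, tau2, map_sub, map_one, map_pow]
  linear_combination cosh_sq_sub_sinh_sq 1

theorem coeff_sinhS_sq (n : ℕ) : ∃ c : ℂ, PowerSeries.coeff n (sinhS 1 ^ 2) = C c ∧
    ‖c‖ ≤ 2 ^ n / n.factorial ∧ (n < 2 → c = 0) := by
  have h : 2 * sinhS 1 ^ 2 = coshS 2 - 1 := by
    have h1 := coshS_two_mul 1
    rw [mul_one] at h1
    rw [h1]; ring
  have h2 := congrArg (PowerSeries.coeff n) h
  rw [show (2 : PolySeries) = PowerSeries.C (C 2) by rw [map_ofNat, map_ofNat],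
    PowerSeries.coeff_C_mul, map_sub, coshS, PowerSeries.coeff_mk, PowerSeries.coeff_one] at h2
  have h3 : PowerSeries.coeff n (sinhS 1 ^ 2) = C (1 / 2) * (C 2 * PowerSeries.coeff n (sinhS 1 ^ 2)) := by
    rw [← mul_assoc, ← C_mul]; norm_num
  rw [h2] at h3
  rcases n with _ | _ | n
  · exact ⟨0, by rw [h3]; simp, by simp, fun _ => rfl⟩
  · exact ⟨0, by rw [h3]; simp, by simp, fun _ => rfl⟩
  · by_cases he : Even (n + 2)
    · refine ⟨1 / 2 * (2 ^ (n + 2) / ((n + 2).factorial : ℂ)), ?_, ?_, fun h => by omega⟩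
      · rw [h3, if_pos he, if_neg (by omega), sub_zero, ← C_mul]
      · rw [norm_mul, norm_div (2 ^ (n + 2)), norm_pow, Complex.norm_natCast]
        norm_num
        have : (0 : ℝ) ≤ 2 ^ (n + 2) / ((n + 2).factorial : ℝ) := by positivity
        linarith
    · refine ⟨0, ?_, by rw [norm_zero]; positivity, fun _ => rfl⟩
      rw [h3, if_neg he, if_neg (by omega)]; simp

theorem sum_pow_div_factorial_le (x : ℝ) (hx : 0 ≤ x) (n : ℕ) :
    ∑ k ∈ Finset.range n, x ^ k / k.factorial ≤ Real.exp x := Real.sum_le_exp_of_nonneg hx n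

/-- The weights (π / 2)ᵏ turn the coefficients 2ᵏ / k! into πᵏ / k!, so each of the three terms in
`kap_sq_eq` contributes at most (n + 1) exp π. The factor n + 1 cancels against the one in
`coeff_kap_sq`. -/
theorem tauNorm_tauQuot_le (n : ℕ) : tauNorm n (tauQuot n) ≤ 3 * Real.exp Real.pi := by
  have hpi := Real.pi_pos
  have hp2 : 1 ≤ Real.pi / 2 := by linarith [Real.pi_gt_three]
  have key : tauNorm n (C ((n : ℂ) + 1) * tauQuot n) ≤ ((n : ℝ) + 1) * (3 * Real.exp Real.pi) := by
    rw [← coeff_kap_sq, kap_sq_eq, map_sub, map_sub]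
    have h1 : tauNorm n (PowerSeries.coeff n (coshS 2)) ≤ ((n : ℝ) + 1) * Real.exp Real.pi := by
      have hn : Real.pi ^ n / n.factorial ≤ Real.exp Real.pi := by
        refine le_trans ?_ (sum_pow_div_factorial_le _ hpi.le (n + 1))
        exact Finset.single_le_sum (f := fun k => Real.pi ^ k / (k.factorial : ℝ))
          (fun _ _ => by positivity) (Finset.self_mem_range_succ n)
      have h0 : Real.exp Real.pi ≤ ((n : ℝ) + 1) * Real.exp Real.pi := by
        have := Real.exp_pos Real.pi
        nlinarith [(Nat.cast_nonneg n : (0 : ℝ) ≤ n)]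
      refine le_trans ?_ (hn.trans h0)
      rw [coshS, PowerSeries.coeff_mk]
      split_ifs
      · rw [tauNorm_C, norm_div, norm_pow, Complex.norm_natCast, div_pow]
        norm_num
      · rw [tauNorm_zero]; positivity
    have h2 : tauNorm n (PowerSeries.coeff n (sinhS 2 * shift 1 u))
        ≤ ((n : ℝ) + 1) * Real.exp Real.pi := by
      have h0 : Real.exp Real.pi ≤ ((n : ℝ) + 1) * Real.exp Real.pi := by
        have := Real.exp_pos Real.pi
        nlinarith [(Nat.cast_nonneg n : (0 : ℝ) ≤ n)]
      refine le_trans ?_ ((sum_pow_div_factorial_le _ hpi.le (n + 1)).trans h0)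
      rw [PowerSeries.coeff_mul, Finset.Nat.sum_antidiagonal_eq_sum_range_succ_mk]
      refine (tauNorm_sum_le _ _ _).trans (Finset.sum_le_sum fun k hk => ?_)
      rw [Finset.mem_range] at hk
      simp only [sinhS, PowerSeries.coeff_mk, coeff_shift_u]
      split_ifs with ho
      · have := ho.pos
        rw [tauNorm_C_mul, one_pow, C_1, one_mul, tauNorm_tau (by omega),
          show n - (n - k + 1) = k - 1 by omega, norm_div, norm_pow, Complex.norm_natCast]
        norm_num
        calc 2 ^ k / (k.factorial : ℝ) * (Real.pi / 2) ^ (k - 1)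
            ≤ 2 ^ k / (k.factorial : ℝ) * (Real.pi / 2) ^ k := by
              gcongr
              omega
          _ = _ := by rw [div_pow]; field_simp
      · rw [zero_mul, tauNorm_zero]; positivity
    have h3 : tauNorm n (PowerSeries.coeff n (sinhS 1 ^ 2 * shift 1 tau2))
        ≤ ((n : ℝ) + 1) * Real.exp Real.pi := by
      refine le_trans ?_ (mul_le_mul_of_nonneg_left (sum_pow_div_factorial_le _ hpi.le (n + 1))
        (by positivity))
      rw [PowerSeries.coeff_mul, Finset.Nat.sum_antidiagonal_eq_sum_range_succ_mk, Finset.mul_sum]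
      refine (tauNorm_sum_le _ _ _).trans (Finset.sum_le_sum fun k hk => ?_)
      rw [Finset.mem_range] at hk
      obtain ⟨c, hc1, hc2, hc3⟩ := coeff_sinhS_sq k
      simp only [hc1, coeff_shift_tau2]
      rcases lt_or_ge k 2 with h2 | h2
      · rw [hc3 h2, C_0, zero_mul, tauNorm_zero]; positivity
      · rw [tauNorm_C_mul, tauNorm_C_mul, tauNorm_tau (by omega),
          show n - (n - k + 2) = k - 2 by omega]
        have e1 : ‖((n - k : ℕ) : ℂ) + 1‖ ≤ (n : ℝ) + 1 := by
          rw [← Nat.cast_add_one, Complex.norm_natCast]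
          exact_mod_cast (by omega : n - k + 1 ≤ n + 1)
        calc ‖c‖ * (‖((n - k : ℕ) : ℂ) + 1‖ * (Real.pi / 2) ^ (k - 2))
            ≤ 2 ^ k / (k.factorial : ℝ) * (((n : ℝ) + 1) * (Real.pi / 2) ^ k) := by
              gcongr
              omega
          _ = _ := by rw [div_pow]; field_simp
    have h4 := tauNorm_sub_le n (PowerSeries.coeff n (coshS 2)
      - PowerSeries.coeff n (sinhS 2 * shift 1 u)) (PowerSeries.coeff n (sinhS 1 ^ 2 * shift 1 tau2))
    have h5 := tauNorm_sub_le n (PowerSeries.coeff n (coshS 2))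
      (PowerSeries.coeff n (sinhS 2 * shift 1 u))
    linarith
  rw [tauNorm_C_mul, ← Nat.cast_add_one, Complex.norm_natCast] at key
  push_cast at key
  exact le_of_mul_le_mul_left key (by positivity)

/-- Division by `τ₂` is bounded. -/
theorem tauNorm_le_of_mul {n : ℕ} {p : ℂ[X]} (hp : PolyDeg n p) :
    tauNorm n p ≤ 3 * Real.exp Real.pi * tauNorm (n + 2) ((1 - X ^ 2) * p) := by
  set q := (1 - X ^ 2) * p with hq
  have hqd : PolyDeg ((n + 2 : ℕ) : ℤ) q := by
    push_cast; rw [add_comm]; exact PolyDeg.one_sub_X_sq.mul hp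
  obtain ⟨h0, h1⟩ := cf_zero_one_of_dvd (Dvd.intro p hq.symm)
  have e : p = ∑ i ∈ Finset.range (n + 1), C (cf (i + 2) q) * tauQuot i := by
    refine mul_left_cancel₀ one_sub_X_sq_ne_zero ?_
    rw [← hq, Finset.mul_sum]
    conv_lhs => rw [eq_sum_cf hqd, Finset.sum_range_succ', Finset.sum_range_succ', zero_add, h0, h1]
    simp only [C_0, zero_mul, add_zero]
    refine Finset.sum_congr rfl fun i _ => ?_
    rw [← mul_tauQuot]; ring
  rw [tauNorm_eq (n + 2) q, Finset.sum_range_succ', Finset.sum_range_succ', zero_add, h0, h1]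
  simp only [norm_zero, zero_mul, add_zero]
  conv_lhs => rw [e]
  rw [Finset.mul_sum]
  refine (tauNorm_sum_le _ _ _).trans (Finset.sum_le_sum fun i hi => ?_)
  rw [Finset.mem_range] at hi
  have hpi := Real.pi_pos
  rw [tauNorm_C_mul, show n = i + (n - i) by omega, tauNorm_add_right (polyDeg_tauQuot i),
    show i + (n - i) + 2 - (i + 1 + 1) = n - i by omega]
  have := tauNorm_tauQuot_le i
  calc _ ≤ ‖cf (i + 2) q‖ * ((Real.pi / 2) ^ (n - i) * (3 * Real.exp Real.pi)) := by gcongr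
    _ = _ := by ring

/-! ### Norms of series -/

/-- The norm of the coefficient of `dⁿ`. -/
def nrm (n : ℕ) (Z : PolySeries) : ℝ := tauNorm n (PowerSeries.coeff n Z)

theorem nrm_nonneg (n : ℕ) (Z : PolySeries) : 0 ≤ nrm n Z := tauNorm_nonneg _ _

theorem nrm_add_le (n : ℕ) (Z Y : PolySeries) : nrm n (Z + Y) ≤ nrm n Z + nrm n Y := by
  rw [nrm, map_add]; exact tauNorm_add_le _ _ _

theorem nrm_neg (n : ℕ) (Z : PolySeries) : nrm n (-Z) = nrm n Z := by
  rw [nrm, map_neg]; exact tauNorm_neg _ _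

theorem nrm_zero (n : ℕ) : nrm n 0 = 0 := by
  rw [nrm, map_zero]; exact tauNorm_zero _

theorem nrm_const_mul (n : ℕ) (c : ℂ) (Z : PolySeries) : nrm n (const c * Z) = ‖c‖ * nrm n Z := by
  rw [nrm, const, ofPoly, PowerSeries.coeff_C_mul]; exact tauNorm_C_mul _ _ _

theorem DegLE.coeff {Z : PolySeries} (hZ : DegLE 0 Z) (n : ℕ) :
    PolyDeg n (PowerSeries.coeff n Z) := by
  have := hZ n
  rwa [add_zero] at this

theorem nrm_mul_le {Z Y : PolySeries} (hZ : DegLE 0 Z) (hY : DegLE 0 Y) (n : ℕ) :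
    nrm n (Z * Y) ≤ 12 * ∑ k ∈ Finset.range (n + 1), nrm k Z * nrm (n - k) Y := by
  rw [nrm, PowerSeries.coeff_mul, Finset.Nat.sum_antidiagonal_eq_sum_range_succ_mk, Finset.mul_sum]
  refine (tauNorm_sum_le _ _ _).trans (Finset.sum_le_sum fun k hk => ?_)
  rw [Finset.mem_range] at hk
  have := tauNorm_mul_le (hZ.coeff k) (hY.coeff (n - k))
  rwa [show k + (n - k) = n by omega] at this

theorem coeff_d_mul (n : ℕ) (Z : PolySeries) :
    PowerSeries.coeff (n + 1) (d * Z) = PowerSeries.coeff n Z := by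
  rw [d, PowerSeries.coeff_succ_X_mul]

theorem DegLE.of_d_mul {k : ℤ} {Z : PolySeries} (h : DegLE k (PolySeries.d * Z)) : DegLE (k + 1) Z := by
  intro n
  have := h (n + 1)
  rw [coeff_d_mul] at this
  convert this using 1
  push_cast; ring

theorem nrm_d_mul {Z : PolySeries} (hZ : DegLE 0 Z) (n : ℕ) :
    nrm (n + 1) (d * Z) = Real.pi / 2 * nrm n Z := by
  rw [nrm, coeff_d_mul, tauNorm_add_right (hZ.coeff n), pow_one, nrm]

theorem nrm_tau2_le {Z : PolySeries} (hZ : DegLE 0 Z) (n : ℕ) :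
    nrm n Z ≤ 3 * Real.exp Real.pi * nrm (n + 2) (d ^ 2 * tau2 * Z) := by
  have h : PowerSeries.coeff (n + 2) (d ^ 2 * tau2 * Z) = (1 - X ^ 2) * PowerSeries.coeff n Z := by
    rw [show d ^ 2 * tau2 * Z = d * (d * (tau2 * Z)) by ring, coeff_d_mul, coeff_d_mul, tau2_eq,
      ofPoly, PowerSeries.coeff_C_mul]
  rw [nrm, nrm, h]
  exact tauNorm_le_of_mul (hZ.coeff n)

/-! ### Convergent series -/

/-- A weighted norm of the part of degree at most `h`. -/
def wnorm (r : ℝ) (h : ℕ) (Z : PolySeries) : ℝ := ∑ n ∈ Finset.range (h + 1), nrm n Z * r ^ n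

theorem wnorm_nonneg {r : ℝ} (hr : 0 ≤ r) (h : ℕ) (Z : PolySeries) : 0 ≤ wnorm r h Z :=
  Finset.sum_nonneg fun n _ => mul_nonneg (nrm_nonneg n Z) (pow_nonneg hr n)

theorem wnorm_add_le {r : ℝ} (hr : 0 ≤ r) (h : ℕ) (Z Y : PolySeries) :
    wnorm r h (Z + Y) ≤ wnorm r h Z + wnorm r h Y := by
  rw [wnorm, wnorm, wnorm, ← Finset.sum_add_distrib]
  refine Finset.sum_le_sum fun n _ => ?_
  rw [← add_mul]
  exact mul_le_mul_of_nonneg_right (nrm_add_le n Z Y) (pow_nonneg hr n)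

theorem wnorm_neg (r : ℝ) (h : ℕ) (Z : PolySeries) : wnorm r h (-Z) = wnorm r h Z := by
  simp only [wnorm, nrm_neg]

theorem wnorm_mul_le {r : ℝ} (hr : 0 ≤ r) (h : ℕ) {Z Y : PolySeries} (hZ : DegLE 0 Z)
    (hY : DegLE 0 Y) : wnorm r h (Z * Y) ≤ 12 * (wnorm r h Z * wnorm r h Y) := by
  have h1 : wnorm r h (Z * Y) ≤ 12 * ∑ n ∈ Finset.range (h + 1), ∑ k ∈ Finset.range (n + 1),
      (nrm k Z * r ^ k) * (nrm (n - k) Y * r ^ (n - k)) := by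
    rw [wnorm, Finset.mul_sum]
    refine Finset.sum_le_sum fun n _ => ?_
    calc nrm n (Z * Y) * r ^ n
        ≤ (12 * ∑ k ∈ Finset.range (n + 1), nrm k Z * nrm (n - k) Y) * r ^ n :=
          mul_le_mul_of_nonneg_right (nrm_mul_le hZ hY n) (pow_nonneg hr n)
      _ = _ := by
          rw [mul_assoc, Finset.sum_mul]
          congr 1
          refine Finset.sum_congr rfl fun k hk => ?_
          rw [Finset.mem_range] at hk
          rw [show r ^ n = r ^ k * r ^ (n - k) by rw [← pow_add]; congr 1; omega]; ring
  refine h1.trans (mul_le_mul_of_nonneg_left ?_ (by norm_num))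
  rw [wnorm, wnorm, Finset.sum_mul_sum,
    Finset.sum_range_diag_flip (h + 1) fun i j => (nrm i Z * r ^ i) * (nrm j Y * r ^ j)]
  refine Finset.sum_le_sum fun i _ => Finset.sum_le_sum_of_subset_of_nonneg
    (Finset.range_subset_range.mpr (Nat.sub_le _ _)) fun j _ _ => ?_
  have := nrm_nonneg i Z
  have := nrm_nonneg j Y
  positivity

theorem nrm_one (n : ℕ) : nrm n 1 = if n = 0 then 1 else 0 := by
  rw [nrm, PowerSeries.coeff_one]
  split_ifs with h
  · rw [h, tauNorm_one, pow_zero]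
  · rw [tauNorm_zero]

theorem wnorm_one (r : ℝ) (h : ℕ) : wnorm r h 1 = 1 := by
  rw [wnorm, Finset.sum_eq_single 0]
  · rw [nrm_one]; simp
  · intro n _ hn; rw [nrm_one, if_neg hn, zero_mul]
  · intro h'; simp at h'

theorem wnorm_pow_le {r : ℝ} (hr : 0 ≤ r) (h : ℕ) {Z : PolySeries} (hZ : DegLE 0 Z) (k : ℕ) :
    wnorm r h (Z ^ k) ≤ (12 * wnorm r h Z) ^ k := by
  induction k with
  | zero => rw [pow_zero, pow_zero, wnorm_one]
  | succ k ih =>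
    rw [pow_succ, pow_succ]
    calc _ ≤ 12 * (wnorm r h (Z ^ k) * wnorm r h Z) := wnorm_mul_le hr h (hZ.pow k (by simp)) hZ
      _ ≤ 12 * ((12 * wnorm r h Z) ^ k * wnorm r h Z) := by
          have := wnorm_nonneg hr h Z
          gcongr
      _ = _ := by ring

theorem wnorm_const_mul (r : ℝ) (h : ℕ) (c : ℂ) (Z : PolySeries) :
    wnorm r h (const c * Z) = ‖c‖ * wnorm r h Z := by
  rw [wnorm, wnorm, Finset.mul_sum]
  refine Finset.sum_congr rfl fun n _ => ?_
  rw [nrm_const_mul, mul_assoc]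

theorem wnorm_sum_le {ι : Type*} {r : ℝ} (hr : 0 ≤ r) (h : ℕ) (s : Finset ι) (f : ι → PolySeries) :
    wnorm r h (∑ i ∈ s, f i) ≤ ∑ i ∈ s, wnorm r h (f i) := by
  classical
  induction s using Finset.induction_on with
  | empty => simp [wnorm, nrm_zero]
  | insert a s ha ih =>
    rw [Finset.sum_insert ha, Finset.sum_insert ha]
    exact (wnorm_add_le hr _ _ _).trans (by linarith)

/-- The polynomial series whose coefficients grow at most geometrically. -/
structure Conv (Z : PolySeries) : Prop where
  deg : DegLE 0 Z
  bound : ∃ r > 0, ∃ M, ∀ h, wnorm r h Z ≤ M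

theorem wnorm_mono {r s : ℝ} (hr : 0 ≤ r) (hrs : r ≤ s) (h : ℕ) (Z : PolySeries) :
    wnorm r h Z ≤ wnorm s h Z := by
  refine Finset.sum_le_sum fun n _ => ?_
  have := nrm_nonneg n Z
  gcongr

theorem Conv.exists_le {Z : PolySeries} (hZ : Conv Z) :
    ∃ C a : ℝ, 0 ≤ C ∧ 0 < a ∧ ∀ n, nrm n Z ≤ C * a ^ n := by
  obtain ⟨r, hr, M, hM⟩ := hZ.bound
  refine ⟨M, r⁻¹, (wnorm_nonneg hr.le 0 Z).trans (hM 0), inv_pos.mpr hr, fun n => ?_⟩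
  have h1 : nrm n Z * r ^ n ≤ M := by
    refine le_trans ?_ (hM n)
    exact Finset.single_le_sum (f := fun n => nrm n Z * r ^ n)
      (fun i _ => mul_nonneg (nrm_nonneg i Z) (pow_nonneg hr.le i)) (Finset.self_mem_range_succ n)
  rw [inv_pow, ← div_eq_mul_inv, le_div_iff₀ (by positivity)]
  exact h1

theorem Conv.of_le {Z : PolySeries} (hd : DegLE 0 Z) {C a : ℝ} (ha : 0 < a)
    (h : ∀ n, nrm n Z ≤ C * a ^ n) : Conv Z := by
  have hC : 0 ≤ C := by
    have := (nrm_nonneg 0 Z).trans (h 0)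
    simpa using this
  refine ⟨hd, (2 * a)⁻¹, by positivity, C * 2, fun N => ?_⟩
  have h1 : wnorm (2 * a)⁻¹ N Z ≤ C * ∑ n ∈ Finset.range (N + 1), (Nat.choose n 0 : ℝ) / 2 ^ n := by
    rw [wnorm, Finset.mul_sum]
    refine Finset.sum_le_sum fun n _ => ?_
    calc nrm n Z * (2 * a)⁻¹ ^ n ≤ (C * a ^ n) * (2 * a)⁻¹ ^ n := by gcongr; exact h n
      _ = _ := by rw [inv_pow, mul_pow]; simp; field_simp
  exact h1.trans (mul_le_mul_of_nonneg_left (sum_choose_le 0 _) hC)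

theorem Conv.add {Z Y : PolySeries} (hZ : Conv Z) (hY : Conv Y) : Conv (Z + Y) := by
  obtain ⟨r, hr, M, hM⟩ := hZ.bound
  obtain ⟨s, hs, N, hN⟩ := hY.bound
  refine ⟨hZ.deg.add hY.deg, min r s, lt_min hr hs, M + N, fun h => ?_⟩
  have h0 : 0 ≤ min r s := (lt_min hr hs).le
  have := wnorm_add_le h0 h Z Y
  have := wnorm_mono h0 (min_le_left r s) h Z
  have := wnorm_mono h0 (min_le_right r s) h Y
  linarith [hM h, hN h]

theorem Conv.mul {Z Y : PolySeries} (hZ : Conv Z) (hY : Conv Y) : Conv (Z * Y) := by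
  obtain ⟨r, hr, M, hM⟩ := hZ.bound
  obtain ⟨s, hs, N, hN⟩ := hY.bound
  refine ⟨hZ.deg.mul hY.deg (by norm_num), min r s, lt_min hr hs, 12 * (M * N), fun h => ?_⟩
  have h0 : 0 ≤ min r s := (lt_min hr hs).le
  refine (wnorm_mul_le h0 h hZ.deg hY.deg).trans ?_
  have h1 := (wnorm_mono h0 (min_le_left r s) h Z).trans (hM h)
  have h2 := (wnorm_mono h0 (min_le_right r s) h Y).trans (hN h)
  have := wnorm_nonneg h0 h Z
  have := wnorm_nonneg h0 h Y
  have : 0 ≤ M := by linarith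
  gcongr

theorem Conv.neg {Z : PolySeries} (hZ : Conv Z) : Conv (-Z) := by
  obtain ⟨r, hr, M, hM⟩ := hZ.bound
  exact ⟨hZ.deg.neg, r, hr, M, fun h => by rw [wnorm_neg]; exact hM h⟩

theorem Conv.sub {Z Y : PolySeries} (hZ : Conv Z) (hY : Conv Y) : Conv (Z - Y) := by
  rw [sub_eq_add_neg]; exact hZ.add hY.neg

theorem Conv.one : Conv 1 := ⟨DegLE.one, 1, one_pos, 1, fun h => (wnorm_one 1 h).le⟩

theorem Conv.zero : Conv 0 :=
  ⟨DegLE.zero 0, 1, one_pos, 0, fun h => by simp [wnorm, nrm_zero]⟩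

theorem Conv.const (c : ℂ) : Conv (const c) := by
  refine ⟨DegLE.const c, 1, one_pos, ‖c‖, fun h => ?_⟩
  have := wnorm_const_mul 1 h c 1
  rw [mul_one, wnorm_one, mul_one] at this
  exact this.le

/-- The ring of convergent series. -/
def convRing : Subring PolySeries where
  carrier := {Z | Conv Z}
  mul_mem' := Conv.mul
  add_mem' := Conv.add
  one_mem' := Conv.one
  zero_mem' := Conv.zero
  neg_mem' := Conv.neg

theorem Conv.pow {Z : PolySeries} (hZ : Conv Z) (k : ℕ) : Conv (Z ^ k) :=
  convRing.pow_mem hZ k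

theorem Conv.two : Conv 2 := by
  rw [← one_add_one_eq_two]; exact Conv.one.add Conv.one

theorem Conv.mk_C {c : ℕ → ℂ} {K a : ℝ} (ha : 0 < a) (h : ∀ n, ‖c n‖ ≤ K * a ^ n) :
    Conv (PowerSeries.mk fun n => C (c n)) := by
  have hpi := Real.pi_pos
  refine Conv.of_le (a := a * (Real.pi / 2)) (C := K) ?_ (by positivity) fun n => ?_
  · intro n
    rw [PowerSeries.coeff_mk]
    exact (PolyDeg.C _).mono (by simp)
  · rw [nrm, PowerSeries.coeff_mk, tauNorm_C, mul_pow, ← mul_assoc]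
    gcongr
    exact h n

theorem norm_pow_div_factorial_le (θ : ℂ) (n : ℕ) :
    ‖θ ^ n / (n.factorial : ℂ)‖ ≤ 1 * (‖θ‖ + 1) ^ n := by
  rw [norm_div, norm_pow, Complex.norm_natCast, one_mul]
  refine (div_le_self (by positivity) (by exact_mod_cast Nat.one_le_of_lt n.factorial_pos)).trans ?_
  exact pow_le_pow_left₀ (norm_nonneg _) (by linarith) n

theorem Conv.expS (θ : ℂ) : Conv (expS θ) := by
  have h : PolySeries.expS θ = PowerSeries.mk fun n => C (θ ^ n / (n.factorial : ℂ)) := by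
    ext1 n; rw [coeff_expS, PowerSeries.coeff_mk]
  rw [h]
  exact Conv.mk_C (by positivity) (norm_pow_div_factorial_le θ)

theorem Conv.coshS (θ : ℂ) : Conv (coshS θ) := by
  have h : PolySeries.coshS θ = PolySeries.const (1 / 2) * (PolySeries.expS θ + PolySeries.expS (-θ)) := by
    rw [← two_mul_coshS, ← mul_assoc, const_half_mul_two, one_mul]
  rw [h]
  exact (Conv.const _).mul ((Conv.expS _).add (Conv.expS _))

theorem Conv.sinhS (θ : ℂ) : Conv (sinhS θ) := by
  have h : PolySeries.sinhS θ = PolySeries.const (1 / 2) * (PolySeries.expS θ - PolySeries.expS (-θ)) := by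
    rw [← two_mul_sinhS, ← mul_assoc, const_half_mul_two, one_mul]
  rw [h]
  exact (Conv.const _).mul ((Conv.expS _).sub (Conv.expS _))

theorem Conv.of_d_mul {Z : PolySeries} (h : Conv (d * Z)) (hd : DegLE 0 Z) : Conv Z := by
  obtain ⟨C, a, hC, ha, hb⟩ := h.exists_le
  have hpi := Real.pi_gt_three
  refine Conv.of_le (C := C * a) hd ha fun n => ?_
  have h1 := hb (n + 1)
  rw [nrm_d_mul hd] at h1
  have := nrm_nonneg n Z
  rw [mul_assoc, ← pow_succ']
  nlinarith

/-- The coefficients are powers of θ times single τ's, which have norm 1 in their own degree; the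
factor d compensates the excess degree. -/
theorem Conv.d_mul_shift_u (θ : ℂ) : Conv (d * shift θ u) := by
  refine Conv.of_le (C := 1) (a := ‖θ‖ + 1) ?_ (by positivity) fun n => ?_
  · exact DegLE.d.mul (DegLE.u.shift θ) (by norm_num)
  · rcases n with _ | n
    · rw [nrm, PolySeries.d, PowerSeries.coeff_zero_X_mul, tauNorm_zero]; positivity
    · rw [nrm, coeff_d_mul, coeff_shift_u, tauNorm_C_mul, tauNorm_tau le_rfl, Nat.sub_self, pow_zero,
        mul_one, one_mul, norm_pow]
      calc ‖θ‖ ^ n ≤ (‖θ‖ + 1) ^ n := pow_le_pow_left₀ (norm_nonneg _) (by linarith) n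
        _ ≤ (‖θ‖ + 1) ^ (n + 1) := pow_le_pow_right₀ (by linarith [norm_nonneg θ]) (by omega)

theorem Conv.d : Conv d := by
  refine Conv.of_le (C := Real.pi / 2) (a := 1) (DegLE.d.mono (by norm_num)) one_pos fun n => ?_
  have hpi := Real.pi_pos
  rw [one_pow, mul_one, ← mul_one PolySeries.d]
  rcases n with _ | n
  · rw [nrm, PolySeries.d, PowerSeries.coeff_zero_X_mul, tauNorm_zero]; positivity
  · rw [nrm_d_mul DegLE.one, nrm_one]
    split_ifs <;> simp; positivity

theorem Conv.du : Conv (PolySeries.d * u) := by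
  have := Conv.d_mul_shift_u 0
  rwa [shift_zero] at this

theorem exists_eq_d_mul_sinhS (θ : ℂ) : ∃ Z, sinhS θ = d * Z ∧ Conv Z := by
  obtain ⟨Z, hZ⟩ := dvd_of_coeff_eq_zero (p := 1) (Z := sinhS θ) (fun n hn => by
    rw [Nat.lt_one_iff.mp hn, coeff_zero_sinhS])
  rw [pow_one] at hZ
  refine ⟨Z, hZ, Conv.of_d_mul (hZ ▸ Conv.sinhS θ) ?_⟩
  have := DegLE.sinhS θ
  rw [hZ] at this
  exact this.of_d_mul

theorem Conv.kap (θ : ℂ) : Conv (kap θ) := by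
  obtain ⟨Z, hZ, hc⟩ := exists_eq_d_mul_sinhS θ
  rw [kap_eq, hZ, show PolySeries.d * Z * shift θ u = Z * (PolySeries.d * shift θ u) by ring]
  exact (Conv.coshS θ).sub (hc.mul (Conv.d_mul_shift_u θ))

theorem Conv.cfac (θ : ℂ) : Conv (cfac θ) := by
  obtain ⟨Z, hZ, hc⟩ := exists_eq_d_mul_sinhS θ
  rw [cfac_eq, hZ, show u * (PolySeries.d * Z) = Z * (PolySeries.d * u) by ring]
  exact (Conv.coshS θ).add (hc.mul Conv.du)

theorem Conv.UdivD : Conv UdivD := by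
  have h1 := Conv.d
  have h2 := Conv.du
  exact (((Conv.const _).mul h2).add (((Conv.const _).mul (h2.pow 3)).sub
    (((Conv.const _).mul h2).mul (h1.pow 2)))).add
    ((((Conv.const _).mul (h2.pow 5)).add (((Conv.const _).mul (h2.pow 3)).mul (h1.pow 2))).sub
      (((Conv.const _).mul h2).mul (h1.pow 4)))

/-- U is a polynomial in d and d u, and the shift fixes d and sends d u to the convergent series d
times the shifted u. -/
theorem Conv.shift_U (θ : ℂ) : Conv (shift θ U) := by
  have h1 := Conv.d
  have h2 := Conv.d_mul_shift_u θ
  rw [U_eq_d_mul, PolySeries.UdivD]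
  simp only [map_mul, map_add, map_sub, map_pow, shift_const, shift_d]
  exact h1.mul ((((Conv.const _).mul h2).add (((Conv.const _).mul (h2.pow 3)).sub
    (((Conv.const _).mul h2).mul (h1.pow 2)))).add
    ((((Conv.const _).mul (h2.pow 5)).add (((Conv.const _).mul (h2.pow 3)).mul (h1.pow 2))).sub
      (((Conv.const _).mul h2).mul (h1.pow 4))))

theorem Conv.shift_Q (θ : ℂ) : Conv (shift θ Q) := by
  have h1 := Conv.d
  have h2 := Conv.d_mul_shift_u θ
  rw [Q_eq_du]
  simp only [map_mul, map_add, map_sub, map_pow, shift_const, shift_d, map_one]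
  exact ((Conv.one.add ((Conv.const _).mul ((h1.pow 2).sub (h2.pow 2)))).add
    ((((Conv.const _).mul (h2.pow 4)).sub (((Conv.const _).mul (h2.pow 2)).mul (h1.pow 2))).add
      ((Conv.const _).mul (h1.pow 4)))).add
    (((((Conv.const _).mul (h2.pow 6)).add (((Conv.const _).mul (h2.pow 4)).mul (h1.pow 2))).sub
      (((Conv.const _).mul (h2.pow 2)).mul (h1.pow 4))).add ((Conv.const _).mul (h1.pow 6)))

theorem Conv.Q : Conv Q := by
  have := Conv.shift_Q 0
  rwa [shift_zero] at this

theorem DegLE.U : DegLE (-1) U := by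
  rw [U_eq_d_mul]; exact DegLE.d.mul Conv.UdivD.deg (by norm_num)

theorem d_dvd_U : d ∣ U := U_eq_d_mul ▸ dvd_mul_right _ _

theorem admissible_U : Admissible U := ⟨d_dvd_U, nu_U, flipU_U, DegLE.U⟩

theorem Conv.lhs {Z : PolySeries} (h1 : Conv (shift 1 Z)) (h2 : Conv (shift (-1) Z))
    (h0 : Conv Z) : Conv (lhs Z) := by
  rw [PolySeries.lhs, expD_neg_one, expD_neg_one]
  exact ((h1.mul (Conv.kap _)).add (h2.mul (Conv.kap _))).sub (Conv.two.mul h0)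

theorem wnorm_congr {r : ℝ} {h : ℕ} {Z Y : PolySeries}
    (hZY : ∀ n ≤ h, PowerSeries.coeff n Z = PowerSeries.coeff n Y) : wnorm r h Z = wnorm r h Y := by
  refine Finset.sum_congr rfl fun n hn => ?_
  rw [Finset.mem_range] at hn
  rw [nrm, nrm, hZY n (by omega)]

/-- By submultiplicativity of the truncated norms the sum is majorized by the exponential series at
12 M, independently of the truncation. -/
theorem Conv.entire {φ : ℕ → ℂ} (hφ : ∀ k, ‖φ k‖ ≤ 1 / k.factorial) {Y : PolySeries} (hY : Conv Y)
    (hd : PolySeries.d ∣ Y) : Conv (entire φ Y) := by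
  obtain ⟨r, hr, M, hM⟩ := hY.bound
  refine ⟨DegLE.entire φ hY.deg, r, hr, Real.exp (12 * M), fun h => ?_⟩
  rw [wnorm_congr (fun n hn => coeff_entire φ hd (show n < h + 1 by omega))]
  have hM0 : 0 ≤ M := (wnorm_nonneg hr.le 0 Y).trans (hM 0)
  calc _ ≤ ∑ k ∈ Finset.range (h + 1), (12 * M) ^ k / k.factorial := by
        refine (wnorm_sum_le hr.le h _ _).trans (Finset.sum_le_sum fun k _ => ?_)
        rw [wnorm_const_mul]
        calc _ ≤ 1 / (k.factorial : ℝ) * (12 * M) ^ k := by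
              refine mul_le_mul (hφ k) ((wnorm_pow_le hr.le h hY.deg k).trans ?_)
                (wnorm_nonneg hr.le h _) (by positivity)
              have := wnorm_nonneg hr.le h Y
              gcongr
              exact hM h
          _ = _ := by ring
    _ ≤ _ := sum_pow_div_factorial_le _ (by positivity) _

theorem norm_cosCoeff_le (k : ℕ) : ‖cosCoeff k‖ ≤ 1 / k.factorial := by
  rw [cosCoeff, norm_div, norm_pow, norm_neg, norm_one, one_pow, Complex.norm_natCast]
  refine one_div_le_one_div_of_le (by positivity) ?_
  exact_mod_cast Nat.factorial_le (by omega)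

theorem norm_sinCoeff_le (k : ℕ) : ‖sinCoeff k‖ ≤ 1 / k.factorial := by
  rw [sinCoeff, norm_div, norm_pow, norm_neg, norm_one, one_pow, Complex.norm_natCast]
  refine one_div_le_one_div_of_le (by positivity) ?_
  exact_mod_cast Nat.factorial_le (by omega)

theorem Conv.d_sq_tau2 : Conv (PolySeries.d ^ 2 * tau2) := by
  rw [tau2, show PolySeries.d ^ 2 * (1 - u ^ 2) = PolySeries.d ^ 2 - (PolySeries.d * u) ^ 2 by ring]
  exact (Conv.d.pow 2).sub (Conv.du.pow 2)

theorem Conv.tau2_U_sq : Conv (tau2 * PolySeries.U ^ 2) := by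
  rw [U_eq_d_mul, show tau2 * (PolySeries.d * PolySeries.UdivD) ^ 2
    = (PolySeries.d ^ 2 * tau2) * PolySeries.UdivD ^ 2 by ring]
  exact Conv.d_sq_tau2.mul (Conv.UdivD.pow 2)

theorem Conv.cosRoot_U : Conv (cosRoot PolySeries.U) := by
  rw [cosRoot_eq]
  exact Conv.entire norm_cosCoeff_le Conv.tau2_U_sq (dvd_tau2_mul_sq d_dvd_U)

theorem exists_sinRoot_U_eq : ∃ Z, sinRoot PolySeries.U = d * Z ∧ Conv Z :=
  ⟨UdivD * entire sinCoeff (tau2 * PolySeries.U ^ 2), by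
    rw [sinRoot_eq d_dvd_U]; nth_rw 1 [U_eq_d_mul]; ring,
    Conv.UdivD.mul (Conv.entire norm_sinCoeff_le Conv.tau2_U_sq (dvd_tau2_mul_sq d_dvd_U))⟩

theorem exists_eps_sq_eq : ∃ Z, eps ^ 2 = d ^ 2 * Z ∧ Conv Z := by
  obtain ⟨Z, hZ, hc⟩ := exists_eq_d_mul_sinhS (1 / 2)
  exact ⟨(2 * Z) ^ 2, by rw [eps, hZ]; ring, (Conv.two.mul hc).pow 2⟩

theorem Conv.d_sq_two_u_sq : Conv (PolySeries.d ^ 2 * (2 * u ^ 2 - 1)) := by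
  rw [show PolySeries.d ^ 2 * (2 * u ^ 2 - 1) = 2 * (PolySeries.d * u) ^ 2 - PolySeries.d ^ 2 by ring]
  exact (Conv.two.mul (Conv.du.pow 2)).sub (Conv.d.pow 2)

theorem Conv.d_mul_sinQ_U : Conv (PolySeries.d * sinQ PolySeries.U) := by
  obtain ⟨Z, hZ, hc⟩ := exists_sinRoot_U_eq
  rw [sinQ, hZ, show PolySeries.d * (2 * u * cosRoot PolySeries.U + (2 * u ^ 2 - 1) * (PolySeries.d * Z))
    = 2 * (PolySeries.d * u) * cosRoot PolySeries.U + (PolySeries.d ^ 2 * (2 * u ^ 2 - 1)) * Z by ring]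
  exact ((Conv.two.mul Conv.du).mul Conv.cosRoot_U).add (Conv.d_sq_two_u_sq.mul hc)

theorem Conv.d_sq_cosQ_U : Conv (PolySeries.d ^ 2 * cosQ PolySeries.U) := by
  obtain ⟨Z, hZ, hc⟩ := exists_sinRoot_U_eq
  rw [cosQ, hZ, show PolySeries.d ^ 2 * ((2 * u ^ 2 - 1) * cosRoot PolySeries.U
      - 2 * u * tau2 * (PolySeries.d * Z))
    = (PolySeries.d ^ 2 * (2 * u ^ 2 - 1)) * cosRoot PolySeries.U
      - 2 * (PolySeries.d * u) * (PolySeries.d ^ 2 * tau2) * Z by ring]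
  exact (Conv.d_sq_two_u_sq.mul Conv.cosRoot_U).sub
    (((Conv.two.mul Conv.du).mul Conv.d_sq_tau2).mul hc)

/-- The iterates of the operator on 1 that occur here are, up to factorials, the odd coefficients of
`kap 1 - kap (-1)`, so they inherit its convergence. -/
theorem Conv.Iseries : Conv Iseries := by
  have hk : Conv (PolySeries.d * (PolySeries.kap 1 - PolySeries.kap (-1))) :=
    Conv.d.mul ((Conv.kap 1).sub (Conv.kap (-1)))
  obtain ⟨K, a, hK, ha, hb⟩ := hk.exists_le
  refine Conv.of_le (C := 4 * K) (a := a) (DegLE.Iseries.mono (by norm_num)) ha fun n => ?_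
  rw [nrm, coeff_Iseries]
  split_ifs with h
  · obtain ⟨m, rfl⟩ : ∃ m, n = m + 1 := ⟨n - 1, by omega⟩
    have ho : Odd m := by
      rcases Nat.even_or_odd m with he | ho
      · exact absurd h.1 (Nat.not_even_iff_odd.mpr he.add_one)
      · exact ho
    have h1 := hb (m + 1)
    have e (θ : ℂ) : PowerSeries.coeff m (PolySeries.kap θ)
        = C (θ ^ m / (m.factorial : ℂ)) * ((Dop (-1)) ^ m) 1 := by
      rw [PolySeries.kap, one_eq_ofPoly, expD_ofPoly, coeff_expPoly]
    rw [nrm, coeff_d_mul, map_sub, e, e, ho.neg_one_pow, one_pow, ← sub_mul, ← C_sub,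
      tauNorm_C_mul] at h1
    rw [tauNorm_C_mul, Nat.add_sub_cancel]
    set t := tauNorm (m + 1) (((Dop (-1)) ^ m) 1)
    have ht : 0 ≤ t := tauNorm_nonneg _ _
    have hm := (Nat.cast_ne_zero.mpr m.factorial_ne_zero : (m.factorial : ℂ) ≠ 0)
    have e2 : ‖(1 : ℂ) / (m.factorial : ℂ) - -1 / (m.factorial : ℂ)‖ = 2 / m.factorial := by
      rw [← sub_div, norm_div, Complex.norm_natCast]; norm_num
    have e3 : ‖(-4 : ℂ) / ((m + 1).factorial : ℂ)‖ ≤ 4 * (2 / m.factorial) := by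
      rw [norm_div, Complex.norm_natCast, norm_neg, ← mul_div_assoc]
      have : (m.factorial : ℝ) ≤ (m + 1).factorial := by exact_mod_cast Nat.factorial_le (by omega)
      have : (0 : ℝ) < m.factorial := by positivity
      gcongr
      norm_num
    rw [e2] at h1
    calc _ ≤ 4 * (2 / (m.factorial : ℝ)) * t := by gcongr
      _ = 4 * (2 / (m.factorial : ℝ) * t) := by ring
      _ ≤ 4 * (K * a ^ (m + 1)) := by gcongr
      _ = _ := by ring
  · rw [tauNorm_zero]; positivity

theorem Conv.residual_U : Conv (residual PolySeries.U) := by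
  obtain ⟨Z, hZ, hc⟩ := exists_eps_sq_eq
  have hU : Conv PolySeries.U := by
    have := Conv.shift_U 0
    rwa [shift_zero] at this
  rw [residual, rhs_eq, hZ, show PolySeries.d ^ 2 * Z * sinQ PolySeries.U
    = PolySeries.d * Z * (PolySeries.d * sinQ PolySeries.U) by ring]
  exact (((Conv.d.mul hc).mul Conv.d_mul_sinQ_U).sub Conv.Iseries).sub
    (Conv.lhs (Conv.shift_U 1) (Conv.shift_U (-1)) hU)

theorem Conv.lhs_Q_sub : Conv (PolySeries.lhs PolySeries.Q - eps ^ 2 * cosQ PolySeries.U * PolySeries.Q) := by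
  obtain ⟨Z, hZ, hc⟩ := exists_eps_sq_eq
  rw [hZ, show PolySeries.d ^ 2 * Z * cosQ PolySeries.U * PolySeries.Q
    = Z * (PolySeries.d ^ 2 * cosQ PolySeries.U) * PolySeries.Q by ring]
  exact (Conv.lhs (Conv.shift_Q 1) (Conv.shift_Q (-1)) Conv.Q).sub
    ((hc.mul Conv.d_sq_cosQ_U).mul Conv.Q)

theorem DegLE.of_mul_eq {Z Y W : PolySeries} (hZ : DegLE 0 Z) (h0 : PowerSeries.coeff 0 Z = 1)
    (hW : DegLE 0 W) (h : Z * Y = W) : DegLE 0 Y := by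
  intro n
  rw [add_zero]
  induction n using Nat.strong_induction_on with
  | _ n ih =>
    have h1 := congrArg (PowerSeries.coeff n) h
    rw [PowerSeries.coeff_mul, Finset.Nat.sum_antidiagonal_eq_sum_range_succ_mk,
      Finset.sum_range_succ', h0, one_mul, Nat.sub_zero] at h1
    rw [← eq_sub_iff_add_eq'] at h1
    rw [h1]
    refine (hW.coeff n).sub (PolyDeg.sum fun k hk => ?_)
    rw [Finset.mem_range] at hk
    have := (hZ.coeff (k + 1)).mul (ih (n - (k + 1)) (by omega))
    convert this using 1
    push_cast [Nat.cast_sub (show k + 1 ≤ n by omega)]; ring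

/-- Shrinking the radius makes Z - 1 small, since it has no constant term; then inv Z = 1 - (Z - 1)
inv Z bounds the truncated norm of inv Z in terms of itself. -/
theorem Conv.inv {Z : PolySeries} (hZ : Conv Z) (h0 : PowerSeries.coeff 0 Z = 1) :
    Conv (inv Z) := by
  have h1 : Z * PolySeries.inv Z = 1 := by rw [mul_comm]; exact inv_mul_self h0
  have hd : DegLE 0 (PolySeries.inv Z) := DegLE.of_mul_eq hZ.deg h0 DegLE.one h1
  have hY := hZ.sub Conv.one
  have hY0 : PowerSeries.coeff 0 (Z - 1) = 0 := by rw [map_sub, h0, PowerSeries.coeff_zero_one, sub_self]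
  obtain ⟨r, hr, M, hM⟩ := hY.bound
  have hM0 : 0 ≤ M := (wnorm_nonneg hr.le 0 _).trans (hM 0)
  -- Chosen so that 12 s M ≤ 1/2, where 12 is the constant of submultiplicativity; this gives the
  -- bound 2 for the inverse.
  set s : ℝ := 1 / (24 * M + 1) with hs
  have hs0 : 0 < s := by positivity
  have hs1 : s ≤ 1 := by rw [hs, div_le_one (by positivity)]; linarith
  refine ⟨hd, s * r, by positivity, 2, fun h => ?_⟩
  have hb : wnorm (s * r) h (Z - 1) ≤ s * M := by
    refine le_trans ?_ (mul_le_mul_of_nonneg_left (hM h) hs0.le)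
    rw [wnorm, wnorm, Finset.mul_sum]
    refine Finset.sum_le_sum fun n _ => ?_
    rcases n with _ | n
    · rw [nrm, hY0, tauNorm_zero]; simp
    · have := nrm_nonneg (n + 1) (Z - 1)
      rw [mul_pow, ← mul_assoc, mul_comm (nrm _ _), mul_assoc]
      refine mul_le_mul_of_nonneg_right ?_ (by positivity)
      rw [pow_succ]
      exact mul_le_of_le_one_left hs0.le (pow_le_one₀ hs0.le hs1)
  have h2 : PolySeries.inv Z = 1 + -((Z - 1) * PolySeries.inv Z) := by linear_combination h1
  have hsr : 0 ≤ s * r := by positivity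
  have h3 := wnorm_add_le hsr h 1 (-((Z - 1) * PolySeries.inv Z))
  rw [← h2, wnorm_one, wnorm_neg] at h3
  have h4 := wnorm_mul_le hsr h hY.deg hd
  have hx := wnorm_nonneg hsr h (PolySeries.inv Z)
  have h5 : 12 * (s * M) ≤ 1 / 2 := by
    rw [hs, one_div, inv_mul_eq_div, ← mul_div_assoc, div_le_div_iff₀ (by positivity) (by norm_num)]
    linarith
  nlinarith

/-! ### Series of factorial growth -/

/-- The weights `(n + κ)! / κ! (2π)⁻ⁿ`. -/
def wt (κ n : ℕ) : ℝ := ((n + κ).factorial : ℝ) / κ.factorial / (2 * Real.pi) ^ n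

theorem wt_pos (κ n : ℕ) : 0 < wt κ n := by
  have := Real.pi_pos
  rw [wt]; positivity

theorem wt_zero (κ : ℕ) : wt κ 0 = 1 := by
  rw [wt, zero_add, pow_zero, div_one, div_self]; positivity

/-- The two end terms dominate the convolution. The loss is linear in κ, while lowering κ by eight
gains far more. -/
theorem sum_factorial_mul_le (κ m : ℕ) : ∑ i ∈ Finset.range (m + 1),
    ((i + κ).factorial : ℝ) * ((m - i + κ).factorial : ℝ)
      ≤ (κ + 3) * (κ.factorial * (m + κ).factorial) := by
  set t : ℕ → ℝ := fun m => ∑ i ∈ Finset.range (m + 1),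
    ((i + κ).factorial : ℝ) * ((m - i + κ).factorial : ℝ) with ht
  -- Split off the last or the first summand and add: the factors (m - i + κ + 1) and (i + κ + 1)
  -- produced by the factorials have the constant sum m + 2κ + 2.
  have hrec (m : ℕ) : 2 * t (m + 1)
      = (m + 2 * κ + 2) * t m + 2 * (κ.factorial * (m + 1 + κ).factorial) := by
    have h1 : t (m + 1) = ∑ i ∈ Finset.range (m + 1),
        ((i + κ).factorial : ℝ) * ((m + 1 - i + κ).factorial : ℝ)
        + (m + 1 + κ).factorial * κ.factorial := by
      rw [ht]; simp only
      rw [Finset.sum_range_succ, Nat.sub_self, zero_add]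
    have h2 : t (m + 1) = ∑ i ∈ Finset.range (m + 1),
        ((i + 1 + κ).factorial : ℝ) * ((m - i + κ).factorial : ℝ)
        + κ.factorial * (m + 1 + κ).factorial := by
      rw [ht]; simp only
      rw [Finset.sum_range_succ', zero_add, Nat.sub_zero]
      simp only [Nat.add_sub_add_right]
    have h3 : (m + 2 * κ + 2) * t m = ∑ i ∈ Finset.range (m + 1),
        ((i + κ).factorial : ℝ) * ((m + 1 - i + κ).factorial : ℝ)
        + ∑ i ∈ Finset.range (m + 1),
        ((i + 1 + κ).factorial : ℝ) * ((m - i + κ).factorial : ℝ) := by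
      rw [ht]; simp only
      rw [Finset.mul_sum, ← Finset.sum_add_distrib]
      refine Finset.sum_congr rfl fun i hi => ?_
      rw [Finset.mem_range] at hi
      rw [show m + 1 - i + κ = (m - i + κ) + 1 by omega, show i + 1 + κ = (i + κ) + 1 by omega,
        Nat.factorial_succ, Nat.factorial_succ]
      have : ((m - i : ℕ) : ℝ) = m - i := Nat.cast_sub (by omega)
      push_cast [this]; ring
    linarith
  have h0 : t 0 = κ.factorial * κ.factorial := by simp [ht]
  have hk : (0 : ℝ) < κ.factorial := by positivity
  have h1 : t 1 = 2 * (κ.factorial * (κ + 1).factorial) := by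
    have := hrec 0
    rw [h0, zero_add, add_comm 1 κ, Nat.factorial_succ] at this
    rw [Nat.factorial_succ]
    push_cast at this ⊢; linarith
  change t m ≤ _
  rcases m with _ | _ | m
  · rw [h0, zero_add]
    nlinarith [mul_pos hk hk, (Nat.cast_nonneg κ : (0 : ℝ) ≤ κ)]
  · rw [zero_add, h1, add_comm 1 κ]
    have : (0 : ℝ) < (κ + 1).factorial := by positivity
    nlinarith [mul_pos hk this, (Nat.cast_nonneg κ : (0 : ℝ) ≤ κ)]
  · induction m with
    | zero =>
      have h2 := hrec 1
      rw [h1] at h2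
      have e : ((1 + 1 + κ).factorial : ℝ) = (κ + 2) * (κ + 1).factorial := by
        rw [show 1 + 1 + κ = (κ + 1) + 1 by ring, Nat.factorial_succ]; push_cast; ring
      rw [zero_add, e]
      rw [e] at h2
      have : (0 : ℝ) < (κ + 1).factorial := by positivity
      have hkk := mul_pos hk this
      set F : ℝ := κ.factorial * (κ + 1).factorial with hF
      have e2 : (κ.factorial : ℝ) * ((κ + 2) * (κ + 1).factorial) = (κ + 2) * F := by rw [hF]; ring
      push_cast at h2
      rw [e2] at h2 ⊢
      have hκ : (0 : ℝ) ≤ κ := Nat.cast_nonneg κ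
      have h3 : 0 ≤ (κ * κ + 2 * κ + 1) * F := by positivity
      change t 2 ≤ _
      linarith
    | succ m ih =>
      have h2 := hrec (m + 2)
      have e : ((m + 2 + 1 + κ).factorial : ℝ) = (m + 3 + κ) * (m + 2 + κ).factorial := by
        rw [show m + 2 + 1 + κ = (m + 2 + κ) + 1 by ring, Nat.factorial_succ]; push_cast; ring
      have ih' : t (m + 2) ≤ (κ + 3) * (κ.factorial * (m + 2 + κ).factorial) := ih
      change t (m + 2 + 1) ≤ (κ + 3) * (κ.factorial * (m + 2 + 1 + κ).factorial)
      rw [e] at h2 ⊢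
      set F : ℝ := κ.factorial * (m + 2 + κ).factorial with hF
      have hF0 : 0 < F := by positivity
      have hm : (0 : ℝ) ≤ m := Nat.cast_nonneg m
      have hκ : (0 : ℝ) ≤ κ := Nat.cast_nonneg κ
      push_cast at h2
      have h3 : ((m : ℝ) + 2 + 2 * κ + 2) * t (m + 2) ≤ ((m : ℝ) + 2 + 2 * κ + 2) * ((κ + 3) * F) :=
        mul_le_mul_of_nonneg_left ih' (by positivity)
      have h4 : 0 ≤ m * (κ + 1) * F := by positivity
      have e2 : (κ.factorial : ℝ) * ((m + 3 + κ) * (m + 2 + κ).factorial) = (m + 3 + κ) * F := by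
        rw [hF]; ring
      rw [e2] at h2 ⊢
      nlinarith

theorem sum_wt_mul_wt_le (κ n : ℕ) :
    ∑ i ∈ Finset.range (n + 1), wt κ i * wt κ (n - i) ≤ (κ + 3) * wt κ n := by
  have hpi := Real.pi_pos
  have hk : (0 : ℝ) < κ.factorial := by positivity
  have e : ∑ i ∈ Finset.range (n + 1), wt κ i * wt κ (n - i)
      = (∑ i ∈ Finset.range (n + 1), ((i + κ).factorial : ℝ) * ((n - i + κ).factorial : ℝ))
        * (1 / (κ.factorial * κ.factorial * (2 * Real.pi) ^ n)) := by
    rw [Finset.sum_mul]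
    refine Finset.sum_congr rfl fun i hi => ?_
    rw [Finset.mem_range] at hi
    rw [wt, wt, show (2 * Real.pi) ^ n = (2 * Real.pi) ^ i * (2 * Real.pi) ^ (n - i) by
      rw [← pow_add]; congr 1; omega]
    field_simp
  rw [e]
  calc _ ≤ (κ + 3) * (κ.factorial * (n + κ).factorial)
        * (1 / (κ.factorial * κ.factorial * (2 * Real.pi) ^ n)) := by
        gcongr; exact sum_factorial_mul_le κ n
    _ = _ := by rw [wt]; field_simp

/-- A binomial coefficient is at least 1. The factor 1 / i! makes multiplication by a convergent
series bounded uniformly in κ. -/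
theorem wt_sub_le {κ n i : ℕ} (h : i ≤ n) :
    wt κ (n - i) ≤ wt κ n * ((2 * Real.pi) ^ i / i.factorial) := by
  have hpi := Real.pi_pos
  have h1 : ((n - i + κ).factorial : ℝ) * i.factorial ≤ (n + κ).factorial := by
    have := Nat.factorial_mul_factorial_dvd_factorial_add (n - i + κ) i
    rw [show n - i + κ + i = n + κ by omega] at this
    exact_mod_cast Nat.le_of_dvd (Nat.factorial_pos _) this
  have hi : (0 : ℝ) < i.factorial := by positivity
  rw [wt, wt, show (2 * Real.pi) ^ n = (2 * Real.pi) ^ i * (2 * Real.pi) ^ (n - i) by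
      rw [← pow_add]; congr 1; omega]
  have e : ((n + κ).factorial : ℝ) / κ.factorial / ((2 * Real.pi) ^ i * (2 * Real.pi) ^ (n - i))
      * ((2 * Real.pi) ^ i / i.factorial)
      = ((n + κ).factorial / i.factorial : ℝ) / κ.factorial / (2 * Real.pi) ^ (n - i) := by
    field_simp
  rw [e]
  gcongr
  rw [le_div_iff₀ hi]; exact h1

theorem wt_mono (κ j n : ℕ) : wt κ n ≤ wt (κ + j) n := by
  have hpi := Real.pi_pos
  rw [wt, wt]
  gcongr ?_ / _
  rw [div_le_div_iff₀ (by positivity) (by positivity)]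
  have h1 : (n + κ).factorial = κ.factorial * (κ + 1).ascFactorial n := by
    rw [add_comm n κ, ← Nat.factorial_mul_ascFactorial]
  have h2 : (n + (κ + j)).factorial = (κ + j).factorial * (κ + j + 1).ascFactorial n := by
    rw [add_comm n (κ + j), ← Nat.factorial_mul_ascFactorial]
  have h3 : (κ + 1).ascFactorial n ≤ (κ + j + 1).ascFactorial n := by
    clear h1 h2
    induction n with
    | zero => simp
    | succ n ih =>
      rw [Nat.ascFactorial_succ, Nat.ascFactorial_succ]
      exact Nat.mul_le_mul (by omega) ih
  rw [h1, h2]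
  have h4 : ((κ + 1).ascFactorial n : ℝ) ≤ (κ + j + 1).ascFactorial n := by exact_mod_cast h3
  push_cast
  have : (0 : ℝ) < κ.factorial * (κ + j).factorial := by positivity
  nlinarith

/-- The polynomial series of order at least `p` whose coefficients of `dᵖ⁺ⁿ`, for `n < H`, are
bounded by `μ (n + κ)! / κ! (2π)⁻ⁿ`. -/
structure Bd (H p κ : ℕ) (μ : ℝ) (Z : PolySeries) : Prop where
  deg : DegLE 0 Z
  dvd : d ^ p ∣ Z
  nonneg : 0 ≤ μ
  bound : ∀ n < H, nrm (p + n) Z ≤ μ * wt κ n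

theorem Bd.mono {H p κ : ℕ} {μ ν : ℝ} {Z : PolySeries} (hZ : Bd H p κ μ Z) (h : μ ≤ ν) :
    Bd H p κ ν Z :=
  ⟨hZ.deg, hZ.dvd, hZ.nonneg.trans h, fun n hn => (hZ.bound n hn).trans
    (mul_le_mul_of_nonneg_right h (wt_pos κ n).le)⟩

theorem Bd.mono_horizon {H H' p κ : ℕ} {μ : ℝ} {Z : PolySeries} (hZ : Bd H p κ μ Z) (h : H' ≤ H) :
    Bd H' p κ μ Z :=
  ⟨hZ.deg, hZ.dvd, hZ.nonneg, fun n hn => hZ.bound n (by omega)⟩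

theorem Bd.mono_kappa {H p κ : ℕ} {μ : ℝ} {Z : PolySeries} (hZ : Bd H p κ μ Z) (j : ℕ) :
    Bd H p (κ + j) μ Z :=
  ⟨hZ.deg, hZ.dvd, hZ.nonneg, fun n hn => (hZ.bound n hn).trans
    (mul_le_mul_of_nonneg_left (wt_mono κ j n) hZ.nonneg)⟩

theorem Bd.add {H p κ : ℕ} {μ ν : ℝ} {Z Y : PolySeries} (hZ : Bd H p κ μ Z) (hY : Bd H p κ ν Y) :
    Bd H p κ (μ + ν) (Z + Y) :=
  ⟨hZ.deg.add hY.deg, hZ.dvd.add hY.dvd, add_nonneg hZ.nonneg hY.nonneg, fun n hn => by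
    have := nrm_add_le (p + n) Z Y
    linarith [hZ.bound n hn, hY.bound n hn]⟩

theorem Bd.neg {H p κ : ℕ} {μ : ℝ} {Z : PolySeries} (hZ : Bd H p κ μ Z) : Bd H p κ μ (-Z) :=
  ⟨hZ.deg.neg, hZ.dvd.neg_right, hZ.nonneg, fun n hn => by rw [nrm_neg]; exact hZ.bound n hn⟩

theorem Bd.sub {H p κ : ℕ} {μ ν : ℝ} {Z Y : PolySeries} (hZ : Bd H p κ μ Z) (hY : Bd H p κ ν Y) :
    Bd H p κ (μ + ν) (Z - Y) := by
  rw [sub_eq_add_neg]; exact hZ.add hY.neg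

theorem coeff_d_pow_mul (p n : ℕ) (Z : PolySeries) :
    PowerSeries.coeff (p + n) (d ^ p * Z) = PowerSeries.coeff n Z := by
  rw [d, add_comm, PowerSeries.coeff_X_pow_mul]

theorem nrm_mul_le_of_dvd {p q : ℕ} {Z Y : PolySeries} (hZ : DegLE 0 Z) (hY : DegLE 0 Y)
    (hp : d ^ p ∣ Z) (hq : d ^ q ∣ Y) (n : ℕ) : nrm (p + q + n) (Z * Y)
      ≤ 12 * ∑ i ∈ Finset.range (n + 1), nrm (p + i) Z * nrm (q + (n - i)) Y := by
  obtain ⟨Z', rfl⟩ := hp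
  obtain ⟨Y', rfl⟩ := hq
  rw [nrm, show d ^ p * Z' * (d ^ q * Y') = d ^ (p + q) * (Z' * Y') by ring, coeff_d_pow_mul,
    PowerSeries.coeff_mul, Finset.Nat.sum_antidiagonal_eq_sum_range_succ_mk, Finset.mul_sum]
  refine (tauNorm_sum_le _ _ _).trans (Finset.sum_le_sum fun i hi => ?_)
  rw [Finset.mem_range] at hi
  have h1 := hZ.coeff (p + i)
  have h2 := hY.coeff (q + (n - i))
  rw [coeff_d_pow_mul] at h1 h2
  have := tauNorm_mul_le h1 h2
  rw [nrm, nrm, coeff_d_pow_mul, coeff_d_pow_mul]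
  rwa [show p + i + (q + (n - i)) = p + q + n by omega] at this

theorem Bd.mul {H p q κ : ℕ} {μ ν : ℝ} {Z Y : PolySeries} (hZ : Bd H p κ μ Z) (hY : Bd H q κ ν Y) :
    Bd H (p + q) κ (12 * (κ + 3) * μ * ν) (Z * Y) := by
  have := hZ.nonneg
  have := hY.nonneg
  refine ⟨hZ.deg.mul hY.deg (by norm_num), pow_add d p q ▸ mul_dvd_mul hZ.dvd hY.dvd,
    by positivity, fun n hn => ?_⟩
  calc _ ≤ 12 * ∑ i ∈ Finset.range (n + 1), nrm (p + i) Z * nrm (q + (n - i)) Y :=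
        nrm_mul_le_of_dvd hZ.deg hY.deg hZ.dvd hY.dvd n
    _ ≤ 12 * ∑ i ∈ Finset.range (n + 1), (μ * wt κ i) * (ν * wt κ (n - i)) := by
        refine mul_le_mul_of_nonneg_left (Finset.sum_le_sum fun i hi => ?_) (by norm_num)
        rw [Finset.mem_range] at hi
        exact mul_le_mul (hZ.bound i (by omega)) (hY.bound (n - i) (by omega)) (nrm_nonneg _ _)
          (mul_nonneg hZ.nonneg (wt_pos _ _).le)
    _ = 12 * (μ * ν) * ∑ i ∈ Finset.range (n + 1), wt κ i * wt κ (n - i) := by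
        rw [Finset.mul_sum, Finset.mul_sum]
        exact Finset.sum_congr rfl fun i _ => by ring
    _ ≤ 12 * (μ * ν) * ((κ + 3) * wt κ n) := by gcongr; exact sum_wt_mul_wt_le κ n
    _ = _ := by ring

/-- Multiplication by a convergent series, uniformly in `κ`. -/
theorem Conv.mul_bd {q : ℕ} {Z : PolySeries} (hZ : Conv Z) (hq : PolySeries.d ^ q ∣ Z) :
    ∃ K : ℝ, 0 ≤ K ∧ ∀ (H p κ : ℕ) (μ : ℝ) (Y : PolySeries), Bd H p κ μ Y →
      Bd H (q + p) κ (K * μ) (Z * Y) := by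
  obtain ⟨C, a, hC, ha, hb⟩ := hZ.exists_le
  have hpi := Real.pi_pos
  refine ⟨12 * (C * a ^ q * Real.exp (2 * Real.pi * a)), by positivity, fun H p κ μ Y hY => ?_⟩
  have := hY.nonneg
  refine ⟨hZ.deg.mul hY.deg (by norm_num), pow_add PolySeries.d q p ▸ mul_dvd_mul hq hY.dvd,
    by positivity, fun n hn => ?_⟩
  have hw := wt_pos κ n
  calc _ ≤ 12 * ∑ i ∈ Finset.range (n + 1), nrm (q + i) Z * nrm (p + (n - i)) Y :=
        nrm_mul_le_of_dvd hZ.deg hY.deg hq hY.dvd n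
    _ ≤ 12 * ∑ i ∈ Finset.range (n + 1), (C * a ^ q * μ * wt κ n)
          * ((2 * Real.pi * a) ^ i / i.factorial) := by
        refine mul_le_mul_of_nonneg_left (Finset.sum_le_sum fun i hi => ?_) (by norm_num)
        rw [Finset.mem_range] at hi
        calc nrm (q + i) Z * nrm (p + (n - i)) Y
            ≤ (C * a ^ (q + i)) * (μ * (wt κ n * ((2 * Real.pi) ^ i / i.factorial))) := by
              refine mul_le_mul (hb _) ((hY.bound (n - i) (by omega)).trans ?_) (nrm_nonneg _ _)
                (by positivity)
              exact mul_le_mul_of_nonneg_left (wt_sub_le (by omega)) hY.nonneg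
          _ = _ := by rw [pow_add, mul_pow]; ring
    _ = 12 * (C * a ^ q * μ * wt κ n)
          * ∑ i ∈ Finset.range (n + 1), (2 * Real.pi * a) ^ i / i.factorial := by
        rw [← Finset.mul_sum]; ring
    _ ≤ 12 * (C * a ^ q * μ * wt κ n) * Real.exp (2 * Real.pi * a) := by
        gcongr
        exact sum_pow_div_factorial_le _ (by positivity) _
    _ = _ := by ring

theorem Bd.one (H κ : ℕ) : Bd H 0 κ 1 1 := by
  refine ⟨DegLE.one, by simp, zero_le_one, fun n _ => ?_⟩
  rw [zero_add, nrm_one]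
  split_ifs with h
  · rw [h, wt_zero, one_mul]
  · have := wt_pos κ n
    linarith

theorem Conv.bd {q : ℕ} {Z : PolySeries} (hZ : Conv Z) (hq : PolySeries.d ^ q ∣ Z) :
    ∃ K : ℝ, 0 ≤ K ∧ ∀ H κ : ℕ, Bd H q κ K Z := by
  obtain ⟨K, hK, h⟩ := hZ.mul_bd hq
  refine ⟨K, hK, fun H κ => ?_⟩
  have := h H 0 κ 1 1 (Bd.one H κ)
  rwa [mul_one, mul_one] at this

/-- Lowering the order and `κ` at the same time. -/
theorem Bd.lower {H p κ : ℕ} (j : ℕ) {μ : ℝ} {Z : PolySeries} (hZ : Bd H (p + j) (κ + j) μ Z) :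
    Bd (H + j) p κ (μ * ((2 * Real.pi) ^ j * (κ.factorial / (κ + j).factorial))) Z := by
  have hpi := Real.pi_pos
  have := hZ.nonneg
  refine ⟨hZ.deg, (pow_dvd_pow d (Nat.le_add_right p j)).trans hZ.dvd, by positivity, fun n hn => ?_⟩
  rcases lt_or_ge n j with h | h
  · rw [nrm, coeff_eq_zero_of_dvd hZ.dvd (by omega), tauNorm_zero]
    have := wt_pos κ n
    positivity
  · obtain ⟨m, rfl⟩ := Nat.exists_eq_add_of_le h
    rw [← add_assoc]
    refine (hZ.bound m (by omega)).trans (le_of_eq ?_)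
    rw [wt, wt, show m + (κ + j) = j + m + κ by ring, pow_add]
    field_simp

theorem nrm_eq_zero {Z : PolySeries} (hZ : DegLE 0 Z) {n : ℕ} (h : nrm n Z ≤ 0) :
    PowerSeries.coeff n Z = 0 := by
  have h0 : ∀ i ≤ n, cf i (PowerSeries.coeff n Z) = 0 := by
    intro i hi
    have h1 := (norm_cf_le hi (PowerSeries.coeff n Z)).trans h
    have hp : (0 : ℝ) < (Real.pi / 2) ^ (n - i) := by have := Real.pi_pos; positivity
    have h2 : ‖cf i (PowerSeries.coeff n Z)‖ ≤ 0 := by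
      by_contra hne
      push Not at hne
      have := mul_pos hne hp
      linarith
    exact norm_le_zero_iff.mp h2
  rw [eq_sum_cf (hZ.coeff n)]
  refine Finset.sum_eq_zero fun i hi => ?_
  rw [Finset.mem_range] at hi
  rw [h0 i (by omega), C_0, zero_mul]

theorem Bd.of_d_mul {H p κ : ℕ} {μ : ℝ} {Z : PolySeries} (hZ : Bd H (p + 1) κ μ (d * Z))
    (hd : DegLE 0 Z) : Bd H p κ μ Z := by
  have hpi := Real.pi_gt_three
  have h (n : ℕ) : nrm n Z ≤ nrm (n + 1) (d * Z) := by
    rw [nrm_d_mul hd]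
    have := nrm_nonneg n Z
    nlinarith
  refine ⟨hd, dvd_of_coeff_eq_zero fun n hn => nrm_eq_zero hd ((h n).trans ?_), hZ.nonneg,
    fun n hn => (h _).trans ?_⟩
  · rw [nrm, coeff_eq_zero_of_dvd hZ.dvd (by omega), tauNorm_zero]
  · have := hZ.bound n hn
    rwa [show p + 1 + n = p + n + 1 by ring] at this

theorem Bd.of_tau2_mul {H p κ : ℕ} {μ : ℝ} {Z : PolySeries}
    (hZ : Bd H (p + 2) κ μ (d ^ 2 * tau2 * Z)) (hd : DegLE 0 Z) :
    Bd H p κ (3 * Real.exp Real.pi * μ) Z := by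
  have := hZ.nonneg
  have h := nrm_tau2_le hd
  refine ⟨hd, dvd_of_coeff_eq_zero fun n hn => nrm_eq_zero hd ((h n).trans ?_), by positivity,
    fun n hn => (h _).trans ?_⟩
  · rw [nrm, coeff_eq_zero_of_dvd hZ.dvd (by omega), tauNorm_zero, mul_zero]
  · have h1 := hZ.bound n hn
    rw [show p + 2 + n = p + n + 2 by ring] at h1
    calc _ ≤ 3 * Real.exp Real.pi * (μ * wt κ n) := by gcongr
      _ = _ := by ring

theorem Bd.pow {H κ : ℕ} {μ : ℝ} {Y : PolySeries} (hY : Bd H 0 κ μ Y) (k : ℕ) :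
    Bd H 0 κ ((12 * (κ + 3) * μ) ^ k) (Y ^ k) := by
  induction k with
  | zero => rw [pow_zero, pow_zero]; exact Bd.one H κ
  | succ k ih =>
    have := ih.mul hY
    rw [pow_succ, pow_succ]
    convert this using 1
    ring

theorem Bd.entire {H κ : ℕ} {μ : ℝ} {Y : PolySeries} (hY : Bd H 0 κ μ Y) (hd : PolySeries.d ∣ Y)
    {φ : ℕ → ℂ} (hφ : ∀ k, ‖φ k‖ ≤ 1 / k.factorial) :
    Bd H 0 κ (Real.exp (12 * (κ + 3) * μ)) (entire φ Y) := by
  have := hY.nonneg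
  refine ⟨DegLE.entire φ hY.deg, by simp, (Real.exp_pos _).le, fun n hn => ?_⟩
  rw [zero_add, nrm, coeff_entire φ hd (Nat.lt_succ_self n), map_sum]
  have hw := wt_pos κ n
  calc _ ≤ ∑ k ∈ Finset.range (n + 1), ((12 * (κ + 3) * μ) ^ k / k.factorial) * wt κ n := by
        refine (tauNorm_sum_le _ _ _).trans (Finset.sum_le_sum fun k _ => ?_)
        have h1 := (hY.pow k).bound n hn
        rw [zero_add] at h1
        change nrm n (const (φ k) * Y ^ k) ≤ _
        rw [nrm_const_mul]
        calc _ ≤ 1 / (k.factorial : ℝ) * ((12 * (κ + 3) * μ) ^ k * wt κ n) :=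
              mul_le_mul (hφ k) h1 (nrm_nonneg _ _) (by positivity)
          _ = _ := by ring
    _ = (∑ k ∈ Finset.range (n + 1), (12 * (κ + 3) * μ) ^ k / k.factorial) * wt κ n := by
        rw [Finset.sum_mul]
    _ ≤ _ := by
        gcongr
        exact sum_pow_div_factorial_le _ (by positivity) _

/-! ### Inversion of the difference operator -/

/-- The central difference `Z (s + d / 2) - Z (s - d / 2)`. -/
def nabla (Z : PolySeries) : PolySeries := shift (1 / 2) Z - shift (-(1 / 2)) Z

theorem cf_Dop (i : ℕ) (p : ℂ[X]) : cf (i + 1) (Dop 0 p) = i * cf i p := by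
  rw [eq_sum_cf (polyDeg_natCast_iff.mpr (le_refl p.natDegree)), map_sum, map_sum, map_sum,
    Finset.mul_sum]
  refine Finset.sum_congr rfl fun j _ => ?_
  rw [Dop_C_mul, Dop_tau, cf_C_mul, cf_C_mul, cf_C_mul, cf_tau, cf_tau]
  by_cases h : j = i
  · subst h; simp; ring
  · rw [if_neg h, if_neg (by omega)]; ring

theorem cf_Dop_pow (a i : ℕ) (p : ℂ[X]) : cf (i + 1) (((Dop 0) ^ a) p)
    = if a ≤ i then (i.factorial : ℂ) / (i - a).factorial * cf (i - a + 1) p else 0 := by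
  induction a generalizing i with
  | zero =>
    have : (i.factorial : ℂ) ≠ 0 := Nat.cast_ne_zero.mpr i.factorial_ne_zero
    rw [if_pos (Nat.zero_le i), Nat.sub_zero, div_self this, one_mul]; rfl
  | succ a ih =>
    rw [pow_succ' (Dop 0), Module.End.mul_apply, cf_Dop]
    rcases i with _ | i
    · simp
    · rw [ih]
      by_cases h : a ≤ i
      · rw [if_pos h, if_pos (by omega), Nat.add_sub_add_right, Nat.factorial_succ]; push_cast; ring
      · rw [if_neg h, if_neg (by omega), mul_zero]

/-- The coordinates of a series along a diagonal, divided by factorials. -/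
def diagS (l : ℕ) (Z : PolySeries) : PowerSeries ℂ :=
  PowerSeries.mk fun i => cf (i + 1) (PowerSeries.coeff (i + 1 + l) Z) / (i.factorial : ℂ)

theorem diagS_sub (l : ℕ) (Z Y : PolySeries) : diagS l (Z - Y) = diagS l Z - diagS l Y := by
  ext i
  rw [map_sub, diagS, diagS, diagS, PowerSeries.coeff_mk, PowerSeries.coeff_mk, PowerSeries.coeff_mk,
    map_sub, map_sub, sub_div]

/-- After division by factorials, d · d/ds moves one step along the diagonal of constant n - i, that
is, it becomes multiplication by x. The coordinate along τ₀ does not interfere, because the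
derivative of τ₀ is zero. -/
theorem diagS_shift (l : ℕ) (θ : ℂ) (Z : PolySeries) :
    diagS l (shift θ Z) = PowerSeries.rescale θ (PowerSeries.exp ℂ) * diagS l Z := by
  ext i
  rw [diagS, PowerSeries.coeff_mk, shift_apply, coeff_expD,
    Finset.Nat.sum_antidiagonal_eq_sum_range_succ_mk, PowerSeries.coeff_mul,
    Finset.Nat.sum_antidiagonal_eq_sum_range_succ_mk, map_sum, Finset.sum_div]
  symm
  refine Finset.sum_subset_zero_on_sdiff (Finset.range_subset_range.mpr (by omega)) ?_ ?_
  · intro a ha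
    rw [Finset.mem_sdiff, Finset.mem_range, Finset.mem_range] at ha
    rw [cf_C_mul, cf_Dop_pow, if_neg (by omega), mul_zero, zero_div]
  · intro a ha
    rw [Finset.mem_range] at ha
    have h1 : (i.factorial : ℂ) ≠ 0 := Nat.cast_ne_zero.mpr i.factorial_ne_zero
    rw [cf_C_mul, cf_Dop_pow, if_pos (by omega), PowerSeries.coeff_rescale, PowerSeries.coeff_exp,
      diagS, PowerSeries.coeff_mk, show i + 1 + l - a = i - a + 1 + l by omega]
    simp only [map_div₀, map_one, map_natCast]
    field_simp

/-- On the diagonal, ∇ is multiplication by 2 sinh (x / 2), which is inverted by `cschCoeff` up to a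
factor x. The coordinate along τ₀ is invisible to ∇ and must be controlled separately. -/
theorem diagS_nabla (l : ℕ) (Z : PolySeries) :
    PowerSeries.X * diagS l Z = PowerSeries.mk cschCoeff * diagS l (nabla Z) := by
  rw [nabla, diagS_sub, diagS_shift, diagS_shift, ← sub_mul, ← mul_assoc, cschCoeff_mul]

theorem cf_eq_of_nabla (l i : ℕ) (Z : PolySeries) :
    cf (i + 1) (PowerSeries.coeff (i + 1 + l) Z) / (i.factorial : ℂ)
      = ∑ s ∈ Finset.range (i + 2), cschCoeff s
        * (cf (i + 1 - s + 1) (PowerSeries.coeff (i + 1 - s + 1 + l) (nabla Z))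
          / ((i + 1 - s).factorial : ℂ)) := by
  have h := congrArg (PowerSeries.coeff (i + 1)) (diagS_nabla l Z)
  rw [PowerSeries.coeff_succ_X_mul, PowerSeries.coeff_mul,
    Finset.Nat.sum_antidiagonal_eq_sum_range_succ_mk] at h
  simpa only [diagS, PowerSeries.coeff_mk] using h

theorem descFactorial_mono_left {a b : ℕ} (h : a ≤ b) (s : ℕ) :
    a.descFactorial s ≤ b.descFactorial s := by
  induction s with
  | zero => simp
  | succ s ih =>
    rw [Nat.descFactorial_succ, Nat.descFactorial_succ]
    exact Nat.mul_le_mul (by omega) ih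

theorem sum_cf_succ_le {M m : ℕ} (h : M ≤ m) (p : ℂ[X]) :
    ∑ i ∈ Finset.range M, ‖cf (i + 1) p‖ * (Real.pi / 2) ^ (m - (i + 1)) ≤ tauNorm m p := by
  have hpi := Real.pi_pos
  rw [tauNorm_eq, Finset.sum_range_succ']
  refine le_trans (Finset.sum_le_sum_of_subset_of_nonneg (Finset.range_subset_range.mpr h)
    fun i _ _ => ?_) (le_add_of_nonneg_right ?_) <;> positivity

/-- The part of the norm that comes from the coordinates along `τᵢ`, for `1 ≤ i ≤ n - L`. -/
theorem sum_norm_cf_le (L n : ℕ) (Z : PolySeries) :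
    ∑ i ∈ Finset.range (n - L), ‖cf (i + 1) (PowerSeries.coeff n Z)‖ * (Real.pi / 2) ^ (n - 1 - i)
      ≤ 4 * nrm (n + 1) (nabla Z) + ∑ s ∈ Finset.range (n - L),
        4 / (2 * Real.pi) ^ (s + 1) * ((n - 1 - L).descFactorial s : ℝ) * nrm (n - s) (nabla Z) := by
  have hpi := Real.pi_pos
  set F := nabla Z with hF
  set g : ℕ → ℕ → ℝ := fun m i => ‖cf (i + 1) (PowerSeries.coeff m F)‖ with hg
  -- The csch coefficient of index 0 looks one order up, at n + 1; that of index s + 1 looks at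
  -- order n - s. The quotient i! / (i - s)! is replaced by its value at the largest admissible i,
  -- namely n - 1 - L.
  have hsum (i : ℕ) (hi : i < n - L) : ‖cf (i + 1) (PowerSeries.coeff n Z)‖ ≤ 4 * g (n + 1) (i + 1)
      + ∑ s ∈ Finset.range (n - L), 4 / (2 * Real.pi) ^ (s + 1) * ((n - 1 - L).descFactorial s : ℝ)
        * (if s ≤ i then g (n - s) (i - s) else 0) := by
    have h := cf_eq_of_nabla (n - 1 - i) i Z
    rw [show i + 1 + (n - 1 - i) = n by omega, Finset.sum_range_succ'] at h
    have hi0 : (i.factorial : ℂ) ≠ 0 := Nat.cast_ne_zero.mpr i.factorial_ne_zero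
    rw [div_eq_iff hi0, add_mul, Finset.sum_mul] at h
    rw [h, add_comm]
    refine (norm_add_le _ _).trans (add_le_add ?_ ?_)
    · rw [Nat.sub_zero, show i + 1 + 1 + (n - 1 - i) = n + 1 by omega, norm_mul, norm_mul, norm_div,
        Complex.norm_natCast, Complex.norm_natCast]
      have h1 : ((i.factorial : ℕ) : ℝ) / (i + 1).factorial ≤ 1 := by
        rw [div_le_one (by positivity)]
        exact_mod_cast Nat.factorial_le (by omega)
      have h2 := norm_cschCoeff_le 0
      rw [pow_zero, div_one] at h2
      calc ‖cschCoeff 0‖ * (‖cf (i + 1 + 1) (PowerSeries.coeff (n + 1) F)‖ / ((i + 1).factorial : ℝ))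
            * (i.factorial : ℝ)
          = ‖cschCoeff 0‖ * ‖cf (i + 1 + 1) (PowerSeries.coeff (n + 1) F)‖
            * ((i.factorial : ℝ) / (i + 1).factorial) := by ring
        _ ≤ 4 * ‖cf (i + 1 + 1) (PowerSeries.coeff (n + 1) F)‖ * 1 := by gcongr
        _ = _ := by rw [mul_one]
    · refine (norm_sum_le _ _).trans ?_
      refine (Finset.sum_le_sum (g := fun s => 4 / (2 * Real.pi) ^ (s + 1)
        * ((n - 1 - L).descFactorial s : ℝ) * (if s ≤ i then g (n - s) (i - s) else 0)) ?_).trans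
        (Finset.sum_le_sum_of_subset_of_nonneg (Finset.range_subset_range.mpr (by omega)) ?_)
      · intro s hs
        rw [Finset.mem_range] at hs
        rw [if_pos (by omega), show i + 1 - (s + 1) = i - s by omega,
          show i - s + 1 + (n - 1 - i) = n - s by omega, norm_mul, norm_mul, norm_div,
          Complex.norm_natCast, Complex.norm_natCast]
        have h1 : (i.factorial : ℝ) / (i - s).factorial ≤ (n - 1 - L).descFactorial s := by
          rw [div_le_iff₀ (by positivity)]
          have h2 := Nat.factorial_mul_descFactorial (show s ≤ i by omega)
          have h3 := descFactorial_mono_left (show i ≤ n - 1 - L by omega) s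
          have : (i - s).factorial * i.descFactorial s ≤ (i - s).factorial * (n - 1 - L).descFactorial s :=
            Nat.mul_le_mul_left _ h3
          rw [h2, mul_comm] at this
          exact_mod_cast this
        calc ‖cschCoeff (s + 1)‖ * (‖cf (i - s + 1) (PowerSeries.coeff (n - s) F)‖
              / ((i - s).factorial : ℝ)) * (i.factorial : ℝ)
            = ‖cschCoeff (s + 1)‖ * ((i.factorial : ℝ) / (i - s).factorial)
              * ‖cf (i - s + 1) (PowerSeries.coeff (n - s) F)‖ := by ring
          _ ≤ _ := by
            gcongr
            exact norm_cschCoeff_le _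
      · intro s _ _
        split_ifs <;> positivity
  calc _ ≤ ∑ i ∈ Finset.range (n - L), (4 * g (n + 1) (i + 1)
      + ∑ s ∈ Finset.range (n - L), 4 / (2 * Real.pi) ^ (s + 1) * ((n - 1 - L).descFactorial s : ℝ)
        * (if s ≤ i then g (n - s) (i - s) else 0)) * (Real.pi / 2) ^ (n - 1 - i) := by
        refine Finset.sum_le_sum fun i hi => ?_
        rw [Finset.mem_range] at hi
        exact mul_le_mul_of_nonneg_right (hsum i hi) (by positivity)
    _ = 4 * ∑ i ∈ Finset.range (n - L), g (n + 1) (i + 1) * (Real.pi / 2) ^ (n - 1 - i)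
        + ∑ s ∈ Finset.range (n - L), 4 / (2 * Real.pi) ^ (s + 1) * ((n - 1 - L).descFactorial s : ℝ)
          * ∑ i ∈ Finset.range (n - L), (if s ≤ i then g (n - s) (i - s) else 0)
            * (Real.pi / 2) ^ (n - 1 - i) := by
        simp only [add_mul, Finset.sum_add_distrib, Finset.mul_sum, Finset.sum_mul]
        rw [Finset.sum_comm]
        congr 1
        · exact Finset.sum_congr rfl fun i _ => by ring
        · exact Finset.sum_congr rfl fun s _ => Finset.sum_congr rfl fun i _ => by ring
    _ ≤ _ := by
        refine add_le_add (mul_le_mul_of_nonneg_left ?_ (by norm_num)) (Finset.sum_le_sum fun s hs =>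
          mul_le_mul_of_nonneg_left ?_ (by positivity))
        · have h1 := sum_cf_succ_le (M := n - L + 1) (m := n + 1) (by omega)
            (PowerSeries.coeff (n + 1) F)
          rw [Finset.sum_range_succ'] at h1
          refine le_trans (le_of_eq ?_) (le_trans (le_add_of_nonneg_right (by positivity)) h1)
          refine Finset.sum_congr rfl fun i _ => ?_
          rw [show n + 1 - (i + 1 + 1) = n - 1 - i by omega]
        · rw [Finset.mem_range] at hs
          have h1 := sum_cf_succ_le (M := n - L - s) (m := n - s) (by omega)
            (PowerSeries.coeff (n - s) F)
          refine le_trans (le_of_eq ?_) h1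
          have e : n - L = s + (n - L - s) := by omega
          conv_lhs => rw [e]
          rw [Finset.sum_range_add, Finset.sum_eq_zero, zero_add]
          · refine Finset.sum_congr rfl fun j _ => ?_
            rw [if_pos (by omega), show s + j - s = j by omega,
              show n - s - (j + 1) = n - 1 - (s + j) by omega]
          · intro i hi
            rw [Finset.mem_range] at hi
            rw [if_neg (by omega), zero_mul]

theorem nrm_eq_sum_cf {Z : PolySeries} {n : ℕ} (h0 : cf 0 (PowerSeries.coeff n Z) = 0) :
    nrm n Z = ∑ i ∈ Finset.range n, ‖cf (i + 1) (PowerSeries.coeff n Z)‖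
      * (Real.pi / 2) ^ (n - 1 - i) := by
  rw [nrm, tauNorm_eq, Finset.sum_range_succ', h0, norm_zero, zero_mul, add_zero]
  refine Finset.sum_congr rfl fun i _ => ?_
  rw [show n - (i + 1) = n - 1 - i by omega]

theorem nrm_le_of_nabla {Z : PolySeries} {n : ℕ} (h0 : cf 0 (PowerSeries.coeff n Z) = 0) :
    nrm n Z ≤ 4 * nrm (n + 1) (nabla Z) + ∑ s ∈ Finset.range n,
        4 / (2 * Real.pi) ^ (s + 1) * ((n - 1).descFactorial s : ℝ) * nrm (n - s) (nabla Z) := by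
  have := sum_norm_cf_le 0 n Z
  rwa [Nat.sub_zero, ← nrm_eq_sum_cf h0, Nat.sub_zero] at this

/-- The difference operator can be inverted on series without component along `τ₀`. -/
theorem Bd.of_nabla {H p κ : ℕ} {μ : ℝ} {Z : PolySeries} (hF : Bd H (p + 1) κ μ (nabla Z))
    (hd : DegLE 0 Z) (h0 : ∀ n, cf 0 (PowerSeries.coeff n Z) = 0) (hκ : p ≤ κ) :
    Bd H p κ (8 * μ) Z := by
  have hpi := Real.pi_pos
  have hμ := hF.nonneg
  have hz (m : ℕ) (hm : m < p + 1) : nrm m (nabla Z) = 0 := by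
    rw [nrm, coeff_eq_zero_of_dvd hF.dvd hm, tauNorm_zero]
  refine ⟨hd, dvd_of_coeff_eq_zero fun n hn => nrm_eq_zero hd ((nrm_le_of_nabla (h0 n)).trans ?_),
    by positivity, fun n hn => (nrm_le_of_nabla (h0 _)).trans ?_⟩
  · rw [hz (n + 1) (by omega), Finset.sum_eq_zero (fun s _ => by rw [hz (n - s) (by omega), mul_zero])]
    simp
  · have h1 := hF.bound n hn
    rw [show p + 1 + n = p + n + 1 by ring] at h1
    -- Here `p ≤ κ` enters: it bounds the falling factorial of p + n - 1 by that of n - 1 + κ, which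
    -- completes the weight to (n - 1 + κ)!. At most n terms remain, and n (n - 1 + κ)! ≤ (n + κ)!.
    have h2 : ∀ s ∈ Finset.range (p + n), 4 / (2 * Real.pi) ^ (s + 1)
        * ((p + n - 1).descFactorial s : ℝ) * nrm (p + n - s) (nabla Z)
        ≤ if s < n then 4 * μ * (((n - 1 + κ).factorial : ℝ) / κ.factorial / (2 * Real.pi) ^ n)
          else 0 := by
      intro s hs
      split_ifs with hsn
      · have h3 := hF.bound (n - 1 - s) (by omega)
        rw [show p + 1 + (n - 1 - s) = p + n - s by omega] at h3
        have h4 : ((p + n - 1).descFactorial s : ℝ) * ((n - 1 - s + κ).factorial : ℝ)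
            ≤ (n - 1 + κ).factorial := by
          have h5 := descFactorial_mono_left (show p + n - 1 ≤ n - 1 + κ by omega) s
          have h6 := Nat.factorial_mul_descFactorial (show s ≤ n - 1 + κ by omega)
          rw [show n - 1 + κ - s = n - 1 - s + κ by omega] at h6
          have := Nat.mul_le_mul_left (n - 1 - s + κ).factorial h5
          rw [h6, mul_comm] at this
          exact_mod_cast this
        calc _ ≤ 4 / (2 * Real.pi) ^ (s + 1) * ((p + n - 1).descFactorial s : ℝ)
              * (μ * wt κ (n - 1 - s)) := by gcongr
          _ = 4 * μ * (((p + n - 1).descFactorial s * (n - 1 - s + κ).factorial : ℝ)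
              / κ.factorial / (2 * Real.pi) ^ n) := by
            rw [wt, show (2 * Real.pi) ^ n = (2 * Real.pi) ^ (s + 1) * (2 * Real.pi) ^ (n - 1 - s) by
              rw [← pow_add]; congr 1; omega]
            field_simp
          _ ≤ _ := by gcongr
      · rw [hz _ (by omega), mul_zero]
    have h3 : ∑ s ∈ Finset.range (p + n), (if s < n then
        4 * μ * (((n - 1 + κ).factorial : ℝ) / κ.factorial / (2 * Real.pi) ^ n) else 0)
        ≤ 4 * μ * wt κ n := by
      rw [← Finset.sum_filter, Finset.sum_const, nsmul_eq_mul]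
      have hc : (Finset.filter (fun s => s < n) (Finset.range (p + n))).card ≤ n := by
        calc _ ≤ (Finset.range n).card := Finset.card_le_card fun s hs => by
              rw [Finset.mem_filter] at hs; exact Finset.mem_range.mpr hs.2
          _ = n := Finset.card_range n
      have hf : (n : ℝ) * (n - 1 + κ).factorial ≤ (n + κ).factorial := by
        rcases n with _ | n
        · simp
        · rw [Nat.add_sub_cancel, show n + 1 + κ = n + κ + 1 by ring, Nat.factorial_succ]
          push_cast
          have : (0 : ℝ) ≤ κ * (n + κ).factorial := by positivity
          nlinarith
      calc _ ≤ (n : ℝ) * (4 * μ * (((n - 1 + κ).factorial : ℝ) / κ.factorial / (2 * Real.pi) ^ n)) := by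
            gcongr
        _ = 4 * μ * ((n * (n - 1 + κ).factorial : ℝ) / κ.factorial / (2 * Real.pi) ^ n) := by ring
        _ ≤ _ := by rw [wt]; gcongr
    have h4 := (Finset.sum_le_sum h2).trans h3
    linarith

/-! ### The equation for the remainder -/

/-- `L (Q G) - G L Q`. -/
def Nser (G : PolySeries) : PolySeries := lhs (Q * G) - G * lhs Q

/-- `Q (s + d / 2) Q (s - d / 2)`. -/
def PiQ : PolySeries := shift (1 / 2) Q * shift (-(1 / 2)) Q

/-- The series `V` with `∇ (τ₂ V) = τ₂ Q N`. -/
def Vser (G : PolySeries) : PolySeries := kap (1 / 2) * kap (-(1 / 2)) * PiQ * nabla G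

/-- The series `M` with `∇ G = M V`. -/
def Mser : PolySeries := cfac (1 / 2) * cfac (-(1 / 2)) * inv PiQ

theorem coeff_zero_shift (θ : ℂ) (Z : PolySeries) :
    PowerSeries.coeff 0 (shift θ Z) = PowerSeries.coeff 0 Z := by
  rw [shift_apply, coeff_expD, Finset.Nat.sum_antidiagonal_eq_sum_range_succ_mk]
  simp

theorem coeff_zero_PiQ : PowerSeries.coeff 0 PiQ = 1 := by
  rw [PiQ, coeff_zero_mul, coeff_zero_shift, coeff_zero_shift, coeff_Q_low.1, one_mul]

theorem Conv.PiQ : Conv PiQ := (Conv.shift_Q _).mul (Conv.shift_Q _)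

theorem Conv.Mser : Conv Mser :=
  ((Conv.cfac _).mul (Conv.cfac _)).mul (Conv.PiQ.inv coeff_zero_PiQ)

theorem nabla_eq_mul (G : PolySeries) : nabla G = Mser * Vser G := by
  have h1 := kap_mul_cfac (1 / 2)
  have h2 := kap_mul_cfac (-(1 / 2))
  have h3 := inv_mul_self coeff_zero_PiQ
  rw [Mser, Vser]
  calc nabla G = (kap (1 / 2) * cfac (1 / 2)) * (kap (-(1 / 2)) * cfac (-(1 / 2)))
        * (inv PiQ * PiQ) * nabla G := by rw [h1, h2, h3]; ring
    _ = _ := by ring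

theorem lhs_eq_shift (Z : PolySeries) :
    lhs Z = shift 1 Z * kap 1 + shift (-1) Z * kap (-1) - 2 * Z := by
  rw [lhs, expD_neg_one, expD_neg_one]

/-- Discrete reduction of order. With y = Q / cosh s, the series τ₂ V is y(s + d/2) y(s - d/2) times
∇G, the Casoratian of y and y G, and its central difference is y L(y G) - y G L(y) for the plain
second difference L. -/
theorem nabla_tau2_mul_Vser (G : PolySeries) : nabla (tau2 * Vser G) = tau2 * Q * Nser G := by
  have a1 : (1 / 2 : ℂ) + 1 / 2 = 1 := by norm_num
  have a2 : (-(1 / 2) : ℂ) + -(1 / 2) = -1 := by norm_num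
  have a3 : (1 / 2 : ℂ) + -(1 / 2) = 0 := by norm_num
  have a4 : (-(1 / 2) : ℂ) + 1 / 2 = 0 := by norm_num
  have k1 := kap_mul_shift_kap (1 / 2) (1 / 2)
  have k2 := kap_mul_shift_kap (1 / 2) (-(1 / 2))
  have k3 := kap_mul_shift_kap (-(1 / 2)) (1 / 2)
  have k4 := kap_mul_shift_kap (-(1 / 2)) (-(1 / 2))
  rw [a1] at k1
  rw [a3, kap_zero] at k2
  rw [a4, kap_zero] at k3
  rw [a2] at k4
  rw [nabla, Nser, lhs_eq_shift, lhs_eq_shift, Vser, PiQ, nabla]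
  simp only [map_mul, map_sub, shift_tau2, shift_shift, a1, a2, a3, a4, shift_zero]
  calc _ = tau2 * (kap (1 / 2) * shift (1 / 2) (kap (1 / 2)))
          * (kap (1 / 2) * shift (1 / 2) (kap (-(1 / 2)))) * (shift 1 Q * Q) * (shift 1 G - G)
        - tau2 * (kap (-(1 / 2)) * shift (-(1 / 2)) (kap (1 / 2)))
          * (kap (-(1 / 2)) * shift (-(1 / 2)) (kap (-(1 / 2)))) * (Q * shift (-1) Q)
          * (G - shift (-1) G) := by ring
    _ = _ := by rw [k1, k2, k3, k4]; ring

/-- The properties of the remainder `G = d G₁` in `A = U + Q G` that are used below. -/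
structure Remainder (G₁ : PolySeries) : Prop where
  deg : DegLE 0 G₁
  dvd : d ^ 7 ∣ G₁
  odd : flipU (d * G₁) = -(d * G₁)
  eq : residual (U + Q * (d * G₁)) = 0

/-- The tail of the series of `cos`. -/
def cosTail (G₁ : PolySeries) : PolySeries :=
  entire (fun k => cosCoeff (k + 1)) (tau2 * (Q * (d * G₁)) ^ 2)

/-- The tail of the series of `sin`. -/
def sinTail (G₁ : PolySeries) : PolySeries :=
  entire (fun k => sinCoeff (k + 1)) (tau2 * (Q * (d * G₁)) ^ 2)

/-- Expand the equation around U by the addition theorem. In the part linear in G only the defect of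
Q as a solution of the linearized equation survives the subtraction of G L(Q). The factor d
compensates the excess degree of `sinQ U`. -/
theorem d_mul_Nser {G₁ : PolySeries} (h : Remainder G₁) : d * Nser (d * G₁)
    = d * residual U - (d ^ 2 * (lhs Q - eps ^ 2 * cosQ U * Q)) * G₁
      + (eps ^ 2 * (d * sinQ U)) * (tau2 * (Q * (d * G₁)) ^ 2 * cosTail G₁)
      + (eps ^ 2 * cosQ U * d * Q)
        * ((d * G₁) * (tau2 * (Q * (d * G₁)) ^ 2 * sinTail G₁)) := by
  have hB : d ∣ Q * (d * G₁) := (dvd_mul_right d G₁).mul_left Q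
  have hY := dvd_tau2_mul_sq hB
  have h1 := residual_add d_dvd_U hB
  rw [h.eq] at h1
  have h2 : cosRoot (Q * (d * G₁)) = 1 + tau2 * (Q * (d * G₁)) ^ 2 * cosTail G₁ := by
    rw [cosRoot_eq, entire_eq _ hY, show cosCoeff 0 = 1 by simp [cosCoeff], const_one]; rfl
  have h3 : sinRoot (Q * (d * G₁))
      = Q * (d * G₁) * (1 + tau2 * (Q * (d * G₁)) ^ 2 * sinTail G₁) := by
    rw [sinRoot_eq hB, entire_eq _ hY, show sinCoeff 0 = 1 by simp [sinCoeff], const_one]; rfl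
  rw [h2, h3] at h1
  rw [Nser]
  linear_combination d * h1

theorem Bd.lower_order {H p κ : ℕ} (j : ℕ) {μ : ℝ} {Z : PolySeries} (hZ : Bd H (p + j) κ μ Z) :
    Bd (H + j) p κ (μ * (2 * Real.pi) ^ j) Z := by
  have hpi := Real.pi_pos
  have := hZ.nonneg
  refine ⟨hZ.deg, (pow_dvd_pow d (Nat.le_add_right p j)).trans hZ.dvd, by positivity, fun n hn => ?_⟩
  rcases lt_or_ge n j with h | h
  · rw [nrm, coeff_eq_zero_of_dvd hZ.dvd (by omega), tauNorm_zero]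
    have := wt_pos κ n
    positivity
  · obtain ⟨m, rfl⟩ := Nat.exists_eq_add_of_le h
    rw [← add_assoc]
    refine (hZ.bound m (by omega)).trans ?_
    rw [mul_assoc]
    refine mul_le_mul_of_nonneg_left ?_ hZ.nonneg
    rw [wt, wt, pow_add]
    have : ((m + κ).factorial : ℝ) ≤ (j + m + κ).factorial := by
      exact_mod_cast Nat.factorial_le (by omega)
    calc _ = (2 * Real.pi) ^ j * (((m + κ).factorial : ℝ) / κ.factorial
          / ((2 * Real.pi) ^ j * (2 * Real.pi) ^ m)) := by field_simp
      _ ≤ _ := by gcongr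

/-! ### Factorial bounds for the remainder. -/

/-- The gain from lowering `κ` by `8`. -/
def gain (κ : ℕ) : ℝ := (2 * Real.pi) ^ 8 * (κ.factorial / (κ + 8).factorial)

/-- A quantity that dominates the powers of `κ` which occur, and tends to `0`. -/
def qGain (κ : ℕ) : ℝ := ((κ : ℝ) + 11) ^ 2 * gain κ

theorem gain_nonneg (κ : ℕ) : 0 ≤ gain κ := by
  have := Real.pi_pos
  rw [gain]; positivity

theorem gain_le (κ : ℕ) : gain κ ≤ qGain κ := by
  have := gain_nonneg κ
  rw [qGain]
  exact le_mul_of_one_le_left this (by nlinarith [(Nat.cast_nonneg κ : (0 : ℝ) ≤ κ)])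

theorem mul_gain_le (κ : ℕ) : ((κ : ℝ) + 3) * gain κ ≤ qGain κ := by
  have := gain_nonneg κ
  rw [qGain]
  exact mul_le_mul_of_nonneg_right (by nlinarith [(Nat.cast_nonneg κ : (0 : ℝ) ≤ κ)]) this

theorem tendsto_qGain : Filter.Tendsto qGain Filter.atTop (nhds 0) := by
  have hpi := Real.pi_pos
  have h := (tendsto_one_div_add_atTop_nhds_zero_nat (𝕜 := ℝ)).const_mul ((2 * Real.pi) ^ 8 * 121)
  rw [mul_zero] at h
  refine squeeze_zero (fun κ => mul_nonneg (by positivity) (gain_nonneg κ)) (fun κ => ?_) h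
  have h1 : (κ.factorial : ℝ) * (κ + 1) ^ 8 ≤ (κ + 8).factorial := by
    exact_mod_cast Nat.factorial_mul_pow_le_factorial
  have hk : (0 : ℝ) < κ.factorial := by positivity
  have hκ : (0 : ℝ) ≤ κ := Nat.cast_nonneg κ
  have h2 : (κ.factorial : ℝ) / (κ + 8).factorial ≤ 1 / (κ + 1) ^ 3 := by
    rw [div_le_div_iff₀ (by positivity) (by positivity), one_mul]
    refine le_trans ?_ h1
    gcongr
    · linarith
    · norm_num
  calc qGain κ ≤ (11 * ((κ : ℝ) + 1)) ^ 2 * ((2 * Real.pi) ^ 8 * (1 / (κ + 1) ^ 3)) := by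
        rw [qGain, gain]
        gcongr
        linarith
    _ = _ := by field_simp; ring

theorem Bd.lower_eight {H p κ : ℕ} {μ : ℝ} {Z : PolySeries} (hZ : Bd H (p + 8) (κ + 8) μ Z) :
    Bd (H + 8) p κ (μ * gain κ) Z := hZ.lower 8

/-- The nonlinear terms, estimated in terms of the remainder itself. -/
theorem exists_bd_Nser : ∃ (K₀ : ℝ) (Ψ : ℝ → ℝ → ℝ), 0 ≤ K₀ ∧ (∀ μ, Continuous (Ψ μ)) ∧
    (∀ μ, Ψ μ 0 = K₀) ∧ ∀ (G₁ : PolySeries) (H κ : ℕ) (μ : ℝ), Remainder G₁ →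
      Bd H 7 (κ + 8) μ G₁ → Bd (H + 8) 10 κ (Ψ μ (qGain κ)) (Nser (d * G₁)) := by
  have hpi := Real.pi_pos
  obtain ⟨E, hE, hcE⟩ := exists_eps_sq_eq
  obtain ⟨K1, hK1, h1⟩ := (Conv.d_sq_tau2.mul (Conv.Q.pow 2)).mul_bd
    (q := 2) ((dvd_mul_right _ _).mul_right _)
  obtain ⟨K2, hK2, h2⟩ := (Conv.d.mul Conv.residual_U).bd (q := 11)
    (by rw [pow_succ']; exact mul_dvd_mul_left d d_pow_dvd_residual_U)
  obtain ⟨K3, hK3, h3⟩ := ((Conv.d.pow 2).mul Conv.lhs_Q_sub).mul_bd (q := 12)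
    (by rw [show 12 = 2 + 10 from rfl, pow_add]; exact mul_dvd_mul_left _ d_pow_dvd_lhs_Q_sub)
  obtain ⟨K4, hK4, h4⟩ := ((Conv.d.pow 2).mul (hcE.mul Conv.d_mul_sinQ_U)).mul_bd (q := 3)
    (by rw [pow_succ]; exact mul_dvd_mul_left _ ((dvd_mul_right d _).mul_left _))
  obtain ⟨K5, hK5, h5⟩ := Conv.d.mul_bd (q := 1) (by rw [pow_one])
  obtain ⟨K6, hK6, h6⟩ := ((hcE.mul Conv.d_sq_cosQ_U).mul (Conv.d.mul Conv.Q)).mul_bd (q := 3)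
    (by rw [pow_succ]; exact mul_dvd_mul ((dvd_mul_right _ _).mul_left _) (dvd_mul_right _ _))
  set w : ℝ → ℝ → ℝ := fun μ q => 12 * (K1 * (12 * μ * μ) * q)
    * Real.exp (12 * (K1 * (12 * μ * μ) * q) * (2 * Real.pi) ^ 8) with hw
  -- Only the residual of U contributes without a factor q, so the value at q = 0 does not depend on
  -- μ; this is what closes the induction later.
  refine ⟨K2, fun μ q => K2 + K3 * μ * q + K4 * w μ q + K6 * (12 * K5 * μ * q * w μ q), hK2,
    fun μ => by fun_prop, fun μ => by simp [hw], fun G₁ H κ μ hR hG => ?_⟩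
  have hμ := hG.nonneg
  have hg := gain_nonneg κ
  have hκ : (0 : ℝ) ≤ κ := Nat.cast_nonneg κ
  set y : ℝ := K1 * (12 * ((κ + 8 : ℕ) + 3) * μ * μ) * gain κ with hy
  have hy0 : 0 ≤ y := by positivity
  -- One factor κ + 11 comes from the square of G₁ at level κ + 8, one factor κ + 3 from the product
  -- with the tail at level κ. This explains the square in `qGain`.
  have hyq : (κ + 3) * y ≤ K1 * (12 * μ * μ) * qGain κ := by
    have : ((κ : ℝ) + 3) * ((κ + 8 : ℕ) + 3) * gain κ ≤ qGain κ := by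
      rw [qGain]; push_cast
      exact mul_le_mul_of_nonneg_right (by nlinarith) hg
    calc (κ + 3) * y = K1 * (12 * μ * μ) * (((κ : ℝ) + 3) * ((κ + 8 : ℕ) + 3) * gain κ) := by
          rw [hy]; ring
      _ ≤ _ := by gcongr
  -- Order 2 from d² τ₂ plus 14 from G₁² is 8 + 8: eight orders pay for lowering κ + 8 to κ, and the
  -- horizon advances by eight.
  have hY : Bd (H + 8) 8 κ y (tau2 * (Q * (d * G₁)) ^ 2) := by
    have := (h1 H 14 (κ + 8) _ _ (hG.mul hG)).lower_eight (p := 8)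
    rw [show tau2 * (Q * (d * G₁)) ^ 2 = d ^ 2 * tau2 * Q ^ 2 * (G₁ * G₁) by ring]
    exact this
  have hdY : d ∣ tau2 * (Q * (d * G₁)) ^ 2 := dvd_tau2_mul_sq ((dvd_mul_right d G₁).mul_left Q)
  have hY0 : Bd (H + 8) 0 κ (y * (2 * Real.pi) ^ 8) (tau2 * (Q * (d * G₁)) ^ 2) :=
    (Bd.lower_order (p := 0) 8 (by rw [zero_add]; exact hY)).mono_horizon (by omega)
  have hq0 : 0 ≤ qGain κ := hg.trans (gain_le κ)
  have hw0 : 0 ≤ w μ (qGain κ) := by simp only [hw]; positivity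
  have htail {φ : ℕ → ℂ} (hφ : ∀ k, ‖φ k‖ ≤ 1 / k.factorial) :
      Bd (H + 8) 8 κ (w μ (qGain κ)) (tau2 * (Q * (d * G₁)) ^ 2
        * entire (fun k => φ (k + 1)) (tau2 * (Q * (d * G₁)) ^ 2)) := by
    have hE := hY0.entire hdY (φ := fun k => φ (k + 1)) (fun k => (hφ _).trans
      (one_div_le_one_div_of_le (by positivity) (by exact_mod_cast Nat.factorial_le (by omega))))
    refine (hY.mul hE).mono ?_
    simp only [hw]
    calc 12 * ((κ : ℝ) + 3) * y * Real.exp (12 * (κ + 3) * (y * (2 * Real.pi) ^ 8))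
        = 12 * ((κ + 3) * y) * Real.exp (12 * ((κ + 3) * y) * (2 * Real.pi) ^ 8) := by ring_nf
      _ ≤ _ := by gcongr
  -- The accuracy of Q is used here: 12 + 7 = 11 + 8.
  have t2 : Bd (H + 8) 11 κ (K3 * μ * qGain κ) ((d ^ 2 * (lhs Q - eps ^ 2 * cosQ U * Q)) * G₁) := by
    refine (Bd.lower_eight (p := 11) (h3 H 7 (κ + 8) μ G₁ hG)).mono ?_
    exact mul_le_mul_of_nonneg_left (gain_le κ) (by positivity)
  have t3 : Bd (H + 8) 11 κ (K4 * w μ (qGain κ))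
      ((eps ^ 2 * (d * sinQ U)) * (tau2 * (Q * (d * G₁)) ^ 2 * cosTail G₁)) := by
    have := h4 (H + 8) 8 κ _ _ (htail norm_cosCoeff_le)
    rw [hE, show d ^ 2 * E * (d * sinQ U) = d ^ 2 * (E * (d * sinQ U)) by ring]
    exact this
  have t4 : Bd (H + 8) 11 κ (K6 * (12 * K5 * μ * qGain κ * w μ (qGain κ)))
      ((eps ^ 2 * cosQ U * d * Q) * ((d * G₁) * (tau2 * (Q * (d * G₁)) ^ 2 * sinTail G₁))) := by
    have hdG := Bd.lower_eight (p := 0) (κ := κ) (h5 H 7 (κ + 8) μ G₁ hG)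
    have hp := hdG.mul (htail norm_sinCoeff_le)
    rw [zero_add] at hp
    have hp' : Bd (H + 8) 8 κ (12 * K5 * μ * qGain κ * w μ (qGain κ))
        ((d * G₁) * (tau2 * (Q * (d * G₁)) ^ 2 * sinTail G₁)) := by
      refine hp.mono ?_
      calc 12 * ((κ : ℝ) + 3) * (K5 * μ * gain κ) * w μ (qGain κ)
          = 12 * K5 * μ * (((κ : ℝ) + 3) * gain κ) * w μ (qGain κ) := by ring
        _ ≤ _ := by
          have := mul_gain_le κ
          gcongr
    have := h6 (H + 8) 8 κ _ _ hp'
    rw [hE, show d ^ 2 * E * cosQ U * d * Q = E * (d ^ 2 * cosQ U) * (d * Q) by ring]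
    exact this
  have hdN : Bd (H + 8) 11 κ
      (K2 + K3 * μ * qGain κ + K4 * w μ (qGain κ) + K6 * (12 * K5 * μ * qGain κ * w μ (qGain κ)))
      (d * Nser (d * G₁)) := by
    rw [d_mul_Nser hR]
    exact (((h2 (H + 8) κ).sub t2).add t3).add t4
  refine hdN.of_d_mul ?_
  have hdG : DegLE 0 (d * G₁) := Conv.d.deg.mul hR.deg (by norm_num)
  exact (Conv.Q.deg.mul hdG (by norm_num)).lhs.sub (hdG.mul Conv.Q.deg.lhs (by norm_num))

theorem cf_zero_of_odd {Z : PolySeries} (h : flipU Z = -Z) (n : ℕ) :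
    cf 0 (PowerSeries.coeff n Z) = 0 := by
  have h1 := cf_comp_neg 0 (PowerSeries.coeff n Z)
  rw [coeff_comp_of_odd h, map_neg, pow_zero, one_mul] at h1
  have : (2 : ℂ) * cf 0 (PowerSeries.coeff n Z) = 0 := by linear_combination -h1
  simpa using this

theorem cf_zero_d_sq_tau2 (Z : PolySeries) (n : ℕ) :
    cf 0 (PowerSeries.coeff n (d ^ 2 * tau2 * Z)) = 0 := by
  refine (cf_zero_one_of_dvd ?_).1
  rw [show d ^ 2 * tau2 * Z = tau2 * (d ^ 2 * Z) by ring, tau2_eq, ofPoly, PowerSeries.coeff_C_mul]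
  exact dvd_mul_right _ _

theorem DegLE.nabla {k : ℤ} {Z : PolySeries} (hZ : DegLE k Z) : DegLE k (nabla Z) :=
  (hZ.shift _).sub (hZ.shift _)

theorem nabla_d_sq_mul (Z : PolySeries) : nabla (d ^ 2 * Z) = d ^ 2 * nabla Z := by
  rw [nabla, nabla, map_mul, map_mul, map_pow, map_pow, shift_d, shift_d]; ring

theorem deg_Vser {G : PolySeries} (hG : DegLE 0 G) : DegLE 0 (Vser G) :=
  (((Conv.kap _).mul (Conv.kap _)).mul Conv.PiQ).deg.mul hG.nabla (by norm_num)

/-- The remainder, estimated in terms of the nonlinear terms. -/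
theorem exists_bd_of_Nser : ∃ K : ℝ, 0 ≤ K ∧ ∀ (G₁ : PolySeries) (H κ : ℕ) (ν : ℝ), Remainder G₁ →
    11 ≤ κ → Bd H 10 κ ν (Nser (d * G₁)) → Bd H 7 κ (K * ν) G₁ := by
  obtain ⟨K1, hK1, h1⟩ := (Conv.d_sq_tau2.mul Conv.Q).mul_bd (q := 2)
    ((dvd_mul_right _ _).mul_right _)
  obtain ⟨K2, hK2, h2⟩ := Conv.Mser.mul_bd (q := 0) (by simp)
  refine ⟨8 * (K2 * (3 * Real.exp Real.pi * (8 * K1))), by positivity, fun G₁ H κ ν hR hκ hN => ?_⟩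
  have hdG : DegLE 0 (d * G₁) := Conv.d.deg.mul hR.deg (by norm_num)
  have hV := deg_Vser hdG
  have hF := h1 H 10 κ ν _ hN
  have e : d ^ 2 * tau2 * Q * Nser (d * G₁) = nabla (d ^ 2 * tau2 * Vser (d * G₁)) := by
    rw [mul_assoc (d ^ 2) tau2 (Vser _), nabla_d_sq_mul, nabla_tau2_mul_Vser]; ring
  rw [e] at hF
  -- The orders run 10, 12, 11, 9, 8, 7: multiplication by d² τ₂ Q, inversion of ∇, division by d²
  -- τ₂, inversion of ∇, division by d. The first inversion, at order 11, forces κ ≥ 11.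
  have hW := Bd.of_nabla (p := 11) hF (Conv.d_sq_tau2.deg.mul hV (by norm_num))
    (cf_zero_d_sq_tau2 _) hκ
  have hV' := Bd.of_tau2_mul (p := 9) hW hV
  have hG := h2 H 9 κ _ _ hV'
  rw [← nabla_eq_mul, zero_add] at hG
  have := Bd.of_nabla (p := 8) hG hdG (cf_zero_of_odd hR.odd) (by omega)
  refine (this.of_d_mul hR.deg).mono (le_of_eq ?_)
  ring

/-- First fix μ = K (K₀ + 1), then take κ so large that the nonlinear estimate stays below K₀ + 1.
The bound with this μ then reproduces itself with the horizon advanced by eight, and for horizon 0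
it is vacuous. The form 8m + 11 prepares the descent to 11. -/
theorem Remainder.exists_bd {G₁ : PolySeries} (hR : Remainder G₁) :
    ∃ (m : ℕ) (μ : ℝ), ∀ H, Bd H 7 (8 * m + 11) μ G₁ := by
  obtain ⟨K₀, Ψ, hK₀, hc, hz, hN⟩ := exists_bd_Nser
  obtain ⟨K, hK, hG⟩ := exists_bd_of_Nser
  set μ := K * (K₀ + 1) with hμ
  have hμ0 : 0 ≤ μ := by positivity
  have ht : Filter.Tendsto (fun κ => Ψ μ (qGain κ)) Filter.atTop (nhds K₀) := by
    have := ((hc μ).tendsto 0).comp tendsto_qGain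
    rwa [hz] at this
  have hev := ht.eventually_le_const (lt_add_one K₀)
  obtain ⟨κ₀, hκ₀⟩ := Filter.eventually_atTop.mp hev
  set κ := 8 * κ₀ + 11 with hκ
  have hstep (H : ℕ) (h : Bd H 7 (κ + 8) μ G₁) : Bd (H + 8) 7 (κ + 8) μ G₁ := by
    have h1 := (hN G₁ H κ μ hR h).mono (hκ₀ κ (by omega))
    exact (hG G₁ (H + 8) κ _ hR (by omega) h1).mono_kappa 8
  have hall (j : ℕ) : Bd (8 * j) 7 (κ + 8) μ G₁ := by
    induction j with
    | zero => exact ⟨hR.deg, hR.dvd, hμ0, fun n hn => by omega⟩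
    | succ j ih => exact hstep _ ih
  exact ⟨κ₀ + 1, μ, fun H => by
    have := (hall H).mono_horizon (show H ≤ 8 * H by omega)
    rwa [show 8 * (κ₀ + 1) + 11 = κ + 8 by omega]⟩

/-- No smallness is needed any more: with all horizons available, each application of the two
estimates lowers κ by eight. The descent stops at 11, where the inversion of ∇ ceases to apply. -/
theorem Remainder.exists_bd_eleven {G₁ : PolySeries} (hR : Remainder G₁) :
    ∃ μ : ℝ, ∀ H, Bd H 7 11 μ G₁ := by
  obtain ⟨m, h⟩ := hR.exists_bd
  induction m with
  | zero => exact h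
  | succ m ih =>
    obtain ⟨μ, h⟩ := h
    obtain ⟨K₀, Ψ, hK₀, hc, hz, hN⟩ := exists_bd_Nser
    obtain ⟨K, hK, hG⟩ := exists_bd_of_Nser
    refine ih ⟨K * Ψ μ (qGain (8 * m + 11)), fun H => ?_⟩
    exact (hG G₁ (H + 8) _ _ hR (by omega) (hN G₁ H (8 * m + 11) μ hR (h H))).mono_horizon (by omega)

/-- The estimate of the nonlinear terms alone, without inverting ∇, can be used once more and
reaches κ = 3. -/
theorem Remainder.exists_bd_Nser {G₁ : PolySeries} (hR : Remainder G₁) :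
    ∃ μ : ℝ, ∀ H, Bd H 10 3 μ (Nser (d * G₁)) := by
  obtain ⟨μ, h⟩ := hR.exists_bd_eleven
  obtain ⟨K₀, Ψ, hK₀, hc, hz, hN⟩ := PolySeries.exists_bd_Nser
  exact ⟨Ψ μ (qGain 3), fun H => (hN G₁ H 3 μ hR (h H)).mono_horizon (by omega)⟩

/-! ### Series with coefficients of size `(n - k)! / (2π)ⁿ` -/

/-- The weight `(n - k)! / (2π)ⁿ`, where the subtraction is truncated. -/
def gw (k n : ℕ) : ℝ := ((n - k).factorial : ℝ) / (2 * Real.pi) ^ n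

theorem gw_pos (k n : ℕ) : 0 < gw k n := by
  have := Real.pi_pos
  rw [gw]; positivity

theorem gw_anti {k l : ℕ} (h : k ≤ l) (n : ℕ) : gw l n ≤ gw k n := by
  have := Real.pi_pos
  rw [gw, gw]
  have : ((n - l).factorial : ℝ) ≤ (n - k).factorial := by
    exact_mod_cast Nat.factorial_le (by omega)
  gcongr

theorem gw_succ (k n : ℕ) : 2 * Real.pi * gw (k + 1) (n + 1) = gw k n := by
  have := Real.pi_pos
  rw [gw, gw, show n + 1 - (k + 1) = n - k by omega, pow_succ]
  field_simp

/-- Polynomial series `Z` with `‖Z‖ₙ = O((n - k)! / (2π)ⁿ)`. -/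
structure Gev (k : ℕ) (Z : PolySeries) : Prop where
  deg : DegLE 0 Z
  bound : ∃ C, ∀ n, nrm n Z ≤ C * gw k n

theorem Gev.exists_nonneg {k : ℕ} {Z : PolySeries} (hZ : Gev k Z) :
    ∃ C, 0 ≤ C ∧ ∀ n, nrm n Z ≤ C * gw k n := by
  obtain ⟨C, hC⟩ := hZ.bound
  refine ⟨C, ?_, hC⟩
  exact nonneg_of_mul_nonneg_left ((nrm_nonneg 0 Z).trans (hC 0)) (gw_pos k 0)

theorem Gev.add {k : ℕ} {Z Y : PolySeries} (hZ : Gev k Z) (hY : Gev k Y) : Gev k (Z + Y) := by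
  obtain ⟨C, hC⟩ := hZ.bound
  obtain ⟨D, hD⟩ := hY.bound
  exact ⟨hZ.deg.add hY.deg, C + D, fun n => (nrm_add_le n Z Y).trans (by
    rw [add_mul]; exact add_le_add (hC n) (hD n))⟩

theorem Gev.neg {k : ℕ} {Z : PolySeries} (hZ : Gev k Z) : Gev k (-Z) := by
  obtain ⟨C, hC⟩ := hZ.bound
  exact ⟨hZ.deg.neg, C, fun n => by rw [nrm_neg]; exact hC n⟩

theorem Gev.sub {k : ℕ} {Z Y : PolySeries} (hZ : Gev k Z) (hY : Gev k Y) : Gev k (Z - Y) := by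
  rw [sub_eq_add_neg]; exact hZ.add hY.neg

theorem Gev.d_mul {k : ℕ} {Z : PolySeries} (hZ : Gev k Z) : Gev (k + 1) (d * Z) := by
  have hpi := Real.pi_pos
  obtain ⟨C, h0, hC⟩ := hZ.exists_nonneg
  refine ⟨Conv.d.deg.mul hZ.deg (by norm_num), Real.pi / 2 * C * (2 * Real.pi), fun n => ?_⟩
  cases n with
  | zero =>
    rw [nrm, d, PowerSeries.coeff_zero_X_mul, tauNorm_zero]
    have := gw_pos (k + 1) 0
    positivity
  | succ n =>
    rw [nrm_d_mul hZ.deg, mul_assoc, mul_assoc, gw_succ]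
    exact mul_le_mul_of_nonneg_left (hC n) (by positivity)

theorem Gev.of_d_mul {k : ℕ} {Z : PolySeries} (hZ : Gev (k + 1) (d * Z)) (hd : DegLE 0 Z) :
    Gev k Z := by
  have hpi := Real.pi_pos
  obtain ⟨C, h0, hC⟩ := hZ.exists_nonneg
  refine ⟨hd, C, fun n => ?_⟩
  have h := hC (n + 1)
  rw [nrm_d_mul hd] at h
  have h1 := nrm_nonneg n Z
  have h2 := gw_pos (k + 1) (n + 1)
  have h3 : 1 ≤ Real.pi / 2 := by linarith [Real.two_le_pi]
  have h4 : 1 ≤ 2 * Real.pi := by linarith [Real.two_le_pi]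
  calc nrm n Z ≤ Real.pi / 2 * nrm n Z := le_mul_of_one_le_left h1 h3
    _ ≤ C * gw (k + 1) (n + 1) := h
    _ ≤ C * (2 * Real.pi * gw (k + 1) (n + 1)) :=
        mul_le_mul_of_nonneg_left (le_mul_of_one_le_left h2.le h4) h0
    _ = _ := by rw [gw_succ]

theorem Gev.of_tau2_mul {k : ℕ} {Z : PolySeries} (hZ : Gev (k + 2) (d ^ 2 * tau2 * Z))
    (hd : DegLE 0 Z) : Gev k Z := by
  have hpi := Real.pi_pos
  obtain ⟨C, h0, hC⟩ := hZ.exists_nonneg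
  refine ⟨hd, 3 * Real.exp Real.pi * C, fun n => ?_⟩
  have h4 : 1 ≤ (2 * Real.pi) * (2 * Real.pi) := by nlinarith [Real.two_le_pi]
  have h2 := gw_pos (k + 2) (n + 2)
  calc nrm n Z ≤ 3 * Real.exp Real.pi * nrm (n + 2) (d ^ 2 * tau2 * Z) := nrm_tau2_le hd n
    _ ≤ 3 * Real.exp Real.pi * (C * gw (k + 2) (n + 2)) := by gcongr; exact hC _
    _ ≤ 3 * Real.exp Real.pi * (C * ((2 * Real.pi) * (2 * Real.pi) * gw (k + 2) (n + 2))) := by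
        gcongr
        exact le_mul_of_one_le_left h2.le h4
    _ = _ := by rw [mul_assoc (2 * Real.pi), gw_succ, gw_succ]; ring

theorem pow_le_factorial_sub {b : ℝ} (hb : 0 ≤ b) (m i : ℕ) :
    b ^ i ≤ (1 + b) ^ m * Real.exp b * (i - m).factorial := by
  rcases lt_or_ge i m with h | h
  · rw [show i - m = 0 by omega, Nat.factorial_zero, Nat.cast_one, mul_one]
    calc b ^ i ≤ (1 + b) ^ i := by gcongr; linarith
      _ ≤ (1 + b) ^ m := pow_le_pow_right₀ (by linarith) h.le
      _ ≤ _ := le_mul_of_one_le_right (by positivity) (Real.one_le_exp hb)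
  · obtain ⟨j, rfl⟩ := Nat.exists_eq_add_of_le h
    rw [show m + j - m = j by omega, pow_add, mul_assoc]
    have h1 := Real.pow_div_factorial_le_exp b hb j
    rw [div_le_iff₀ (by positivity)] at h1
    gcongr
    linarith

theorem Conv.mul_gev {q k : ℕ} {Z Y : PolySeries} (hZ : Conv Z) (hq : PolySeries.d ^ q ∣ Z)
    (hY : Gev k Y) : Gev (k + q) (Z * Y) := by
  have hpi := Real.pi_pos
  obtain ⟨C, a, hC, ha, hZb⟩ := hZ.exists_le
  obtain ⟨D, hD, hYb⟩ := hY.exists_nonneg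
  -- With this b, aⁱ equals bⁱ divided by (2π)ⁱ 2ⁱ: bⁱ is absorbed by a factorial, and 2⁻ⁱ makes the
  -- convolution sum geometric.
  set b : ℝ := 4 * Real.pi * a with hb
  have hb0 : 0 ≤ b := by positivity
  set K : ℝ := (1 + b) ^ (q + k) * Real.exp b with hK
  have hK0 : 0 ≤ K := by positivity
  refine ⟨hZ.deg.mul hY.deg (by norm_num), 12 * (C * D * K * 2), fun n => ?_⟩
  have hw := gw_pos (k + q) n
  have hterm (i : ℕ) (hi : i ∈ Finset.range (n + 1)) :
      nrm i Z * nrm (n - i) Y ≤ C * D * K * gw (k + q) n * (1 / 2) ^ i := by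
    have hin : i ≤ n := by have := Finset.mem_range.mp hi; omega
    rcases lt_or_ge i q with h | h
    · rw [nrm, coeff_eq_zero_of_dvd hq h, tauNorm_zero, zero_mul]
      positivity
    · have h1 : a ^ i * gw k (n - i) ≤ K * gw (k + q) n * (1 / 2) ^ i := by
        have e : (2 * Real.pi) ^ n = (2 * Real.pi) ^ (n - i) * (2 * Real.pi) ^ i := by
          rw [← pow_add]; congr 1; omega
        have e2 : a ^ i = b ^ i / ((2 * Real.pi) ^ i * 2 ^ i) := by
          rw [hb, ← mul_pow, ← div_pow]; congr 1; field_simp; ring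
        have h2 : ((n - i - k).factorial : ℝ) * (i - (q + k)).factorial
            ≤ (n - (k + q)).factorial := by
          have := Nat.le_of_dvd (Nat.factorial_pos _)
            (Nat.factorial_mul_factorial_dvd_factorial_add (n - i - k) (i - (q + k)))
          exact_mod_cast this.trans (Nat.factorial_le (by omega))
        have h3 := pow_le_factorial_sub hb0 (q + k) i
        rw [gw, gw, e, e2]
        calc b ^ i / ((2 * Real.pi) ^ i * 2 ^ i) * ((n - i - k).factorial / (2 * Real.pi) ^ (n - i))
            ≤ (K * (i - (q + k)).factorial) / ((2 * Real.pi) ^ i * 2 ^ i)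
              * ((n - i - k).factorial / (2 * Real.pi) ^ (n - i)) := by gcongr
          _ = K * ((((n - i - k).factorial : ℝ) * (i - (q + k)).factorial)
              / ((2 * Real.pi) ^ (n - i) * (2 * Real.pi) ^ i)) * (1 / 2) ^ i := by
              rw [div_pow, one_pow]; field_simp
          _ ≤ _ := by gcongr
      calc nrm i Z * nrm (n - i) Y ≤ (C * a ^ i) * (D * gw k (n - i)) :=
            mul_le_mul (hZb i) (hYb _) (nrm_nonneg _ _) (by positivity)
        _ = C * D * (a ^ i * gw k (n - i)) := by ring
        _ ≤ C * D * (K * gw (k + q) n * (1 / 2) ^ i) := by gcongr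
        _ = _ := by ring
  calc nrm n (Z * Y) ≤ 12 * ∑ i ∈ Finset.range (n + 1), nrm i Z * nrm (n - i) Y :=
        nrm_mul_le hZ.deg hY.deg n
    _ ≤ 12 * ∑ i ∈ Finset.range (n + 1), C * D * K * gw (k + q) n * (1 / 2) ^ i := by
        exact mul_le_mul_of_nonneg_left (Finset.sum_le_sum hterm) (by norm_num)
    _ = 12 * (C * D * K * gw (k + q) n * ∑ i ∈ Finset.range (n + 1), (1 / 2 : ℝ) ^ i) := by
        rw [← Finset.mul_sum]
    _ ≤ 12 * (C * D * K * gw (k + q) n * 2) := by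
        gcongr
        exact sum_geometric_two_le (n + 1)
    _ = _ := by ring

theorem Gev.one (k : ℕ) : Gev k 1 := by
  refine ⟨DegLE.one, 1, fun n => ?_⟩
  rw [nrm_one, one_mul]
  split_ifs with h
  · rw [h, gw]; simp
  · exact (gw_pos k n).le

theorem Conv.gev {Z : PolySeries} (hZ : Conv Z) (k : ℕ) : Gev k Z := by
  have := hZ.mul_gev (q := 0) (by simp) (Gev.one k)
  rwa [mul_one] at this

theorem Gev.const_mul {k : ℕ} {Z : PolySeries} (c : ℂ) (hZ : Gev k Z) : Gev k (const c * Z) := by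
  have := (Conv.const c).mul_gev (q := 0) (by simp) hZ
  exact this

/-! ### Comparison of the weights with powers -/

theorem factorial_sub_mul_pow_le (σ j : ℕ) :
    (j - σ).factorial * (j + 1) ^ σ ≤ (σ + 1) ^ σ * j.factorial := by
  rcases lt_or_ge j σ with h | h
  · rw [show j - σ = 0 by omega, Nat.factorial_zero, one_mul]
    exact (Nat.pow_le_pow_left (by omega) σ).trans
      (Nat.le_mul_of_pos_right _ (Nat.factorial_pos j))
  · obtain ⟨m, rfl⟩ := Nat.exists_eq_add_of_le h
    have h1 : (σ + m + 1) ^ σ ≤ (σ + 1) ^ σ * (m + 1) ^ σ := by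
      rw [← mul_pow]
      exact Nat.pow_le_pow_left (by nlinarith) σ
    calc (σ + m - σ).factorial * (σ + m + 1) ^ σ
        ≤ m.factorial * ((σ + 1) ^ σ * (m + 1) ^ σ) := by
          rw [Nat.add_sub_cancel_left]; gcongr
      _ = (σ + 1) ^ σ * (m.factorial * (m + 1) ^ σ) := by ring
      _ ≤ (σ + 1) ^ σ * (m + σ).factorial := by
          gcongr; exact Nat.factorial_mul_pow_le_factorial
      _ = _ := by rw [add_comm m σ]

theorem factorial_le_factorial_sub_mul_pow (m i : ℕ) :
    i.factorial ≤ (i - m).factorial * (i + 2) ^ m := by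
  rcases lt_or_ge i m with h | h
  · rw [show i - m = 0 by omega, Nat.factorial_zero, one_mul]
    calc i.factorial ≤ i ^ i := Nat.factorial_le_pow i
      _ ≤ (i + 2) ^ i := Nat.pow_le_pow_left (by omega) i
      _ ≤ _ := Nat.pow_le_pow_right (by omega) h.le
  · rw [← Nat.factorial_mul_descFactorial h]
    gcongr
    exact (Nat.descFactorial_le_pow i m).trans (Nat.pow_le_pow_left (by omega) m)

/-- Two of the σ factors telescope; the other σ - 2 are bounded by their value at the start of the
tail. -/
theorem sum_one_div_pow_le {σ : ℕ} (hσ : 2 ≤ σ) (N M : ℕ) :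
    ∑ j ∈ Finset.range M, 1 / ((j : ℝ) + N + 2) ^ σ ≤ 1 / ((N : ℝ) + 1) ^ (σ - 1) := by
  have hN : (0 : ℝ) ≤ N := Nat.cast_nonneg N
  suffices h : ∑ j ∈ Finset.range M, 1 / ((j : ℝ) + N + 2) ^ σ
      ≤ 1 / ((N : ℝ) + 1) ^ (σ - 2) * (1 / (N + 1) - 1 / (M + N + 1)) by
    refine h.trans ?_
    rw [show σ - 1 = σ - 2 + 1 by omega, pow_succ, one_div_mul_eq_div, one_div, one_div, one_div,
      mul_inv, div_eq_mul_inv, mul_comm]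
    gcongr
    have : (0 : ℝ) ≤ ((M : ℝ) + N + 1)⁻¹ := by positivity
    linarith
  induction M with
  | zero => simp
  | succ M ih =>
    have hM : (0 : ℝ) ≤ M := Nat.cast_nonneg M
    rw [Finset.sum_range_succ]
    refine (add_le_add_left ih _).trans ?_
    have h1 : 1 / ((M : ℝ) + N + 2) ^ σ
        ≤ 1 / ((N : ℝ) + 1) ^ (σ - 2) * (1 / (M + N + 1) - 1 / (M + N + 2)) := by
      have h2 : 1 / ((M : ℝ) + N + 2) ^ 2 ≤ 1 / (M + N + 1) - 1 / (M + N + 2) := by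
        rw [div_sub_div _ _ (by positivity) (by positivity),
          div_le_div_iff₀ (by positivity) (by positivity)]
        nlinarith
      calc 1 / ((M : ℝ) + N + 2) ^ σ
          = 1 / ((M : ℝ) + N + 2) ^ (σ - 2) * (1 / (M + N + 2) ^ 2) := by
            rw [one_div_mul_one_div, ← pow_add]; congr 2; omega
        _ ≤ 1 / ((N : ℝ) + 1) ^ (σ - 2) * (1 / (M + N + 2) ^ 2) := by
            gcongr
            · linarith
            · norm_num
        _ ≤ _ := by gcongr
    push_cast
    calc _ ≤ 1 / ((N : ℝ) + 1) ^ (σ - 2) * (1 / (N + 1) - 1 / (M + N + 1))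
          + 1 / ((N : ℝ) + 1) ^ (σ - 2) * (1 / (M + N + 1) - 1 / (M + N + 2)) := by gcongr
      _ = _ := by rw [← mul_add]; congr 1; ring

/-! ### Extraction of the leading asymptotics -/

/-- The convolution is rᴺ times a partial sum of the series of g j / rʲ, which converges absolutely;
c is its sum and the error is its tail. The tail estimate costs one power of N. -/
theorem exists_geometric_limit {σ : ℕ} (hσ : 2 ≤ σ) {g : ℕ → ℂ} {C : ℝ} (hC : 0 ≤ C)
    (hg : ∀ j, ‖g j‖ ≤ C / (2 * Real.pi) ^ j / ((j : ℝ) + 1) ^ σ) {r : ℂ}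
    (hr : ‖r‖ = (2 * Real.pi)⁻¹) :
    ∃ c : ℂ, ∀ N : ℕ, ‖(∑ s ∈ Finset.range (N + 1), r ^ s * g (N - s)) - c * r ^ N‖
      ≤ C / (2 * Real.pi) ^ N / ((N : ℝ) + 1) ^ (σ - 1) := by
  have hpi := Real.pi_pos
  have hr0 : r ≠ 0 := by
    rw [← norm_pos_iff, hr]; positivity
  have hb (j : ℕ) : ‖g j / r ^ j‖ ≤ C * (1 / ((j : ℝ) + 1) ^ σ) := by
    rw [norm_div, norm_pow, hr, inv_pow, div_inv_eq_mul]
    calc ‖g j‖ * (2 * Real.pi) ^ j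
        ≤ C / (2 * Real.pi) ^ j / ((j : ℝ) + 1) ^ σ * (2 * Real.pi) ^ j := by gcongr; exact hg j
      _ = _ := by field_simp
  have hs : Summable fun j : ℕ => C * (1 / ((j : ℝ) + 1) ^ σ) := by
    refine Summable.mul_left C ?_
    have := (summable_nat_add_iff 1).mpr (Real.summable_one_div_nat_pow.mpr (show 1 < σ by omega))
    simpa using this
  have hsb : Summable fun j => g j / r ^ j := Summable.of_norm_bounded hs hb
  refine ⟨∑' j, g j / r ^ j, fun N => ?_⟩
  have e1 : ∑ s ∈ Finset.range (N + 1), r ^ s * g (N - s)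
      = r ^ N * ∑ j ∈ Finset.range (N + 1), g j / r ^ j := by
    rw [← Finset.sum_range_reflect, Finset.mul_sum]
    refine Finset.sum_congr rfl fun s hs => ?_
    have hsN : s ≤ N := by have := Finset.mem_range.mp hs; omega
    rw [show N + 1 - 1 - s = N - s by omega, show N - (N - s) = s by omega,
      ← pow_sub_mul_pow r hsN]
    field_simp
  have e2 := hsb.sum_add_tsum_nat_add (N + 1)
  rw [e1, ← e2, mul_comm _ (r ^ N), ← mul_sub, sub_add_cancel_left, norm_mul, norm_neg, norm_pow,
    hr]
  have hs' : Summable fun j : ℕ => C * (1 / (((j + (N + 1) : ℕ) : ℝ) + 1) ^ σ) :=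
    (summable_nat_add_iff (N + 1)).mpr hs
  have h1 : ‖∑' j, g (j + (N + 1)) / r ^ (j + (N + 1))‖ ≤ C * (1 / ((N : ℝ) + 1) ^ (σ - 1)) := by
    refine (tsum_of_norm_bounded hs'.hasSum fun j => hb _).trans ?_
    refine Real.tsum_le_of_sum_range_le (fun j => by positivity) fun M => ?_
    rw [← Finset.mul_sum]
    refine mul_le_mul_of_nonneg_left ?_ hC
    refine le_trans (le_of_eq ?_) (sum_one_div_pow_le hσ N M)
    refine Finset.sum_congr rfl fun j _ => ?_
    push_cast
    ring
  refine (mul_le_mul_of_nonneg_left h1 (by positivity)).trans (le_of_eq ?_)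
  rw [inv_pow]
  ring

theorem exists_sum_two_pow_le (σ : ℕ) : ∃ K : ℝ, 0 ≤ K ∧ ∀ N : ℕ,
    ∑ s ∈ Finset.range (N + 1), (1 / 2 : ℝ) ^ s * ((s : ℝ) + 1) ^ σ ≤ K := by
  have h := summable_pow_mul_geometric_of_norm_lt_one (R := ℝ) σ (r := 1 / 2) (by norm_num)
  have h1 : Summable fun s : ℕ => (1 / 2 : ℝ) ^ s * ((s : ℝ) + 1) ^ σ := by
    refine (((summable_nat_add_iff 1).mpr h).mul_left 2).congr fun s => ?_
    push_cast
    ring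
  exact ⟨_, tsum_nonneg fun s => by positivity, fun N =>
    h1.sum_le_tsum _ fun s _ => by positivity⟩

/-- Split the csch coefficients into the two geometric sequences and the part coming from the
farther poles. The latter decays faster by 2⁻ˢ and contributes only to the error. -/
theorem exists_csch_asymptotics {σ : ℕ} (hσ : 2 ≤ σ) {g : ℕ → ℂ} {C : ℝ} (hC : 0 ≤ C)
    (hg : ∀ j, ‖g j‖ ≤ C / (2 * Real.pi) ^ j / ((j : ℝ) + 1) ^ σ) :
    ∃ (c₁ c₂ : ℂ) (K : ℝ), 0 ≤ K ∧ ∀ N : ℕ,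
      ‖(∑ s ∈ Finset.range (N + 1), cschCoeff s * g (N - s)) - (c₁ * rr ^ N + c₂ * (-rr) ^ N)‖
        ≤ K / (2 * Real.pi) ^ N / ((N : ℝ) + 1) ^ (σ - 1) := by
  have hpi := Real.pi_pos
  obtain ⟨c₁, h1⟩ := exists_geometric_limit hσ hC hg norm_rr
  obtain ⟨c₂, h2⟩ := exists_geometric_limit hσ hC hg ((norm_neg rr).trans norm_rr)
  obtain ⟨K, hK, hKs⟩ := exists_sum_two_pow_le σ
  refine ⟨c₁, c₂, 8 * C * K + C + C, by positivity, fun N => ?_⟩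
  have hN : (0 : ℝ) ≤ N := Nat.cast_nonneg N
  have h3 : ‖∑ s ∈ Finset.range (N + 1), (cschCoeff s - (rr ^ s + (-rr) ^ s)) * g (N - s)‖
      ≤ 8 * C * K / (2 * Real.pi) ^ N / ((N : ℝ) + 1) ^ (σ - 1) := by
    have hterm (s : ℕ) (hs : s ∈ Finset.range (N + 1)) :
        ‖(cschCoeff s - (rr ^ s + (-rr) ^ s)) * g (N - s)‖
          ≤ 8 * C / (2 * Real.pi) ^ N / ((N : ℝ) + 1) ^ σ
            * ((1 / 2 : ℝ) ^ s * ((s : ℝ) + 1) ^ σ) := by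
      have hsN : s ≤ N := by have := Finset.mem_range.mp hs; omega
      obtain ⟨j, rfl⟩ := Nat.exists_eq_add_of_le hsN
      rw [norm_mul, Nat.add_sub_cancel_left]
      have hj : (0 : ℝ) ≤ j := Nat.cast_nonneg j
      have hs0 : (0 : ℝ) ≤ s := Nat.cast_nonneg s
      have h4 : (((s + j : ℕ) : ℝ) + 1) ^ σ ≤ ((s : ℝ) + 1) ^ σ * ((j : ℝ) + 1) ^ σ := by
        rw [← mul_pow]
        gcongr
        push_cast
        nlinarith
      calc _ ≤ 8 / (4 * Real.pi) ^ s * (C / (2 * Real.pi) ^ j / ((j : ℝ) + 1) ^ σ) :=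
            mul_le_mul (norm_cschCoeff_sub_le s) (hg j) (norm_nonneg _) (by positivity)
        _ = 8 * C / (2 * Real.pi) ^ (s + j) * (1 / 2 : ℝ) ^ s * (1 / ((j : ℝ) + 1) ^ σ) := by
            rw [pow_add, show 4 * Real.pi = 2 * (2 * Real.pi) by ring, mul_pow 2 (2 * Real.pi),
              div_pow, one_pow]
            field_simp
        _ ≤ 8 * C / (2 * Real.pi) ^ (s + j) * (1 / 2 : ℝ) ^ s
            * (((s : ℝ) + 1) ^ σ / (((s + j : ℕ) : ℝ) + 1) ^ σ) := by
            refine mul_le_mul_of_nonneg_left ?_ (by positivity)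
            rw [div_le_div_iff₀ (by positivity) (by positivity), one_mul]
            exact h4
        _ = _ := by field_simp
    refine (norm_sum_le_of_le _ hterm).trans ?_
    rw [← Finset.mul_sum]
    calc _ ≤ 8 * C / (2 * Real.pi) ^ N / ((N : ℝ) + 1) ^ σ * K := by gcongr; exact hKs N
      _ ≤ 8 * C / (2 * Real.pi) ^ N / ((N : ℝ) + 1) ^ (σ - 1) * K := by
          gcongr
          · linarith
          · omega
      _ = _ := by ring
  have e : (∑ s ∈ Finset.range (N + 1), cschCoeff s * g (N - s)) - (c₁ * rr ^ N + c₂ * (-rr) ^ N)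
      = ∑ s ∈ Finset.range (N + 1), (cschCoeff s - (rr ^ s + (-rr) ^ s)) * g (N - s)
        + ((∑ s ∈ Finset.range (N + 1), rr ^ s * g (N - s)) - c₁ * rr ^ N)
        + ((∑ s ∈ Finset.range (N + 1), (-rr) ^ s * g (N - s)) - c₂ * (-rr) ^ N) := by
    simp only [sub_mul, add_mul, Finset.sum_sub_distrib, Finset.sum_add_distrib]
    ring
  rw [e, add_div, add_div, add_div, add_div]
  exact norm_add₃_le.trans (add_le_add (add_le_add h3 (h1 N)) (h2 N))

/-- On the l-th diagonal an index K means K - 1 - l powers of 1 / j relative to j!, the decay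
required by `exists_csch_asymptotics`. -/
theorem norm_cf_nabla_le {K l : ℕ} (h : l + 1 ≤ K) {F : PolySeries} {C : ℝ} (hC : 0 ≤ C)
    (hF : ∀ n, nrm n F ≤ C * gw K n) (j : ℕ) :
    ‖cf (j + 1) (PowerSeries.coeff (j + 1 + l) F) / (j.factorial : ℂ)‖
      ≤ C * (((K - 1 - l : ℕ) : ℝ) + 1) ^ (K - 1 - l) / (2 * Real.pi) ^ j
        / ((j : ℝ) + 1) ^ (K - 1 - l) := by
  have hpi := Real.pi_pos
  set σ := K - 1 - l with hσ
  have h1 := (norm_cf_le (show j + 1 ≤ j + 1 + l by omega)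
    (PowerSeries.coeff (j + 1 + l) F)).trans (hF (j + 1 + l))
  have h2 : ‖cf (j + 1) (PowerSeries.coeff (j + 1 + l) F)‖ ≤ C * gw K (j + 1 + l) := by
    refine le_trans (le_mul_of_one_le_right (norm_nonneg _) ?_) h1
    exact one_le_pow₀ (by linarith [Real.two_le_pi])
  have h3 : gw K (j + 1 + l) ≤ (j - σ).factorial / (2 * Real.pi) ^ j := by
    rw [gw, show j + 1 + l - K = j - σ by omega]
    gcongr
    · linarith [Real.two_le_pi]
    · omega
  have h4 : ((j - σ).factorial : ℝ) * ((j : ℝ) + 1) ^ σ ≤ ((σ : ℝ) + 1) ^ σ * j.factorial := by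
    exact_mod_cast factorial_sub_mul_pow_le σ j
  rw [norm_div, Complex.norm_natCast, div_le_iff₀ (by positivity)]
  calc _ ≤ C * ((j - σ).factorial / (2 * Real.pi) ^ j) :=
        h2.trans (mul_le_mul_of_nonneg_left h3 hC)
    _ = C / (2 * Real.pi) ^ j / ((j : ℝ) + 1) ^ σ
        * ((j - σ).factorial * ((j : ℝ) + 1) ^ σ) := by field_simp
    _ ≤ C / (2 * Real.pi) ^ j / ((j : ℝ) + 1) ^ σ * (((σ : ℝ) + 1) ^ σ * j.factorial) := by gcongr
    _ = _ := by ring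

/-- The asymptotics of the coefficients on the `l`-th diagonal. -/
theorem exists_cf_asymptotics {K l : ℕ} (h : l + 3 ≤ K) {Z : PolySeries} (hF : Gev K (nabla Z)) :
    ∃ (c₁ c₂ : ℂ) (C : ℝ), 0 ≤ C ∧ ∀ i : ℕ,
      ‖cf (i + 1) (PowerSeries.coeff (i + 1 + l) Z)
        - i.factorial * (c₁ * rr ^ (i + 1) + c₂ * (-rr) ^ (i + 1))‖
          ≤ C * gw (K - 1) (i + 1 + l) := by
  have hpi := Real.pi_pos
  obtain ⟨C, hC, hb⟩ := hF.exists_nonneg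
  obtain ⟨c₁, c₂, D, hD, hc⟩ := exists_csch_asymptotics (σ := K - 1 - l) (by omega)
    (by positivity) (norm_cf_nabla_le (l := l) (by omega) hC hb)
  refine ⟨c₁, c₂, D * (2 * Real.pi) ^ l, by positivity, fun i => ?_⟩
  have h1 := hc (i + 1)
  rw [← cf_eq_of_nabla] at h1
  have hi : (i.factorial : ℂ) ≠ 0 := Nat.cast_ne_zero.mpr (Nat.factorial_ne_zero i)
  have e : cf (i + 1) (PowerSeries.coeff (i + 1 + l) Z)
        - i.factorial * (c₁ * rr ^ (i + 1) + c₂ * (-rr) ^ (i + 1))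
      = i.factorial * (cf (i + 1) (PowerSeries.coeff (i + 1 + l) Z) / i.factorial
        - (c₁ * rr ^ (i + 1) + c₂ * (-rr) ^ (i + 1))) := by
    field_simp
  rw [e, norm_mul, Complex.norm_natCast]
  have h2 : (i.factorial : ℝ) ≤ (i - (K - 1 - l - 1)).factorial * ((i : ℝ) + 2) ^ (K - 1 - l - 1) := by
    exact_mod_cast factorial_le_factorial_sub_mul_pow _ i
  have e2 : (((i + 1 : ℕ) : ℝ) + 1) = (i : ℝ) + 2 := by push_cast; ring
  rw [e2] at h1
  calc _ ≤ ((i - (K - 1 - l - 1)).factorial * ((i : ℝ) + 2) ^ (K - 1 - l - 1))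
        * (D / (2 * Real.pi) ^ (i + 1) / ((i : ℝ) + 2) ^ (K - 1 - l - 1)) := by gcongr
    _ = _ := by
      rw [gw, show i + 1 + l - (K - 1) = i - (K - 1 - l - 1) by omega, pow_add _ (i + 1) l]
      field_simp

theorem exists_sum_norm_cf_le {K L : ℕ} (h : L + 1 ≤ K) {Z : PolySeries} (hF : Gev K (nabla Z)) :
    ∃ C : ℝ, 0 ≤ C ∧ ∀ n : ℕ,
      ∑ i ∈ Finset.range (n - L), ‖cf (i + 1) (PowerSeries.coeff n Z)‖ * (Real.pi / 2) ^ (n - 1 - i)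
        ≤ C * (gw (K - 1) n + gw (L + 1) n
          * ∑ m ∈ Finset.range (n - L), ((m - (K - 1 - L)).factorial : ℝ) / m.factorial) := by
  have hpi := Real.pi_pos
  obtain ⟨C, hC, hb⟩ := hF.exists_nonneg
  refine ⟨4 * C, by positivity, fun n => (sum_norm_cf_le L n Z).trans ?_⟩
  have hp : 1 ≤ 2 * Real.pi := by linarith [Real.two_le_pi]
  have h1 : 4 * nrm (n + 1) (nabla Z) ≤ 4 * C * gw (K - 1) n := by
    have h2 : gw K (n + 1) ≤ gw (K - 1) n := by
      rw [← gw_succ (K - 1) n, show K - 1 + 1 = K by omega]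
      exact le_mul_of_one_le_left (gw_pos _ _).le hp
    calc _ ≤ 4 * (C * gw K (n + 1)) := by gcongr; exact hb _
      _ ≤ 4 * (C * gw (K - 1) n) := by gcongr
      _ = _ := by ring
  rw [mul_add]
  refine add_le_add h1 ?_
  rw [← Finset.sum_range_reflect (fun m => ((m - (K - 1 - L)).factorial : ℝ) / m.factorial),
    Finset.mul_sum, Finset.mul_sum]
  refine Finset.sum_le_sum fun s hs => ?_
  have hsn := Finset.mem_range.mp hs
  have e1 : ((n - 1 - L).descFactorial s : ℝ)
      = (n - 1 - L).factorial / (n - L - 1 - s).factorial := by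
    rw [eq_div_iff (by positivity), mul_comm]
    have := Nat.factorial_mul_descFactorial (show s ≤ n - 1 - L by omega)
    rw [show n - L - 1 - s = n - 1 - L - s by omega]
    exact_mod_cast this
  have e2 : n - L - 1 - s - (K - 1 - L) = n - s - K := by omega
  have h2 := hb (n - s)
  rw [e1, e2]
  calc _ ≤ 4 / (2 * Real.pi) ^ (s + 1) * ((n - 1 - L).factorial / (n - L - 1 - s).factorial)
        * (C * gw K (n - s)) := by gcongr
    _ ≤ 4 / (2 * Real.pi) ^ s * ((n - 1 - L).factorial / (n - L - 1 - s).factorial)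
        * (C * gw K (n - s)) := by
        have := gw_pos K (n - s)
        gcongr
        omega
    _ = _ := by
        rw [gw, gw, show n - (L + 1) = n - 1 - L by omega,
          ← pow_sub_mul_pow (2 * Real.pi) (show s ≤ n by omega)]
        field_simp

/-- The factorial quotients are at most 1 and there are n - L of them, so one unit of the index is
lost. -/
theorem exists_tail_le {K L : ℕ} (h : L + 1 ≤ K) {Z : PolySeries} (hF : Gev K (nabla Z)) :
    ∃ C : ℝ, 0 ≤ C ∧ ∀ n : ℕ,
      ∑ i ∈ Finset.range (n - L), ‖cf (i + 1) (PowerSeries.coeff n Z)‖ * (Real.pi / 2) ^ (n - 1 - i)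
        ≤ C * gw L n := by
  have hpi := Real.pi_pos
  obtain ⟨C, hC, hb⟩ := exists_sum_norm_cf_le h hF
  refine ⟨C * 2, by positivity, fun n => (hb n).trans ?_⟩
  rw [mul_assoc, two_mul]
  refine mul_le_mul_of_nonneg_left (add_le_add (gw_anti (by omega) n) ?_) hC
  have h1 : ∑ m ∈ Finset.range (n - L), ((m - (K - 1 - L)).factorial : ℝ) / m.factorial
      ≤ (n - L : ℕ) := by
    calc _ ≤ ∑ m ∈ Finset.range (n - L), (1 : ℝ) := by
          refine Finset.sum_le_sum fun m _ => ?_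
          rw [div_le_one (by positivity)]
          exact_mod_cast Nat.factorial_le (by omega)
      _ = _ := by simp
  refine (mul_le_mul_of_nonneg_left h1 (gw_pos _ _).le).trans ?_
  rw [gw, gw, div_mul_eq_mul_div]
  gcongr
  rcases Nat.eq_zero_or_pos (n - L) with h0 | h0
  · rw [h0]; simp
  · rw [mul_comm]
    exact_mod_cast (Nat.mul_factorial_pred (by omega : n - L ≠ 0)).le

/-- With K - 1 - L ≥ 2 the factorial quotients are O(1 / m²), hence summable, and the unit lost in
`exists_tail_le` is kept. -/
theorem exists_tail_le_of_gap {K L : ℕ} (h : L + 3 ≤ K) {Z : PolySeries} (hF : Gev K (nabla Z)) :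
    ∃ C : ℝ, 0 ≤ C ∧ ∀ n : ℕ,
      ∑ i ∈ Finset.range (n - L), ‖cf (i + 1) (PowerSeries.coeff n Z)‖ * (Real.pi / 2) ^ (n - 1 - i)
        ≤ C * gw (L + 1) n := by
  obtain ⟨C, hC, hb⟩ := exists_sum_norm_cf_le (L := L) (by omega) hF
  have h1 (M : ℕ) : ∑ m ∈ Finset.range M, ((m - (K - 1 - L)).factorial : ℝ) / m.factorial ≤ 18 := by
    calc ∑ m ∈ Finset.range M, ((m - (K - 1 - L)).factorial : ℝ) / m.factorial
        ≤ ∑ m ∈ Finset.range M, 9 * (1 / ((m : ℝ) + 1) ^ 2) := by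
          refine Finset.sum_le_sum fun m _ => ?_
          have h2 : ((m - 2).factorial : ℝ) * ((m : ℝ) + 1) ^ 2 ≤ (2 + 1) ^ 2 * m.factorial := by
            exact_mod_cast factorial_sub_mul_pow_le 2 m
          have h3 : ((m - (K - 1 - L)).factorial : ℝ) ≤ (m - 2).factorial := by
            exact_mod_cast Nat.factorial_le (by omega)
          rw [mul_one_div, div_le_div_iff₀ (by positivity) (by positivity)]
          calc _ ≤ ((m - 2).factorial : ℝ) * ((m : ℝ) + 1) ^ 2 := by gcongr
            _ ≤ _ := h2.trans (by norm_num)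
      _ ≤ 9 * 2 := by
          rw [← Finset.mul_sum]
          gcongr
          cases M with
          | zero => simp
          | succ M =>
            rw [Finset.sum_range_succ']
            have := sum_one_div_pow_le (σ := 2) le_rfl 0 M
            have e : ∑ k ∈ Finset.range M, 1 / (((k + 1 : ℕ) : ℝ) + 1) ^ 2
                = ∑ j ∈ Finset.range M, 1 / ((j : ℝ) + (0 : ℕ) + 2) ^ 2 := by
              refine Finset.sum_congr rfl fun k _ => ?_
              push_cast
              ring
            rw [e]
            norm_num at this ⊢
            linarith
      _ = 18 := by norm_num
  refine ⟨C * (1 + 18), by positivity, fun n => (hb n).trans ?_⟩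
  rw [mul_assoc]
  refine mul_le_mul_of_nonneg_left ?_ hC
  rw [add_mul, one_mul, mul_comm (18 : ℝ)]
  exact add_le_add (gw_anti (by omega) n) (mul_le_mul_of_nonneg_left (h1 _) (gw_pos _ _).le)

/-! ### Diagonal series -/

/-- The series `∑ₘ m! yₘ τₘ₊₁ dᵐ⁺¹`. -/
def diagSer (y : ℕ → ℂ) : PolySeries :=
  d * PowerSeries.mk fun m => C ((m.factorial : ℂ) * y m) * tau (m + 1)

theorem coeff_zero_diagSer (y : ℕ → ℂ) : PowerSeries.coeff 0 (diagSer y) = 0 := by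
  rw [diagSer, d, PowerSeries.coeff_zero_X_mul]

theorem coeff_succ_diagSer (y : ℕ → ℂ) (m : ℕ) :
    PowerSeries.coeff (m + 1) (diagSer y) = C ((m.factorial : ℂ) * y m) * tau (m + 1) := by
  rw [diagSer, coeff_d_mul, PowerSeries.coeff_mk]

theorem eq_diagSer {Z : PolySeries} {y : ℕ → ℂ} (h0 : PowerSeries.coeff 0 Z = 0)
    (h : ∀ m, PowerSeries.coeff (m + 1) Z = C ((m.factorial : ℂ) * y m) * tau (m + 1)) :
    Z = diagSer y := by
  ext1 n
  cases n with
  | zero => rw [h0, coeff_zero_diagSer]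
  | succ m => rw [h, coeff_succ_diagSer]

theorem diagSer_add (y z : ℕ → ℂ) : diagSer (fun m => y m + z m) = diagSer y + diagSer z := by
  refine (eq_diagSer ?_ fun m => ?_).symm
  · rw [map_add, coeff_zero_diagSer, coeff_zero_diagSer, add_zero]
  · rw [map_add, coeff_succ_diagSer, coeff_succ_diagSer, mul_add, C_add, add_mul]

theorem diagSer_const_mul (c : ℂ) (y : ℕ → ℂ) :
    diagSer (fun m => c * y m) = const c * diagSer y := by
  refine (eq_diagSer ?_ fun m => ?_).symm
  · rw [coeff_zero_mul, coeff_zero_diagSer, mul_zero]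
  · rw [const, ofPoly, PowerSeries.coeff_C_mul, coeff_succ_diagSer, ← mul_assoc, ← C_mul]
    congr 2
    ring

theorem DegLE.diagSer (y : ℕ → ℂ) : DegLE 0 (diagSer y) := by
  intro n
  cases n with
  | zero => rw [coeff_zero_diagSer]; exact PolyDeg.zero _
  | succ m =>
    rw [coeff_succ_diagSer]
    exact ((PolyDeg.C _).mul (polyDeg_tau (m + 1))).mono (by omega)

theorem nrm_zero_diagSer (y : ℕ → ℂ) : nrm 0 (diagSer y) = 0 := by
  rw [nrm, coeff_zero_diagSer, tauNorm_zero]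

theorem nrm_succ_diagSer (y : ℕ → ℂ) (m : ℕ) :
    nrm (m + 1) (diagSer y) = m.factorial * ‖y m‖ := by
  rw [nrm, coeff_succ_diagSer, tauNorm_C_mul, tauNorm_tau le_rfl, Nat.sub_self, pow_zero, mul_one,
    norm_mul, Complex.norm_natCast]

theorem Conv.diagSer {y : ℕ → ℂ} {K a : ℝ} (ha : 0 < a)
    (h : ∀ m, m.factorial * ‖y m‖ ≤ K * a ^ m) : Conv (diagSer y) := by
  have hK : 0 ≤ K := by
    have := h 0
    rw [pow_zero, mul_one] at this
    exact le_trans (by positivity) this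
  refine Conv.of_le (DegLE.diagSer y) (C := K / a) ha fun n => ?_
  cases n with
  | zero => rw [nrm_zero_diagSer]; positivity
  | succ m =>
    rw [nrm_succ_diagSer]
    refine (h m).trans (le_of_eq ?_)
    rw [pow_succ]
    field_simp

/-! ### The action of shifts on diagonal series. -/

/-- The product of `exp (θ x)` and `∑ₘ yₘ xᵐ`. -/
def expConv (θ : ℂ) (y : ℕ → ℂ) (m : ℕ) : ℂ :=
  ∑ k ∈ Finset.range (m + 1), θ ^ k / (k.factorial : ℂ) * y (m - k)

/-- The factorials in `diagSer` are those of the Borel transform ∑ yₘ xᵐ, on which the shift is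
multiplication by exp (θ x). -/
theorem shift_diagSer (θ : ℂ) (y : ℕ → ℂ) : shift θ (diagSer y) = diagSer (expConv θ y) := by
  refine eq_diagSer ?_ fun m => ?_
  · rw [coeff_zero_shift, coeff_zero_diagSer]
  · rw [shift_apply, coeff_expD, Finset.Nat.sum_antidiagonal_eq_sum_range_succ_mk,
      Finset.sum_range_succ, Nat.sub_self, coeff_zero_diagSer, map_zero, mul_zero, add_zero,
      expConv, Finset.mul_sum, map_sum, Finset.sum_mul]
    refine Finset.sum_congr rfl fun k hk => ?_
    have hkm : k ≤ m := by have := Finset.mem_range.mp hk; omega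
    have hf : ((m - k).factorial : ℂ) ≠ 0 := Nat.cast_ne_zero.mpr (Nat.factorial_ne_zero _)
    rw [show m + 1 - k = m - k + 1 by omega, coeff_succ_diagSer, Dop_pow_C_mul, Dop_pow_tau,
      show m - k + k = m by omega, show m - k + 1 + k = m + 1 by omega, ← mul_assoc, ← mul_assoc,
      ← C_mul, ← C_mul]
    congr 2
    field_simp

theorem norm_exp_sub_sum_le_factorial (x : ℂ) (n : ℕ) :
    n.factorial * ‖Complex.exp x - ∑ m ∈ Finset.range n, x ^ m / m.factorial‖
      ≤ ‖x‖ ^ n * Real.exp ‖x‖ := by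
  have h1 := NormedSpace.expSeries_div_hasSum_exp (𝔸 := ℂ) x
  have h2 := NormedSpace.expSeries_div_hasSum_exp (𝔸 := ℝ) ‖x‖
  rw [← Complex.exp_eq_exp_ℂ] at h1
  rw [← Real.exp_eq_exp_ℝ] at h2
  have h3 := ((hasSum_nat_add_iff' n).mpr h1).norm_le_of_bounded
    (h2.mul_left (‖x‖ ^ n / n.factorial)) fun i => by
      rw [norm_div, norm_pow, Complex.norm_natCast, pow_add, mul_comm (‖x‖ ^ i),
        div_mul_div_comm]
      gcongr
      rw [mul_comm]
      exact_mod_cast Nat.le_of_dvd (Nat.factorial_pos _)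
        (Nat.factorial_mul_factorial_dvd_factorial_add i n)
  calc _ ≤ n.factorial * (‖x‖ ^ n / n.factorial * Real.exp ‖x‖) := by gcongr
    _ = _ := by field_simp

/-- `∑ₘ m! rᵐ⁺¹ τₘ₊₁ dᵐ⁺¹`. -/
def geomSer (r : ℂ) : PolySeries := diagSer fun m => r ^ (m + 1)

/-- `∑ₘ (m + 1)! rᵐ⁺² τₘ₊₁ dᵐ⁺¹`. -/
def geomSer' (r : ℂ) : PolySeries := diagSer fun m => (m + 1) * r ^ (m + 2)

/-- The Borel transform of `geomSer r` is r / (1 - r x). The hypothesis makes exp (θ x) + 1 vanish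
at the pole 1 / r, so the product is entire; its coefficients are remainders of the exponential
series. -/
theorem Conv.shift_geomSer {θ r : ℂ} (hr : r ≠ 0) (hx : Complex.exp (θ / r) = -1) :
    Conv (shift θ (geomSer r) + geomSer r) := by
  rw [geomSer, shift_diagSer, ← diagSer_add]
  set x := θ / r with hxd
  have hθ : θ = x * r := by rw [hxd]; field_simp
  refine Conv.diagSer (K := ‖r‖ * ‖x‖ * Real.exp ‖x‖) (a := ‖r‖ * ‖x‖ + 1) (by positivity)
    fun m => ?_
  have e : expConv θ (fun m => r ^ (m + 1)) m + r ^ (m + 1)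
      = -(r ^ (m + 1)
        * (Complex.exp x - ∑ k ∈ Finset.range (m + 1), x ^ k / (k.factorial : ℂ))) := by
    have : expConv θ (fun m => r ^ (m + 1)) m
        = r ^ (m + 1) * ∑ k ∈ Finset.range (m + 1), x ^ k / (k.factorial : ℂ) := by
      rw [expConv, Finset.mul_sum]
      refine Finset.sum_congr rfl fun k hk => ?_
      have hkm : k ≤ m := by have := Finset.mem_range.mp hk; omega
      rw [hθ, mul_pow, show m + 1 = m - k + 1 + k by omega, pow_add r (m - k + 1) k]
      ring
    rw [this, hx]; ring
  rw [e, norm_neg, norm_mul, norm_pow]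
  have h1 := norm_exp_sub_sum_le_factorial x (m + 1)
  have h2 : (m.factorial : ℝ) ≤ (m + 1).factorial := by
    exact_mod_cast Nat.factorial_le (by omega)
  calc _ ≤ ((m + 1).factorial : ℝ) * (‖r‖ ^ (m + 1)
        * ‖Complex.exp x - ∑ k ∈ Finset.range (m + 1), x ^ k / (k.factorial : ℂ)‖) := by gcongr
    _ ≤ ‖r‖ ^ (m + 1) * (‖x‖ ^ (m + 1) * Real.exp ‖x‖) := by
        rw [mul_left_comm]; gcongr
    _ = ‖r‖ * ‖x‖ * Real.exp ‖x‖ * (‖r‖ * ‖x‖) ^ m := by rw [mul_pow]; ring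
    _ ≤ _ := by gcongr; linarith

/-- The transform now has a double pole, and the simple zero of exp (θ x) + 1 reduces it to a simple
one, which is θ r / (1 - r x); the last term removes it. -/
theorem Conv.shift_geomSer' {θ r : ℂ} (hr : r ≠ 0) (hx : Complex.exp (θ / r) = -1) :
    Conv (shift θ (geomSer' r) + geomSer' r + PolySeries.const (-θ) * geomSer r) := by
  rw [geomSer', geomSer, shift_diagSer, ← diagSer_add, ← diagSer_const_mul, ← diagSer_add]
  set x := θ / r with hxd
  have hθ : θ = x * r := by rw [hxd]; field_simp
  refine Conv.diagSer (K := 2 * ‖r‖ ^ 2 * ‖x‖ * Real.exp ‖x‖) (a := ‖r‖ * ‖x‖ + 1)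
    (by positivity) fun m => ?_
  set E : ℕ → ℂ := fun n => Complex.exp x - ∑ k ∈ Finset.range n, x ^ k / (k.factorial : ℂ) with hE
  have e : expConv θ (fun m => (m + 1) * r ^ (m + 2)) m + (m + 1) * r ^ (m + 2)
        + -θ * r ^ (m + 1) = r ^ (m + 2) * (x * E m - (m + 1) * E (m + 1)) := by
    have h1 : expConv θ (fun m => (m + 1) * r ^ (m + 2)) m
        = r ^ (m + 2) * ((m + 1) * ∑ k ∈ Finset.range (m + 1), x ^ k / (k.factorial : ℂ)
          - ∑ k ∈ Finset.range (m + 1), k * (x ^ k / (k.factorial : ℂ))) := by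
      rw [expConv, Finset.mul_sum, ← Finset.sum_sub_distrib, Finset.mul_sum]
      refine Finset.sum_congr rfl fun k hk => ?_
      have hkm : k ≤ m := by have := Finset.mem_range.mp hk; omega
      rw [hθ, mul_pow, show m + 2 = m - k + 2 + k by omega, pow_add r (m - k + 2) k,
        Nat.cast_sub hkm]
      ring
    have h2 : ∑ k ∈ Finset.range (m + 1), k * (x ^ k / (k.factorial : ℂ))
        = x * ∑ k ∈ Finset.range m, x ^ k / (k.factorial : ℂ) := by
      rw [Finset.sum_range_succ', Nat.cast_zero, zero_mul, add_zero, Finset.mul_sum]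
      refine Finset.sum_congr rfl fun k _ => ?_
      rw [Nat.factorial_succ]
      have : (k.factorial : ℂ) ≠ 0 := Nat.cast_ne_zero.mpr (Nat.factorial_ne_zero _)
      have h3 : (k : ℂ) + 1 ≠ 0 := Nat.cast_add_one_ne_zero k
      push_cast
      field_simp
      ring
    simp only [hE]
    rw [h1, h2, hx, hθ]
    ring
  rw [e, norm_mul, norm_pow]
  have h1 := norm_exp_sub_sum_le_factorial x m
  have h2 := norm_exp_sub_sum_le_factorial x (m + 1)
  have h3 : ‖x * E m - (m + 1) * E (m + 1)‖ ≤ ‖x‖ * ‖E m‖ + (m + 1) * ‖E (m + 1)‖ := by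
    refine (norm_sub_le _ _).trans (le_of_eq ?_)
    rw [norm_mul, norm_mul]
    congr 2
    exact_mod_cast Complex.norm_natCast (m + 1)
  rw [Nat.factorial_succ] at h2
  push_cast at h2
  calc _ ≤ m.factorial * (‖r‖ ^ (m + 2) * (‖x‖ * ‖E m‖ + (m + 1) * ‖E (m + 1)‖)) := by gcongr
    _ = ‖r‖ ^ (m + 2) * (‖x‖ * (m.factorial * ‖E m‖)
        + (m + 1) * m.factorial * ‖E (m + 1)‖) := by ring
    _ ≤ ‖r‖ ^ (m + 2) * (‖x‖ * (‖x‖ ^ m * Real.exp ‖x‖) + ‖x‖ ^ (m + 1) * Real.exp ‖x‖) := by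
        gcongr
    _ = 2 * ‖r‖ ^ 2 * ‖x‖ * Real.exp ‖x‖ * (‖r‖ * ‖x‖) ^ m := by rw [mul_pow]; ring
    _ ≤ _ := by gcongr; linarith

theorem Conv.shift_diagSer_finite (θ : ℂ) (M : ℕ) (y : ℕ → ℂ) :
    Conv (shift θ (PolySeries.diagSer fun m => if m < M then y m else 0)) := by
  rw [shift_diagSer]
  obtain ⟨B, hB0, hB⟩ : ∃ B : ℝ, 0 ≤ B ∧ ∀ j < M, ‖y j‖ ≤ B :=
    ⟨∑ j ∈ Finset.range M, ‖y j‖, Finset.sum_nonneg fun _ _ => norm_nonneg _, fun j hj =>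
      Finset.single_le_sum (f := fun j => ‖y j‖) (fun _ _ => norm_nonneg _)
        (Finset.mem_range.mpr hj)⟩
  refine Conv.diagSer (K := M.factorial * B) (a := ‖θ‖ + 1) (by positivity) fun m => ?_
  have h1 : ‖expConv θ (fun m => if m < M then y m else 0) m‖
      ≤ ∑ k ∈ Finset.range (m + 1), ‖θ‖ ^ k * (M.factorial * B * (m.choose k / m.factorial)) := by
    refine norm_sum_le_of_le _ fun k hk => ?_
    have hkm : k ≤ m := by have := Finset.mem_range.mp hk; omega
    rw [norm_mul, norm_div, norm_pow, Complex.norm_natCast, div_mul_eq_mul_div, mul_div_assoc]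
    refine mul_le_mul_of_nonneg_left ?_ (by positivity)
    beta_reduce
    split_ifs with h
    · have h2 := hB _ h
      have h3 : ((m - k).factorial : ℝ) ≤ M.factorial := by
        exact_mod_cast Nat.factorial_le h.le
      rw [Nat.cast_choose ℝ hkm]
      have hmk : (1 : ℝ) ≤ M.factorial / (m - k).factorial := by
        rw [le_div_iff₀ (by positivity), one_mul]; exact h3
      calc ‖y (m - k)‖ / k.factorial ≤ B / k.factorial * 1 := by rw [mul_one]; gcongr
        _ ≤ B / k.factorial * (M.factorial / (m - k).factorial) := by gcongr
        _ = _ := by field_simp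
    · rw [norm_zero, zero_div]; positivity
  calc (m.factorial : ℝ) * ‖expConv θ (fun m => if m < M then y m else 0) m‖
      ≤ m.factorial * ∑ k ∈ Finset.range (m + 1),
        ‖θ‖ ^ k * (M.factorial * B * (m.choose k / m.factorial)) := by gcongr
    _ = M.factorial * B * (‖θ‖ + 1) ^ m := by
      rw [add_pow, Finset.mul_sum, Finset.mul_sum]
      refine Finset.sum_congr rfl fun k _ => ?_
      rw [one_pow]
      field_simp

/-! ### The series `H₀`, `H₁`, `H₂` -/

theorem rr_ne_zero : rr ≠ 0 := by
  have := Real.pi_pos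
  rw [← norm_pos_iff, norm_rr]; positivity

theorem half_rr_add {n : ℕ} : (1 / 2 : ℂ) * (rr ^ n + (-rr) ^ n) = if Even n then rr ^ n else 0 := by
  split_ifs with h
  · rw [h.neg_pow]; ring
  · rw [(Nat.not_even_iff_odd.mp h).neg_pow]; ring

theorem H0_eq_diagSer :
    H0 = diagSer fun m => if Even (m + 1) ∧ 10 ≤ m + 1 then rr ^ (m + 1) else 0 := by
  refine eq_diagSer ?_ fun m => ?_
  · rw [H0, PowerSeries.coeff_mk, if_neg (by omega)]
  · rw [H0, PowerSeries.coeff_mk, Nat.add_sub_cancel]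
    split_ifs
    · rfl
    · simp

theorem H1_eq_diagSer :
    H1 = diagSer fun m => if Odd (m + 1) ∧ 9 ≤ m + 1 then rr ^ (m + 2) else 0 := by
  refine eq_diagSer ?_ fun m => ?_
  · rw [H1, PowerSeries.coeff_mk, if_neg (by omega)]
  · rw [H1, PowerSeries.coeff_mk, Nat.add_sub_cancel]
    split_ifs
    · rfl
    · simp

theorem H2_eq_diagSer :
    H2 = diagSer fun m => if Odd (m + 1) ∧ 9 ≤ m + 1 then ((m : ℂ) + 1) * rr ^ (m + 2) else 0 := by
  refine eq_diagSer ?_ fun m => ?_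
  · rw [H2, PowerSeries.coeff_mk, if_neg (by omega)]
  · rw [H2, PowerSeries.coeff_mk]
    split_ifs
    · congr 2
      rw [Nat.factorial_succ, rr]
      push_cast
      ring
    · simp

/-- The initial part that distinguishes `H₀` from a sum of geometric series. -/
def H0init : PolySeries :=
  diagSer fun m => if m < 9 then (1 / 2 : ℂ) * (rr ^ (m + 1) + (-rr) ^ (m + 1)) else 0

/-- The initial part that distinguishes `H₂` from a sum of geometric series. -/
def H2init : PolySeries :=
  diagSer fun m => if m < 8 then (m + 1) * ((1 / 2 : ℂ) * (rr ^ (m + 2) + (-rr) ^ (m + 2))) else 0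

theorem H0_add_init : H0 + H0init = const (1 / 2) * (geomSer rr + geomSer (-rr)) := by
  rw [H0_eq_diagSer, H0init, geomSer, geomSer, ← diagSer_add, ← diagSer_add, ← diagSer_const_mul]
  congr 1
  funext m
  rw [half_rr_add]
  split_ifs <;> grind

theorem H2_add_init : H2 + H2init = const (1 / 2) * (geomSer' rr + geomSer' (-rr)) := by
  rw [H2_eq_diagSer, H2init, geomSer', geomSer', ← diagSer_add, ← diagSer_add,
    ← diagSer_const_mul]
  congr 1
  funext m
  rw [← mul_add, mul_left_comm (1 / 2 : ℂ), half_rr_add]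
  split_ifs <;> grind

/-- 1 / rr = -2πi, so a half shift acts as exp (-πi) at the pole. This is why H₀ changes sign under
half shifts, up to convergent series. -/
theorem exp_half_div_rr : Complex.exp (1 / 2 / rr) = -1 := by
  have hpi : (Real.pi : ℂ) ≠ 0 := by exact_mod_cast Real.pi_ne_zero
  have : (1 / 2 / rr : ℂ) = -(Real.pi * Complex.I) := by
    rw [rr]
    field_simp
    rw [Complex.I_sq, neg_neg]
  rw [this, Complex.exp_neg, Complex.exp_pi_mul_I]
  norm_num

theorem exp_neg_half_div_rr : Complex.exp (-(1 / 2) / rr) = -1 := by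
  rw [neg_div, Complex.exp_neg, exp_half_div_rr]; norm_num

theorem exp_div_rr {θ : ℂ} (hθ : θ = 1 / 2 ∨ θ = -(1 / 2)) :
    Complex.exp (θ / rr) = -1 ∧ Complex.exp (θ / -rr) = -1 := by
  rcases hθ with rfl | rfl
  · exact ⟨exp_half_div_rr, by rw [div_neg, ← neg_div]; exact exp_neg_half_div_rr⟩
  · exact ⟨exp_neg_half_div_rr, by rw [neg_div_neg_eq]; exact exp_half_div_rr⟩

theorem Conv.shift_H0 {θ : ℂ} (hθ : θ = 1 / 2 ∨ θ = -(1 / 2)) : Conv (shift θ H0 + H0) := by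
  have h1 := Conv.shift_geomSer rr_ne_zero (exp_div_rr hθ).1
  have h2 := Conv.shift_geomSer (neg_ne_zero.mpr rr_ne_zero) (exp_div_rr hθ).2
  have h3 : Conv (shift θ H0init) := Conv.shift_diagSer_finite θ _ _
  have h4 : Conv H0init := by
    have : Conv (shift 0 H0init) := Conv.shift_diagSer_finite 0 _ _
    rwa [shift_zero] at this
  have e0 := H0_add_init
  have e1 := congrArg (shift θ) e0
  simp only [map_add, map_mul, shift_const] at e1
  have e : shift θ H0 + H0 = PolySeries.const (1 / 2) * ((shift θ (geomSer rr) + geomSer rr)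
      + (shift θ (geomSer (-rr)) + geomSer (-rr))) - (shift θ H0init + H0init) := by
    linear_combination e0 + e1
  rw [e]
  exact ((Conv.const _).mul (h1.add h2)).sub (h3.add h4)

theorem Conv.shift_H2 {θ : ℂ} (hθ : θ = 1 / 2 ∨ θ = -(1 / 2)) :
    Conv (shift θ H2 + H2 + PolySeries.const (-θ) * H0) := by
  have h1 := Conv.shift_geomSer' rr_ne_zero (exp_div_rr hθ).1
  have h2 := Conv.shift_geomSer' (neg_ne_zero.mpr rr_ne_zero) (exp_div_rr hθ).2
  have h3 : Conv (shift θ H2init) := Conv.shift_diagSer_finite θ _ _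
  have h4 : Conv H2init := by
    have : Conv (shift 0 H2init) := Conv.shift_diagSer_finite 0 _ _
    rwa [shift_zero] at this
  have h5 : Conv H0init := by
    have : Conv (shift 0 H0init) := Conv.shift_diagSer_finite 0 _ _
    rwa [shift_zero] at this
  have e0 := H2_add_init
  have e1 := congrArg (shift θ) e0
  have e2 := H0_add_init
  simp only [map_add, map_mul, shift_const] at e1
  have e : shift θ H2 + H2 + PolySeries.const (-θ) * H0
      = PolySeries.const (1 / 2) * ((shift θ (geomSer' rr) + geomSer' rr
          + PolySeries.const (-θ) * geomSer rr) + (shift θ (geomSer' (-rr)) + geomSer' (-rr)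
          + PolySeries.const (-θ) * geomSer (-rr)))
        - (shift θ H2init + H2init + PolySeries.const (-θ) * H0init) := by
    clear h1 h2 h3 h4 h5
    generalize PolySeries.const (-θ) = c at *
    generalize PolySeries.const (1 / 2) = c' at *
    generalize shift θ H2 = a1 at *
    generalize shift θ H2init = a2 at *
    generalize shift θ (geomSer' rr) = a3 at *
    generalize shift θ (geomSer' (-rr)) = a4 at *
    linear_combination e0 + e1 + c * e2
  rw [e]
  exact ((Conv.const _).mul (h1.add h2)).sub ((h3.add h4).add ((Conv.const _).mul h5))

theorem Conv.nabla_H2 : Conv (nabla H2 - H0) := by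
  have h1 := Conv.shift_H2 (Or.inl rfl)
  have h2 := Conv.shift_H2 (Or.inr rfl)
  have e : nabla H2 - H0 = (shift (1 / 2) H2 + H2 + PolySeries.const (-(1 / 2)) * H0)
      - (shift (-(1 / 2)) H2 + H2 + PolySeries.const (- -(1 / 2)) * H0) := by
    have e1 : PolySeries.const (-(1 / 2)) = PolySeries.const (1 / 2) - 1 := by
      rw [eq_sub_iff_add_eq, ← const_one, ← const_add]; norm_num
    have e2 : PolySeries.const (1 / 2) * 2 = 1 := const_half_mul_two
    rw [nabla, neg_neg, e1]
    ring
  rw [e]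
  exact h1.sub h2

/-! ### Expansions of the coefficients of the linear operators -/

theorem tau2_ne_zero : tau2 ≠ 0 := by
  rw [tau2_eq, ofPoly]
  exact (map_ne_zero_iff _ PowerSeries.C_injective).mpr one_sub_X_sq_ne_zero

theorem d_sq_dvd_shift_add (θ : ℂ) (Z : PolySeries) :
    d ^ 2 ∣ shift θ Z + shift (-θ) Z - 2 * Z := by
  refine dvd_of_coeff_eq_zero fun n hn => ?_
  rw [two_mul, map_sub, map_add, map_add, shift_apply, shift_apply, coeff_expD, coeff_expD,
    Finset.Nat.sum_antidiagonal_eq_sum_range_succ_mk,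
    Finset.Nat.sum_antidiagonal_eq_sum_range_succ_mk]
  interval_cases n
  · simp
  · simp [Finset.sum_range_succ]
    ring

/-- Only the term 1 + τ₂ d² / 4 of Q matters, and the two opposite shifts of τ₂ add up to 2 τ₂
modulo d². -/
theorem d_pow_four_dvd_PiQ : d ^ 4 ∣ PiQ - (1 + const (1 / 2) * tau2 * d ^ 2) := by
  obtain ⟨W, hW⟩ := d_sq_dvd_shift_add (1 / 2) tau2
  obtain ⟨R, hR⟩ : ∃ R, Q = 1 + const (1 / 4) * tau2 * d ^ 2 + d ^ 4 * R :=
    ⟨ofPoly Qcoeff4 + ofPoly Qcoeff6 * d ^ 2, by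
      rw [Q_eq, Qcoeff2, ofPoly_mul, ← tau2_eq, const]; ring⟩
  have hc : const (1 / 2) = 2 * const (1 / 4) := by
    rw [two_mul, ← const_add]; norm_num
  have e (θ : ℂ) : shift θ Q
      = 1 + const (1 / 4) * shift θ tau2 * d ^ 2 + d ^ 4 * shift θ R := by
    conv_lhs => rw [hR]
    simp only [map_add, map_mul, map_one, map_pow, shift_const, shift_d]
  rw [PiQ, e, e, hc]
  generalize shift (1 / 2) tau2 = a at *
  generalize shift (-(1 / 2)) tau2 = b at *
  generalize shift (1 / 2) R = x at *
  generalize shift (-(1 / 2)) R = y at *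
  exact ⟨const (1 / 4) * W + const (1 / 4) ^ 2 * a * b
    + x * (1 + const (1 / 4) * b * d ^ 2) + y * (1 + const (1 / 4) * a * d ^ 2) + d ^ 4 * x * y, by
      linear_combination const (1 / 4) * d ^ 2 * hW⟩

theorem d_pow_four_dvd_eps_sq : d ^ 4 ∣ eps ^ 2 - d ^ 2 := by
  refine dvd_of_coeff_eq_zero fun n hn => ?_
  rw [map_sub, coeff_eps_sq, d, PowerSeries.coeff_X_pow]
  interval_cases n
  · simp
  · simp
  · norm_num [Nat.factorial]
  · rw [if_neg (by decide), if_neg (by decide), sub_zero]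

theorem cfac_mul_cfac_neg : cfac (1 / 2) * cfac (-(1 / 2)) = 1 + const (1 / 4) * tau2 * eps ^ 2 := by
  have h := cosh_sq_sub_sinh_sq (1 / 2)
  have hc : const (1 / 4) * 4 = 1 := by
    rw [show (4 : PolySeries) = const 4 by rw [const, map_ofNat, ofPoly, map_ofNat], ← const_mul]
    norm_num [const_one]
  rw [cfac_neg, cfac_eq, eps, tau2]
  linear_combination h - (1 - u ^ 2) * sinhS (1 / 2) ^ 2 * hc

/-- Modulo d⁴, M is (1 + τ₂ d² / 4) / (1 + τ₂ d² / 2). -/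
theorem d_pow_four_dvd_Mser : d ^ 4 ∣ Mser - (1 - const (1 / 4) * tau2 * d ^ 2) := by
  obtain ⟨W, hW⟩ := d_pow_four_dvd_PiQ
  obtain ⟨E, hE⟩ := d_pow_four_dvd_eps_sq
  have h1 : inv PiQ * PiQ = 1 := inv_mul_self coeff_zero_PiQ
  have hc : const (1 / 2) = 2 * const (1 / 4) := by
    rw [two_mul, ← const_add]; norm_num
  rw [hc] at hW
  refine ⟨inv PiQ * (const (1 / 4) * tau2 * E + 2 * const (1 / 4) ^ 2 * tau2 ^ 2
    - (1 - const (1 / 4) * tau2 * d ^ 2) * W), ?_⟩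
  rw [Mser, cfac_mul_cfac_neg]
  generalize inv PiQ = I at *
  linear_combination const (1 / 4) * tau2 * I * hE
    - I * (1 - const (1 / 4) * tau2 * d ^ 2) * hW + (1 - const (1 / 4) * tau2 * d ^ 2) * h1

theorem d_pow_five_dvd_sinhS : d ^ 5 ∣ sinhS 1 - (d + const (1 / 6) * d ^ 3) := by
  refine dvd_of_coeff_eq_zero fun n hn => ?_
  rw [map_sub, map_add, const, ofPoly, PowerSeries.coeff_C_mul, sinhS, PowerSeries.coeff_mk, d,
    PowerSeries.coeff_X_pow, PowerSeries.coeff_X]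
  interval_cases n
  · simp
  · simp
  · rw [if_neg (by decide)]; simp
  · rw [if_pos (by decide)]; norm_num [Nat.factorial]
  · rw [if_neg (by decide)]; simp

theorem nabla_mul_of_shift_eq {Z : PolySeries} (hZ : ∀ θ, shift θ Z = Z) (Y : PolySeries) :
    nabla (Z * Y) = Z * nabla Y := by
  rw [nabla, nabla, map_mul, map_mul, hZ, hZ, mul_sub]

theorem nabla_sub (Z Y : PolySeries) : nabla (Z - Y) = nabla Z - nabla Y := by
  rw [nabla, nabla, nabla, map_sub, map_sub]; ring

/-! ### The quotient of `H₀` by `τ₂` -/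

/-- `H₀ / τ₂`. -/
def H0div : PolySeries := PowerSeries.mk fun n => if Even n ∧ 10 ≤ n then
  C (((n - 1).factorial : ℂ) * rr ^ n) * tauQuot (n - 2) else 0

theorem tau2_mul_H0div : tau2 * H0div = H0 := by
  ext1 n
  rw [tau2_eq, ofPoly, PowerSeries.coeff_C_mul, H0div, H0, PowerSeries.coeff_mk,
    PowerSeries.coeff_mk]
  split_ifs with h
  · obtain ⟨m, rfl⟩ : ∃ m, n = m + 2 := ⟨n - 2, by omega⟩
    rw [Nat.add_sub_cancel, ← mul_tauQuot, rr]; ring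
  · rw [mul_zero]

theorem tau2_mul_uH0divTau2 : tau2 * uH0divTau2 = u * H0 := by
  rw [tau2_eq, ← tau_two, tau_two_mul_uH0divTau2]

theorem uH0divTau2_eq : uH0divTau2 = u * H0div := by
  refine mul_left_cancel₀ tau2_ne_zero ?_
  rw [tau2_mul_uH0divTau2, ← tau2_mul_H0div]; ring

theorem d_sq_dvd_H0div : d ^ 2 ∣ H0div :=
  dvd_of_coeff_eq_zero fun n hn => by
    rw [H0div, PowerSeries.coeff_mk, if_neg (by omega)]

theorem DegLE.H0div : DegLE (-2) H0div := by
  intro n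
  rw [PolySeries.H0div, PowerSeries.coeff_mk]
  split_ifs with h
  · exact ((PolyDeg.C _).mul (polyDeg_tauQuot (n - 2))).mono (by omega)
  · exact PolyDeg.zero _

theorem DegLE.uH0divTau2 : DegLE (-1) uH0divTau2 := by
  rw [uH0divTau2_eq]
  exact DegLE.u.mul DegLE.H0div (by norm_num)

theorem DegLE.H0 : DegLE 0 H0 := by
  rw [← tau2_mul_H0div]
  exact DegLE.tau2.mul DegLE.H0div (by norm_num)

theorem Gev.H0div : Gev 1 H0div := by
  have hpi := Real.pi_pos
  refine ⟨DegLE.H0div.mono (by norm_num), (Real.pi / 2) ^ 2 * (3 * Real.exp Real.pi), fun n => ?_⟩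
  rw [nrm, PolySeries.H0div, PowerSeries.coeff_mk]
  have hw := gw_pos 1 n
  split_ifs with h
  · obtain ⟨m, rfl⟩ : ∃ m, n = m + 2 := ⟨n - 2, by omega⟩
    rw [tauNorm_C_mul, Nat.add_sub_cancel, tauNorm_add_right (polyDeg_tauQuot m), norm_mul, norm_pow,
      norm_rr, Complex.norm_natCast, inv_pow, ← div_eq_mul_inv, ← gw, mul_comm]
    gcongr
    exact tauNorm_tauQuot_le m
  · rw [tauNorm_zero]; positivity

theorem Gev.H0 : Gev 1 H0 := by
  have hpi := Real.pi_pos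
  refine ⟨DegLE.H0, 1, fun n => ?_⟩
  have hw := gw_pos 1 n
  rw [nrm, PolySeries.H0, PowerSeries.coeff_mk, one_mul]
  split_ifs with h
  · rw [tauNorm_C_mul, tauNorm_tau le_rfl, Nat.sub_self, pow_zero, mul_one, norm_mul, norm_pow, ← rr,
      norm_rr, Complex.norm_natCast, inv_pow, ← div_eq_mul_inv, ← gw]
  · rw [tauNorm_zero]; exact hw.le

theorem polyDeg_X_mul_tauQuot_sub (n : ℕ) : PolyDeg n (X * tauQuot n - tau (n + 1)) := by
  have hd : (tau (n + 1)).natDegree ≤ n + 1 := natDegree_le_of_degree_le (degree_tau _).le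
  intro i hi
  have hi : n < i := by exact_mod_cast hi
  obtain ⟨j, rfl⟩ : ∃ j, i = j + 1 := ⟨i - 1, by omega⟩
  rw [coeff_sub, coeff_X_mul, tauQuot, coeff_C_mul, coeff_derivative]
  rcases eq_or_lt_of_le (show n ≤ j by omega) with rfl | h
  · have : (n : ℂ) + 1 ≠ 0 := Nat.cast_add_one_ne_zero n
    field_simp
    ring
  · rw [coeff_eq_zero_of_natDegree_lt (by omega)]
    simp

/-- The leading terms cancel in the difference of the two main parts. -/
theorem DegLE.uH0divTau2_sub : DegLE (-2) (PolySeries.uH0divTau2 - PolySeries.d * H2) := by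
  intro n
  rw [uH0divTau2_eq, map_sub, PolySeries.u, PolySeries.ofPoly, PowerSeries.coeff_C_mul, PolySeries.H0div,
    PowerSeries.coeff_mk]
  cases n with
  | zero =>
    rw [PolySeries.d, PowerSeries.coeff_zero_X_mul, if_neg (by omega), mul_zero, sub_zero]
    exact PolyDeg.zero _
  | succ n =>
    rw [coeff_d_mul, H2, PowerSeries.coeff_mk]
    split_ifs with h1 h2 h2
    · obtain ⟨m, rfl⟩ : ∃ m, n = m + 1 := ⟨n - 1, by omega⟩
      have h := (PolyDeg.C (((m + 1).factorial : ℂ) * rr ^ (m + 2))).mul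
        (polyDeg_X_mul_tauQuot_sub m)
      have e : X * (C ((((m + 1 + 1 - 1 : ℕ)).factorial : ℂ) * rr ^ (m + 1 + 1))
            * tauQuot (m + 1 + 1 - 2))
          - C (((m + 1).factorial : ℂ) * (Complex.I / (2 * (Real.pi : ℂ))) ^ (m + 1 + 1))
            * tau (m + 1)
          = C (((m + 1).factorial : ℂ) * rr ^ (m + 2)) * (X * tauQuot m - tau (m + 1)) := by
        rw [Nat.add_sub_cancel, show m + 1 + 1 - 2 = m by omega, ← rr]; ring
      rw [e]
      exact h.mono (by push_cast; omega)
    · exact absurd ⟨by grind, by omega⟩ h2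
    · exact absurd ⟨by grind, by grind⟩ h1
    · rw [mul_zero, sub_zero]; exact PolyDeg.zero _

theorem tau2_mul_shift_uH0divTau2 (θ : ℂ) :
    tau2 * shift θ uH0divTau2 = (sinhS θ + u * coshS θ) * cfac θ * shift θ H0 := by
  have h1 := congrArg (shift θ) tau2_mul_uH0divTau2
  rw [map_mul, map_mul, shift_tau2] at h1
  have h2 := shift_u_mul_cfac θ
  have h3 := kap_mul_cfac θ
  rw [← h2]
  linear_combination cfac θ ^ 2 * h1
    - tau2 * shift θ uH0divTau2 * (kap θ * cfac θ + 1) * h3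

/-- `∇ (u H₀ / τ₂)`, up to small terms. -/
theorem gev_nabla_uH0divTau2 (k : ℕ) :
    Gev k (nabla uH0divTau2 + sinhS 1 * (2 * H0div - H0)) := by
  have hdeg : DegLE 0 (nabla uH0divTau2 + sinhS 1 * (2 * H0div - H0)) := by
    refine (DegLE.uH0divTau2.nabla.mono (by norm_num)).add
      ((DegLE.sinhS 1).mul (k := -1) (l := 0) ?_ (by norm_num))
    exact (DegLE.two.mul DegLE.H0div (by norm_num)).sub DegLE.H0
  refine Gev.of_tau2_mul (Conv.gev ?_ (k + 2)) hdeg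
  have h1 := Conv.shift_H0 (θ := 1 / 2) (Or.inl rfl)
  have h2 := Conv.shift_H0 (θ := -(1 / 2)) (Or.inr rfl)
  have hs (θ : ℂ) : Conv (d * (sinhS θ + u * coshS θ)) := by
    rw [mul_add, ← mul_assoc]
    exact (Conv.d.mul (Conv.sinhS θ)).add (Conv.du.mul (Conv.coshS θ))
  have e1 := tau2_mul_shift_uH0divTau2 (1 / 2)
  have e2 := tau2_mul_shift_uH0divTau2 (-(1 / 2))
  have e3 := sinhS_two_mul (1 / 2)
  rw [show (2 * (1 / 2) : ℂ) = 1 by norm_num] at e3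
  -- Both half shifts send H₀ to -H₀ up to convergent series, and u / τ₂ = sinh s cosh s has central
  -- difference sinh d cosh 2s, where cosh 2s = 2 / τ₂ - 1.
  have e : d ^ 2 * tau2 * (nabla uH0divTau2 + sinhS 1 * (2 * H0div - H0))
      = d * (sinhS (1 / 2) + u * coshS (1 / 2)) * (cfac (1 / 2)) * (d * (shift (1 / 2) H0 + H0))
      - d * (sinhS (-(1 / 2)) + u * coshS (-(1 / 2))) * (cfac (-(1 / 2)))
        * (d * (shift (-(1 / 2)) H0 + H0)) := by
    have e4 := tau2_mul_H0div
    rw [e3, nabla]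
    rw [cfac_neg, sinhS_neg, coshS_neg] at e2 ⊢
    rw [cfac_eq] at e1 ⊢
    rw [tau2] at *
    clear h1 h2 hs hdeg e3
    generalize shift (1 / 2) H0 = a1 at *
    generalize shift (-(1 / 2)) H0 = a2 at *
    generalize shift (1 / 2) uH0divTau2 = a3 at *
    generalize shift (-(1 / 2)) uH0divTau2 = a4 at *
    linear_combination d ^ 2 * e1 - d ^ 2 * e2
      + d ^ 2 * 2 * (2 * sinhS (1 / 2) * coshS (1 / 2)) * e4
  rw [e]
  exact (((hs _).mul (Conv.cfac _)).mul (Conv.d.mul h1)).sub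
    (((hs _).mul (Conv.cfac _)).mul (Conv.d.mul h2))

/-! ### Symmetries -/

theorem nu_diagSer (y : ℕ → ℂ) : nu (diagSer y) = diagSer fun m => (-1) ^ (m + 1) * y m := by
  refine eq_diagSer ?_ fun m => ?_
  · rw [coeff_nu, coeff_zero_diagSer, mul_zero]
  · rw [coeff_nu, coeff_succ_diagSer]
    simp only [C_mul, C_pow, C_neg, C_1]
    ring

theorem flipU_diagSer (y : ℕ → ℂ) : flipU (diagSer y) = nu (diagSer y) := by
  ext1 n
  rw [coeff_flipU, coeff_nu]
  cases n with
  | zero => rw [coeff_zero_diagSer, mul_zero, zero_comp]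
  | succ m => rw [coeff_succ_diagSer, mul_comp, C_comp, tau_comp_neg]; ring

theorem conjS_diagSer (y : ℕ → ℂ) :
    conjS (diagSer y) = diagSer fun m => starRingEnd ℂ (y m) := by
  refine eq_diagSer ?_ fun m => ?_
  · rw [coeff_conjS, coeff_zero_diagSer, Polynomial.map_zero]
  · rw [coeff_conjS, coeff_succ_diagSer, Polynomial.map_mul, map_C, tau_map_conj, map_mul,
      Complex.conj_natCast]

/-- The sequence `rᵐ⁺¹⁺ᵇ`, for `m + 1 + b` even and `m ≥ N`, where `r = i / 2π`. -/
def mainSeq (b N m : ℕ) : ℂ := if Even (m + 1 + b) ∧ N ≤ m then rr ^ (m + 1 + b) else 0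

theorem H0_eq : H0 = diagSer (mainSeq 0 9) := by
  rw [H0_eq_diagSer]
  congr 1
  funext m
  rw [mainSeq]
  congr 1
  simp

theorem H1_eq : H1 = diagSer (mainSeq 1 8) := by
  rw [H1_eq_diagSer]
  congr 1
  funext m
  rw [mainSeq]
  congr 1
  grind

theorem H2_eq : H2 = diagSer fun m => (m + 1) * mainSeq 1 8 m := by
  rw [H2_eq_diagSer]
  congr 1
  funext m
  rw [mainSeq]
  split_ifs <;> grind

theorem conj_rr_pow {n : ℕ} (h : Even n) : starRingEnd ℂ (rr ^ n) = rr ^ n := by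
  obtain ⟨k, rfl⟩ := h
  rw [← two_mul, rr_pow_even, Complex.conj_ofReal]

theorem conj_mainSeq (b N m : ℕ) : starRingEnd ℂ (mainSeq b N m) = mainSeq b N m := by
  rw [mainSeq]
  split_ifs with h
  · exact conj_rr_pow h.1
  · exact map_zero _

theorem neg_one_pow_mul_mainSeq (b N m : ℕ) :
    (-1) ^ (m + 1) * mainSeq b N m = (-1) ^ b * mainSeq b N m := by
  rw [mainSeq]
  split_ifs with h
  · congr 1
    rcases Nat.even_or_odd b with hb | hb
    · rw [hb.neg_one_pow, Even.neg_one_pow (by grind)]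
    · rw [hb.neg_one_pow, Odd.neg_one_pow (by grind)]
  · rw [mul_zero, mul_zero]

theorem nu_H0 : nu H0 = H0 := by
  rw [H0_eq, nu_diagSer]
  congr 1
  funext m
  rw [neg_one_pow_mul_mainSeq, pow_zero, one_mul]

theorem flipU_H0 : flipU H0 = H0 := by
  have := nu_H0
  rw [H0_eq] at *
  rw [flipU_diagSer, this]

theorem conjS_H0 : conjS H0 = H0 := by
  rw [H0_eq, conjS_diagSer]
  congr 1
  funext m
  exact conj_mainSeq _ _ _

theorem nu_H2 : nu H2 = -H2 := by
  have h := diagSer_const_mul (-1) fun m => (m + 1) * mainSeq 1 8 m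
  rw [const_neg, const_one, neg_one_mul] at h
  rw [H2_eq, nu_diagSer, ← h]
  congr 1
  funext m
  rw [mul_left_comm, neg_one_pow_mul_mainSeq, pow_one]
  ring

theorem flipU_H2 : flipU H2 = -H2 := by
  have := nu_H2
  rw [H2_eq] at *
  rw [flipU_diagSer, this]

theorem conjS_H2 : conjS H2 = H2 := by
  rw [H2_eq, conjS_diagSer]
  congr 1
  funext m
  rw [map_mul, conj_mainSeq, map_add, map_one, Complex.conj_natCast]

theorem nu_uH0divTau2 : nu uH0divTau2 = uH0divTau2 := by
  have h := congrArg nu tau2_mul_uH0divTau2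
  rw [map_mul, map_mul, nu_tau2, nu_u, nu_H0, ← tau2_mul_uH0divTau2] at h
  exact mul_left_cancel₀ tau2_ne_zero h

theorem flipU_uH0divTau2 : flipU uH0divTau2 = -uH0divTau2 := by
  have h := congrArg flipU tau2_mul_uH0divTau2
  rw [map_mul, map_mul, flipU_tau2, flipU_u, flipU_H0, neg_mul, ← tau2_mul_uH0divTau2,
    ← mul_neg] at h
  exact mul_left_cancel₀ tau2_ne_zero h

theorem conjS_uH0divTau2 : conjS uH0divTau2 = uH0divTau2 := by
  have h := congrArg conjS tau2_mul_uH0divTau2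
  rw [map_mul, map_mul, conjS_tau2, conjS_u, conjS_H0, ← tau2_mul_uH0divTau2] at h
  exact mul_left_cancel₀ tau2_ne_zero h

theorem nu_nabla (Z : PolySeries) : nu (nabla Z) = -nabla (nu Z) := by
  simp only [nabla, map_sub, shift_apply, nu_expD, neg_neg, neg_sub]

theorem flipU_nabla (Z : PolySeries) : flipU (nabla Z) = -nabla (flipU Z) := by
  simp only [nabla, map_sub, shift_apply, flipU_expD, neg_neg, neg_sub]

theorem conjS_nabla (Z : PolySeries) : conjS (nabla Z) = nabla (conjS Z) := by
  have h1 := conjS_expD 0 (1 / 2) Z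
  have h2 := conjS_expD 0 (-(1 / 2)) Z
  push_cast at h1 h2
  rw [nabla, nabla, map_sub, shift_apply, shift_apply, shift_apply, shift_apply, h1, h2]

theorem nu_Vser (G : PolySeries) : nu (Vser G) = -Vser (nu G) := by
  rw [Vser, Vser, PiQ]
  simp only [map_mul, nu_nabla, kap, shift_apply, nu_expD, nu_Q, map_one, neg_neg]
  ring

theorem flipU_Vser (G : PolySeries) : flipU (Vser G) = -Vser (flipU G) := by
  rw [Vser, Vser, PiQ]
  simp only [map_mul, flipU_nabla, kap, shift_apply, flipU_expD, flipU_Q, map_one, neg_neg]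
  ring

theorem conjS_Vser (G : PolySeries) : conjS (Vser G) = Vser (conjS G) := by
  have h1 (Z : PolySeries) := conjS_expD 0 (1 / 2) Z
  have h2 (Z : PolySeries) := conjS_expD 0 (-(1 / 2)) Z
  have h3 (Z : PolySeries) := conjS_expD (-1) (1 / 2) Z
  have h4 (Z : PolySeries) := conjS_expD (-1) (-(1 / 2)) Z
  push_cast at h1 h2 h3 h4
  rw [Vser, Vser, PiQ]
  simp only [map_mul, conjS_nabla, kap, shift_apply, h1, h2, h3, h4, conjS_Q, map_one]

/-! ### Asymptotics under the symmetries -/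

/-- The coordinate of τᵢ dⁱ⁺ˡ is multiplied by (-1)ⁱ under u ↦ -u and by (-1)ⁱ⁺ˡ under d ↦ -d. So
only i of the parity of b and odd l can occur. -/
theorem cf_eq_zero_of_parity {b : ℕ} {Z : PolySeries} (hn : nu Z = (-1) ^ (b + 1) * Z)
    (hf : flipU Z = (-1) ^ b * Z) {i l : ℕ} (h : Odd (i + b) ∨ Even l) :
    cf i (PowerSeries.coeff (i + l) Z) = 0 := by
  have e (k : ℕ) : (-1 : PolySeries) ^ k = PowerSeries.C ((-1) ^ k) := by simp
  have e' (k : ℕ) (p : ℂ[X]) : cf i ((-1) ^ k * p) = (-1) ^ k * cf i p := by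
    rw [← cf_C_mul, C_pow, C_neg, C_1]
  have h1 := congrArg (PowerSeries.coeff (i + l)) hn
  have h2 := congrArg (PowerSeries.coeff (i + l)) hf
  rw [coeff_nu, e, PowerSeries.coeff_C_mul] at h1
  rw [coeff_flipU, e, PowerSeries.coeff_C_mul] at h2
  have h3 := congrArg (cf i) h1
  have h4 := congrArg (cf i) h2
  rw [e', e'] at h3
  rw [cf_comp_neg, e'] at h4
  generalize cf i (PowerSeries.coeff (i + l) Z) = c at *
  have key : c = -c → c = 0 := fun hc => self_eq_neg.mp hc
  rcases Nat.even_or_odd i with hi | hi <;> rcases Nat.even_or_odd b with hb | hb <;>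
    rcases Nat.even_or_odd l with hl | hl <;>
    simp only [pow_add, hi.neg_one_pow, hb.neg_one_pow, hl.neg_one_pow, pow_one, one_mul, mul_one,
      neg_mul, mul_neg, neg_neg] at h3 h4 <;>
    first
    | exact key h3
    | exact key h4
    | exact key h3.symm
    | exact key h4.symm
    | (exfalso; grind)

/-- For real a and x, passing to the real part of c only discards the imaginary part of the error.
-/
theorem norm_sub_re_mul_le {a c x : ℂ} (ha : starRingEnd ℂ a = a) (hx : starRingEnd ℂ x = x) :
    ‖a - c.re * x‖ ≤ ‖a - c * x‖ := by
  obtain ⟨a, rfl⟩ := Complex.conj_eq_iff_real.mp ha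
  obtain ⟨x, rfl⟩ := Complex.conj_eq_iff_real.mp hx
  have e : ((a : ℂ) - c.re * x) = (((a : ℂ) - c * x).re : ℂ) := by simp
  rw [e, Complex.norm_real]
  exact Complex.abs_re_le_norm _

/-- The asymptotics of the coefficients on the `l`-th diagonal, for a real series of given
parities. -/
theorem exists_real_cf_asymptotics {K l b : ℕ} (N : ℕ) (h : l + 3 ≤ K) {Z : PolySeries}
    (hF : Gev K (nabla Z)) (hc : conjS Z = Z) (hn : nu Z = (-1) ^ (b + 1) * Z)
    (hf : flipU Z = (-1) ^ b * Z) :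
    ∃ c C : ℝ, 0 ≤ C ∧ ∀ i : ℕ, ‖cf (i + 1) (PowerSeries.coeff (i + 1 + l) Z)
      - c * (i.factorial * mainSeq b N i)‖ ≤ C * gw (K - 1) (i + 1 + l) := by
  obtain ⟨c₁, c₂, C, hC, hb⟩ := exists_cf_asymptotics h hF
  -- When i + 1 has the parity of b, the two geometric sequences agree up to the sign (-1)ᵇ and
  -- their constants merge. Division by rrᵇ matches the exponent in `mainSeq`.
  set c : ℂ := (c₁ + (-1) ^ b * c₂) / rr ^ b with hcd
  -- Absorbs the finitely many terms i < N at which `mainSeq` is cut off.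
  set D : ℝ := ∑ i ∈ Finset.range N,
    ‖(c.re : ℂ) * (i.factorial * rr ^ (i + 1 + b))‖ / gw (K - 1) (i + 1 + l) with hD
  have hD0 (i : ℕ) :
      0 ≤ ‖(c.re : ℂ) * (i.factorial * rr ^ (i + 1 + b))‖ / gw (K - 1) (i + 1 + l) :=
    div_nonneg (norm_nonneg _) (gw_pos _ _).le
  have hDn : 0 ≤ D := Finset.sum_nonneg fun i _ => hD0 i
  refine ⟨c.re, C + D, by positivity, fun i => ?_⟩
  have hw := gw_pos (K - 1) (i + 1 + l)
  rcases Nat.even_or_odd (i + 1 + b) with he | ho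
  · have h1 : ‖cf (i + 1) (PowerSeries.coeff (i + 1 + l) Z)
        - c.re * (i.factorial * rr ^ (i + 1 + b))‖ ≤ C * gw (K - 1) (i + 1 + l) := by
      refine (norm_sub_re_mul_le ?_ ?_).trans (le_of_eq_of_le ?_ (hb i))
      · rw [← cf_map_conj, ← coeff_conjS, hc]
      · rw [map_mul, conj_rr_pow he, Complex.conj_natCast]
      · have h2 : (-rr) ^ (i + 1) = (-1) ^ b * rr ^ (i + 1) := by
          rw [neg_pow]
          congr 1
          rcases Nat.even_or_odd b with hb' | hb'
          · rw [hb'.neg_one_pow, Even.neg_one_pow (by grind)]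
          · rw [hb'.neg_one_pow, Odd.neg_one_pow (by grind)]
        have hr := pow_ne_zero b rr_ne_zero
        rw [h2, hcd, pow_add rr (i + 1) b]
        congr 2
        field_simp
    by_cases hiN : N ≤ i
    · rw [mainSeq, if_pos ⟨he, hiN⟩]
      refine h1.trans ?_
      gcongr
      linarith
    · rw [mainSeq, if_neg fun h => hiN h.2, mul_zero, mul_zero, sub_zero]
      have h3 : ‖(c.re : ℂ) * (i.factorial * rr ^ (i + 1 + b))‖ ≤ D * gw (K - 1) (i + 1 + l) := by
        rw [← div_le_iff₀ hw]
        exact Finset.single_le_sum (f := fun i =>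
          ‖(c.re : ℂ) * (i.factorial * rr ^ (i + 1 + b))‖ / gw (K - 1) (i + 1 + l))
          (fun i _ => hD0 i) (Finset.mem_range.mpr (by omega))
      rw [add_mul]
      refine le_trans ?_ (add_le_add h1 h3)
      refine le_trans (le_of_eq ?_) (norm_add_le _ _)
      rw [sub_add_cancel]
  · rw [cf_eq_zero_of_parity hn hf (Or.inl ho), mainSeq,
      if_neg fun h => Nat.not_even_iff_odd.mpr ho h.1, mul_zero, mul_zero, sub_zero, norm_zero]
    positivity

theorem cf_d_pow_mul_diagSer (p l i : ℕ) (y : ℕ → ℂ) :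
    cf (i + 1) (PowerSeries.coeff (i + 1 + l) (d ^ p * diagSer y))
      = if l = p then i.factorial * y i else 0 := by
  rcases lt_or_ge (i + 1 + l) p with h | h
  · rw [coeff_eq_zero_of_dvd (dvd_mul_right _ _) h, map_zero, if_neg (by omega)]
  · obtain ⟨n, hn⟩ := Nat.exists_eq_add_of_le h
    rw [hn, coeff_d_pow_mul]
    cases n with
    | zero => rw [coeff_zero_diagSer, map_zero, if_neg (by omega)]
    | succ m =>
      rw [coeff_succ_diagSer, cf_C_mul, cf_tau]
      split_ifs with h1 h2 h2
      · rw [show m = i by omega, mul_one]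
      · omega
      · omega
      · rw [mul_zero]

/-- The norm splits into finitely many diagonals near the top degree, which are estimated one by
one, and the remaining coordinates, where Y and Z agree and the tail estimate for Z applies. -/
theorem gev_of_diagonals {L k : ℕ} {Y Z : PolySeries} (hdeg : DegLE 0 Y)
    (h0 : ∀ n, cf 0 (PowerSeries.coeff n Y) = 0)
    (hd : ∀ l < L, ∃ C : ℝ, 0 ≤ C ∧ ∀ i : ℕ,
      ‖cf (i + 1) (PowerSeries.coeff (i + 1 + l) Y)‖ ≤ C * gw k (i + 1 + l))
    (hlow : ∀ l i : ℕ, L ≤ l → cf (i + 1) (PowerSeries.coeff (i + 1 + l) Y)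
      = cf (i + 1) (PowerSeries.coeff (i + 1 + l) Z))
    (htail : ∃ C : ℝ, 0 ≤ C ∧ ∀ n : ℕ, ∑ i ∈ Finset.range (n - L),
      ‖cf (i + 1) (PowerSeries.coeff n Z)‖ * (Real.pi / 2) ^ (n - 1 - i) ≤ C * gw k n) :
    Gev k Y := by
  have hp : 1 ≤ Real.pi / 2 := by linarith [Real.two_le_pi]
  have hd' (l : ℕ) : ∃ C : ℝ, 0 ≤ C ∧ (l < L → ∀ i : ℕ,
      ‖cf (i + 1) (PowerSeries.coeff (i + 1 + l) Y)‖ ≤ C * gw k (i + 1 + l)) := by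
    by_cases hl : l < L
    · obtain ⟨C, hC, h⟩ := hd l hl
      exact ⟨C, hC, fun _ => h⟩
    · exact ⟨0, le_rfl, fun h => absurd h hl⟩
  choose C hC hCb using hd'
  obtain ⟨D, hD, hDb⟩ := htail
  refine ⟨hdeg, D + ∑ l ∈ Finset.range L, C l * (Real.pi / 2) ^ l, fun n => ?_⟩
  have hw := gw_pos k n
  rw [nrm_eq_sum_cf (h0 n), add_mul]
  have hsplit := Finset.sum_range_add_sum_Ico
    (fun i => ‖cf (i + 1) (PowerSeries.coeff n Y)‖ * (Real.pi / 2) ^ (n - 1 - i))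
    (Nat.sub_le n L)
  rw [← hsplit]
  refine add_le_add ?_ ?_
  · refine le_of_eq_of_le (Finset.sum_congr rfl fun i hi => ?_) (hDb n)
    have hi' := Finset.mem_range.mp hi
    have := hlow (n - (i + 1)) i (by omega)
    rw [show i + 1 + (n - (i + 1)) = n by omega] at this
    rw [this]
  · have hterm (i : ℕ) (hi : i ∈ Finset.Ico (n - L) n) :
        ‖cf (i + 1) (PowerSeries.coeff n Y)‖ * (Real.pi / 2) ^ (n - 1 - i)
          ≤ C (n - 1 - i) * (Real.pi / 2) ^ (n - 1 - i) * gw k n := by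
      have hi' := Finset.mem_Ico.mp hi
      have := hCb (n - 1 - i) (by omega) i
      rw [show i + 1 + (n - 1 - i) = n by omega] at this
      rw [mul_right_comm]
      gcongr
    refine (Finset.sum_le_sum hterm).trans ?_
    rw [← Finset.sum_mul]
    refine mul_le_mul_of_nonneg_right ?_ hw.le
    have hinj : Set.InjOn (fun i => n - 1 - i) (Finset.Ico (n - L) n : Set ℕ) := by
      intro i hi j hj hij
      simp only [Finset.coe_Ico, Set.mem_Ico] at hi hj hij
      omega
    rw [← Finset.sum_image (f := fun l => C l * (Real.pi / 2) ^ l) hinj]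
    refine Finset.sum_le_sum_of_subset_of_nonneg ?_ fun l _ _ =>
      mul_nonneg (hC l) (by positivity)
    intro l hl
    obtain ⟨i, hi, rfl⟩ := Finset.mem_image.mp hl
    have hi' := Finset.mem_Ico.mp hi
    exact Finset.mem_range.mpr (by omega)

/-! ### The asymptotics of the remainder -/

theorem gev_of_bd {p κ : ℕ} (h : κ ≤ p) {μ : ℝ} {Z : PolySeries} (hZ : ∀ H, Bd H p κ μ Z) :
    Gev (p - κ) Z := by
  have hpi := Real.pi_pos
  have hμ := (hZ 0).nonneg
  refine ⟨(hZ 0).deg, μ * (2 * Real.pi) ^ p, fun n => ?_⟩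
  have hw := gw_pos (p - κ) n
  rcases lt_or_ge n p with hn | hn
  · rw [nrm, coeff_eq_zero_of_dvd (hZ 0).dvd hn, tauNorm_zero]
    positivity
  · obtain ⟨m, rfl⟩ := Nat.exists_eq_add_of_le hn
    refine ((hZ (m + 1)).bound m (by omega)).trans ?_
    rw [mul_assoc]
    refine mul_le_mul_of_nonneg_left ?_ hμ
    rw [wt, gw, show p + m - (p - κ) = m + κ by omega, pow_add]
    have h1 : (1 : ℝ) ≤ κ.factorial := by exact_mod_cast Nat.factorial_pos κ
    calc ((m + κ).factorial : ℝ) / κ.factorial / (2 * Real.pi) ^ m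
        ≤ (m + κ).factorial / 1 / (2 * Real.pi) ^ m := by gcongr
      _ = _ := by field_simp

theorem cf_coeff_const_mul (i n : ℕ) (c : ℂ) (Z : PolySeries) :
    cf i (PowerSeries.coeff n (const c * Z)) = c * cf i (PowerSeries.coeff n Z) := by
  rw [const, ofPoly, PowerSeries.coeff_C_mul, cf_C_mul]

theorem cf_zero_d_pow_mul_diagSer (p n : ℕ) (y : ℕ → ℂ) :
    cf 0 (PowerSeries.coeff n (d ^ p * diagSer y)) = 0 := by
  rcases lt_or_ge n p with h | h
  · rw [coeff_eq_zero_of_dvd (dvd_mul_right _ _) h, map_zero]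
  · obtain ⟨m, rfl⟩ := Nat.exists_eq_add_of_le h
    rw [coeff_d_pow_mul]
    cases m with
    | zero => rw [coeff_zero_diagSer, map_zero]
    | succ m => rw [coeff_succ_diagSer, cf_C_mul, cf_tau, if_neg (by omega), mul_zero]

/-- The index 9 is the order 10 of N, plus 2 from the factor d² τ₂, minus κ = 3. -/
theorem Gev.nabla_d_sq_tau2_mul_Vser {G₁ : PolySeries} (hR : Remainder G₁) :
    Gev 9 (nabla (d ^ 2 * tau2 * Vser (d * G₁))) := by
  obtain ⟨K, hK, h1⟩ := (Conv.d_sq_tau2.mul Conv.Q).mul_bd (q := 2)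
    ((dvd_mul_right _ _).mul_right _)
  obtain ⟨μ, hμ⟩ := hR.exists_bd_Nser
  have e : nabla (d ^ 2 * tau2 * Vser (d * G₁)) = d ^ 2 * tau2 * Q * Nser (d * G₁) := by
    rw [mul_assoc (d ^ 2) tau2 (Vser _), nabla_d_sq_mul, nabla_tau2_mul_Vser]; ring
  rw [e]
  exact gev_of_bd (p := 12) (κ := 3) (by norm_num) fun H => h1 H 10 3 μ _ (hμ H)

/-- The leading asymptotics of `d² τ₂ V`. -/
theorem Remainder.exists_Vser_asymptotics {G₁ : PolySeries} (hR : Remainder G₁)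
    (hn : nu (d * G₁) = d * G₁) (hc : conjS (d * G₁) = d * G₁) :
    ∃ c₁ c₃ : ℝ, Gev 6 (d ^ 2 * tau2 * Vser (d * G₁) - const c₁ * (d * H0)
      - const c₃ * (d ^ 3 * H0)) := by
  have hF := Gev.nabla_d_sq_tau2_mul_Vser hR
  set Z := d ^ 2 * tau2 * Vser (d * G₁) with hZ
  have hZd : DegLE 0 Z :=
    Conv.d_sq_tau2.deg.mul (deg_Vser (Conv.d.deg.mul hR.deg (by norm_num))) (by norm_num)
  have hZc : conjS Z = Z := by
    rw [hZ, map_mul, map_mul, map_pow, conjS_d, conjS_tau2, conjS_Vser, hc]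
  have hZn : nu Z = (-1) ^ (0 + 1) * Z := by
    rw [hZ, map_mul, map_mul, map_pow, nu_d, nu_tau2, nu_Vser, hn]; ring
  have hVn (G : PolySeries) : Vser (-G) = -Vser G := by
    rw [Vser, Vser, nabla, nabla, map_neg, map_neg]; ring
  have hZf : flipU Z = (-1) ^ 0 * Z := by
    rw [hZ, map_mul, map_mul, map_pow, flipU_d, flipU_tau2, flipU_Vser, hR.odd, hVn]; ring
  obtain ⟨c₁, C₁, hC₁, h1⟩ :=
    exists_real_cf_asymptotics (l := 1) 9 (by norm_num) hF hZc hZn hZf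
  obtain ⟨c₃, C₃, hC₃, h3⟩ :=
    exists_real_cf_asymptotics (l := 3) 9 (by norm_num) hF hZc hZn hZf
  refine ⟨c₁, c₃, ?_⟩
  have key (l i : ℕ) : cf (i + 1) (PowerSeries.coeff (i + 1 + l)
      (Z - const c₁ * (d * H0) - const c₃ * (d ^ 3 * H0)))
      = cf (i + 1) (PowerSeries.coeff (i + 1 + l) Z)
        - c₁ * (if l = 1 then i.factorial * mainSeq 0 9 i else 0)
        - c₃ * (if l = 3 then i.factorial * mainSeq 0 9 i else 0) := by
    have e := cf_d_pow_mul_diagSer 1 l i (mainSeq 0 9)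
    rw [pow_one] at e
    rw [map_sub, map_sub, map_sub, map_sub, cf_coeff_const_mul, cf_coeff_const_mul, H0_eq, e,
      cf_d_pow_mul_diagSer]
  -- Of the diagonals 0 to 4, the even ones vanish by parity and 1 and 3 carry the constants c₁ and
  -- c₃. The tail below them has index 5 + 1 = 6.
  refine gev_of_diagonals (L := 5) (Z := Z) ?_ (fun n => ?_) (fun l hl => ?_) (fun l i hl => ?_)
    (exists_tail_le_of_gap (by norm_num) hF)
  · have := Gev.H0.deg
    exact (hZd.sub ((DegLE.const _).mul (Conv.d.deg.mul this le_rfl) le_rfl)).sub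
      ((DegLE.const _).mul ((Conv.d.pow 3).deg.mul this le_rfl) le_rfl)
  · have e := cf_zero_d_pow_mul_diagSer 1 n (mainSeq 0 9)
    rw [pow_one] at e
    rw [map_sub, map_sub, map_sub, map_sub, cf_coeff_const_mul, cf_coeff_const_mul, H0_eq, e,
      cf_zero_d_pow_mul_diagSer, hZ, cf_zero_d_sq_tau2]
    ring
  · have hev (hl : Even l) (h1 : l ≠ 1) (h3 : l ≠ 3) : ∃ C : ℝ, 0 ≤ C ∧ ∀ i : ℕ,
        ‖cf (i + 1) (PowerSeries.coeff (i + 1 + l)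
          (Z - const c₁ * (d * H0) - const c₃ * (d ^ 3 * H0)))‖ ≤ C * gw 6 (i + 1 + l) :=
      ⟨0, le_rfl, fun i => by
        rw [key, cf_eq_zero_of_parity hZn hZf (Or.inr hl), if_neg h1, if_neg h3]; simp⟩
    have hw (C : ℝ) (hC : 0 ≤ C) (n : ℕ) : C * gw (9 - 1) n ≤ C * gw 6 n :=
      mul_le_mul_of_nonneg_left (gw_anti (by norm_num) n) hC
    interval_cases l
    · exact hev (by decide) (by norm_num) (by norm_num)
    · exact ⟨C₁, hC₁, fun i => by
        rw [key, if_pos rfl, if_neg (by norm_num), mul_zero, sub_zero]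
        exact (h1 i).trans (hw _ hC₁ _)⟩
    · exact hev (by decide) (by norm_num) (by norm_num)
    · exact ⟨C₃, hC₃, fun i => by
        rw [key, if_pos rfl, if_neg (by norm_num), mul_zero, sub_zero]
        exact (h3 i).trans (hw _ hC₃ _)⟩
    · exact hev (by decide) (by norm_num) (by norm_num)
  · rw [key, if_neg (by omega), if_neg (by omega)]
    ring

theorem gev_d_pow_mul (p : ℕ) {k : ℕ} {Z : PolySeries} (hZ : Gev k Z) : Gev (k + p) (d ^ p * Z) :=
  (Conv.d.pow p).mul_gev dvd_rfl hZ

/-- The leading asymptotics of `d² ∇ G`. -/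
theorem Remainder.gev_nabla {G₁ : PolySeries} (hR : Remainder G₁) {c₁ c₃ : ℂ}
    (h : Gev 6 (d ^ 2 * tau2 * Vser (d * G₁) - const c₁ * (d * H0) - const c₃ * (d ^ 3 * H0))) :
    Gev 6 (d ^ 2 * nabla (d * G₁) - (const c₁ * (d * H0div) + const c₃ * (d ^ 3 * H0div)
      - const (c₁ / 4) * (d ^ 3 * H0))) := by
  have hh := Gev.H0div
  have hV := deg_Vser (Conv.d.deg.mul hR.deg (m := 0) (by norm_num))
  set E := d ^ 2 * Vser (d * G₁) - const c₁ * (d * H0div) - const c₃ * (d ^ 3 * H0div) with hE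
  have e1 : d ^ 2 * tau2 * Vser (d * G₁) - const c₁ * (d * H0) - const c₃ * (d ^ 3 * H0)
      = tau2 * E := by
    rw [hE, ← tau2_mul_H0div]; ring
  have hEd : DegLE 0 E :=
    (((Conv.d.pow 2).deg.mul hV le_rfl).sub
      ((DegLE.const _).mul (Conv.d.deg.mul hh.deg le_rfl) le_rfl)).sub
      ((DegLE.const _).mul ((Conv.d.pow 3).deg.mul hh.deg le_rfl) le_rfl)
  have hEg : Gev 6 E := by
    refine Gev.of_tau2_mul ?_ hEd
    rw [e1] at h
    have := gev_d_pow_mul 2 h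
    rwa [← mul_assoc] at this
  -- The expansion of M is needed to different precision: order 4 against d H₀ / τ₂, which has index
  -- 2, and order 2 against d³ H₀ / τ₂, which has index 4. Both errors have index 6.
  have hM2 : d ^ 2 ∣ Mser - 1 := by
    obtain ⟨W, hW⟩ := d_pow_four_dvd_Mser
    exact ⟨d ^ 2 * W - const (1 / 4) * tau2, by linear_combination hW⟩
  have hM4 : Conv (Mser - (1 - const (1 / 4) * tau2 * d ^ 2)) := by
    have := (Conv.const (1 / 4)).mul Conv.d_sq_tau2
    rw [show const (1 / 4) * tau2 * d ^ 2 = const (1 / 4) * (d ^ 2 * tau2) by ring]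
    exact Conv.Mser.sub (Conv.one.sub this)
  have g1 : Gev 6 (Mser * E) := Conv.Mser.mul_gev (q := 0) (by simp) hEg
  have g2 : Gev 6 (const c₁ * ((Mser - (1 - const (1 / 4) * tau2 * d ^ 2)) * (d * H0div))) :=
    (hM4.mul_gev (q := 4) d_pow_four_dvd_Mser hh.d_mul).const_mul c₁
  have g3 : Gev 6 (const c₃ * ((Mser - 1) * (d ^ 3 * H0div))) :=
    ((Conv.Mser.sub Conv.one).mul_gev (q := 2) hM2 (gev_d_pow_mul 3 hh)).const_mul c₃
  have hc : const (c₁ / 4) = const c₁ * const (1 / 4) := by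
    rw [← const_mul, mul_one_div]
  have e : d ^ 2 * nabla (d * G₁) - (const c₁ * (d * H0div) + const c₃ * (d ^ 3 * H0div)
      - const (c₁ / 4) * (d ^ 3 * H0))
      = Mser * E + const c₁ * ((Mser - (1 - const (1 / 4) * tau2 * d ^ 2)) * (d * H0div))
        + const c₃ * ((Mser - 1) * (d ^ 3 * H0div)) := by
    rw [nabla_eq_mul, hE, hc, ← tau2_mul_H0div]
    ring
  rw [e]
  exact (g1.add g2).add g3

/-- The explicit part of `d² G`, without its last term. -/
def mainPart (α β : ℂ) : PolySeries :=
  (const α + const (β + α / 3) * d ^ 2) * uH0divTau2 - (const β * d ^ 3 + const α * d) * H2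

/-- Up to small terms, ∇(u H₀ / τ₂) = -sinh d (2 H₀ / τ₂ - H₀) and ∇H₂ = H₀. Expand sinh d to third
order: at order d the multiples of H₀ cancel, and the summand α / 3 produces the coefficient α / 2
of d³ H₀. -/
theorem gev_nabla_mainPart (α β : ℂ) : Gev 6 (nabla (mainPart α β)
    - (const (-(2 * α)) * (d * H0div) + const (-(2 * β + α)) * (d ^ 3 * H0div)
      + const (α / 2) * (d ^ 3 * H0))) := by
  have g1 := gev_nabla_uH0divTau2 6
  have g2 := Conv.nabla_H2.gev 6
  have g3 : Gev 1 (2 * H0div - H0) := by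
    rw [two_mul]
    exact (Gev.H0div.add Gev.H0div).sub Gev.H0
  have hR : Conv (sinhS 1 - (d + const (1 / 6) * d ^ 3)) :=
    (Conv.sinhS 1).sub (Conv.d.add ((Conv.const _).mul (Conv.d.pow 3)))
  have g4 := hR.mul_gev (q := 5) d_pow_five_dvd_sinhS g3
  have g5 := gev_d_pow_mul 5 g3
  have hp : Conv (const α + const (β + α / 3) * d ^ 2) :=
    (Conv.const _).add ((Conv.const _).mul (Conv.d.pow 2))
  have hq : Conv (const β * d ^ 3 + const α * d) :=
    ((Conv.const _).mul (Conv.d.pow 3)).add ((Conv.const _).mul Conv.d)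
  have e1 : nabla (mainPart α β) = (const α + const (β + α / 3) * d ^ 2) * nabla uH0divTau2
      - (const β * d ^ 3 + const α * d) * nabla H2 := by
    rw [mainPart, nabla_sub, nabla_mul_of_shift_eq, nabla_mul_of_shift_eq] <;>
    · intro θ
      simp only [map_add, map_mul, map_pow, shift_const, shift_d]
  have c6 : const (1 / 6) * 6 = 1 := by
    rw [show (6 : PolySeries) = const 6 by rw [const, map_ofNat, ofPoly, map_ofNat], ← const_mul]
    norm_num [const_one]
  have k1 : const (β + α / 3) = const β + 2 * const (1 / 6) * const α := by
    rw [two_mul, ← const_add, ← const_mul, ← const_add]; congr 1; ring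
  have k2 : const (-(2 * α)) = -(2 * const α) := by
    rw [const_neg, two_mul, two_mul, const_add]
  have k3 : const (-(2 * β + α)) = -(2 * const β + const α) := by
    rw [const_neg, const_add, two_mul, two_mul, const_add]
  have k4 : const (α / 2) = 3 * const (1 / 6) * const α := by
    rw [show (3 : PolySeries) = const 3 by rw [const, map_ofNat, ofPoly, map_ofNat], ← const_mul,
      ← const_mul]
    congr 1; ring
  have e : nabla (mainPart α β) - (const (-(2 * α)) * (d * H0div)
        + const (-(2 * β + α)) * (d ^ 3 * H0div) + const (α / 2) * (d ^ 3 * H0))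
      = (const α + const (β + α / 3) * d ^ 2) * (nabla uH0divTau2 + sinhS 1 * (2 * H0div - H0))
        - (const β * d ^ 3 + const α * d) * (nabla H2 - H0)
        - (const α + const (β + α / 3) * d ^ 2)
          * ((sinhS 1 - (d + const (1 / 6) * d ^ 3)) * (2 * H0div - H0))
        - const (β + α / 3) * (const (1 / 6) * (d ^ 5 * (2 * H0div - H0))) := by
    rw [e1, k1, k2, k3, k4]
    generalize nabla uH0divTau2 = x
    generalize nabla H2 = y
    linear_combination (-(const α * d ^ 3 * H0div)) * c6
  rw [e]
  have h0 (Z : PolySeries) : d ^ 0 ∣ Z := by simp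
  exact (((hp.mul_gev (h0 _) g1).sub (hq.mul_gev (h0 _) g2)).sub (hp.mul_gev (h0 _) g4)).sub
    ((g5.const_mul _).const_mul _)

theorem d_sq_dvd_mainPart (α β : ℂ) : d ^ 2 ∣ mainPart α β := by
  rw [mainPart, uH0divTau2_eq]
  obtain ⟨W, hW⟩ := d_sq_dvd_H0div
  refine dvd_sub ⟨(const α + const (β + α / 3) * d ^ 2) * u * W, by rw [hW]; ring⟩ ?_
  obtain ⟨Y, hY⟩ : d ∣ H2 := by rw [H2_eq]; exact dvd_mul_right _ _
  exact ⟨(const β * d ^ 2 + const α) * Y, by rw [hY]; ring⟩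

/-- The coefficient α is common to u H₀ / τ₂ and d H₂, so their top degrees cancel. This excess of
two allows division by d² within the polynomial series. -/
theorem DegLE.mainPart (α β : ℂ) : DegLE (-2) (mainPart α β) := by
  have hH : DegLE 0 H2 := by rw [H2_eq]; exact DegLE.diagSer _
  have e : PolySeries.mainPart α β
      = PolySeries.const α * (PolySeries.uH0divTau2 - PolySeries.d * H2)
        + PolySeries.const (β + α / 3) * (PolySeries.d ^ 2 * PolySeries.uH0divTau2)
        - PolySeries.const β * (PolySeries.d ^ 3 * H2) := by
    rw [PolySeries.mainPart]; ring
  rw [e]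
  have h2 := DegLE.d.pow (m := -2) 2 (by norm_num)
  have h3 := DegLE.d.pow (m := -3) 3 (by norm_num)
  exact (((DegLE.const _).mul DegLE.uH0divTau2_sub le_rfl).add
    ((DegLE.const _).mul (h2.mul DegLE.uH0divTau2 (m := -2) (by norm_num)) le_rfl)).sub
    ((DegLE.const _).mul (h3.mul hH (m := -2) (by norm_num)) le_rfl)

theorem nu_mainPart (α β : ℂ) : nu (mainPart α β) = mainPart α β := by
  simp only [mainPart, map_sub, map_mul, map_add, map_pow, nu_const, nu_d, nu_uH0divTau2, nu_H2]
  ring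

theorem flipU_mainPart (α β : ℂ) : flipU (mainPart α β) = -mainPart α β := by
  simp only [mainPart, map_sub, map_mul, map_add, map_pow, flipU_const, flipU_d, flipU_uH0divTau2,
    flipU_H2]
  ring

theorem conjS_mainPart (α β : ℝ) : conjS (mainPart α β) = mainPart α β := by
  simp only [mainPart, map_sub, map_mul, map_add, map_pow, conjS_const, conjS_d, conjS_uH0divTau2,
    conjS_H2, map_div₀, Complex.conj_ofReal, Complex.conj_ofNat]

/-- The extraction of the last explicit term. -/
theorem exists_last_term {Z : PolySeries} (hF : Gev 4 (nabla Z)) (hd : DegLE 0 Z)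
    (hc : conjS Z = Z) (hn : nu Z = Z) (hf : flipU Z = -Z) :
    ∃ δ : ℝ, Gev 3 (Z - const δ * (d * H1)) := by
  obtain ⟨δ, C, hC, h1⟩ := exists_real_cf_asymptotics (l := 1) (b := 1) 8 (by norm_num) hF hc
    (by rw [hn]; ring) (by rw [hf]; ring)
  refine ⟨δ, ?_⟩
  have key (l i : ℕ) : cf (i + 1) (PowerSeries.coeff (i + 1 + l) (Z - const δ * (d * H1)))
      = cf (i + 1) (PowerSeries.coeff (i + 1 + l) Z)
        - δ * (if l = 1 then i.factorial * mainSeq 1 8 i else 0) := by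
    have e := cf_d_pow_mul_diagSer 1 l i (mainSeq 1 8)
    rw [pow_one] at e
    rw [map_sub, map_sub, cf_coeff_const_mul, H1_eq, e]
  -- The diagonals 0 and 2 vanish by parity and diagonal 1 yields δ. The index 4 leaves no gap above
  -- L = 3, so the plain tail estimate is used; it fixes the final error (n - 3)! (2π)⁻ⁿ.
  refine gev_of_diagonals (L := 3) (Z := Z) ?_ (fun n => ?_) (fun l hl => ?_) (fun l i hl => ?_)
    (exists_tail_le (by norm_num) hF)
  · rw [H1_eq]
    exact hd.sub ((DegLE.const _).mul (Conv.d.deg.mul (DegLE.diagSer _) le_rfl) le_rfl)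
  · have e := cf_zero_d_pow_mul_diagSer 1 n (mainSeq 1 8)
    rw [pow_one] at e
    rw [map_sub, map_sub, cf_coeff_const_mul, H1_eq, e, cf_zero_of_odd hf]
    ring
  · by_cases hl1 : l = 1
    · subst hl1
      exact ⟨C, hC, fun i => by rw [key, if_pos rfl]; exact h1 i⟩
    · refine ⟨0, le_rfl, fun i => ?_⟩
      rw [key, cf_eq_zero_of_parity (b := 1) (by rw [hn]; ring) (by rw [hf]; ring)
        (Or.inr (by interval_cases l <;> first | decide | omega)), if_neg hl1]
      simp
  · rw [key, if_neg (by omega)]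
    ring

theorem d_pow_ne_zero (n : ℕ) : d ^ n ≠ 0 := pow_ne_zero n PowerSeries.X_ne_zero

/-- The asymptotics of the remainder. -/
theorem Remainder.exists_asymptotics {G₁ : PolySeries} (hR : Remainder G₁)
    (hn : nu (d * G₁) = d * G₁) (hc : conjS (d * G₁) = d * G₁) :
    ∃ (α β δ : ℝ) (S : PolySeries),
      d ^ 2 * (d * G₁) = mainPart α β + const δ * d ^ 3 * H1 + d ^ 2 * S ∧ Gev 3 S := by
  obtain ⟨c₁, c₃, h⟩ := hR.exists_Vser_asymptotics hn hc
  -- α and β are determined by the terms in d H₀ / τ₂ and d³ H₀ / τ₂; the third condition, for d³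
  -- H₀, then holds automatically (`k3`).
  set α : ℝ := -c₁ / 2 with hα
  set β : ℝ := -(c₃ + α) / 2 with hβ
  have h1 := hR.gev_nabla h
  have h2 := gev_nabla_mainPart (α : ℂ) (β : ℂ)
  have k1 : (-(2 * α) : ℂ) = c₁ := by rw [hα]; push_cast; ring
  have k2 : (-(2 * β + α) : ℂ) = c₃ := by rw [hβ]; push_cast; ring
  have k3 : (α / 2 : ℂ) = -(c₁ / 4) := by rw [hα]; push_cast; ring
  rw [k1, k2, k3, const_neg] at h2
  have h3 : Gev 6 (nabla (d ^ 2 * (d * G₁) - mainPart α β)) := by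
    rw [nabla_sub, nabla_d_sq_mul]
    convert h1.sub h2 using 1
    ring
  obtain ⟨Y, hY⟩ := (dvd_mul_right (d ^ 2) (d * G₁)).sub (d_sq_dvd_mainPart α β)
  have hdeg : DegLE 0 Y := by
    have h4 : DegLE (-2) (d ^ 2 * (d * G₁) - mainPart α β) :=
      ((DegLE.d.pow (m := -2) 2 (by norm_num)).mul
        (Conv.d.deg.mul hR.deg (m := 0) (by norm_num)) (by norm_num)).sub (DegLE.mainPart _ _)
    rw [hY, pow_two, mul_assoc] at h4
    exact h4.of_d_mul.of_d_mul
  have hF : Gev 4 (nabla Y) := by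
    rw [hY, nabla_d_sq_mul, pow_two, mul_assoc] at h3
    have hd1 : DegLE 0 (d * nabla Y) := Conv.d.deg.mul hdeg.nabla (by norm_num)
    exact (h3.of_d_mul hd1).of_d_mul hdeg.nabla
  have hYc : conjS Y = Y := by
    refine mul_left_cancel₀ (d_pow_ne_zero 2) ?_
    have := congrArg conjS hY
    rw [map_sub, map_mul _ (d ^ 2), map_mul _ (d ^ 2), map_pow, conjS_d, hc, conjS_mainPart, hY] at this
    exact this.symm
  have hYn : nu Y = Y := by
    refine mul_left_cancel₀ (d_pow_ne_zero 2) ?_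
    have := congrArg nu hY
    rw [map_sub, map_mul _ (d ^ 2), map_mul _ (d ^ 2), map_pow, nu_d, hn, nu_mainPart, neg_sq, hY] at this
    exact this.symm
  have hYf : flipU Y = -Y := by
    refine mul_left_cancel₀ (d_pow_ne_zero 2) ?_
    have := congrArg flipU hY
    rw [map_sub, map_mul _ (d ^ 2), map_mul _ (d ^ 2), map_pow, flipU_d, hR.odd, flipU_mainPart] at this
    linear_combination -this - hY
  obtain ⟨δ, hS⟩ := exists_last_term hF hdeg hYc hYn hYf
  exact ⟨α, β, δ, _, by linear_combination hY, hS⟩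

/-- Starting the construction at U gives A - U divisible by d⁸, and Q is invertible since its
constant term is 1. The quotient G inherits oddness, evenness and reality from A, U and Q; the
degree bound for A - U makes G / d a polynomial series. -/
theorem exists_remainder : ∃ A G₁ : PolySeries, Admissible A ∧ residual A = 0 ∧
    A = U + Q * (d * G₁) ∧ Remainder G₁ ∧ nu (d * G₁) = d * G₁ ∧ conjS (d * G₁) = d * G₁ := by
  obtain ⟨A, hA, hr, W, hW⟩ := exists_solution (n := 4) (by norm_num) admissible_U
    d_pow_dvd_residual_U
  have hQ0 : Q ≠ 0 := by
    intro h
    have := coeff_Q_low.1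
    rw [h, map_zero] at this
    exact zero_ne_one this
  have hQ := inv_mul_self coeff_Q_low.1
  set G₁ := d ^ 7 * (inv Q * W) with hG
  have hQG : Q * G₁ = d ^ 7 * W := by
    rw [hG]; linear_combination d ^ 7 * W * hQ
  have hAU : Q * (d * G₁) = A - U := by
    rw [hW]; linear_combination d * hQG
  have hconj : conjS A = A := solution_unique hA hA.conj hr (by
    rw [← conjS_residual hA.dvd, hr, map_zero])
  have hdeg : DegLE 0 G₁ := by
    refine DegLE.of_mul_eq Conv.Q.deg coeff_Q_low.1 ?_ hQG
    have h : DegLE (-1) (d * (d ^ 7 * W)) := by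
      rw [← hQG, mul_left_comm, hAU]
      exact hA.deg.sub DegLE.U
    exact h.of_d_mul
  have hodd : flipU (d * G₁) = -(d * G₁) := by
    refine mul_left_cancel₀ hQ0 ?_
    have h := congrArg flipU hAU
    rw [map_mul, flipU_Q, map_sub, hA.odd, flipU_U] at h
    linear_combination h + hAU
  have hnu : nu (d * G₁) = d * G₁ := by
    refine mul_left_cancel₀ hQ0 ?_
    have h := congrArg nu hAU
    rwa [map_mul, nu_Q, map_sub, hA.even, nu_U, ← hAU] at h
  have hcj : conjS (d * G₁) = d * G₁ := by
    refine mul_left_cancel₀ hQ0 ?_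
    have h := congrArg conjS hAU
    rwa [map_mul, conjS_Q, map_sub, hconj, conjS_U, ← hAU] at h
  have hAeq : A = U + Q * (d * G₁) := by rw [hAU]; ring
  exact ⟨A, G₁, hA, hr, hAeq, ⟨hdeg, dvd_mul_right _ _, hodd, hAeq ▸ hr⟩, hnu, hcj⟩

end

end PolySeries

theorem theorem5p1 :
    ∃ A : PolySeries, PolySeries.IsFormalSolution A ∧
      (∀ B : PolySeries, PolySeries.IsFormalSolution B → B = A) ∧
      ∃ G : PolySeries, PolySeries.d ^ 8 ∣ G ∧
        A = PolySeries.U + PolySeries.Q * G ∧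
        ∃ (α β δ : ℝ) (S : PolySeries),
          PolySeries.d ^ 2 * G =
              (PolySeries.const (α : ℂ)
                  + PolySeries.const ((β : ℂ) + (α : ℂ) / 3) * PolySeries.d ^ 2)
                * PolySeries.uH0divTau2
              - (PolySeries.const (β : ℂ) * PolySeries.d ^ 3
                  + PolySeries.const (α : ℂ) * PolySeries.d) * PolySeries.H2
              + PolySeries.const (δ : ℂ) * PolySeries.d ^ 3 * PolySeries.H1
              + PolySeries.d ^ 2 * S ∧
          PolySeries.IsPolynomialSeries S ∧
          (fun n : ℕ => PolySeries.tauNorm n (PowerSeries.coeff n S))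
            =O[Filter.atTop]
              (fun n : ℕ => ((n - 3).factorial : ℝ) * ((2 * Real.pi) ^ n)⁻¹) := by
  obtain ⟨A, G₁, hA, hr, hAeq, hR, hn, hc⟩ := PolySeries.exists_remainder
  obtain ⟨α, β, δ, S, hS, hSg⟩ := hR.exists_asymptotics hn hc
  refine ⟨A, PolySeries.isFormalSolution_iff.mpr ⟨hA, hr⟩, fun B hB => ?_, PolySeries.d * G₁, ?_,
    hAeq, α, β, δ, S, hS, fun n => ?_, ?_⟩
  · obtain ⟨hB, hrB⟩ := PolySeries.isFormalSolution_iff.mp hB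
    exact PolySeries.solution_unique hA hB hr hrB
  · rw [pow_succ']
    exact mul_dvd_mul_left _ hR.dvd
  · exact PolySeries.polyDeg_natCast_iff.mp (hSg.deg.coeff n)
  · obtain ⟨C, hC⟩ := hSg.bound
    refine Asymptotics.IsBigO.of_bound C (Filter.Eventually.of_forall fun n => ?_)
    rw [← div_eq_mul_inv, ← PolySeries.gw, Real.norm_of_nonneg (PolySeries.tauNorm_nonneg _ _),
      Real.norm_of_nonneg (PolySeries.gw_pos 3 n).le]
    exact hC n
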